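/- **Wooded triangulations.** A wooded triangulation of size $n$ is a simple plane triangulation with outer vertices $A_{\mathrm b},A_{\mathrm r},A_{\mathrm g}$ in counterclockwise order and $n$ inner vertices, with a Schnyder wood: each of its $3n$ inner edges is directed and colored blue (b), red (r) or green (g) so that clockwise around each inner vertex one finds one outgoing blue edge, incoming red edges, one outgoing green edge, incoming blue edges, one outgoing red edge, incoming green edges (the number of incoming edges of each color may be zero), and the inner edges at $A_c$ are incoming of color $c$, for $c\in\{\mathrm b,\mathrm r,\mathrm g\}$. Wooded triangulations are considered up to isomorphism (orientation-preserving homeomorphism). They are viewed as graphs with colored directed edges, the three outer edges being uncolored and undirected. **Benjamini–Schramm convergence.** Random graphs $(G^n,e_n)$ with colored directed edges, rooted at an edge, converge to $(G,e)$ in the Benjamini–Schramm sense if, for every such rooted graph $T$ and every integer $k\ge 0$, the probability that the radius-$k$ neighborhood of $e_n$ in $G^n$ (the subgraph induced on the vertices at graph distance at most $k$ from an endpoint of $e_n$, rooted at $e_n$) is isomorphic to $T$ converges, as $n\to\infty$, to the probability that the radius-$k$ neighborhood of $e$ in $G$ is isomorphic to $T$. Isomorphisms preserve colors, directions and the root.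 **The infinite object.** Let $w=(w_i)_{i\in\mathbb Z}$ be the stationary Markov chain on $\{\mathrm b,\mathrm r,\mathrm g\}$ with transition probabilities $P(\mathrm b,\cdot)=P(\mathrm g,\cdot)=(\tfrac12,\tfrac14,\tfrac14)$ and $P(\mathrm r,\cdot)=(0,\tfrac12,\tfrac12)$ (in the order b, r, g), whose stationary distribution is uniform. For letters $x\ne y$ and $j<k$, call $(w_j,w_k)$ an $xy$ match if $w_j=x$, $w_k=y$, and the word obtained from $w_{j+1}\cdots w_{k-1}$ by dropping the letters other than $x,y$ reduces to the empty word under $xy=\emptyset$. The graph $S^\infty$ has as vertices the positions $i$ with $w_i=\mathrm b$, and for each $i\in\mathbb Z$ one edge associated with $w_i$ (all the objects named below exist almost surely): 1. if $w_i=\mathrm b$, a blue edge from $i$ to the least $k>i$ for which there is $j<i$ such that $(w_j,w_k)$ is a gb match; 2. if $w_i=\mathrm r$, a red edge from $i'$ to $k$, where $(w_{i'},w_i)$ is a br match, $j$ is the least $j>i$ with $w_j=\mathrm g$, and $(w_j,w_k)$ is a gb match; 3. if $w_i=\mathrm g$, a green edge from $i'$ to $j$, where $(w_i,w_{i'})$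 is a gb match and $j$ is the greatest $j<i$ for which there is $k>i$ such that $(w_j,w_k)$ is a br match. Let $e_0$ be the edge associated with $w_0$. The rooted graph $(S^\infty,e_0)$ is called the uniform infinite wooded triangulation. **Proposition.** For $n\ge1$ let $S^n$ be a uniformly random wooded triangulation of size $n$ and, given $S^n$, let $e_n$ be a uniformly random inner edge of $S^n$. Then $(S^n,e_n)$ converges to $(S^\infty,e_0)$ in the Benjamini–Schramm sense as $n\to\infty$. -/

import Mathlib

open MeasureTheory Filter Topology

namespace SchnyderWood

/-- The three colors blue, red, green; also the letters of the words. -/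
inductive Color where
  | b | r | g
  deriving DecidableEq

namespace Color

instance : Fintype Color := ⟨{b, r, g}, by rintro (_ | _ | _) <;> decide⟩

instance : MeasurableSpace Color := ⊤

/-- The clockwise cyclic order blue, green, red, blue of the outgoing edges. -/
def next : Color → Color
  | b => g
  | g => r
  | r => b

def prev (c : Color) : Color := c.next.next

end Color

/-! ### Rooted graphs with colored directed edges, and their local convergence -/

/-- A graph rooted at a colored directed edge.  `arc c u v` says that there is an edge of color `c`
directed from `u` to `v`; `plain u v` says that there is an uncolored, undirected edge between
`u` and `v` (the three outer edges of a wooded triangulation are of this kind). -/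
structure RootedGraph where
  V : Type
  arc : Color → V → V → Prop
  plain : V → V → Prop
  plain_symm : ∀ u v, plain u v → plain v u
  rootTail : V
  rootHead : V
  rootColor : Color
  root_arc : arc rootColor rootTail rootHead

namespace RootedGraph

/-- Isomorphism of rooted graphs, preserving colors, directions and the root edge. -/
def Isomorphic (G H : RootedGraph) : Prop :=
  ∃ e : G.V ≃ H.V,
    (∀ c u v, G.arc c u v ↔ H.arc c (e u) (e v)) ∧
    (∀ u v, G.plain u v ↔ H.plain (e u) (e v)) ∧
    e G.rootTail = H.rootTail ∧ e G.rootHead = H.rootHead ∧ G.rootColor = H.rootColor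

/-- The underlying simple graph, used only to measure graph distances. -/
def toSimpleGraph (G : RootedGraph) : SimpleGraph G.V :=
  SimpleGraph.fromRel fun u v => (∃ c, G.arc c u v) ∨ G.plain u v

/-- The vertices at graph distance at most `k` from the root edge. -/
def ballSet (G : RootedGraph) (k : ℕ) : Set G.V :=
  {v | G.toSimpleGraph.edist G.rootTail v ≤ k ∨ G.toSimpleGraph.edist G.rootHead v ≤ k}

/-- The radius-`k` neighborhood of the root edge: the subgraph induced on the vertices at
distance at most `k` from the root edge, rooted at the same edge. -/
def ball (G : RootedGraph) (k : ℕ) : RootedGraph where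
  V := G.ballSet k
  arc c u v := G.arc c u v
  plain u v := G.plain u v
  plain_symm u v h := G.plain_symm u v h
  rootTail := ⟨G.rootTail, Or.inl (by simp)⟩
  rootHead := ⟨G.rootHead, Or.inr (by simp)⟩
  rootColor := G.rootColor
  root_arc := G.root_arc

end RootedGraph

/-- Benjamini-Schramm convergence of random rooted graphs.  A random rooted graph enters through
the function `P` that gives the probability `P A` that it has the property `A`. -/
def BenjaminiSchrammConverges (P : ℕ → Set RootedGraph → ℝ) (Q : Set RootedGraph → ℝ) : Prop :=
  ∀ (T : RootedGraph) (k : ℕ),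
    Tendsto (fun n => P n {G | (G.ball k).Isomorphic T}) atTop
      (𝓝 (Q {G | (G.ball k).Isomorphic T}))

/-! ### Wooded triangulations, as combinatorial maps -/

/-- The cycles of a permutation. -/
abbrev Cycles {D : Type} (p : Equiv.Perm D) : Type :=
  Quotient (Equiv.Perm.SameCycle.setoid p)

/-- A simple plane triangulation with a marked outer face and named outer vertices, as a
combinatorial map on the finite set `D` of darts (directed edges).  `rev` reverses a dart, `rot`
sends a dart to the clockwise next dart with the same tail.  Vertices, edges and faces are the
cycles of `rot`, of `rev` and of `rot * rev`; the last permutation sends a dart to the next dart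
on the boundary of the face to its left.  The outer face is the one to the left of `root`. -/
structure PlaneTriangulation (D : Type) where
  rot : Equiv.Perm D
  rev : Equiv.Perm D
  root : D
  rev_rev : ∀ d, rev (rev d) = d
  rev_ne : ∀ d, rev d ≠ d
  connected : ∀ d d', ∃ p ∈ Subgroup.closure {rot, rev}, p d = d'
  /-- Euler's formula: the surface carrying the map is a sphere. -/
  planar : Nat.card (Cycles rot) + Nat.card (Cycles (rot * rev)) = Nat.card (Cycles rev) + 2
  /-- Every face is bounded by three edges. -/
  face_three : ∀ d, (rot * rev) d ≠ d ∧ ((rot * rev) ^ 3) d = d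
  no_loop : ∀ d, ¬ rot.SameCycle d (rev d)
  no_multi : ∀ d d', rot.SameCycle d d' → rot.SameCycle (rev d) (rev d') → d = d'

namespace PlaneTriangulation

variable {D : Type} (M : PlaneTriangulation D)

abbrev Vertex : Type := Cycles M.rot

/-- The tail of a dart. -/
def src (d : D) : M.Vertex := Quotient.mk _ d

/-- The head of a dart. -/
def tgt (d : D) : M.Vertex := M.src (M.rev d)

/-- Permutation of the darts that turns around the face to the left of a dart. -/
def face : Equiv.Perm D := M.rot * M.rev

/-- The darts of the three outer edges, in both directions. -/
def IsOuter (d : D) : Prop :=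
  M.face.SameCycle M.root d ∨ M.face.SameCycle M.root (M.rev d)

/-- The outer vertices `A_b`, `A_r`, `A_g`.  With the unbounded face to its left, `root` leads
from `A_b` to `A_g`, followed by the darts from `A_g` to `A_r` and from `A_r` to `A_b`.  So
`A_b, A_r, A_g` are in counterclockwise order. -/
def outerVertex : Color → M.Vertex
  | .b => M.src M.root
  | .g => M.src (M.face M.root)
  | .r => M.src (M.face (M.face M.root))

def IsInner (v : M.Vertex) : Prop := ∀ c, v ≠ M.outerVertex c

/-- The size of a triangulation is its number of inner vertices. -/
noncomputable def size : ℕ := Nat.card {v : M.Vertex // M.IsInner v}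

end PlaneTriangulation

/-- A simple plane triangulation with a Schnyder wood.  `col d = some c` means that `d` is a
directed inner edge of color `c`, traversed in its direction. -/
structure WoodedTriangulation (D : Type) extends PlaneTriangulation D where
  col : D → Option Color
  /-- Outer edges are neither directed nor colored. -/
  col_outer : ∀ d, toPlaneTriangulation.IsOuter d → col d = none
  /-- Every inner edge has exactly one direction. -/
  col_inner : ∀ d, ¬ toPlaneTriangulation.IsOuter d →
    ((col d).isSome = true ↔ col (rev d) = none)
  /-- Every inner vertex has exactly one outgoing edge of each color. -/
  col_out : ∀ v, toPlaneTriangulation.IsInner v →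
    ∀ c, ∃! d, toPlaneTriangulation.src d = v ∧ col d = some c
  /-- Schnyder's rule.  Clockwise around an inner vertex one finds: blue out, red in (any number),
  green out, blue in (any number), red out, green in (any number). -/
  schnyder : ∀ d, toPlaneTriangulation.IsInner (toPlaneTriangulation.src d) → ∀ c,
    (col d = some c → col (rot d) = some c.next ∨ col (rev (rot d)) = some c.prev) ∧
    (col (rev d) = some c → col (rev (rot d)) = some c ∨ col (rot d) = some c.prev)
  /-- The inner edges at the outer vertex of color `c` have color `c` and are incoming. -/
  col_outerVertex : ∀ c d, toPlaneTriangulation.src d = toPlaneTriangulation.outerVertex c →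
    ¬ toPlaneTriangulation.IsOuter d → col (rev d) = some c

namespace WoodedTriangulation

variable {D : Type}

/-- Isomorphism of wooded triangulations: a bijection between the darts that preserves the map,
the outer face with its named vertices, the directions and the colors. -/
def Isomorphic (S S' : WoodedTriangulation D) : Prop :=
  ∃ e : Equiv.Perm D, (∀ d, e (S.rot d) = S'.rot (e d)) ∧ (∀ d, e (S.rev d) = S'.rev (e d)) ∧
    e S.root = S'.root ∧ ∀ d, S.col d = S'.col (e d)

/-- The inner edges, each represented by its dart in forward direction. -/
abbrev InnerEdge (S : WoodedTriangulation D) : Type := {d : D // (S.col d).isSome = true}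

/-- A wooded triangulation, rooted at an inner edge, as a rooted graph with colored directed
edges. -/
def rootedGraph (S : WoodedTriangulation D) (e : S.InnerEdge) : RootedGraph where
  V := S.Vertex
  arc c u v := ∃ d, S.col d = some c ∧ S.src d = u ∧ S.tgt d = v
  plain u v := ∃ d, S.IsOuter d ∧ S.src d = u ∧ S.tgt d = v
  plain_symm := by
    rintro u v ⟨d, hd, hu, hv⟩
    refine ⟨S.rev d, ?_, hv, ?_⟩
    · unfold PlaneTriangulation.IsOuter at *
      rw [S.rev_rev]
      exact hd.symm
    · rw [← hu, PlaneTriangulation.tgt, S.rev_rev]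
  rootTail := S.src e.1
  rootHead := S.tgt e.1
  rootColor := (S.col e.1).get e.2
  root_arc := ⟨e.1, by simp, rfl, rfl⟩

instance [Finite D] : Finite (WoodedTriangulation D) :=
  Finite.of_injective
    (fun S : WoodedTriangulation D => (S.rot, S.rev, S.root, S.col)) (by
      rintro ⟨⟨⟩⟩ ⟨⟨⟩⟩ h
      simp only [Prod.mk.injEq] at h
      obtain ⟨rfl, rfl, rfl, rfl⟩ := h
      rfl)

end WoodedTriangulation

/-- Wooded triangulations of size `n` on a fixed set of darts.  A simple triangulation with `n`
inner vertices has `3 * n + 3` edges, hence `6 * n + 6` darts. -/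
abbrev LabelledWood (n : ℕ) : Type :=
  {S : WoodedTriangulation (Fin (6 * n + 6)) // S.size = n}

/-- Isomorphism, as an equivalence relation. -/
instance woodSetoid (n : ℕ) : Setoid (LabelledWood n) where
  r S S' := S.1.Isomorphic S'.1
  iseqv := by
    refine ⟨fun S => ⟨1, by simp⟩, ?_, ?_⟩
    · rintro S S' ⟨e, h1, h2, h3, h4⟩
      refine ⟨e.symm, fun d => ?_, fun d => ?_, ?_, fun d => ?_⟩
      · rw [Equiv.symm_apply_eq, h1, Equiv.apply_symm_apply]
      · rw [Equiv.symm_apply_eq, h2, Equiv.apply_symm_apply]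
      · rw [Equiv.symm_apply_eq, h3]
      · rw [h4, Equiv.apply_symm_apply]
    · rintro S S' S'' ⟨e, h1, h2, h3, h4⟩ ⟨f, k1, k2, k3, k4⟩
      refine ⟨e.trans f, fun d => ?_, fun d => ?_, ?_, fun d => ?_⟩
      · simp [h1, k1]
      · simp [h2, k2]
      · simp [h3, k3]
      · rw [h4, k4]
        rfl

/-- The finite set of wooded triangulations of size `n`, up to isomorphism. -/
abbrev Wood (n : ℕ) : Type := Quotient (woodSetoid n)

noncomputable instance (n : ℕ) : Fintype (Wood n) := Fintype.ofFinite _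

/-- The law of a uniform wooded triangulation of size `n`, rooted at a uniform inner edge: the
average over the wooded triangulations of size `n` of the proportion of inner edges for which the
rooted graph has the property `A` (where `A` is invariant under isomorphism, so that the choice of
a representative does not matter). -/
noncomputable def finiteLaw (n : ℕ) (A : Set RootedGraph) : ℝ :=
  (∑ s : Wood n, (Nat.card {e : s.out.1.InnerEdge // s.out.1.rootedGraph e ∈ A} : ℝ) /
      Nat.card s.out.1.InnerEdge) / Nat.card (Wood n)

/-! ### The uniform infinite wooded triangulation -/

/-- The number of letters `x` minus the number of letters `y` among `w (j + 1), …, w m`. -/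
noncomputable def excess (x y : Color) (w : ℤ → Color) (j m : ℤ) : ℤ :=
  ∑ i ∈ Finset.Ioc j m, ((if w i = x then 1 else 0) - (if w i = y then 1 else 0))

/-- `(w j, w k)` is an `xy` match: `w j = x`, `w k = y`, and the word strictly between them, with
all letters other than `x` and `y` dropped, is a parenthesis matching with open parenthesis `x`
and closed parenthesis `y` (i.e. reduces to the empty word under `xy = ∅`). -/
def IsMatch (x y : Color) (w : ℤ → Color) (j k : ℤ) : Prop :=
  j < k ∧ w j = x ∧ w k = y ∧ (∀ m, j ≤ m → m < k → 0 ≤ excess x y w j m) ∧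
    excess x y w j (k - 1) = 0

/-- The edge associated with the letter `w i` leads from the vertex `t` to the vertex `h`, where
the vertices are the positions of the letters `b`. -/
def IsEdge (w : ℤ → Color) (i t h : ℤ) : Prop :=
  match w i with
  | .b => t = i ∧ IsLeast {k | ∃ j, j < i ∧ i < k ∧ IsMatch .g .b w j k} h
  | .r => IsMatch .b .r w t i ∧ ∃ j, IsLeast {j | i < j ∧ w j = .g} j ∧ IsMatch .g .b w j h
  | .g => IsMatch .g .b w i t ∧ IsGreatest {j | ∃ k, j < i ∧ i < k ∧ IsMatch .b .r w j k} h

/-- The infinite graph built from a bi-infinite word `w`, rooted at the edge associated with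
`w 0`. -/
def infiniteGraph (w : ℤ → Color) (t h : {i : ℤ // w i = .b}) (hroot : IsEdge w 0 t h) :
    RootedGraph where
  V := {i : ℤ // w i = .b}
  arc c u v := ∃ i, w i = c ∧ IsEdge w i u v
  plain _ _ := False
  plain_symm _ _ hf := hf
  rootTail := t
  rootHead := h
  rootColor := w 0
  root_arc := ⟨0, rfl, hroot⟩

/-- Transition matrix of the Markov chain on the letters. -/
noncomputable def transition : Color → Color → ℝ
  | .b, .b => 1 / 2
  | .b, .r => 1 / 4
  | .b, .g => 1 / 4
  | .r, .b => 0
  | .r, .r => 1 / 2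
  | .r, .g => 1 / 2
  | .g, .b => 1 / 2
  | .g, .r => 1 / 4
  | .g, .g => 1 / 4

/-- The random bi-infinite word `w` is the stationary Markov chain with the transition matrix
above; its stationary distribution is uniform on the three letters. -/
structure IsStationaryMarkovWord {Ω : Type*} [MeasurableSpace Ω] (μ : Measure Ω)
    (w : Ω → ℤ → Color) : Prop where
  measurable : ∀ i, Measurable fun ω => w ω i
  law : ∀ (m : ℤ) (k : ℕ) (x : ℕ → Color),
    μ.real {ω | ∀ j ≤ k, w ω (m + j) = x j} =
      1 / 3 * ∏ j ∈ Finset.range k, transition (x j) (x (j + 1))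

/-- The law of the uniform infinite wooded triangulation, built from the random word `w` and rooted
at the edge associated with `w 0` (which exists almost surely). -/
noncomputable def infiniteLaw {Ω : Type*} [MeasurableSpace Ω] (μ : Measure Ω)
    (w : Ω → ℤ → Color) (A : Set RootedGraph) : ℝ :=
  μ.real {ω | ∃ (t h : {i : ℤ // w ω i = .b}) (hroot : IsEdge (w ω) 0 t h),
    infiniteGraph (w ω) t h hroot ∈ A}

end SchnyderWood

/-! A clockwise walk around the blue tree turns a wooded triangulation into a word. At each vertex
the walk writes one r per incoming red edge, then g for the outgoing green edge, then visits the
blue children in turn, and finally writes b for the outgoing blue edge along which it leaves. Every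
inner edge gets exactly one letter, the gb matches are the visits to the vertices, and the end
points of the edges are recovered from gb and br matches by the rules that define the infinite
graph. The words that occur are those without the factor rb for which the walks #g - #b and #b - #r
stay nonnegative and return to 0; `Valid` expresses this after framing the word with letters for the
outer edges. `Coding.valid` shows that triangulations give such words, `Valid.wood` builds a
triangulation from such a word by gluing one triangle per letter r or g, and `exists_code`
identifies `Wood n` with the set `words n`.

The uniform law on `words n` is compared with the Markov chain. A transition probability is a ratio
of values of a harmonic function times a weight of the new letter (`Ex_eq_word`), so under the chain
all elements of `words n` have the same probability up to a factor 2 (`weight_bounds`). The total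
probability of `words n` decays more slowly than any exponential (`exists_le_Ex_words`): lift both
walks by a small multiple of n, follow a typical trajectory, then bring the walks back to 0. In
contrast, the frequency of a fixed pattern in the chain falls short of its stationary probability
only with exponentially small probability (`exists_concentration`). Hence all but a vanishing
fraction of `words n` contain the pattern almost as often as predicted (`tendsto_card_atypical`).

The rules for the edges are local. Almost surely all matches exist (`ae_nice`). This does not use
recurrence: unmatched letters accumulate as excess, which is of smaller order than the length, so
they have density zero (`exists_small`). Thus a ball of the infinite graph is determined by a finite
window of the word (`Nice.exists_window`), and an inner edge of a finite triangulation whose letter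
has the same window around it has an isomorphic ball (`ball_isomorphic_of_window`). Counting windows
bounds the lower limit of the finite probabilities from below by the infinite probability.

This lower bound is applied to an event and to its complement. The two finite probabilities add up
to 1 and the two infinite ones to at least 1, so the lower bounds already force convergence, and no
upper tail estimate is needed. -/

namespace SchnyderWood

/-! ### Balanced intervals of words -/

/-- The contribution of a letter to the excess of `x` over `y`. -/
def step (x y c : Color) : ℤ := (if c = x then 1 else 0) - (if c = y then 1 else 0)

section Words

variable {x y : Color} {w w' : ℤ → Color} {i j k m : ℤ}

lemma excess_eq : excess x y w j m = ∑ i ∈ Finset.Ioc j m, step x y (w i) := rfl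

lemma step_le_one (x y c : Color) : step x y c ≤ 1 := by unfold step; split_ifs <;> norm_num

lemma neg_one_le_step (x y c : Color) : -1 ≤ step x y c := by unfold step; split_ifs <;> norm_num

lemma step_eq_one (h : step x y k' = 1) : k' = x := by
  unfold step at h; split_ifs at h <;> simp_all

lemma step_eq_neg_one (h : step x y k' = -1) : k' = y := by
  unfold step at h; split_ifs at h <;> simp_all

lemma excess_self (x y : Color) (w : ℤ → Color) (j : ℤ) : excess x y w j j = 0 := by
  simp [excess]

lemma excess_add (h1 : j ≤ i) (h2 : i ≤ m) :
    excess x y w j m = excess x y w j i + excess x y w i m := by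
  rw [excess_eq, excess_eq, excess_eq, ← Finset.sum_union]
  · rw [Finset.Ioc_union_Ioc_eq_Ioc h1 h2]
  · rw [Finset.disjoint_left]; intro a; simp only [Finset.mem_Ioc]; omega

lemma excess_one (x y : Color) (w : ℤ → Color) (j : ℤ) :
    excess x y w (j - 1) j = step x y (w j) := by
  have : Finset.Ioc (j - 1) j = {j} := by ext a; simp only [Finset.mem_Ioc, Finset.mem_singleton]; omega
  rw [excess_eq, this, Finset.sum_singleton]

lemma excess_last (h : j < m) :
    excess x y w j m = excess x y w j (m - 1) + step x y (w m) := by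
  rw [excess_add (i := m - 1) (by omega) (by omega), excess_one]

lemma excess_first (h : j < m) :
    excess x y w j m = step x y (w (j + 1)) + excess x y w (j + 1) m := by
  rw [excess_add (i := j + 1) (by omega) (by omega)]
  have := excess_one x y w (j + 1)
  rw [add_sub_cancel_right] at this
  rw [this]

lemma excess_congr (h : ∀ i, j < i → i ≤ m → w i = w' i) : excess x y w j m = excess x y w' j m := by
  apply Finset.sum_congr rfl
  intro i hi
  rw [Finset.mem_Ioc] at hi
  rw [h i hi.1 hi.2]

/-- The word `w (j + 1) ⋯ w (k - 1)` is a parenthesis matching. -/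
def Bal (x y : Color) (w : ℤ → Color) (j k : ℤ) : Prop :=
  j < k ∧ (∀ m, j ≤ m → m < k → 0 ≤ excess x y w j m) ∧ excess x y w j (k - 1) = 0

lemma Bal.le_zero (h : Bal x y w j k) (h1 : j ≤ m) (h2 : m < k) : excess x y w m (k - 1) ≤ 0 := by
  have := h.2.1 m h1 h2
  have := excess_add (x := x) (y := y) (w := w) h1 (show m ≤ k - 1 by omega)
  have := h.2.2
  omega

lemma Bal.eq_neg_one (h : Bal x y w j k) (hk : step x y (w k) = -1) : excess x y w j k = -1 := by
  rw [excess_last h.1, h.2.2, hk]; norm_num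

lemma Bal.eq_one (h : Bal x y w j k) (hj : step x y (w j) = 1) :
    excess x y w (j - 1) (k - 1) = 1 := by
  rw [excess_first (by have := h.1; omega), sub_add_cancel, h.2.2, hj]; norm_num

lemma Bal.congr (h : Bal x y w j k) (hw : ∀ i, j < i → i < k → w i = w' i) : Bal x y w' j k := by
  refine ⟨h.1, fun m h1 h2 => ?_, ?_⟩
  · rw [← excess_congr (w := w) fun i hi hi' => hw i hi (by omega)]
    exact h.2.1 m h1 h2
  · rw [← excess_congr (w := w) fun i hi hi' => hw i hi (by omega)]
    exact h.2.2

/-- A closing letter brings the excess from `j` to `-1` for the first time, so both ends are the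
first passage. Left uniqueness is the same argument read backwards. -/
lemma Bal.right_unique (h : Bal x y w j k) (h' : Bal x y w j m) (hk : step x y (w k) = -1)
    (hm : step x y (w m) = -1) : k = m := by
  have h1 := h.eq_neg_one hk
  have h2 := h'.eq_neg_one hm
  have := h.1
  have := h'.1
  rcases lt_trichotomy k m with hl | hl | hl
  · have := h'.2.1 k (by omega) hl; omega
  · exact hl
  · have := h.2.1 m (by omega) hl; omega

lemma Bal.left_unique (h : Bal x y w i k) (h' : Bal x y w j k) (hi : step x y (w i) = 1)
    (hj : step x y (w j) = 1) : i = j := by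
  have h1 := h.eq_one hi
  have h2 := h'.eq_one hj
  have := h.1
  have := h'.1
  rcases lt_trichotomy i j with hl | hl | hl
  · have := h.le_zero (m := j - 1) (by omega) (by omega); omega
  · exact hl
  · have := h'.le_zero (m := i - 1) (by omega) (by omega); omega

lemma Bal.of_adjacent (x y : Color) (w : ℤ → Color) (i : ℤ) : Bal x y w i (i + 1) := by
  refine ⟨by omega, fun m h1 h2 => ?_, ?_⟩
  · rw [show m = i by omega, excess_self]
  · rw [add_sub_cancel_right, excess_self]

lemma Bal.trans (h : Bal x y w i j) (h' : Bal x y w j k) (hj : step x y (w j) = 0) :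
    Bal x y w i k := by
  have e : excess x y w i j = 0 := by rw [excess_last h.1, h.2.2, hj]; rfl
  have := h.1
  have := h'.1
  refine ⟨by omega, fun m h1 h2 => ?_, ?_⟩
  · rcases lt_or_ge m j with hl | hl
    · exact h.2.1 m h1 hl
    · rw [excess_add h.1.le hl, e]
      have := h'.2.1 m hl h2; omega
  · rw [excess_add (i := j) (by omega) (by omega), e, h'.2.2]; rfl

/-- If the `y` at `j` closes an interval that the `x` just after `i` opens, the interval from `j`
extends to `i`. -/
lemma Bal.trans_forward (hi : step x y (w (i + 1)) = 1) (h : Bal x y w (i + 1) j)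
    (hj : step x y (w j) = -1) (h' : Bal x y w j k) : Bal x y w i k := by
  have e := h.eq_neg_one hj
  have := h.1
  have := h'.1
  have e0 : ∀ m, i + 1 ≤ m → excess x y w i m = 1 + excess x y w (i + 1) m := fun m hm => by
    rw [excess_first (by omega), hi]
  refine ⟨by omega, fun m h1 h2 => ?_, ?_⟩
  · rcases eq_or_lt_of_le h1 with rfl | h1
    · rw [excess_self]
    rw [e0 m (by omega)]
    rcases lt_or_ge m j with hl | hl
    · have := h.2.1 m (by omega) hl; omega
    · rw [excess_add (i := j) (by omega) hl, e]
      have := h'.2.1 m hl h2; omega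
  · rw [e0 _ (by omega), excess_add (i := j) (by omega) (by omega), e, h'.2.2]; rfl

lemma Bal.trans_backward (hi : step x y (w (i - 1)) = -1) (h : Bal x y w j (i - 1))
    (hj : step x y (w j) = 1) (h' : Bal x y w k j) : Bal x y w k i := by
  have := h.1
  have := h'.1
  have e1 : excess x y w k j = 1 := by rw [excess_last h'.1, h'.2.2, hj]; rfl
  refine ⟨by omega, fun m h1 h2 => ?_, ?_⟩
  · rcases lt_or_ge m j with hl | hl
    · exact h'.2.1 m h1 hl
    · rw [excess_add (i := j) (by omega) hl, e1]
      rcases lt_or_ge m (i - 1) with hl' | hl'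
      · have := h.2.1 m hl hl'; omega
      · obtain rfl : m = i - 1 := by omega
        rw [h.eq_neg_one hi]; rfl
  · rw [excess_add (i := j) (by omega) (by omega), e1, h.eq_neg_one hi]; rfl

/-- First passage of the excess below its initial value. -/
lemma exists_bal_right (h : ∃ m, i < m ∧ excess x y w i m < 0) :
    ∃ k, Bal x y w i k ∧ step x y (w k) = -1 ∧ ∀ m, i < m → excess x y w i m < 0 → k ≤ m := by
  obtain ⟨k, ⟨hk1, hk2⟩, hk3⟩ :=
    Int.exists_least_of_bdd (P := fun m => i < m ∧ excess x y w i m < 0) ⟨i, fun z hz => hz.1.le⟩ h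
  have hpos : ∀ m, i ≤ m → m < k → 0 ≤ excess x y w i m := fun m h1 h2 => by
    rcases eq_or_lt_of_le h1 with rfl | h1
    · rw [excess_self]
    · by_contra hc
      have := hk3 m ⟨h1, by omega⟩
      omega
  have e := excess_last (x := x) (y := y) (w := w) hk1
  have h1 := hpos (k - 1) (by omega) (by omega)
  have h2 := neg_one_le_step x y (w k)
  exact ⟨k, ⟨hk1, hpos, by omega⟩, by omega, fun m h1 h2 => hk3 m ⟨h1, h2⟩⟩

/-- Last passage of the backward excess. -/
lemma exists_bal_left (h : ∃ m, m < i ∧ 0 < excess x y w m (i - 1)) :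
    ∃ k, Bal x y w k i ∧ step x y (w k) = 1 ∧ ∀ m, m < i → 0 < excess x y w m (i - 1) → m < k := by
  obtain ⟨k, ⟨hk1, hk2⟩, hk3⟩ :=
    Int.exists_greatest_of_bdd (P := fun m => m < i ∧ 0 < excess x y w m (i - 1))
      ⟨i, fun z hz => hz.1.le⟩ h
  have hki : k ≠ i - 1 := by rintro rfl; rw [excess_self] at hk2; omega
  have hneg : ∀ m, k < m → m ≤ i - 1 → excess x y w m (i - 1) ≤ 0 := fun m h1 h2 => by
    by_contra hc
    have := hk3 m ⟨by omega, by omega⟩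
    omega
  have e := excess_first (x := x) (y := y) (w := w) (show k < i - 1 by omega)
  have h1 := hneg (k + 1) (by omega) (by omega)
  have h2 := step_le_one x y (w (k + 1))
  have h0 : excess x y w (k + 1) (i - 1) = 0 := by omega
  refine ⟨k + 1, ⟨by omega, fun m h1 h2 => ?_, h0⟩, by omega, fun m h1 h2 => ?_⟩
  · have := excess_add (x := x) (y := y) (w := w) h1 (show m ≤ i - 1 by omega)
    rcases eq_or_lt_of_le h1 with rfl | h1
    · rw [excess_self]
    have := hneg m (by omega) (by omega)
    omega
  · have := hk3 m ⟨h1, h2⟩; omega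

/-- `k` is the right end of the innermost `gb` interval around the position just after `i`. -/
def Up (w : ℤ → Color) (i k : ℤ) : Prop := Bal .g .b w i k ∧ w k = .b

/-- `j` is the left end of the innermost `br` interval around the position just before `i`. -/
def Dn (w : ℤ → Color) (i j : ℤ) : Prop := Bal .b .r w j i ∧ w j = .b

lemma Up.lt (h : Up w i k) : i < k := h.1.1

lemma Dn.lt (h : Dn w i j) : j < i := h.1.1

lemma Up.unique (h : Up w i j) (h' : Up w i k) : j = k :=
  h.1.right_unique h'.1 (by rw [h.2]; rfl) (by rw [h'.2]; rfl)

lemma Dn.unique (h : Dn w i j) (h' : Dn w i k) : j = k :=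
  h.1.left_unique h'.1 (by rw [h.2]; rfl) (by rw [h'.2]; rfl)

lemma Up.inj (h : Up w i k) (h' : Up w j k) (hi : w i = .g) (hj : w j = .g) : i = j :=
  h.1.left_unique h'.1 (by rw [hi]; rfl) (by rw [hj]; rfl)

lemma Dn.inj (h : Dn w i k) (h' : Dn w j k) (hi : w i = .r) (hj : w j = .r) : i = j :=
  h.1.right_unique h'.1 (by rw [hi]; rfl) (by rw [hj]; rfl)

/-- One letter at a time computes the first passage: b ends it, r is invisible, g opens an excursion
that is skipped as a whole. Each of these rules, and of those for `Dn` (read backwards, with g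
invisible), corresponds to moving across one triangle. -/
lemma Up.of_b (h : w (i + 1) = .b) : Up w i (i + 1) := ⟨Bal.of_adjacent .., h⟩

lemma Up.of_r (h : w (i + 1) = .r) (h' : Up w (i + 1) k) : Up w i k :=
  ⟨(Bal.of_adjacent ..).trans h'.1 (by rw [h]; rfl), h'.2⟩

lemma Up.of_g (h : w (i + 1) = .g) (h' : Up w (i + 1) j) (h'' : Up w j k) : Up w i k :=
  ⟨Bal.trans_forward (by rw [h]; rfl) h'.1 (by rw [h'.2]; rfl) h''.1, h''.2⟩

lemma Dn.of_b (h : w (i - 1) = .b) : Dn w i (i - 1) := by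
  have := Bal.of_adjacent .b .r w (i - 1)
  rw [sub_add_cancel] at this
  exact ⟨this, h⟩

lemma Dn.of_g (h : w (i - 1) = .g) (h' : Dn w (i - 1) k) : Dn w i k := by
  have := Bal.of_adjacent .b .r w (i - 1)
  rw [sub_add_cancel] at this
  exact ⟨h'.1.trans this (by rw [h]; rfl), h'.2⟩

lemma Dn.of_r (h : w (i - 1) = .r) (h' : Dn w (i - 1) j) (h'' : Dn w j k) : Dn w i k :=
  ⟨Bal.trans_backward (by rw [h]; rfl) h'.1 (by rw [h'.2]; rfl) h''.1, h''.2⟩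

/-- `j` is the first position from `i` on with letter `g`. -/
def NextG (w : ℤ → Color) (i j : ℤ) : Prop := i ≤ j ∧ w j = .g ∧ ∀ k, i ≤ k → k < j → w k ≠ .g

lemma NextG.unique (h : NextG w i j) (h' : NextG w i k) : j = k := by
  rcases lt_trichotomy j k with hl | hl | hl
  · exact absurd h.2.1 (h'.2.2 j h.1 hl)
  · exact hl
  · exact absurd h'.2.1 (h.2.2 k h'.1 hl)

lemma NextG.self (h : w i = .g) : NextG w i i := ⟨le_rfl, h, fun k h1 h2 => by omega⟩

lemma NextG.of_succ (h : w i ≠ .g) (h' : NextG w (i + 1) j) : NextG w i j := by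
  refine ⟨by have := h'.1; omega, h'.2.1, fun k h1 h2 => ?_⟩
  rcases eq_or_lt_of_le h1 with rfl | h1
  · exact h
  · exact h'.2.2 k (by omega) h2

/-- A run of r and the g after it announce a blue child, whose own b is at `k`. The passage from `i`
skips the visit to the child, so it ends where the passage from `k` ends: at the parent. -/
lemma Up.of_run {k' : ℤ} (hij : i < j) (hr : ∀ a, i < a → a < j → w a = .r) (hg : w j = .g)
    (h : Up w j k) (h' : Up w k k') : Up w i k' := by
  have hj1 : Up w (j - 1) k' := by
    have e : j - 1 + 1 = j := by omega
    exact Up.of_g (by rw [e]; exact hg) (by rw [e]; exact h) h'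
  have aux : ∀ m : ℕ, i ≤ j - 1 - m → Up w (j - 1 - m) k' := by
    intro m
    induction m with
    | zero => intro _; simpa using hj1
    | succ m ihm =>
      intro h1
      push_cast at h1 ⊢
      have e : j - 1 - (m + 1 : ℤ) + 1 = j - 1 - m := by ring
      exact Up.of_r (by rw [e]; exact hr _ (by omega) (by omega))
        (by rw [e]; exact ihm (by omega))
  have := aux (j - 1 - i).toNat (by omega)
  rwa [show j - 1 - ((j - 1 - i).toNat : ℤ) = i by omega] at this

/-- Without the factor rb, an r is followed by r or g only. Hence the first g after a red letter
belongs to the vertex that is being visited. -/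
lemma NextG.run (h : NextG w i j) (hi : w i ≠ .b)
    (hrb : ∀ a, i ≤ a → a + 1 < j → w a = .r → w (a + 1) ≠ .b) :
    ∀ a, i ≤ a → a < j → w a = .r := by
  intro a ha
  obtain ⟨m, rfl⟩ : ∃ m : ℕ, a = i + m := ⟨(a - i).toNat, by omega⟩
  clear ha
  induction m with
  | zero =>
    intro ha
    rcases h' : w (i + (0 : ℕ)) with _ | _ | _
    · simp at hi h'; exact absurd h' hi
    · rfl
    · exact absurd h' (h.2.2 _ (by omega) ha)
  | succ m ihm =>
    intro ha
    push_cast at ha ⊢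
    have h1 := ihm (by omega)
    rcases h' : w (i + (m + 1)) with _ | _ | _
    · exact absurd (by rw [← h', ← add_assoc]) (hrb _ (by omega) (by omega) h1)
    · rfl
    · exact absurd h' (h.2.2 _ (by omega) ha)

/-- The vertex at which the edge of the letter `r` or `g` at `i` is met. -/
def Vtx (w : ℤ → Color) (i k : ℤ) : Prop := ∃ j, NextG w i j ∧ Up w j k

lemma Vtx.unique (h : Vtx w i j) (h' : Vtx w i k) : j = k := by
  obtain ⟨a, ha, ha'⟩ := h
  obtain ⟨b, hb, hb'⟩ := h'
  obtain rfl := ha.unique hb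
  exact ha'.unique hb'

lemma Vtx.lt (h : Vtx w i j) : i < j := by
  obtain ⟨a, ha, ha'⟩ := h
  have := ha.1; have := ha'.lt; omega

/-- The edge of the letter at `i` leads from `t` to `h`. -/
def EdgeAt (w : ℤ → Color) (i t h : ℤ) : Prop :=
  match w i with
  | .b => t = i ∧ Up w i h
  | .r => Dn w i t ∧ Vtx w i h
  | .g => Up w i t ∧ Dn w i h

lemma edgeAt_b (hi : w i = .b) {t h : ℤ} : EdgeAt w i t h ↔ t = i ∧ Up w i h := by
  simp [EdgeAt, hi]

lemma edgeAt_r (hi : w i = .r) {t h : ℤ} : EdgeAt w i t h ↔ Dn w i t ∧ Vtx w i h := by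
  simp [EdgeAt, hi]

lemma edgeAt_g (hi : w i = .g) {t h : ℤ} : EdgeAt w i t h ↔ Up w i t ∧ Dn w i h := by
  simp [EdgeAt, hi]

lemma EdgeAt.unique {t h t' h' : ℤ} (H : EdgeAt w i t h) (H' : EdgeAt w i t' h') :
    t = t' ∧ h = h' := by
  rcases hi : w i with _ | _ | _
  · rw [edgeAt_b hi] at H H'
    exact ⟨H.1.trans H'.1.symm, H.2.unique H'.2⟩
  · rw [edgeAt_r hi] at H H'
    exact ⟨H.1.unique H'.1, H.2.unique H'.2⟩
  · rw [edgeAt_g hi] at H H'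
    exact ⟨H.1.unique H'.1, H.2.unique H'.2⟩

lemma isMatch_gb_iff : IsMatch .g .b w j k ↔ w j = .g ∧ Up w j k := by
  unfold IsMatch Up Bal; tauto

lemma isMatch_br_iff : IsMatch .b .r w j k ↔ w k = .r ∧ Dn w k j := by
  unfold IsMatch Dn Bal; tauto

lemma isEdge_b (hi : w i = .b) {t h : ℤ} : IsEdge w i t h ↔
    t = i ∧ IsLeast {k | ∃ j, j < i ∧ i < k ∧ IsMatch .g .b w j k} h := by
  simp [IsEdge, hi]

lemma isEdge_r (hi : w i = .r) {t h : ℤ} : IsEdge w i t h ↔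
    IsMatch .b .r w t i ∧ ∃ j, IsLeast {j | i < j ∧ w j = .g} j ∧ IsMatch .g .b w j h := by
  simp [IsEdge, hi]

lemma isEdge_g (hi : w i = .g) {t h : ℤ} : IsEdge w i t h ↔
    IsMatch .g .b w i t ∧ IsGreatest {j | ∃ k, j < i ∧ i < k ∧ IsMatch .b .r w j k} h := by
  simp [IsEdge, hi]

lemma IsEdge.unique {t h t' h' : ℤ} (H : IsEdge w i t h) (H' : IsEdge w i t' h') :
    t = t' ∧ h = h' := by
  rcases hi : w i with _ | _ | _
  · rw [isEdge_b hi] at H H'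
    exact ⟨H.1.trans H'.1.symm, H.2.unique H'.2⟩
  · rw [isEdge_r hi] at H H'
    obtain ⟨a1, b1, c1, d1⟩ := H
    obtain ⟨a2, b2, c2, d2⟩ := H'
    rw [isMatch_br_iff] at a1 a2
    rw [isMatch_gb_iff] at d1 d2
    obtain rfl := c1.unique c2
    exact ⟨a1.2.unique a2.2, d1.2.unique d2.2⟩
  · rw [isEdge_g hi] at H H'
    rw [isMatch_gb_iff] at H H'
    exact ⟨H.1.2.unique H'.1.2, H.2.unique H'.2⟩

/-- If the matches of its head exist, the edge at `i` is an edge of the infinite graph. -/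
lemma EdgeAt.isEdge {t h : ℤ} (H : EdgeAt w i t h)
    (hb : w i = .b → ∃ j, w j = .g ∧ Up w j h) (hg : w i = .g → ∃ k, w k = .r ∧ Dn w k h) :
    IsEdge w i t h := by
  rcases hi : w i with _ | _ | _
  · rw [edgeAt_b hi] at H
    rw [isEdge_b hi]
    obtain ⟨j, hj, hj'⟩ := hb hi
    obtain ⟨H1, H2⟩ := H
    have hji : j ≠ i := by rintro rfl; simp [hi] at hj
    have := H2.lt
    have := hj'.lt
    have hlt : j < i := by
      -- A g that opens after `i` and closes at `h` would leave a suffix of excess `1`, but the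
      -- suffixes of a balanced word have excess at most `0`.
      by_contra hc
      have h1 := hj'.1.eq_one (by rw [hj]; rfl)
      have h2 := H2.1.le_zero (m := j - 1) (by omega) (by omega)
      omega
    refine ⟨H1, ⟨j, hlt, H2.lt, isMatch_gb_iff.2 ⟨hj, hj'⟩⟩, ?_⟩
    rintro k ⟨j', hj1, hj2, hj3⟩
    rw [isMatch_gb_iff] at hj3
    by_contra hc
    -- A match around `i` that closes before `h` would make the excess from `i` negative before its
    -- first passage.
    have h1 := hj3.2.1.2.1 i (by omega) hj2
    have h2 := hj3.2.1.eq_neg_one (by rw [hj3.2.2]; rfl)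
    have h3 := excess_add (x := .g) (y := .b) (w := w) hj1.le hj2.le
    have h4 := H2.1.2.1 k (by omega) (by omega)
    omega
  · rw [edgeAt_r hi] at H
    rw [isEdge_r hi]
    obtain ⟨H1, j, hj, hj'⟩ := H
    refine ⟨isMatch_br_iff.2 ⟨hi, H1⟩, j, ⟨⟨?_, hj.2.1⟩, ?_⟩, isMatch_gb_iff.2 ⟨hj.2.1, hj'⟩⟩
    · rcases eq_or_lt_of_le hj.1 with h1 | h1
      · have := hj.2.1; rw [← h1, hi] at this; cases this
      · exact h1
    · rintro k ⟨hk1, hk2⟩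
      by_contra hc
      exact hj.2.2 k hk1.le (by omega) hk2
  · rw [edgeAt_g hi] at H
    rw [isEdge_g hi]
    obtain ⟨k, hk, hk'⟩ := hg hi
    obtain ⟨H1, H2⟩ := H
    have hki : k ≠ i := by rintro rfl; simp [hi] at hk
    have := H2.lt
    have := hk'.lt
    have hlt : i < k := by
      by_contra hc
      have h1 := hk'.1.eq_neg_one (by rw [hk]; rfl)
      have h2 := H2.1.2.1 k (by omega) (by omega)
      omega
    refine ⟨isMatch_gb_iff.2 ⟨hi, H1⟩, ⟨k, H2.lt, hlt, isMatch_br_iff.2 ⟨hk, hk'⟩⟩, ?_⟩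
    rintro j ⟨k', hj1, hj2, hj3⟩
    rw [isMatch_br_iff] at hj3
    by_contra hc
    have h1 := hj3.2.1.le_zero (m := i - 1) (by omega) (by omega)
    have h2 := hj3.2.1.eq_one (by rw [hj3.2.2]; rfl)
    have h3 := excess_add (x := .b) (y := .r) (w := w) (show j - 1 ≤ i - 1 by omega)
      (show i - 1 ≤ k' - 1 by omega)
    have h4 := H2.1.le_zero (m := j - 1) (by omega) (by omega)
    omega

/-- The letters whose edges are incident to the vertex `v` lie between the last `g` before the
partner `p` of `v` and the letter `r` matched to `v`. -/
lemma EdgeAt.incident {t h v p q p' : ℤ} (H : EdgeAt w i t h) (hv : t = v ∨ h = v)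
    (hp : w p = .g) (hpv : Up w p v) (hq : w q = .r) (hqv : Dn w q v) (hp' : w p' = .g)
    (hpp' : p' < p) : p' ≤ i ∧ i ≤ q := by
  have := hpv.lt
  have := hqv.lt
  rcases hi : w i with _ | _ | _
  · rw [edgeAt_b hi] at H
    obtain ⟨rfl, H⟩ := H
    rcases hv with rfl | rfl
    · omega
    have := H.lt
    refine ⟨?_, by omega⟩
    -- Otherwise the g at `p` opens between `i` and `v`, and a suffix of excess `1` precedes the
    -- first passage at `v`.
    by_contra hc
    have h1 := H.1.le_zero (m := p - 1) (by omega) (by omega)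
    have h2 := hpv.1.eq_one (by rw [hp]; rfl)
    omega
  · rw [edgeAt_r hi] at H
    obtain ⟨H1, j, H2, H3⟩ := H
    rcases hv with rfl | rfl
    · obtain rfl := H1.inj hqv hi hq
      have := H1.lt
      omega
    · obtain rfl := H3.inj hpv H2.2.1 hp
      have := H2.1
      refine ⟨?_, by omega⟩
      -- A red letter attaches to the first g after it, and a letter before `p'` would attach to
      -- `p'` or earlier. This is the only case in which the bound has to be `p'` instead of `p`.
      by_contra hc
      exact H2.2.2 p' (by omega) hpp' hp'
  · rw [edgeAt_g hi] at H
    rcases hv with rfl | rfl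
    · obtain rfl := H.1.inj hpv hi hp
      omega
    · have := H.2.lt
      refine ⟨by omega, ?_⟩
      by_contra hc
      have h1 := hqv.1.eq_neg_one (by rw [hq]; rfl)
      have h2 := H.2.1.2.1 q (by omega) (by omega)
      omega

lemma Up.congr (h : Up w i k) (hw : ∀ a, i < a → a ≤ k → w a = w' a) : Up w' i k :=
  ⟨h.1.congr fun a h1 h2 => hw a h1 h2.le, by rw [← hw k h.lt le_rfl]; exact h.2⟩

lemma Dn.congr (h : Dn w i k) (hw : ∀ a, k ≤ a → a < i → w a = w' a) : Dn w' i k :=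
  ⟨h.1.congr fun a h1 h2 => hw a h1.le h2, by rw [← hw k le_rfl h.lt]; exact h.2⟩

lemma NextG.congr (h : NextG w i k) (hw : ∀ a, i ≤ a → a ≤ k → w a = w' a) : NextG w' i k :=
  ⟨h.1, by rw [← hw k h.1 le_rfl]; exact h.2.1,
    fun a h1 h2 => by rw [← hw a h1 h2.le]; exact h.2.2 a h1 h2⟩

lemma Vtx.congr (h : Vtx w i k) (hw : ∀ a, i ≤ a → a ≤ k → w a = w' a) : Vtx w' i k := by
  obtain ⟨j, h1, h2⟩ := h
  have := h1.1; have := h2.lt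
  exact ⟨j, h1.congr fun a ha ha' => hw a ha (by omega),
    h2.congr fun a ha ha' => hw a (by omega) ha'⟩

lemma EdgeAt.congr {t h l u : ℤ} (H : EdgeAt w i t h) (hw : ∀ a, l ≤ a → a ≤ u → w a = w' a)
    (hi : l ≤ i ∧ i ≤ u) (ht : l ≤ t ∧ t ≤ u) (hh : l ≤ h ∧ h ≤ u) : EdgeAt w' i t h := by
  have hwi := hw i hi.1 hi.2
  rcases hi' : w i with _ | _ | _
  · rw [edgeAt_b hi'] at H
    rw [edgeAt_b (hwi ▸ hi')]
    exact ⟨H.1, H.2.congr fun a h1 h2 => hw a (by omega) (by omega)⟩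
  · rw [edgeAt_r hi'] at H
    rw [edgeAt_r (hwi ▸ hi')]
    exact ⟨H.1.congr fun a h1 h2 => hw a (by omega) (by omega),
      H.2.congr fun a h1 h2 => hw a (by omega) (by omega)⟩
  · rw [edgeAt_g hi'] at H
    rw [edgeAt_g (hwi ▸ hi')]
    exact ⟨H.1.congr fun a h1 h2 => hw a (by omega) (by omega),
      H.2.congr fun a h1 h2 => hw a (by omega) (by omega)⟩

lemma EdgeAt.color {t h : ℤ} (H : EdgeAt w i t h) : w t = .b ∧ w h = .b := by
  rcases hi : w i with _ | _ | _
  · rw [edgeAt_b hi] at H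
    exact ⟨H.1 ▸ hi, H.2.2⟩
  · rw [edgeAt_r hi] at H
    obtain ⟨H1, j, _, H2⟩ := H
    exact ⟨H1.2, H2.2⟩
  · rw [edgeAt_g hi] at H
    exact ⟨H.1.2, H.2.2⟩

end Words

end SchnyderWood
namespace SchnyderWood

/-! ### Local structure of wooded triangulations -/

namespace WoodedTriangulation

variable {D : Type} (S : WoodedTriangulation D) {d d' : D} {c c' : Color}

lemma face_apply (d : D) : S.face d = S.rot (S.rev d) := rfl

lemma face_face_face (d : D) : S.face (S.face (S.face d)) = d := (S.face_three d).2

lemma face_rev (d : D) : S.face (S.rev d) = S.rot d := by rw [face_apply, S.rev_rev]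

lemma rev_inj (h : S.rev d = S.rev d') : d = d' := S.rev.injective h

lemma src_rot (d : D) : S.src (S.rot d) = S.src d :=
  Quotient.sound (s := Equiv.Perm.SameCycle.setoid S.rot)
    (show S.rot.SameCycle (S.rot d) d from (Equiv.Perm.sameCycle_apply_left).2 (.refl _ _))

lemma src_face (d : D) : S.src (S.face d) = S.src (S.rev d) := S.src_rot _

lemma src_ne (d : D) : S.src d ≠ S.src (S.rev d) := fun h => S.no_loop d (Quotient.exact h)

lemma tgt_eq (d : D) : S.tgt d = S.src (S.rev d) := rfl

/-- The outer dart from `A_g` to `A_r`. -/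
def dartX : D := S.face S.root

/-- The outer dart from `A_r` to `A_b`. -/
def dartY : D := S.face S.dartX

lemma face_dartY : S.face S.dartY = S.root := S.face_face_face _

lemma rot_rev_root : S.rot (S.rev S.root) = S.dartX := rfl

lemma rot_rev_dartX : S.rot (S.rev S.dartX) = S.dartY := rfl

lemma rot_rev_dartY : S.rot (S.rev S.dartY) = S.root := S.face_dartY

lemma src_root : S.src S.root = S.outerVertex .b := rfl

lemma src_dartX : S.src S.dartX = S.outerVertex .g := rfl

lemma src_dartY : S.src S.dartY = S.outerVertex .r := rfl

lemma src_rev_root : S.src (S.rev S.root) = S.outerVertex .g := by rw [← src_face]; rfl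

lemma src_rev_dartX : S.src (S.rev S.dartX) = S.outerVertex .r := by rw [← src_face]; rfl

lemma src_rev_dartY : S.src (S.rev S.dartY) = S.outerVertex .b := by
  rw [← src_face, face_dartY]; rfl

lemma outerVertex_injective : Function.Injective S.outerVertex := by
  have h1 : S.outerVertex .b ≠ S.outerVertex .g := by
    rw [← src_root, ← src_rev_root]; exact S.src_ne _
  have h2 : S.outerVertex .g ≠ S.outerVertex .r := by
    rw [← src_dartX, ← src_rev_dartX]; exact S.src_ne _
  have h3 : S.outerVertex .r ≠ S.outerVertex .b := by
    rw [← src_dartY, ← src_rev_dartY]; exact S.src_ne _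
  rintro (_ | _ | _) (_ | _ | _) h
  all_goals first | rfl | exact absurd h ‹_› | exact absurd h.symm ‹_›

lemma face_sameCycle_iff (d d' : D) :
    S.face.SameCycle d d' ↔ d' = d ∨ d' = S.face d ∨ d' = S.face (S.face d) := by
  constructor
  · rintro ⟨k, rfl⟩
    have h3 : S.face ^ (3 : ℤ) = 1 := by
      ext x
      exact S.face_face_face x
    have : S.face ^ k = S.face ^ (k % 3) := by
      conv_lhs => rw [← Int.emod_add_mul_ediv k 3, zpow_add, zpow_mul, h3, one_zpow, mul_one]
    rw [this]
    have h1 := Int.emod_nonneg k (show (3 : ℤ) ≠ 0 by norm_num)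
    have h2 := Int.emod_lt_of_pos k (show (0 : ℤ) < 3 by norm_num)
    obtain h | h | h : k % 3 = 0 ∨ k % 3 = 1 ∨ k % 3 = 2 := by omega
    · rw [h]; left; rfl
    · rw [h]; right; left; rfl
    · rw [h]; right; right; rfl
  · rintro (rfl | rfl | rfl)
    · exact .refl _ _
    · exact Equiv.Perm.sameCycle_apply_right.2 (.refl _ _)
    · exact Equiv.Perm.sameCycle_apply_right.2 (Equiv.Perm.sameCycle_apply_right.2 (.refl _ _))

lemma isOuter_iff (d : D) : S.IsOuter d ↔ d = S.root ∨ d = S.dartX ∨ d = S.dartY ∨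
    d = S.rev S.root ∨ d = S.rev S.dartX ∨ d = S.rev S.dartY := by
  have h : ∀ a, S.rev d = a ↔ d = S.rev a := fun a =>
    ⟨fun h => by rw [← h, S.rev_rev], fun h => by rw [h, S.rev_rev]⟩
  unfold PlaneTriangulation.IsOuter
  rw [face_sameCycle_iff, face_sameCycle_iff, h, h, h]
  unfold dartY dartX
  tauto

lemma isOuter_rev (d : D) : S.IsOuter (S.rev d) ↔ S.IsOuter d := by
  unfold PlaneTriangulation.IsOuter
  rw [S.rev_rev]; tauto

lemma not_isOuter_of_isInner (h : S.IsInner (S.src d)) : ¬ S.IsOuter d := by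
  rw [isOuter_iff]
  rintro (rfl | rfl | rfl | rfl | rfl | rfl)
  · exact h .b rfl
  · exact h .g rfl
  · exact h .r rfl
  · exact h .g S.src_rev_root
  · exact h .r S.src_rev_dartX
  · exact h .b S.src_rev_dartY

open Classical in
/-- The coloring, extended to the outer edges: those at `A_b` are directed to `A_b` and blue, the
third one is directed from `A_g` to `A_r` and red. -/
noncomputable def xcol (d : D) : Option Color :=
  if d = S.rev S.root ∨ d = S.dartY then some .b else if d = S.dartX then some .r else S.col d

lemma ne_of_src (h : S.src d ≠ S.src d') : d ≠ d' := fun e => h (e ▸ rfl)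

lemma ne_of_outer (h : S.src d = S.outerVertex c) (h' : S.src d' = S.outerVertex c')
    (hc : c ≠ c') : d ≠ d' :=
  S.ne_of_src (by rw [h, h']; exact fun e => hc (S.outerVertex_injective e))

lemma rev_root_ne_dartX : S.rev S.root ≠ S.dartX := fun h => by
  have := congrArg S.rev h
  rw [S.rev_rev] at this
  exact S.ne_of_outer S.src_root S.src_rev_dartX (by decide) this

lemma dartY_ne_rev_dartX : S.dartY ≠ S.rev S.dartX := fun h => by
  have := congrArg S.rev h
  rw [S.rev_rev] at this
  exact S.ne_of_outer S.src_rev_dartY S.src_dartX (by decide) this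

lemma xcol_of_not_isOuter (h : ¬ S.IsOuter d) : S.xcol d = S.col d := by
  rw [isOuter_iff] at h
  unfold xcol
  rw [if_neg (by tauto), if_neg (by tauto)]

lemma xcol_rev_root : S.xcol (S.rev S.root) = some .b := by simp [xcol]

lemma xcol_dartY : S.xcol S.dartY = some .b := by simp [xcol]

lemma xcol_dartX : S.xcol S.dartX = some .r := by
  unfold xcol
  rw [if_neg, if_pos rfl]
  rintro (h | h)
  · exact S.rev_root_ne_dartX h.symm
  · exact S.ne_of_outer S.src_dartX S.src_dartY (by decide) h

lemma xcol_root : S.xcol S.root = none := by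
  unfold xcol
  rw [if_neg, if_neg, S.col_outer _ ((S.isOuter_iff _).2 (Or.inl rfl))]
  · exact S.ne_of_outer S.src_root S.src_dartX (by decide)
  · rintro (h | h)
    · exact S.rev_ne _ h.symm
    · exact S.ne_of_outer S.src_root S.src_dartY (by decide) h

lemma xcol_rev_dartX : S.xcol (S.rev S.dartX) = none := by
  unfold xcol
  rw [if_neg, if_neg, S.col_outer _ ((S.isOuter_iff _).2 (by tauto))]
  · exact S.rev_ne _
  · rintro (h | h)
    · exact S.ne_of_outer S.src_rev_dartX S.src_rev_root (by decide) h
    · exact S.dartY_ne_rev_dartX h.symm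

lemma xcol_rev_dartY : S.xcol (S.rev S.dartY) = none := by
  unfold xcol
  rw [if_neg, if_neg, S.col_outer _ ((S.isOuter_iff _).2 (by tauto))]
  · exact S.ne_of_outer S.src_rev_dartY S.src_dartX (by decide)
  · rintro (h | h)
    · exact S.ne_of_outer S.src_rev_dartY S.src_rev_root (by decide) h
    · exact S.rev_ne _ h

lemma xcol_rev_eq_none (h : S.xcol d = some c) : S.xcol (S.rev d) = none := by
  by_cases ho : S.IsOuter d
  · rw [isOuter_iff] at ho
    rcases ho with rfl | rfl | rfl | rfl | rfl | rfl
    · rw [xcol_root] at h; cases h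
    · exact S.xcol_rev_dartX
    · exact S.xcol_rev_dartY
    · rw [S.rev_rev, xcol_root]
    · rw [xcol_rev_dartX] at h; cases h
    · rw [xcol_rev_dartY] at h; cases h
  · rw [S.xcol_of_not_isOuter ho] at h
    rw [S.xcol_of_not_isOuter (by rwa [isOuter_rev]), ← S.col_inner d ho, h]
    rfl

/-- The dart leaves its tail along an edge of color `c`. -/
def Out (c : Color) (d : D) : Prop := S.xcol d = some c

/-- The dart leaves its tail against the direction of an edge of color `c`. -/
def In (c : Color) (d : D) : Prop := S.xcol (S.rev d) = some c

variable {S}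

lemma In.not_out (h : S.In c d) (h' : S.Out c' d) : False := by
  have := S.xcol_rev_eq_none h'
  rw [In, this] at h; cases h

lemma Out.color (h : S.Out c d) (h' : S.Out c' d) : c = c' := by
  rw [Out] at h h'; rw [h] at h'; exact Option.some.inj h'

lemma In.color (h : S.In c d) (h' : S.In c' d) : c = c' := by
  rw [In] at h h'; rw [h] at h'; exact Option.some.inj h'

variable (S)

lemma in_rev : S.In c (S.rev d) ↔ S.Out c d := by rw [In, Out, S.rev_rev]

lemma out_rev : S.Out c (S.rev d) ↔ S.In c d := Iff.rfl

lemma at_outer (h : S.src d = S.outerVertex c) (ho : ¬ S.IsOuter d) : S.In c d := by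
  rw [In, S.xcol_of_not_isOuter (by rwa [isOuter_rev])]
  exact S.col_outerVertex c d h ho

/-- The orientation chosen for the outer edges makes `A_b` the root of the blue tree. -/
lemma at_b (h : S.src d = S.outerVertex .b) : S.In .b d := by
  by_cases ho : S.IsOuter d
  · rw [isOuter_iff] at ho
    rcases ho with rfl | rfl | rfl | rfl | rfl | rfl
    · exact S.xcol_rev_root
    · exact absurd rfl (S.ne_of_outer S.src_dartX h (by decide))
    · exact absurd rfl (S.ne_of_outer S.src_dartY h (by decide))
    · exact absurd rfl (S.ne_of_outer S.src_rev_root h (by decide))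
    · exact absurd rfl (S.ne_of_outer S.src_rev_dartX h (by decide))
    · rw [in_rev]; exact S.xcol_dartY
  · exact S.at_outer h ho

lemma at_g (h : S.src d = S.outerVertex .g) :
    S.In .g d ∨ (d = S.dartX ∧ S.Out .r d) ∨ (d = S.rev S.root ∧ S.Out .b d) := by
  by_cases ho : S.IsOuter d
  · rw [isOuter_iff] at ho
    rcases ho with rfl | rfl | rfl | rfl | rfl | rfl
    · exact absurd rfl (S.ne_of_outer S.src_root h (by decide))
    · exact Or.inr (Or.inl ⟨rfl, S.xcol_dartX⟩)
    · exact absurd rfl (S.ne_of_outer S.src_dartY h (by decide))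
    · exact Or.inr (Or.inr ⟨rfl, S.xcol_rev_root⟩)
    · exact absurd rfl (S.ne_of_outer S.src_rev_dartX h (by decide))
    · exact absurd rfl (S.ne_of_outer S.src_rev_dartY h (by decide))
  · exact Or.inl (S.at_outer h ho)

lemma at_r (h : S.src d = S.outerVertex .r) : S.In .r d ∨ (d = S.dartY ∧ S.Out .b d) := by
  by_cases ho : S.IsOuter d
  · rw [isOuter_iff] at ho
    rcases ho with rfl | rfl | rfl | rfl | rfl | rfl
    · exact absurd rfl (S.ne_of_outer S.src_root h (by decide))
    · exact absurd rfl (S.ne_of_outer S.src_dartX h (by decide))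
    · exact Or.inr ⟨rfl, S.xcol_dartY⟩
    · exact absurd rfl (S.ne_of_outer S.src_rev_root h (by decide))
    · left; rw [in_rev]; exact S.xcol_dartX
    · exact absurd rfl (S.ne_of_outer S.src_rev_dartY h (by decide))
  · exact Or.inl (S.at_outer h ho)

lemma vertex_cases (v : S.Vertex) : S.IsInner v ∨ v = S.outerVertex .b ∨ v = S.outerVertex .g ∨
    v = S.outerVertex .r := by
  by_cases h : S.IsInner v
  · exact Or.inl h
  · simp only [PlaneTriangulation.IsInner, not_forall, not_not] at h
    obtain ⟨_ | _ | _, h⟩ := h <;> tauto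

lemma rule_inner (h : S.IsInner (S.src d)) (c : Color) :
    (S.Out c d → S.Out c.next (S.rot d) ∨ S.In c.prev (S.rot d)) ∧
    (S.In c d → S.In c (S.rot d) ∨ S.Out c.prev (S.rot d)) := by
  have h1 := S.not_isOuter_of_isInner h
  have h2 : ¬ S.IsOuter (S.rot d) := S.not_isOuter_of_isInner (by rwa [src_rot])
  have h3 : ¬ S.IsOuter (S.rev d) := by rwa [isOuter_rev]
  have h4 : ¬ S.IsOuter (S.rev (S.rot d)) := by rwa [isOuter_rev]
  unfold Out In
  rw [S.xcol_of_not_isOuter h1, S.xcol_of_not_isOuter h2, S.xcol_of_not_isOuter h3,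
    S.xcol_of_not_isOuter h4]
  exact S.schnyder d h c

variable {S}

lemma Out.at_g (h : S.Out c d) (hs : S.src d = S.outerVertex .g) :
    (d = S.dartX ∧ c = .r) ∨ (d = S.rev S.root ∧ c = .b) := by
  rcases S.at_g hs with h1 | ⟨h1, h2⟩ | ⟨h1, h2⟩
  · exact (h1.not_out h).elim
  · exact Or.inl ⟨h1, h.color h2⟩
  · exact Or.inr ⟨h1, h.color h2⟩

lemma Out.at_r (h : S.Out c d) (hs : S.src d = S.outerVertex .r) : d = S.dartY ∧ c = .b := by
  rcases S.at_r hs with h1 | ⟨h1, h2⟩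
  · exact (h1.not_out h).elim
  · exact ⟨h1, h.color h2⟩

lemma Out.not_at_b (h : S.Out c d) (hs : S.src d = S.outerVertex .b) : False :=
  (S.at_b hs).not_out h

lemma In.at_g (h : S.In c d) (hs : S.src d = S.outerVertex .g) : c = .g := by
  rcases S.at_g hs with h1 | ⟨h1, h2⟩ | ⟨h1, h2⟩
  · exact h.color h1
  · exact (h.not_out h2).elim
  · exact (h.not_out h2).elim

lemma In.at_r (h : S.In c d) (hs : S.src d = S.outerVertex .r) : c = .r := by
  rcases S.at_r hs with h1 | ⟨h1, h2⟩
  · exact h.color h1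
  · exact (h.not_out h2).elim

/-- With the extended coloring this covers the outer vertices too: `A_b` has no outgoing dart, `A_g`
has one red and one blue, `A_r` has one blue. -/
lemma Out.unique (h : S.Out c d) (h' : S.Out c d') (hs : S.src d = S.src d') : d = d' := by
  rcases S.vertex_cases (S.src d) with hv | hv | hv | hv
  · obtain ⟨e, -, he⟩ := S.col_out _ hv c
    rw [Out, S.xcol_of_not_isOuter (S.not_isOuter_of_isInner hv)] at h
    rw [Out, S.xcol_of_not_isOuter (S.not_isOuter_of_isInner (hs ▸ hv))] at h'
    rw [he d ⟨rfl, h⟩, he d' ⟨hs.symm, h'⟩]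
  · exact (h.not_at_b hv).elim
  · rcases h.at_g hv with ⟨h1, h2⟩ | ⟨h1, h2⟩ <;>
      rcases h'.at_g (hs ▸ hv) with ⟨h3, h4⟩ | ⟨h3, h4⟩
    · rw [h1, h3]
    · subst h2; cases h4
    · subst h2; cases h4
    · rw [h1, h3]
  · rw [(h.at_r hv).1, (h'.at_r (hs ▸ hv)).1]

/-- Schnyder's rule persists at the outer vertices for the four kinds of darts that the walk uses,
except at corners of the outer face. Here the exception is the corner at `A_r`, where `S.rev
S.dartX` is followed by `S.dartY`. -/
lemma In.rot_r (h : S.In .r d) (hX : d ≠ S.rev S.dartX) :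
    S.In .r (S.rot d) ∨ S.Out .g (S.rot d) := by
  rcases S.vertex_cases (S.src d) with hv | hv | hv | hv
  · exact (S.rule_inner hv .r).2 h
  · cases h.color (S.at_b hv)
  · cases h.at_g hv
  · rcases S.at_r (d := S.rot d) (by rw [src_rot, hv]) with h1 | ⟨h1, -⟩
    · exact Or.inl h1
    · exact absurd (S.rot.injective (h1.trans S.rot_rev_dartX.symm)) hX

lemma Out.rot_g (h : S.Out .g d) : S.In .b (S.rot d) ∨ S.Out .r (S.rot d) := by
  rcases S.vertex_cases (S.src d) with hv | hv | hv | hv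
  · exact ((S.rule_inner hv .g).1 h).symm
  · exact (h.not_at_b hv).elim
  · rcases h.at_g hv with ⟨-, h⟩ | ⟨-, h⟩ <;> cases h
  · cases (h.at_r hv).2

lemma In.rot_b (h : S.In .b d) : S.In .b (S.rot d) ∨ S.Out .r (S.rot d) := by
  rcases S.vertex_cases (S.src d) with hv | hv | hv | hv
  · exact (S.rule_inner hv .b).2 h
  · exact Or.inl (S.at_b (by rw [src_rot, hv]))
  · cases h.at_g hv
  · cases h.at_r hv

/-- The exception is the corner of the outer face at `A_g`, where `S.rev S.root` is followed by
`S.dartX`. -/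
lemma Out.rot_b (h : S.Out .b d) (hr : d ≠ S.rev S.root) :
    S.In .r (S.rot d) ∨ S.Out .g (S.rot d) := by
  rcases S.vertex_cases (S.src d) with hv | hv | hv | hv
  · exact ((S.rule_inner hv .b).1 h).symm
  · exact (h.not_at_b hv).elim
  · rcases h.at_g hv with ⟨-, h⟩ | ⟨h, -⟩
    · cases h
    · exact absurd h hr
  · rcases S.at_r (d := S.rot d) (by rw [src_rot, hv]) with h1 | ⟨h1, -⟩
    · exact Or.inl h1
    · have := S.rot.injective (h1.trans S.rot_rev_dartX.symm)
      rw [(h.at_r hv).1] at this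
      exact absurd this S.dartY_ne_rev_dartX

end WoodedTriangulation

end SchnyderWood
namespace SchnyderWood
namespace WoodedTriangulation

variable {D : Type} (S : WoodedTriangulation D) {d d' p p' q : D} {c c' : Color}

/-! ### The word of a wooded triangulation -/

/-- The dart `d` is met with letter `c`: outgoing blue or green edges, incoming red edges. -/
def Letter (d : D) : Color → Prop
  | .b => S.Out .b d
  | .r => S.In .r d
  | .g => S.Out .g d

/-- The step of the clockwise walk around the blue tree from one letter to the next. -/
def Step (p p' : D) : Prop :=
  (S.In .r p ∧ p' = S.rot p) ∨
  ∃ d, ((S.Out .g p ∧ d = S.rot p) ∨ (S.Out .b p ∧ d = S.rot (S.rev p))) ∧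
    ((S.In .b d ∧ p' = S.rot (S.rev d)) ∨ (S.Out .r d ∧ S.Out .b p' ∧ S.src p' = S.src d))

variable {S}

lemma Letter.color (h : S.Letter d c) (h' : S.Letter d c') : c = c' := by
  rcases c with _ | _ | _ <;> rcases c' with _ | _ | _ <;> first
    | rfl
    | (exact (In.not_out h h').elim)
    | (exact (In.not_out h' h).elim)
    | (cases Out.color h h')

lemma Step.ne_dartX (h : S.Letter p' c) : p' ≠ S.dartX := by
  rintro rfl
  rcases c with _ | _ | _
  · cases Out.color h S.xcol_dartX
  · exact In.not_out h S.xcol_dartX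
  · cases Out.color h S.xcol_dartX

lemma Step.of_r (h : S.Step p p') (hp : S.In .r p) : p' = S.rot p := by
  rcases h with h | ⟨d, h | h, -⟩
  · exact h.2
  · exact (hp.not_out h.1).elim
  · exact (hp.not_out h.1).elim

/-- The dart that follows a blue or green letter. -/
def turn (S : WoodedTriangulation D) (c : Color) (p : D) : D :=
  if c = .g then S.rot p else S.rot (S.rev p)

lemma Step.of_bg (h : S.Step p p') (hp : S.Letter p c) (hc : c ≠ .r) :
    (S.In .b (S.turn c p) ∧ p' = S.rot (S.rev (S.turn c p))) ∨
      (S.Out .r (S.turn c p) ∧ S.Out .b p' ∧ S.src p' = S.src (S.turn c p)) := by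
  rcases c with _ | _ | _
  · rcases h with h | ⟨d, h | h, h'⟩
    · exact (h.1.not_out hp).elim
    · cases h.1.color hp
    · rw [h.2] at h'; exact h'
  · exact absurd rfl hc
  · rcases h with h | ⟨d, h | h, h'⟩
    · exact (h.1.not_out hp).elim
    · rw [h.2] at h'; exact h'
    · cases h.1.color hp

/-- The predecessor can be recognized: a letter b is reached from the outgoing red edge of its
vertex, any other letter by rotation from an incoming red or an outgoing blue edge. The dart
`S.dartY` is excluded because the walk turns from it to the root dart, whose reverse is the
exception to the rotation rule for blue edges. -/
lemma Step.injective (hp : S.Step p p') (hq : S.Step q p') (hpY : p ≠ S.dartY)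
    (hqY : q ≠ S.dartY) : p = q := by
  have key : ∀ {p d}, p ≠ S.dartY →
      ((S.Out .g p ∧ d = S.rot p) ∨ (S.Out .b p ∧ d = S.rot (S.rev p))) → d ≠ S.root := by
    rintro p d hY (⟨h1, rfl⟩ | ⟨h1, rfl⟩) h
    · have := S.rot.injective (h.trans S.rot_rev_dartY.symm)
      subst this
      exact h1.not_at_b S.src_rev_dartY
    · exact hY (S.rev_inj (S.rot.injective (h.trans S.rot_rev_dartY.symm)))
  have clash : ∀ {p q}, S.In .r p ∧ p' = S.rot p →
      (∃ d, ((S.Out .g q ∧ d = S.rot q) ∨ (S.Out .b q ∧ d = S.rot (S.rev q))) ∧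
      ((S.In .b d ∧ p' = S.rot (S.rev d)) ∨ (S.Out .r d ∧ S.Out .b p' ∧ S.src p' = S.src d))) →
      False := by
    rintro p q ⟨h1, h2⟩ ⟨d, -, ⟨h3, h4⟩ | ⟨h3, h4, h5⟩⟩
    · have := S.rot.injective (h2.symm.trans h4)
      subst this
      exact h1.not_out h3
    · by_cases hX : p = S.rev S.dartX
      · rw [hX, rot_rev_dartX] at h2
        rw [h2] at h5
        cases (h3.at_r (h5.symm.trans S.src_dartY)).2
      · subst h2
        rcases h1.rot_r hX with h6 | h6
        · exact h6.not_out h4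
        · cases h6.color h4
  have clash2 : ∀ {d d' q}, q ≠ S.dartY →
      ((S.Out .g q ∧ d = S.rot q) ∨ (S.Out .b q ∧ d = S.rot (S.rev q))) →
      (S.In .b d ∧ p' = S.rot (S.rev d)) →
      (S.Out .r d' ∧ S.Out .b p' ∧ S.src p' = S.src d') → False := by
    rintro d d' q hY h ⟨h1, rfl⟩ ⟨h2, h3, h4⟩
    rcases Out.rot_b (d := S.rev d) h1 (fun e => key hY h (S.rev_inj e)) with h5 | h5
    · exact h5.not_out h3
    · cases h5.color h3
  have same : ∀ {d}, ((S.Out .g p ∧ d = S.rot p) ∨ (S.Out .b p ∧ d = S.rot (S.rev p))) →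
      ((S.Out .g q ∧ d = S.rot q) ∨ (S.Out .b q ∧ d = S.rot (S.rev q))) → p = q := by
    rintro d (⟨h1, h2⟩ | ⟨h1, h2⟩) (⟨h3, h4⟩ | ⟨h3, h4⟩)
    · exact S.rot.injective (h2.symm.trans h4)
    · have := S.rot.injective (h2.symm.trans h4)
      subst this
      exact (In.not_out (S.in_rev.2 h3) h1).elim
    · have := S.rot.injective (h2.symm.trans h4)
      subst this
      exact (In.not_out (S.in_rev.2 h1) h3).elim
    · exact S.rev_inj (S.rot.injective (h2.symm.trans h4))
  rcases hp with hp | ⟨d, hd, hp⟩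
  · rcases hq with hq | hq
    · exact S.rot.injective (hp.2.symm.trans hq.2)
    · exact (clash hp hq).elim
  · rcases hq with hq | ⟨e, he, hq⟩
    · exact (clash hq ⟨d, hd, hp⟩).elim
    · rcases hp with hp | hp <;> rcases hq with hq | hq
      · have := S.rev_inj (S.rot.injective (hp.2.symm.trans hq.2))
        subst this
        exact same hd he
      · exact (clash2 hpY hd hp hq).elim
      · exact (clash2 hqY he hq hp).elim
      · have := hp.1.unique hq.1 (hp.2.2.symm.trans hq.2.2)
        subst this
        exact same hd he

/-- A predecessor would have to arrive through the outgoing red edge `S.dartX` of `A_g`. Turning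
back from there leads to the outer edge between `A_g` and `A_b`, in a role (outgoing green, or
outgoing blue at `A_b`) that it does not have. -/
lemma Step.ne_rev_root (h : S.Step p (S.rev S.root)) : False := by
  rcases h with ⟨h1, h2⟩ | ⟨d, h1, ⟨h2, h3⟩ | ⟨h2, h3, h4⟩⟩
  · cases h1.at_g (by rw [← S.src_rot, ← h2]; exact S.src_rev_root)
  · have h4 : S.src (S.rev d) = S.outerVertex .g := by rw [← S.src_rot, ← h3]; exact S.src_rev_root
    rcases Out.at_g (d := S.rev d) h2 h4 with ⟨-, h5⟩ | ⟨h5, -⟩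
    · cases h5
    · rw [h5, rot_rev_root] at h3
      exact S.rev_root_ne_dartX h3
  · rcases h2.at_g (h4.symm.trans S.src_rev_root) with ⟨h5, -⟩ | ⟨-, h5⟩
    · subst h5
      rcases h1 with ⟨h6, h7⟩ | ⟨h6, h7⟩
      · rw [← S.rot.injective (S.rot_rev_root.trans h7)] at h6
        cases h6.color S.xcol_rev_root
      · rw [← S.rev_inj (S.rot.injective (S.rot_rev_root.trans h7))] at h6
        exact h6.not_at_b S.src_root
    · cases h5

/-- The rotation rules provide the next letter except at the end of the walk: `S.rev S.dartX` is
followed by `S.dartY`, and `S.dartY` by the outer face. -/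
lemma exists_step (hp : S.Letter p c) (hpY : p ≠ S.dartY) (hpX : p ≠ S.rev S.dartX) :
    ∃ p' c', S.Step p p' ∧ S.Letter p' c' := by
  by_cases hc : c = .r
  · subst hc
    rcases In.rot_r hp hpX with h | h
    · exact ⟨S.rot p, .r, Or.inl ⟨hp, rfl⟩, h⟩
    · exact ⟨S.rot p, .g, Or.inl ⟨hp, rfl⟩, h⟩
  obtain ⟨d, hd, hd'⟩ : ∃ d, ((S.Out .g p ∧ d = S.rot p) ∨ (S.Out .b p ∧ d = S.rot (S.rev p))) ∧
      (S.In .b d ∨ S.Out .r d) := by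
    rcases c with _ | _ | _
    · exact ⟨_, Or.inr ⟨hp, rfl⟩, In.rot_b (S.in_rev.2 hp)⟩
    · exact absurd rfl hc
    · exact ⟨_, Or.inl ⟨hp, rfl⟩, Out.rot_g hp⟩
  rcases hd' with hb | hr
  · have hroot : S.rev d ≠ S.rev S.root := fun e => by
      have e := S.rev_inj e
      rcases hd with ⟨h1, rfl⟩ | ⟨h1, rfl⟩
      · rw [S.rot.injective (e.trans S.rot_rev_dartY.symm)] at h1
        exact h1.not_at_b S.src_rev_dartY
      · exact hpY (S.rev_inj (S.rot.injective (e.trans S.rot_rev_dartY.symm)))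
    rcases Out.rot_b (d := S.rev d) hb hroot with h | h
    · exact ⟨_, .r, Or.inr ⟨d, hd, Or.inl ⟨hb, rfl⟩⟩, h⟩
    · exact ⟨_, .g, Or.inr ⟨d, hd, Or.inl ⟨hb, rfl⟩⟩, h⟩
  · rcases S.vertex_cases (S.src d) with hv | hv | hv | hv
    · obtain ⟨e, ⟨he1, he2⟩, -⟩ := S.col_out _ hv .b
      have he : S.Out .b e := by
        rw [Out, S.xcol_of_not_isOuter (S.not_isOuter_of_isInner (he1 ▸ hv))]; exact he2
      exact ⟨e, .b, Or.inr ⟨d, hd, Or.inr ⟨hr, he, he1⟩⟩, he⟩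
    · exact (hr.not_at_b hv).elim
    · exact ⟨S.rev S.root, .b, Or.inr ⟨d, hd, Or.inr ⟨hr, S.xcol_rev_root, by
        rw [hv, src_rev_root]⟩⟩, S.xcol_rev_root⟩
    · cases (hr.at_r hv).2

variable (S) in
/-- The letters met on the clockwise walk around the blue tree, from `A_g` to `A_r`, form the word
`w` on the interval from `-1` to `M`. -/
structure Coding (w : ℤ → Color) (M : ℤ) (P : ℤ → D) : Prop where
  nonneg : 0 ≤ M
  start : P (-1) = S.rev S.root
  finish : P M = S.rev S.dartX
  last : P (M + 2) = S.dartY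
  step : ∀ i, -1 ≤ i → i < M → S.Step (P i) (P (i + 1))
  letter : ∀ i, -1 ≤ i → i ≤ M → S.Letter (P i) (w i)

/-- The walk from `A_g` around the blue tree reaches `A_r`. -/
lemma exists_coding [Finite D] (S : WoodedTriangulation D) : ∃ w M P, S.Coding w M P := by
  classical
  let T := {d : D // ∃ c, S.Letter d c}
  let p0 : T := ⟨S.rev S.root, .b, S.xcol_rev_root⟩
  let pX : T := ⟨S.rev S.dartX, .r, by
    change S.In .r _
    rw [in_rev]; exact S.xcol_dartX⟩
  let pY : T := ⟨S.dartY, .b, S.xcol_dartY⟩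
  -- The walk is closed up to a self-map of the finite set of darts with letters, by sending `dartY`
  -- back to the start. This map is injective, so the start is periodic. Going backwards from the
  -- start one meets `dartY` and then `rev dartX`, hence the walk passes through both, and no
  -- termination measure is needed.
  have hex : ∀ p : T, ∃ p' : T, (p = pY → p' = p0) ∧ (p ≠ pY → S.Step p.1 p'.1) := fun p => by
    by_cases hY : p = pY
    · exact ⟨p0, fun _ => rfl, fun h => absurd hY h⟩
    by_cases hX : p = pX
    · refine ⟨pY, fun h => absurd h hY, fun _ => Or.inl ?_⟩
      subst hX
      exact ⟨by rw [in_rev]; exact S.xcol_dartX, rfl⟩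
    · obtain ⟨p', c', h1, h2⟩ := exists_step p.2.choose_spec (fun e => hY (Subtype.ext e))
        (fun e => hX (Subtype.ext e))
      exact ⟨⟨p', c', h2⟩, fun h => absurd h hY, fun _ => h1⟩
  choose f hf1 hf2 using hex
  have hf0 : ∀ p, f p = p0 → p = pY := fun p hp => by
    by_contra hY
    have := hf2 p hY
    rw [hp] at this
    exact this.ne_rev_root
  have hinj : Function.Injective f := fun p q hpq => by
    by_cases hp : p = pY
    · rw [hp]
      exact (hf0 q (by rw [← hpq]; exact hf1 p hp)).symm
    by_cases hq : q = pY
    · rw [hq]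
      exact (hf0 p (by rw [hpq]; exact hf1 q hq))
    have h1 := hf2 p hp
    have h2 := hf2 q hq
    rw [hpq] at h1
    exact Subtype.ext (h1.injective h2 (fun e => hp (Subtype.ext e)) (fun e => hq (Subtype.ext e)))
  have hXY : f pX = pY := by
    have : pX ≠ pY := fun e => S.dartY_ne_rev_dartX (congrArg Subtype.val e).symm
    have h := (hf2 pX this).of_r (by rw [in_rev]; exact S.xcol_dartX)
    exact Subtype.ext h
  have h0Y : p0 ≠ pY := fun e =>
    S.ne_of_outer S.src_rev_root S.src_dartY (by decide) (congrArg Subtype.val e)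
  have h0X : p0 ≠ pX := fun e =>
    S.ne_of_outer S.src_rev_root S.src_rev_dartX (by decide) (congrArg Subtype.val e)
  have hXY' : pX ≠ pY := fun e => S.dartY_ne_rev_dartX (congrArg Subtype.val e).symm
  have hper : ∃ k, 0 < k ∧ f^[k] p0 = p0 := by
    obtain ⟨k, hk, hk'⟩ := hinj.mem_periodicPts p0
    exact ⟨k, hk, hk'⟩
  obtain ⟨k, hk, hk', hmin⟩ : ∃ k, 0 < k ∧ f^[k] p0 = p0 ∧ ∀ j, 0 < j → j < k → f^[j] p0 ≠ p0 :=
    ⟨Nat.find hper, (Nat.find_spec hper).1, (Nat.find_spec hper).2,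
      fun j h1 h2 h3 => Nat.find_min hper h2 ⟨h1, h3⟩⟩
  obtain ⟨k, rfl⟩ : ∃ m, k = m + 1 := ⟨k - 1, by omega⟩
  rw [Function.iterate_succ_apply'] at hk'
  have hkY := hf0 _ hk'
  obtain ⟨k, rfl⟩ : ∃ m, k = m + 1 := ⟨k - 1, by
    rcases k with _ | k
    · exact absurd hkY h0Y
    · rfl⟩
  rw [Function.iterate_succ_apply', ← hXY] at hkY
  have hkX := hinj hkY
  obtain ⟨k, rfl⟩ : ∃ m, k = m + 1 := ⟨k - 1, by
    rcases k with _ | k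
    · exact absurd hkX h0X
    · rfl⟩
  have hne : ∀ j ≤ k, f^[j] p0 ≠ pY := fun j hj e => by
    have := hf1 _ e
    rw [← Function.iterate_succ_apply' f] at this
    exact hmin (j + 1) (by omega) (by omega) this
  -- Positions begin at `-1`, which shifts the iterates by one. The dart after `P M` is placed at `M
  -- + 2`, because `M + 1` is reserved for a fictitious letter g of `A_r`, which has no outgoing
  -- green edge.
  choose w hw using fun i : ℤ => (f^[(i + 1).toNat] p0).2
  refine ⟨w, k, fun i => if i = k + 2 then S.dartY else (f^[(i + 1).toNat] p0).1, by omega, ?_, ?_,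
    if_pos rfl, fun i h1 h2 => ?_, fun i h1 h2 => ?_⟩
  · rw [if_neg (by omega)]; rfl
  · rw [if_neg (by omega), show ((k : ℤ) + 1).toNat = k + 1 by omega, hkX]
  · rw [if_neg (by omega), if_neg (by omega), show (i + 1 + 1).toNat = (i + 1).toNat + 1 by omega,
      Function.iterate_succ_apply']
    exact hf2 _ (hne _ (by omega))
  · rw [if_neg (by omega)]; exact hw i

end WoodedTriangulation
end SchnyderWood
-- Matches in the word of a wooded triangulation
namespace SchnyderWood
namespace WoodedTriangulation

variable {D : Type} {S : WoodedTriangulation D} {w : ℤ → Color} {M : ℤ} {P : ℤ → D}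

/-- The letters that follow the word of a wooded triangulation. -/
structure Framed (w : ℤ → Color) (M : ℤ) : Prop where
  g : w (M + 1) = .g
  b : w (M + 2) = .b
  b' : w (M + 3) = .b

/-- The dart of the edge of the letter `b` or `g` at `i` that has its triangle to the left. -/
def leftDart (S : WoodedTriangulation D) (w : ℤ → Color) (P : ℤ → D) (i : ℤ) : D :=
  if w i = .g then S.rev (P i) else P i

/-- The vertex of the letter `b` at `k`. -/
def vert (S : WoodedTriangulation D) (M : ℤ) (P : ℤ → D) (k : ℤ) : S.Vertex :=
  if k = M + 3 then S.outerVertex .b else S.src (P k)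

namespace Coding

variable (C : S.Coding w M P)
include C

lemma letter_start : w (-1) = .b := by
  have h := C.letter (-1) le_rfl (by have := C.nonneg; omega)
  rw [C.start] at h
  exact h.color (c' := .b) S.xcol_rev_root

lemma letter_finish : w M = .r := by
  have h := C.letter M (by have := C.nonneg; omega) le_rfl
  rw [C.finish] at h
  exact h.color (c' := .r) (S.in_rev.2 S.xcol_dartX)

/-- From `S.dartY` the walk would turn to the root dart and from there to `S.dartX`, which carries
no letter. -/
lemma ne_dartY {i : ℤ} (h1 : -1 ≤ i) (h2 : i ≤ M) : P i ≠ S.dartY := fun h => by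
  rcases eq_or_lt_of_le h2 with rfl | h2
  · rw [C.finish] at h; exact S.dartY_ne_rev_dartX h.symm
  · have hs := C.step i h1 h2
    have hl := C.letter (i + 1) (by omega) (by omega)
    rw [h] at hs
    rcases hs.of_bg (c := .b) S.xcol_dartY (by decide) with ⟨-, h4⟩ | ⟨h3, -⟩
    · have : S.turn .b S.dartY = S.root := S.rot_rev_dartY
      rw [this, rot_rev_root] at h4
      exact Step.ne_dartX hl h4
    · have : S.turn .b S.dartY = S.root := S.rot_rev_dartY
      rw [this, Out, xcol_root] at h3
      cases h3

/-- Steps are injective and nothing precedes the start, so a repetition could be moved back to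
position `-1`, where it is impossible. -/
lemma inj {i j : ℤ} (hi : -1 ≤ i) (hi' : i ≤ M) (hj : -1 ≤ j) (hj' : j ≤ M) (h : P i = P j) :
    i = j := by
  have key : ∀ (n : ℕ) (i j : ℤ), i = n - 1 → i < j → j ≤ M → P i ≠ P j := by
    intro n
    induction n with
    | zero =>
      intro i j hi hij hj h
      have hs := C.step (j - 1) (by omega) (by omega)
      rw [sub_add_cancel, ← h, show i = -1 by simpa using hi, C.start] at hs
      exact hs.ne_rev_root
    | succ n ih =>
      intro i j hi hij hj h
      push_cast at hi
      have h1 := C.step (i - 1) (by omega) (by omega)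
      have h2 := C.step (j - 1) (by omega) (by omega)
      rw [sub_add_cancel] at h1 h2
      rw [← h] at h2
      exact ih (i - 1) (j - 1) (by omega) (by omega) (by omega)
        (h1.injective h2 (C.ne_dartY (by omega) (by omega)) (C.ne_dartY (by omega) (by omega)))
  rcases lt_trichotomy i j with hl | hl | hl
  · exact absurd h (key (i + 1).toNat i j (by omega) hl hj')
  · exact hl
  · exact absurd h.symm (key (j + 1).toNat j i (by omega) hl hi')

lemma not_isOuter {i : ℤ} (h1 : 0 ≤ i) (h2 : i < M) : ¬ S.IsOuter (P i) := by
  have hl := C.letter i (by omega) h2.le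
  rw [isOuter_iff]
  rintro (h | h | h | h | h | h)
  · rw [h] at hl
    rcases hw : w i with _ | _ | _ <;> rw [hw] at hl
    · exact In.not_out (c := .b) S.xcol_rev_root hl
    · cases In.color (c := .b) S.xcol_rev_root hl
    · exact In.not_out (c := .b) S.xcol_rev_root hl
  · exact Step.ne_dartX hl h
  · exact C.ne_dartY (by omega) (by omega) h
  · rw [← C.start] at h
    have := C.inj (by omega) (by omega) le_rfl (by omega) h; omega
  · rw [← C.finish] at h
    have := C.inj (by omega) (by omega) (by omega) le_rfl h; omega
  · rw [h] at hl
    have h3 : S.In .b (S.rev S.dartY) := S.in_rev.2 S.xcol_dartY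
    rcases hw : w i with _ | _ | _ <;> rw [hw] at hl
    · exact h3.not_out hl
    · cases h3.color hl
    · exact h3.not_out hl

lemma out_b {i : ℤ} (h1 : -1 ≤ i) (h2 : i ≤ M) (hw : w i = .b) : S.Out .b (P i) := by
  have := C.letter i h1 h2
  rwa [hw] at this

lemma out_g {i : ℤ} (h1 : -1 ≤ i) (h2 : i ≤ M) (hw : w i = .g) : S.Out .g (P i) := by
  have := C.letter i h1 h2
  rwa [hw] at this

lemma in_r {i : ℤ} (h1 : -1 ≤ i) (h2 : i ≤ M) (hw : w i = .r) : S.In .r (P i) := by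
  have := C.letter i h1 h2
  rwa [hw] at this

/-- After a letter `r` the walk stays at its vertex. -/
lemma next_of_r {i : ℤ} (h1 : -1 ≤ i) (h2 : i < M) (hw : w i = .r) : P (i + 1) = S.rot (P i) :=
  (C.step i h1 h2).of_r (C.in_r h1 h2.le hw)

/-- Clockwise after an incoming red edge comes another one or the outgoing green edge. The corner of
the outer face at `A_r` is avoided before `M`. -/
lemma not_rb {i : ℤ} (h1 : -1 ≤ i) (h2 : i < M) (hw : w i = .r) : w (i + 1) ≠ .b := fun hb => by
  have h3 := C.out_b (by omega) (by omega) hb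
  rw [C.next_of_r h1 h2 hw] at h3
  rcases In.rot_r (C.in_r h1 h2.le hw) (fun h => by
    rw [← C.finish] at h
    have := C.inj h1 h2.le (by omega) le_rfl h; omega) with h | h
  · exact h.not_out h3
  · cases h.color h3

omit C in
lemma face_leftDart {i : ℤ} (hw : w i ≠ .r) :
    S.face (S.leftDart w P i) = S.turn (w i) (P i) := by
  unfold leftDart turn
  rcases h : w i with _ | _ | _
  · rfl
  · exact absurd h hw
  · simp [face_rev]

/-- The next letter tells what the walk met after turning: an outgoing red edge means that the
children are exhausted and b follows, an incoming blue edge leads up to a child and r or g follows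
(`next_rg`). -/
lemma next_b {i : ℤ} (h1 : -1 ≤ i) (h2 : i < M) (hw : w i ≠ .r) (hb : w (i + 1) = .b) :
    S.Out .r (S.turn (w i) (P i)) ∧ S.src (P (i + 1)) = S.src (S.turn (w i) (P i)) := by
  have hb' := C.out_b (by omega) (by omega) hb
  rcases (C.step i h1 h2).of_bg (C.letter i h1 h2.le) hw with ⟨h3, h4⟩ | ⟨h3, -, h4⟩
  · exfalso
    rcases Out.rot_b (d := S.rev (S.turn (w i) (P i))) h3 (fun e => by
      rw [e, rot_rev_root] at h4
      exact Step.ne_dartX (C.letter (i + 1) (by omega) (by omega)) h4) with h | h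
    · rw [← h4] at h
      exact h.not_out hb'
    · rw [← h4] at h
      cases h.color hb'
  · exact ⟨h3, h4⟩

lemma next_rg {i : ℤ} (h1 : -1 ≤ i) (h2 : i < M) (hw : w i ≠ .r) (hb : w (i + 1) ≠ .b) :
    S.In .b (S.turn (w i) (P i)) ∧ P (i + 1) = S.face (S.turn (w i) (P i)) := by
  rcases (C.step i h1 h2).of_bg (C.letter i h1 h2.le) hw with h | ⟨-, h3, -⟩
  · exact h
  · exact absurd ((C.letter (i + 1) (by omega) (by omega)).color (c' := .b) h3) hb

/-- The triangle of the letter `r` or `g` at `j`, and the tail of the edge of a letter `r` or the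
head of the edge of a letter `g`. -/
lemma exists_dn {j : ℤ} (h0 : 0 ≤ j) (hM : j ≤ M) (hw : w j ≠ .b) :
    ∃ y, Dn w j y ∧ -1 ≤ y ∧ S.src (S.rev (P j)) = S.src (P y) ∧
      ∃ z, -1 ≤ z ∧ z < j ∧ w z ≠ .r ∧ S.face (P j) = S.leftDart w P z ∧
        (w (j - 1) ≠ .r → z = j - 1) ∧ (w (j - 1) = .r → Dn w (j - 1) (z + 1)) := by
  suffices H : ∀ (n : ℕ) (j : ℤ), j < n → 0 ≤ j → j ≤ M → w j ≠ .b →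
      ∃ y, Dn w j y ∧ -1 ≤ y ∧ S.src (S.rev (P j)) = S.src (P y) ∧
      ∃ z, -1 ≤ z ∧ z < j ∧ w z ≠ .r ∧ S.face (P j) = S.leftDart w P z ∧
        (w (j - 1) ≠ .r → z = j - 1) ∧ (w (j - 1) = .r → Dn w (j - 1) (z + 1)) from
    H (j.toNat + 1) j (by omega) h0 hM hw
  intro n
  induction n with
  | zero => intro j h1 h2; exfalso; push_cast at h1; omega
  | succ n ih =>
    intro j hjn h0 hM hw
    push_cast at hjn
    have hj1 : j - 1 + 1 = j := by omega
    -- The far end of the edge at `j` is the tail of the next side of its triangle. If that side is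
    -- a blue edge the vertex is found at `z`; if it is a green edge, induction applies at `z`. The
    -- two cases are the rules `Dn.of_b` and `Dn.of_g`.
    have fin : ∀ z, -1 ≤ z → z < j → w z ≠ .r → S.face (P j) = S.leftDart w P z →
        ∃ y, (z = j - 1 → Dn w j y) ∧ (z ≠ j - 1 → Dn w (z + 1) y) ∧ -1 ≤ y ∧
          S.src (S.rev (P j)) = S.src (P y) := by
      intro z hz hzj hzr hf
      rw [← src_face, hf, leftDart]
      rcases hz' : w z with _ | _ | _
      · rw [if_neg (by decide)]
        refine ⟨z, ?_, fun _ => ?_, hz, rfl⟩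
        · rintro rfl; exact Dn.of_b hz'
        · have := Dn.of_b (w := w) (i := z + 1) (by rwa [add_sub_cancel_right])
          rwa [add_sub_cancel_right] at this
      · exact absurd hz' hzr
      · rw [if_pos rfl]
        have hz0 : z ≠ -1 := by
          rintro rfl; rw [C.letter_start] at hz'; cases hz'
        obtain ⟨y, hy1, hy2, hy3, -⟩ := ih z (by omega) (by omega) (by omega) (by rw [hz']; decide)
        refine ⟨y, ?_, fun _ => ?_, hy2, hy3⟩
        · rintro rfl; exact Dn.of_g hz' hy1
        · refine Dn.of_g (w := w) (i := z + 1) ?_ ?_ <;> rwa [add_sub_cancel_right]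
    by_cases hr : w (j - 1) = .r
    · have hj0 : j - 1 ≠ -1 := by
        intro h; rw [h, C.letter_start] at hr; cases hr
      obtain ⟨y, hy1, hy2, hy3, -⟩ := ih (j - 1) (by omega) (by omega) (by omega)
        (by rw [hr]; decide)
      have hyb := hy1.2
      have hylt := hy1.lt
      have hin : S.Out .r (S.rev (P (j - 1))) := C.in_r (by omega) (by omega) hr
      -- The vertex at `-1` is `A_g`, whose only outgoing red edge is the outer one, read at `M` and
      -- not before.
      have hy0 : 0 ≤ y := by
        by_contra hc
        obtain rfl : y = -1 := by omega
        rw [C.start, src_rev_root] at hy3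
        rcases hin.at_g hy3 with ⟨h, -⟩ | ⟨-, h⟩
        · have h' : P (j - 1) = P M := by
            rw [C.finish, ← h, S.rev_rev]
          have := C.inj (by omega) (by omega) (by omega) le_rfl h'
          omega
        · cases h
      have hz1 : y - 1 + 1 = y := by omega
      have hzr : w (y - 1) ≠ .r := fun h => C.not_rb (by omega) (by omega) h (by rw [hz1]; exact hyb)
      obtain ⟨h1, h2⟩ := C.next_b (i := y - 1) (by omega) (by omega) hzr (by rw [hz1]; exact hyb)
      rw [hz1] at h2
      -- Both darts are the outgoing red edge of the vertex at `y`. This attaches the triangle at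
      -- `j` to the edge that is read just before `y`.
      have h3 : S.turn (w (y - 1)) (P (y - 1)) = S.rev (P (j - 1)) :=
        h1.unique hin (h2.symm.trans hy3.symm)
      have h4 := C.next_of_r (i := j - 1) (by omega) (by omega) hr
      rw [hj1] at h4
      have hf : S.face (P j) = S.leftDart w P (y - 1) := by
        rw [h4, ← S.face_rev, ← h3, ← face_leftDart hzr, face_face_face]
      obtain ⟨y', h5, h6, h7, h8⟩ := fin (y - 1) (by omega) (by omega) hzr hf
      refine ⟨y', Dn.of_r hr hy1 ?_, h7, h8, y - 1, by omega, by omega, hzr, hf,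
        fun h => absurd hr h, fun _ => by rwa [hz1]⟩
      rw [hz1] at h6
      exact h6 (by omega)
    · obtain ⟨h1, h2⟩ := C.next_rg (i := j - 1) (by omega) (by omega) hr (by rwa [hj1])
      rw [hj1] at h2
      have hf : S.face (P j) = S.leftDart w P (j - 1) := by
        rw [h2, ← face_leftDart hr, face_face_face]
      obtain ⟨y', h5, h6, h7, h8⟩ := fin (j - 1) (by omega) (by omega) hr hf
      exact ⟨y', h5 rfl, h7, h8, j - 1, by omega, by omega, hr, hf, fun _ => rfl,
        fun h => absurd h hr⟩

variable (F : Framed w M)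
include F

/-- Head of the edge of a letter `b`, tail of the edge of a letter `g`, head of the edge of a
letter `r`. -/
lemma exists_up_vtx {i : ℤ} (h0 : -1 ≤ i) (hM : i ≤ M) :
    (w i ≠ .r → i < M → ∃ k, Up w i k ∧ k ≤ M + 3 ∧
      S.src (S.turn (w i) (P i)) = S.vert M P k) ∧
    (w i ≠ .b → 0 ≤ i → ∃ k, Vtx w i k ∧ k ≤ M + 2 ∧ S.src (P i) = S.vert M P k ∧
      ∃ d, S.Out .b d ∧ S.src d = S.src (P i) ∧ d = P k) := by
  suffices H : ∀ (n : ℕ) (i : ℤ), M - i < n → -1 ≤ i → i ≤ M →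
      (w i ≠ .r → i < M → ∃ k, Up w i k ∧ k ≤ M + 3 ∧
        S.src (S.turn (w i) (P i)) = S.vert M P k) ∧
      (w i ≠ .b → 0 ≤ i → ∃ k, Vtx w i k ∧ k ≤ M + 2 ∧ S.src (P i) = S.vert M P k ∧
        ∃ d, S.Out .b d ∧ S.src d = S.src (P i) ∧ d = P k) from
    H ((M - i).toNat + 1) i (by omega) h0 hM
  intro n
  induction n with
  | zero => intro i h1 h2 h3; exfalso; push_cast at h1; omega
  | succ n ih =>
    intro i hin h0 hM
    push_cast at hin
    have hup : w i ≠ .r → i < M → ∃ k, Up w i k ∧ k ≤ M + 3 ∧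
        S.src (S.turn (w i) (P i)) = S.vert M P k := by
      intro hw hiM
      rcases hw' : w (i + 1) with _ | _ | _
      · obtain ⟨h1, h2⟩ := C.next_b h0 hiM hw hw'
        exact ⟨i + 1, Up.of_b hw', by omega, by rw [← h2, vert, if_neg (by omega)]⟩
      all_goals
        obtain ⟨h1, h2⟩ := C.next_rg h0 hiM hw (by rw [hw']; decide)
        obtain ⟨k, ⟨j, hk1, hk1'⟩, hk2, hk3, d, hd1, hd2, hd3⟩ :=
          (ih (i + 1) (by omega) (by omega) (by omega)).2 (by rw [hw']; decide) (by omega)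
        -- The walk enters a child through the outgoing blue edge of the child, which is read later,
        -- at `k`. The vertex in question is the head of that edge, so induction applies at `k`.
        have hd : S.rev (S.turn (w i) (P i)) = P k := by
          rw [← hd3]
          refine Out.unique (c := .b) h1 hd1 ?_
          rw [hd2, h2, src_face]
        have hlt := hk1'.lt
        have hle := hk1.1
        obtain ⟨k', hk4, hk5, hk6⟩ : ∃ k', Up w k k' ∧ k' ≤ M + 3 ∧
            S.src (S.turn (w i) (P i)) = S.vert M P k' := by
          -- Position `M + 2` is the outer edge from `A_r` to `A_b`, whose head stands at `M + 3`.
          rcases eq_or_ne k (M + 2) with rfl | hkM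
          · refine ⟨M + 3, ?_, le_rfl, ?_⟩
            · have := Up.of_b (w := w) (i := M + 2) (by rw [add_assoc]; exact F.b')
              rwa [add_assoc] at this
            · rw [C.last] at hd
              rw [vert, if_pos rfl, ← S.rev_rev (S.turn (w i) (P i)), hd, src_rev_dartY]
          · have hkM' : k ≠ M := by
              rintro rfl
              have := hk1'.2; rw [C.letter_finish] at this; cases this
            have hkM'' : k ≠ M + 1 := by
              rintro rfl
              have := hk1'.2; rw [F.g] at this; cases this
            obtain ⟨k', h5, h6, h7⟩ := (ih k (by omega) (by omega) (by omega)).1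
              (by rw [hk1'.2]; decide) (by omega)
            refine ⟨k', h5, h6, ?_⟩
            rw [← h7, ← S.rev_rev (S.turn (w i) (P i)), hd, hk1'.2]
            change _ = S.src (S.rot (S.rev (P k)))
            rw [src_rot]
        have hj0 : j ≤ M + 1 := by
          by_contra hc
          exact hk1.2.2 (M + 1) (by omega) (by omega) F.g
        have hrun := hk1.run (by rw [hw']; decide)
          fun a h1 h2 => C.not_rb (by omega) (by omega)
        exact ⟨k', Up.of_run (by omega) (fun a h1 h2 => hrun a (by omega) h2) hk1.2.1 hk1' hk4,
          hk5, hk6⟩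
    refine ⟨hup, fun hw hi0 => ?_⟩
    rcases hw' : w i with _ | _ | _
    · exact absurd hw' hw
    -- The r at `M` is the outer edge into `A_r`; the g that it attaches to is the fictitious one at
    -- `M + 1`.
    · rcases eq_or_lt_of_le hM with rfl | hiM
      · refine ⟨i + 2, ⟨i + 1, ⟨by omega, F.g, fun k h1 h2 => ?_⟩, ?_⟩, le_rfl, ?_, S.dartY,
          S.xcol_dartY, ?_, C.last.symm⟩
        · rw [show k = i by omega, hw']; decide
        · have := Up.of_b (w := w) (i := i + 1) (by rw [add_assoc]; exact F.b)
          rwa [add_assoc] at this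
        · rw [vert, if_neg (by omega), C.last, C.finish, src_rev_dartX, src_dartY]
        · rw [C.finish, src_rev_dartX, src_dartY]
      · have h1 := C.next_of_r h0 hiM hw'
        obtain ⟨k, ⟨j, h2, h2'⟩, h3, h4, d, h5, h6, h7⟩ :=
          (ih (i + 1) (by omega) (by omega) (by omega)).2
          (C.not_rb h0 hiM hw') (by omega)
        rw [h1, src_rot] at h4 h6
        exact ⟨k, ⟨j, h2.of_succ (by rw [hw']; decide), h2'⟩, h3, h4, d, h5, h6, h7⟩
    · have hiM : i < M := lt_of_le_of_ne hM (by
        rintro rfl; rw [C.letter_finish] at hw'; cases hw')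
      obtain ⟨k, h1, h2, h3⟩ := hup (by rw [hw']; decide) hiM
      have hg := C.out_g h0 hM hw'
      have h4 : S.src (P i) = S.vert M P k := by
        rw [← h3, hw']
        change _ = S.src (S.rot (P i))
        rw [src_rot]
      have hk : k ≠ M + 3 := by
        rintro rfl
        rw [vert, if_pos rfl] at h4
        exact hg.not_at_b h4
      refine ⟨k, ⟨i, NextG.self hw', h1⟩, by omega, h4, P k, ?_, ?_, rfl⟩
      · rcases eq_or_ne k (M + 2) with rfl | hk2
        · rw [C.last]; exact S.xcol_dartY
        · have hkM'' : k ≠ M + 1 := by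
            rintro rfl
            have := h1.2; rw [F.g] at this; cases this
          have := h1.lt
          exact C.out_b (by omega) (by omega) h1.2
      · rw [h4, vert, if_neg hk]

end Coding

end WoodedTriangulation
end SchnyderWood
namespace SchnyderWood

/-! ### Valid words -/

open WoodedTriangulation in
/-- The words of wooded triangulations.  The letters at `0, …, M - 1` belong to the inner edges. -/
structure Valid (w : ℤ → Color) (M : ℤ) : Prop extends Framed w M where
  nonneg : 0 ≤ M
  start : w (-1) = .b
  finish : w M = .r
  not_rb : ∀ i, -1 ≤ i → i < M → w i = .r → w (i + 1) ≠ .b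
  dn : Dn w M (-1)
  up : Up w (-1) (M + 3)

namespace Valid

variable {w : ℤ → Color} {M : ℤ} (V : Valid w M)
include V

lemma excess_br_nonneg {m : ℤ} (h1 : -1 ≤ m) (h2 : m < M) : 0 ≤ excess .b .r w (-1) m :=
  V.dn.1.2.1 m h1 h2

lemma excess_br_eq_zero : excess .b .r w (-1) (M - 1) = 0 := V.dn.1.2.2

lemma excess_gb_nonneg {m : ℤ} (h1 : -1 ≤ m) (h2 : m < M + 3) : 0 ≤ excess .g .b w (-1) m :=
  V.up.1.2.1 m h1 h2

/-- The framing letters r, g, b at `M`, `M + 1`, `M + 2` contribute 0, 1 and -1, so the balance up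
to the b at `M + 3` is the balance of the word itself. -/
lemma excess_gb_eq_zero : excess .g .b w (-1) (M - 1) = 0 := by
  have h := V.up.1.2.2
  have := V.nonneg
  rw [excess_last (by omega), excess_last (by omega), excess_last (by omega)] at h
  have e1 : M + 3 - 1 = M + 2 := by ring
  have e2 : M + 2 - 1 = M + 1 := by ring
  have e3 : M + 1 - 1 = M := by ring
  rw [e1, e2, e3, V.b, V.g, V.finish] at h
  simpa [step] using h

lemma exists_up {i : ℤ} (h1 : -1 ≤ i) (h2 : i < M + 3) : ∃ k, Up w i k ∧ k ≤ M + 3 := by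
  have h3 := V.excess_gb_nonneg h1 h2
  have h4 := V.up.1.eq_neg_one (by rw [V.b']; rfl)
  have h5 := excess_add (x := .g) (y := .b) (w := w) h1 h2.le
  obtain ⟨k, h6, h7, h8⟩ := exists_bal_right (x := .g) (y := .b) (w := w) (i := i)
    ⟨M + 3, h2, by omega⟩
  exact ⟨k, ⟨h6, step_eq_neg_one h7⟩, h8 _ h2 (by omega)⟩

/-- A g lifts the walk to a positive height, and the walk is back at 0 at `M - 1`, so the partner
lies within the word. -/
lemma exists_up_g {i : ℤ} (h1 : 0 ≤ i) (h2 : i < M) (hw : w i = .g) : ∃ k, Up w i k ∧ k < M := by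
  have h3 := V.excess_gb_nonneg (m := i - 1) (by omega) (by omega)
  have h4 := excess_last (x := .g) (y := .b) (w := w) (show -1 < i by omega)
  rw [hw] at h4
  have h5 := excess_add (x := .g) (y := .b) (w := w) (show -1 ≤ i by omega) (show i ≤ M - 1 by omega)
  rw [V.excess_gb_eq_zero] at h5
  have h6 : step .g .b .g = 1 := rfl
  have hi : i ≠ M - 1 := by
    rintro rfl
    rw [V.excess_gb_eq_zero] at h4; omega
  obtain ⟨k, h7, h8, h9⟩ := exists_bal_right (x := .g) (y := .b) (w := w) (i := i)
    ⟨M - 1, by omega, by omega⟩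
  exact ⟨k, ⟨h7, step_eq_neg_one h8⟩, by have := h9 (M - 1) (by omega) (by omega); omega⟩

lemma exists_dn {j : ℤ} (h1 : 0 ≤ j) (h2 : j ≤ M) : ∃ y, Dn w j y ∧ -1 ≤ y := by
  have h3 := V.excess_br_nonneg (m := j - 1) (by omega) (by omega)
  have h4 := excess_one .b .r w (-1)
  have h5 := excess_add (x := .b) (y := .r) (w := w) (show (-1 : ℤ) - 1 ≤ -1 by omega)
    (show -1 ≤ j - 1 by omega)
  rw [h4, V.start] at h5
  have h6 : step .b .r .b = 1 := rfl
  obtain ⟨k, h7, h8, h9⟩ := exists_bal_left (x := .b) (y := .r) (w := w) (i := j)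
    ⟨-1 - 1, by omega, by omega⟩
  exact ⟨k, ⟨h7, step_eq_one h8⟩, by have := h9 (-1 - 1) (by omega) (by omega); omega⟩

lemma exists_nextG {j : ℤ} (h2 : j ≤ M) : ∃ k, NextG w j k ∧ k ≤ M + 1 := by
  obtain ⟨k, ⟨hk1, hk2⟩, hk3⟩ := Int.exists_least_of_bdd (P := fun k => j ≤ k ∧ w k = .g)
    ⟨j, fun z hz => hz.1⟩ ⟨M + 1, by omega, V.g⟩
  exact ⟨k, ⟨hk1, hk2, fun a h3 h4 h5 => by have := hk3 a ⟨h3, h5⟩; omega⟩,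
    hk3 _ ⟨by omega, V.g⟩⟩

/-- If no g follows inside the word, the letter attaches to the g at `M + 1`, hence to `A_r` at `M +
2`. -/
lemma exists_vtx {j : ℤ} (h1 : 0 ≤ j) (h2 : j ≤ M) : ∃ k, Vtx w j k ∧ w k = .b ∧
    (k < M ∨ k = M + 2) := by
  obtain ⟨g, hg, hg'⟩ := V.exists_nextG h2
  have := hg.1
  rcases eq_or_lt_of_le hg' with rfl | h3
  · refine ⟨M + 2, ⟨_, hg, ?_⟩, V.b, Or.inr rfl⟩
    have := Up.of_b (w := w) (i := M + 1) (by rw [add_assoc]; exact V.b)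
    rwa [add_assoc] at this
  · have : g ≠ M := by rintro rfl; have := hg.2.1; rw [V.finish] at this; cases this
    obtain ⟨k, hk, hk'⟩ := V.exists_up_g (i := g) (by omega) (by omega) hg.2.1
    exact ⟨k, ⟨g, hg, hk⟩, hk.2, Or.inl hk'⟩

omit V in
lemma excess_eq_card_sub (x y : Color) (w : ℤ → Color) (j m : ℤ) : excess x y w j m =
    ((Finset.Ioc j m).filter (w · = x)).card - ((Finset.Ioc j m).filter (w · = y)).card := by
  rw [excess, Finset.sum_sub_distrib, Finset.card_filter, Finset.card_filter]
  push_cast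
  rfl

/-- Both walks return to 0, so the three letters occur equally often. -/
lemma card_b : 3 * (((Finset.Ioc (-1) (M - 1)).filter (w · = .b)).card : ℤ) = M := by
  have h1 := V.excess_gb_eq_zero
  have h2 := V.excess_br_eq_zero
  rw [excess_eq_card_sub] at h1 h2
  have h3 : ((Finset.Ioc (-1) (M - 1)).card : ℤ) =
      ∑ c : Color, (((Finset.Ioc (-1) (M - 1)).filter (w · = c)).card : ℤ) := by
    rw [Finset.card_eq_sum_card_fiberwise (f := w) (t := Finset.univ) (by simp)]
    push_cast; rfl
  have h4 : (Finset.univ : Finset Color) = {.b, .r, .g} := rfl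
  rw [h4, Finset.sum_insert (by decide), Finset.sum_insert (by decide), Finset.sum_singleton,
    Int.card_Ioc] at h3
  have := V.nonneg
  omega

end Valid

/-! ### Validity of the word of a wooded triangulation -/

namespace WoodedTriangulation.Coding

variable {D : Type} {S : WoodedTriangulation D} {w : ℤ → Color} {M : ℤ} {P : ℤ → D}
  (C : S.Coding w M P) (F : Framed w M)
include C F

lemma out_b' {k : ℤ} (h1 : -1 ≤ k) (h2 : k ≤ M + 2) (hw : w k = .b) : S.Out .b (P k) := by
  rcases eq_or_ne k (M + 2) with rfl | hk2
  · rw [C.last]; exact S.xcol_dartY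
  · have : k ≠ M + 1 := by rintro rfl; rw [F.g] at hw; cases hw
    exact C.out_b h1 (by omega) hw

/-- A vertex other than `A_b` determines its outgoing blue edge, and the walk reads that edge only
once; `A_b` has no such edge. -/
lemma vert_injective {k l : ℤ} (hk : -1 ≤ k) (hk' : k ≤ M + 3) (hl : -1 ≤ l) (hl' : l ≤ M + 3)
    (hwk : w k = .b) (hwl : w l = .b) (h : S.vert M P k = S.vert M P l) : k = l := by
  unfold vert at h
  have aux : ∀ {k}, -1 ≤ k → k ≤ M + 3 → w k = .b → k ≠ M + 3 → k ≠ M + 2 →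
      k ≤ M := fun {k} h1 h2 h3 h4 h5 => by
    have : k ≠ M + 1 := by rintro rfl; rw [F.g] at h3; cases h3
    omega
  split_ifs at h with h1 h2 h2
  · omega
  · exact ((C.out_b' F hl (by omega) hwl).not_at_b h.symm).elim
  · exact ((C.out_b' F hk (by omega) hwk).not_at_b h).elim
  · have h3 := (C.out_b' F hk (by omega) hwk).unique (C.out_b' F hl (by omega) hwl) h
    rcases eq_or_ne k (M + 2) with rfl | hk2
    · rcases eq_or_ne l (M + 2) with rfl | hl2
      · rfl
      · exact absurd (h3.symm.trans C.last) (C.ne_dartY hl (aux hl hl' hwl h2 hl2))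
    · rcases eq_or_ne l (M + 2) with rfl | hl2
      · exact absurd (h3.trans C.last) (C.ne_dartY hk (aux hk hk' hwk h1 hk2))
      · exact C.inj hk (aux hk hk' hwk h1 hk2) hl (aux hl hl' hwl h2 hl2) h3

/-- The matches computed for the outer edges at `M` and at `-1` end at the vertices `A_g` and `A_b`,
and injectivity of the vertices turns this into the positions `-1` and `M + 3`. -/
lemma valid : Valid w M := by
  have hM := C.nonneg
  refine ⟨F, hM, C.letter_start, C.letter_finish, fun i h1 h2 => C.not_rb h1 h2, ?_, ?_⟩
  · obtain ⟨y, h1, h2, h3, -⟩ := C.exists_dn hM le_rfl (by rw [C.letter_finish]; decide)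
    have := h1.lt
    have h4 := C.vert_injective F h2 (by omega) le_rfl (by omega) h1.2 C.letter_start (by
      rw [vert, vert, if_neg (by omega), if_neg (by omega), ← h3, C.finish, C.start, S.rev_rev,
        src_dartX, src_rev_root])
    rwa [h4] at h1
  · obtain ⟨k, h1, h2, h3⟩ := (C.exists_up_vtx F le_rfl (by omega)).1
      (by rw [C.letter_start]; decide) (by omega)
    have := h1.lt
    have h4 := C.vert_injective F (by omega) h2 (by omega) le_rfl h1.2 F.b' (by
      rw [← h3, C.start, C.letter_start]
      change S.src (S.rot (S.rev (S.rev S.root))) = _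
      rw [src_rot, S.rev_rev, vert, if_pos rfl, src_root])
    rwa [h4] at h1

end WoodedTriangulation.Coding
end SchnyderWood
namespace SchnyderWood

/-! ### The wooded triangulation of a valid word -/

/-- The edges are the positions of the letters, including those of the three outer edges. -/
def IsPos (M i : ℤ) : Prop := (-1 ≤ i ∧ i ≤ M) ∨ i = M + 2

/-- Darts of the wooded triangulation of a word: `(i, true)` is the dart that is met with the
letter at `i` and `(i, false)` its reverse. -/
abbrev Dart (M : ℤ) : Type := {x : ℤ × Bool // IsPos M x.1}

open Classical in
/-- The dart at a position. -/
noncomputable def dart (M : ℤ) (i : ℤ) (s : Bool) : Dart M :=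
  if h : IsPos M i then ⟨(i, s), h⟩ else ⟨(M + 2, s), Or.inr rfl⟩

section Functions

open Classical in
/-- The function of the relation `Up`. -/
noncomputable def up (w : ℤ → Color) (i : ℤ) : ℤ := if h : ∃ k, Up w i k then h.choose else 0

open Classical in
/-- The function of the relation `Dn`. -/
noncomputable def dn (w : ℤ → Color) (i : ℤ) : ℤ := if h : ∃ k, Dn w i k then h.choose else 0

open Classical in
/-- The function of the relation `Vtx`. -/
noncomputable def vtx (w : ℤ → Color) (i : ℤ) : ℤ := if h : ∃ k, Vtx w i k then h.choose else 0

variable {w : ℤ → Color} {i j k M : ℤ} {s : Bool}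

lemma Up.eq (h : Up w i k) : up w i = k := by
  have h' : ∃ k, Up w i k := ⟨k, h⟩
  rw [up, dif_pos h']
  exact h'.choose_spec.unique h

lemma Dn.eq (h : Dn w i k) : dn w i = k := by
  have h' : ∃ k, Dn w i k := ⟨k, h⟩
  rw [dn, dif_pos h']
  exact h'.choose_spec.unique h

lemma Vtx.eq (h : Vtx w i k) : vtx w i = k := by
  have h' : ∃ k, Vtx w i k := ⟨k, h⟩
  rw [vtx, dif_pos h']
  exact h'.choose_spec.unique h

lemma dart_val (h : IsPos M i) : (dart M i s).1 = (i, s) := by rw [dart, dif_pos h]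

lemma dart_eta (d : Dart M) : dart M d.1.1 d.1.2 = d := Subtype.ext (dart_val d.2)

/-- The position of the letter `b` or `g` in the triangle of the letter `r` or `g` at `j`. -/
noncomputable def leftPos (w : ℤ → Color) (j : ℤ) : ℤ :=
  if w (j - 1) = .r then dn w (j - 1) - 1 else j - 1

/-- The dart after the dart at `j` around the triangle of the letter `r` or `g` at `j`. -/
noncomputable def second (w : ℤ → Color) (M j : ℤ) : Dart M :=
  dart M (leftPos w j) (decide (w (leftPos w j) ≠ .g))

/-- The dart before the dart at `j` around the triangle of the letter `r` or `g` at `j`. -/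
noncomputable def third (w : ℤ → Color) (M j : ℤ) : Dart M :=
  if w (j - 1) = .r then dart M (j - 1) false else dart M (vtx w j) false

/-- The darts on the inner triangles (one for each `r` or `g` at `j`) and on the outer face. -/
noncomputable def faceDart (w : ℤ → Color) (M : ℤ) :
    Option {j : ℤ // 0 ≤ j ∧ j ≤ M ∧ w j ≠ .b} × Fin 3 → Dart M
  | (none, 0) => dart M (-1) false
  | (none, 1) => dart M M false
  | (none, 2) => dart M (M + 2) true
  | (some j, 0) => dart M j true
  | (some j, 1) => second w M j
  | (some j, 2) => third w M j

end Functions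

namespace Valid

variable {w : ℤ → Color} {M : ℤ} (V : Valid w M)
include V

lemma isPos_start : IsPos M (-1) := Or.inl ⟨le_rfl, by have := V.nonneg; omega⟩

lemma isPos_finish : IsPos M M := Or.inl ⟨by have := V.nonneg; omega, le_rfl⟩

lemma leftPos_spec {j : ℤ} (h1 : 0 ≤ j) (h2 : j ≤ M) :
    -1 ≤ leftPos w j ∧ leftPos w j < j ∧ w (leftPos w j) ≠ .r ∧
      ((w (j - 1) ≠ .r ∧ leftPos w j = j - 1) ∨
        (w (j - 1) = .r ∧ 0 ≤ j - 1 ∧ Dn w (j - 1) (leftPos w j + 1) ∧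
          w (leftPos w j + 1) = .b)) := by
  by_cases hr : w (j - 1) = .r
  · have hj : j ≠ 0 := by
      rintro rfl
      have := V.start
      rw [show (0 : ℤ) - 1 = -1 by rfl, this] at hr; cases hr
    obtain ⟨y, h3, h4⟩ := V.exists_dn (j := j - 1) (by omega) (by omega)
    have hl : leftPos w j = y - 1 := by rw [leftPos, if_pos hr, h3.eq]
    have hlt := h3.lt
    -- The b at `-1` is already matched to the r at `M`.
    have hy : y ≠ -1 := by
      rintro rfl
      have := h3.inj V.dn hr V.finish
      omega
    have e : y - 1 + 1 = y := by omega
    rw [hl, e]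
    refine ⟨by omega, by omega, fun h => ?_, Or.inr ⟨hr, by omega, h3, h3.2⟩⟩
    exact V.not_rb (y - 1) (by omega) (by omega) h (by rw [e]; exact h3.2)
  · rw [leftPos, if_neg hr]
    exact ⟨by omega, by omega, hr, Or.inl ⟨hr, rfl⟩⟩

lemma isPos_leftPos {j : ℤ} (h1 : 0 ≤ j) (h2 : j ≤ M) : IsPos M (leftPos w j) := by
  have := V.leftPos_spec h1 h2
  exact Or.inl ⟨this.1, by omega⟩

lemma second_cases {j : ℤ} (h1 : 0 ≤ j) (h2 : j ≤ M) :
    (w (leftPos w j) = .g ∧ second w M j = dart M (leftPos w j) false) ∨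
    (w (leftPos w j) = .b ∧ second w M j = dart M (leftPos w j) true) := by
  have := (V.leftPos_spec h1 h2).2.2.1
  rcases h : w (leftPos w j) with _ | _ | _
  · right; simp [second, h]
  · exact absurd h this
  · left; simp [second, h]

lemma vtx_spec {j : ℤ} (h1 : 0 ≤ j) (h2 : j ≤ M) :
    Vtx w j (vtx w j) ∧ w (vtx w j) = .b ∧ (vtx w j < M ∨ vtx w j = M + 2) ∧ j < vtx w j := by
  obtain ⟨k, h3, h4, h5⟩ := V.exists_vtx h1 h2
  rw [h3.eq]
  exact ⟨h3, h4, h5, h3.lt⟩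

lemma isPos_vtx {j : ℤ} (h1 : 0 ≤ j) (h2 : j ≤ M) : IsPos M (vtx w j) := by
  obtain ⟨-, -, h3, h4⟩ := V.vtx_spec h1 h2
  rcases h3 with h3 | h3
  · exact Or.inl ⟨by omega, by omega⟩
  · exact Or.inr h3

lemma third_cases {j : ℤ} (h1 : 0 ≤ j) (h2 : j ≤ M) :
    (w (j - 1) = .r ∧ 0 ≤ j - 1 ∧ third w M j = dart M (j - 1) false) ∨
    (w (j - 1) ≠ .r ∧ third w M j = dart M (vtx w j) false) := by
  rcases (V.leftPos_spec h1 h2).2.2.2 with ⟨h3, -⟩ | ⟨h3, h4, -⟩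
  · right; exact ⟨h3, by rw [third, if_neg h3]⟩
  · left; exact ⟨h3, h4, by rw [third, if_pos h3]⟩

lemma run_of_vtx {j g : ℤ} (h1 : -1 ≤ j) (h2 : j ≤ M) (hw : w j ≠ .b) (hg : NextG w j g) :
    ∀ a, j ≤ a → a < g → w a = .r := by
  have : g ≤ M + 1 := by
    by_contra hc
    exact hg.2.2 (M + 1) (by omega) (by omega) V.g
  exact hg.run hw fun a h3 h4 => V.not_rb a (by omega) (by omega)

/-- A common vertex means a common next g, and only r stands before that g. A letter that is not
preceded by r is the beginning of this run, so there is only one. -/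
lemma vtx_inj {i j : ℤ} (hi : 0 ≤ i) (hi' : i ≤ M) (hj : 0 ≤ j) (hj' : j ≤ M)
    (hwi : w i ≠ .b) (hwj : w j ≠ .b) (hri : w (i - 1) ≠ .r) (hrj : w (j - 1) ≠ .r)
    (h : vtx w i = vtx w j) : i = j := by
  obtain ⟨⟨g, hg1, hg2⟩, -⟩ := V.vtx_spec hi hi'
  obtain ⟨⟨g', hg1', hg2'⟩, -⟩ := V.vtx_spec hj hj'
  rw [h] at hg2
  obtain rfl := hg2.inj hg2' hg1.2.1 hg1'.2.1
  have h1 := hg1.1; have h2 := hg1'.1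
  rcases lt_trichotomy i j with hl | hl | hl
  · exact absurd (V.run_of_vtx (by omega) hi' hwi hg1 (j - 1) (by omega) (by omega)) hrj
  · exact hl
  · exact absurd (V.run_of_vtx (by omega) hj' hwj hg1' (i - 1) (by omega) (by omega)) hri

/-- In the first case of `leftPos` the next letter is the r or g itself, in the second it is a b, so
the cases exclude each other. Within the second case, a b has only one matched r. -/
lemma leftPos_inj {i j : ℤ} (hi : 0 ≤ i) (hi' : i ≤ M) (hj : 0 ≤ j) (hj' : j ≤ M)
    (hwi : w i ≠ .b) (hwj : w j ≠ .b) (h : leftPos w i = leftPos w j) : i = j := by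
  obtain ⟨-, -, -, h1⟩ := V.leftPos_spec hi hi'
  obtain ⟨-, -, -, h2⟩ := V.leftPos_spec hj hj'
  rcases h1 with ⟨-, h1⟩ | ⟨h1, -, h3, h3'⟩ <;> rcases h2 with ⟨-, h2⟩ | ⟨h2, -, h4, h4'⟩
  · omega
  · rw [← h, h1, sub_add_cancel] at h4'
    exact absurd h4' hwi
  · rw [h, h2, sub_add_cancel] at h3'
    exact absurd h3' hwj
  · rw [h] at h3
    have := h3.inj h4 h1 h2
    omega

omit V in
lemma dart_inj {i j : ℤ} {s t : Bool} (hi : IsPos M i) (hj : IsPos M j)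
    (h : dart M i s = dart M j t) : i = j ∧ s = t := by
  have := congrArg Subtype.val h
  rw [dart_val hi, dart_val hj, Prod.mk.injEq] at this
  exact this

omit V in
lemma isPos_of {j : ℤ} (h1 : 0 ≤ j) (h2 : j ≤ M) : IsPos M j := Or.inl ⟨by omega, h2⟩

/-- Position, orientation and color of the darts of the triangles. -/
lemma second_spec {j : ℤ} (h1 : 0 ≤ j) (h2 : j ≤ M) :
    ∃ z s, second w M j = dart M z s ∧ z = leftPos w j ∧ IsPos M z ∧ z < M ∧
      ((w z = .g ∧ s = false) ∨ (w z = .b ∧ s = true)) := by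
  have h3 := V.leftPos_spec h1 h2
  rcases V.second_cases h1 h2 with ⟨h4, h5⟩ | ⟨h4, h5⟩
  · exact ⟨_, _, h5, rfl, V.isPos_leftPos h1 h2, by omega, Or.inl ⟨h4, rfl⟩⟩
  · exact ⟨_, _, h5, rfl, V.isPos_leftPos h1 h2, by omega, Or.inr ⟨h4, rfl⟩⟩

lemma third_spec {j : ℤ} (h1 : 0 ≤ j) (h2 : j ≤ M) :
    ∃ v, third w M j = dart M v false ∧ IsPos M v ∧ 0 ≤ v ∧ v ≠ M ∧
      ((w (j - 1) = .r ∧ v = j - 1) ∨ (w (j - 1) ≠ .r ∧ w v = .b ∧ v = vtx w j)) := by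
  have h5 := V.vtx_spec h1 h2
  rcases V.third_cases h1 h2 with ⟨h3, h4, h6⟩ | ⟨h3, h6⟩
  · exact ⟨_, h6, Or.inl ⟨by omega, by omega⟩, h4, by omega, Or.inl ⟨h3, rfl⟩⟩
  · exact ⟨_, h6, V.isPos_vtx h1 h2, by omega, by omega, Or.inr ⟨h3, h5.2.1, rfl⟩⟩

/-- Letter and orientation decide which side of a triangle a dart can be: r or g met forward is the
first, b forward or g reversed the second, r or b reversed the third. Within a class, `leftPos_inj`
and `vtx_inj` recover the triangle. The darts of the outer face are the ones missed at the ends of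
the word. -/
lemma faceDart_injective : Function.Injective (faceDart w M) := by
  have hM := V.nonneg
  have pS := V.isPos_start
  have pM := V.isPos_finish
  have p2 : IsPos M (M + 2) := Or.inr rfl
  have o1 : ∀ {j}, 0 ≤ j ∧ j ≤ M ∧ w j ≠ .b → ∀ {i s}, IsPos M i →
      dart M i s = dart M j true → s = true ∧ i = j ∧ w i ≠ .b := fun {j} hj {i s} hi h => by
    obtain ⟨rfl, rfl⟩ := dart_inj hi (isPos_of hj.1 hj.2.1) h
    exact ⟨rfl, rfl, hj.2.2⟩
  have o2 : ∀ {j}, 0 ≤ j ∧ j ≤ M ∧ w j ≠ .b → ∀ {i s}, IsPos M i →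
      dart M i s = second w M j → i = leftPos w j ∧ i < M ∧
        ((w i = .g ∧ s = false) ∨ (w i = .b ∧ s = true)) := fun {j} hj {i s} hi h => by
    obtain ⟨z, t, h1, h2, h3, h4, h5⟩ := V.second_spec hj.1 hj.2.1
    rw [h1] at h
    obtain ⟨rfl, rfl⟩ := dart_inj hi h3 h
    exact ⟨h2, h4, h5⟩
  have o3 : ∀ {j}, 0 ≤ j ∧ j ≤ M ∧ w j ≠ .b → ∀ {i s}, IsPos M i →
      dart M i s = third w M j → s = false ∧ 0 ≤ i ∧ i ≠ M ∧
        ((w (j - 1) = .r ∧ i = j - 1) ∨ (w (j - 1) ≠ .r ∧ w i = .b ∧ i = vtx w j)) :=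
    fun {j} hj {i s} hi h => by
    obtain ⟨v, h1, h2, h3, h4, h5⟩ := V.third_spec hj.1 hj.2.1
    rw [h1] at h
    obtain ⟨rfl, rfl⟩ := dart_inj hi h2 h
    exact ⟨rfl, h3, h4, h5⟩
  have outer : ∀ (a : Fin 3) (j : {j : ℤ // 0 ≤ j ∧ j ≤ M ∧ w j ≠ .b}) (b : Fin 3),
      faceDart w M (none, a) ≠ faceDart w M (some j, b) := by
    intro a j b h
    have hb : ∀ {i}, w i = .b → w i ≠ .g := fun h => by rw [h]; decide
    fin_cases a <;> fin_cases b <;> simp only [faceDart] at h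
    · cases (o1 j.2 pS h).1
    · rcases (o2 j.2 pS h).2.2 with h | h
      · rw [V.start] at h; cases h.1
      · cases h.2
    · have := (o3 j.2 pS h).2.1; omega
    · cases (o1 j.2 pM h).1
    · have := (o2 j.2 pM h).2.1; omega
    · exact (o3 j.2 pM h).2.2.1 rfl
    · exact (o1 j.2 p2 h).2.2 V.b
    · have := (o2 j.2 p2 h).2.1; omega
    · cases (o3 j.2 p2 h).1
  have inner : ∀ (i j : {j : ℤ // 0 ≤ j ∧ j ≤ M ∧ w j ≠ .b}) (a b : Fin 3), a ≤ b →
      faceDart w M (some i, a) = faceDart w M (some j, b) → i = j ∧ a = b := by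
    intro i j a b hab h
    fin_cases a <;> fin_cases b <;> simp only [faceDart] at h <;> first
      | (exfalso; revert hab; decide)
      | skip
    · exact ⟨Subtype.ext (o1 j.2 (isPos_of i.2.1 i.2.2.1) h).2.1, rfl⟩
    · rcases (o2 j.2 (isPos_of i.2.1 i.2.2.1) h).2.2 with h | h
      · cases h.2
      · exact absurd h.1 i.2.2.2
    · cases (o3 j.2 (isPos_of i.2.1 i.2.2.1) h).1
    · obtain ⟨z, t, h1, h2, h3, h4, h5⟩ := V.second_spec i.2.1 i.2.2.1
      rw [h1] at h
      have := (o2 j.2 h3 h).1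
      exact ⟨Subtype.ext (V.leftPos_inj i.2.1 i.2.2.1 j.2.1 j.2.2.1 i.2.2.2 j.2.2.2
        (h2.symm.trans this)), rfl⟩
    · obtain ⟨z, t, h1, h2, h3, h4, h5⟩ := V.second_spec i.2.1 i.2.2.1
      rw [h1] at h
      obtain ⟨h6, h7, h8, h9⟩ := o3 j.2 h3 h
      rcases h5 with ⟨h5, -⟩ | ⟨-, h5⟩
      · rcases h9 with ⟨h9, h10⟩ | ⟨-, h9, -⟩
        · rw [h10, h9] at h5; cases h5
        · rw [h9] at h5; cases h5
      · rw [h5] at h6; cases h6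
    · obtain ⟨v, h1, h2, h3, h4, h5⟩ := V.third_spec i.2.1 i.2.2.1
      rw [h1] at h
      obtain ⟨-, -, -, h6⟩ := o3 j.2 h2 h
      refine ⟨Subtype.ext ?_, rfl⟩
      rcases h5 with ⟨h5, h5'⟩ | ⟨h5, h7, h7'⟩ <;> rcases h6 with ⟨h6, h6'⟩ | ⟨h6, h8, h8'⟩
      · omega
      · rw [h5', h5] at h8; cases h8
      · rw [h6', h6] at h7; cases h7
      · exact V.vtx_inj i.2.1 i.2.2.1 j.2.1 j.2.2.1 i.2.2.2 j.2.2.2 h5 h6 (h7'.symm.trans h8')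
  rintro ⟨_ | i, a⟩ ⟨_ | j, b⟩ h
  · have : a = b := by
      fin_cases a <;> fin_cases b <;> simp only [faceDart] at h <;> first
        | rfl
        | (have h' := dart_inj pS pM h; omega)
        | (have h' := dart_inj pM pS h; omega)
        | (have h' := dart_inj pS p2 h; omega)
        | (have h' := dart_inj p2 pS h; omega)
        | (have h' := dart_inj p2 pM h; omega)
        | (have h' := dart_inj pM p2 h; omega)
    rw [this]
  · exact absurd h (outer a j b)
  · exact absurd h.symm (outer b i a)
  · rcases le_total a b with hab | hab
    · obtain ⟨rfl, rfl⟩ := inner i j a b hab h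
      rfl
    · obtain ⟨rfl, rfl⟩ := inner j i b a hab h.symm
      rfl

end Valid

/-! ### Every dart lies on exactly one face -/

section Card

lemma coe_setOf_isPos (M : ℤ) :
    {i | IsPos M i} = ↑(insert (M + 2) (Finset.Icc (-1) M)) := by
  ext i; simp [IsPos]; tauto

instance (M : ℤ) : Finite (Dart M) := by
  have : Finite {i : ℤ // IsPos M i} := by
    apply Set.Finite.to_subtype
    exact (Set.finite_Icc (-1) M |>.union (Set.finite_singleton (M + 2))).subset fun i hi => hi
  exact Finite.of_injective (β := {i : ℤ // IsPos M i} × Bool)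
    (fun d => (⟨d.1.1, d.2⟩, d.1.2)) fun d e h => by
      simp only [Prod.mk.injEq, Subtype.mk.injEq] at h
      exact Subtype.ext (Prod.ext h.1 h.2)

lemma card_dart {M : ℤ} (hM : 0 ≤ M) : (Nat.card (Dart M) : ℤ) = 2 * (M + 3) := by
  have e : Dart M ≃ {i : ℤ // IsPos M i} × Bool :=
    { toFun := fun d => (⟨d.1.1, d.2⟩, d.1.2)
      invFun := fun x => ⟨(x.1.1, x.2), x.1.2⟩
      left_inv := fun _ => rfl
      right_inv := fun _ => rfl }
  have h : Nat.card {i : ℤ // IsPos M i} = (insert (M + 2) (Finset.Icc (-1) M)).card := by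
    rw [← Set.ncard_coe_finset, ← coe_setOf_isPos M]; rfl
  rw [Nat.card_congr e, Nat.card_prod, h, Finset.card_insert_of_notMem (by simp), Int.card_Icc,
    Nat.card_eq_fintype_card, Fintype.card_bool]
  push_cast
  omega

lemma Valid.card_face {w : ℤ → Color} {M : ℤ} (V : Valid w M) :
    (Nat.card (Option {j : ℤ // 0 ≤ j ∧ j ≤ M ∧ w j ≠ .b} × Fin 3) : ℤ) = 2 * (M + 3) := by
  have hM := V.nonneg
  have h1 : Nat.card {j : ℤ // 0 ≤ j ∧ j ≤ M ∧ w j ≠ .b} =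
      ((Finset.Icc 0 M).filter (w · ≠ .b)).card := by
    rw [← Set.ncard_coe_finset]
    change Set.ncard {j : ℤ | 0 ≤ j ∧ j ≤ M ∧ w j ≠ .b} = _
    congr 1
    ext j
    simp [and_assoc]
  have hf : Finite {j : ℤ // 0 ≤ j ∧ j ≤ M ∧ w j ≠ .b} :=
    Set.Finite.to_subtype (s := {j : ℤ | 0 ≤ j ∧ j ≤ M ∧ w j ≠ .b})
      ((Set.finite_Icc 0 M).subset fun j hj => ⟨hj.1, hj.2.1⟩)
  have h2 : ((Finset.Icc 0 M).filter (w · = .b)).card =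
      ((Finset.Ioc (-1) (M - 1)).filter (w · = .b)).card := by
    congr 1
    ext a
    simp only [Finset.mem_filter, Finset.mem_Icc, Finset.mem_Ioc]
    constructor
    · rintro ⟨h, h'⟩
      have : a ≠ M := by rintro rfl; rw [V.finish] at h'; cases h'
      exact ⟨by omega, h'⟩
    · rintro ⟨h, h'⟩
      exact ⟨by omega, h'⟩
  have h3 := Finset.card_filter_add_card_filter_not (s := Finset.Icc 0 M) (w · = .b)
  rw [Int.card_Icc, h2] at h3
  have h4 := V.card_b
  rw [Nat.card_prod, Finite.card_option, h1, Nat.card_eq_fintype_card, Fintype.card_fin]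
  push_cast
  simp only [ne_eq] at h3 ⊢
  omega

/-- Both sides have `2 * (M + 3)` elements, so injectivity suffices. Surjectivity is used later to
find matches without following the word. -/
lemma Valid.faceDart_bijective {w : ℤ → Color} {M : ℤ} (V : Valid w M) :
    Function.Bijective (faceDart w M) := by
  have h := V.card_face
  rw [← card_dart V.nonneg] at h
  have hinj := V.faceDart_injective
  have : Finite (Option {j : ℤ // 0 ≤ j ∧ j ≤ M ∧ w j ≠ .b} × Fin 3) := Finite.of_injective _ hinj
  cases nonempty_fintype (Dart M)
  cases nonempty_fintype (Option {j : ℤ // 0 ≤ j ∧ j ≤ M ∧ w j ≠ .b} × Fin 3)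
  refine (Fintype.bijective_iff_injective_and_card _).2 ⟨hinj, ?_⟩
  rw [Nat.card_eq_fintype_card, Nat.card_eq_fintype_card] at h
  exact_mod_cast h

end Card

end SchnyderWood
-- Faces and vertices of the model as cycles of permutations
namespace SchnyderWood

lemma card_cycles {D α : Type} (p : Equiv.Perm D) (f : D → α) (hf : Function.Surjective f)
    (h : ∀ d d', p.SameCycle d d' ↔ f d = f d') : Nat.card (Cycles p) = Nat.card α := by
  refine Nat.card_congr (Equiv.ofBijective
    (Quotient.lift f fun a b hab => (h a b).1 hab) ⟨?_, fun a => ?_⟩)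
  · rintro ⟨a⟩ ⟨b⟩ hab
    exact Quotient.sound ((h a b).2 hab)
  · obtain ⟨d, rfl⟩ := hf a
    exact ⟨Quotient.mk _ d, rfl⟩

/-- Reversal of the darts. -/
def Dart.rev (M : ℤ) : Equiv.Perm (Dart M) :=
  Function.Involutive.toPerm (fun d => ⟨(d.1.1, !d.1.2), d.2⟩) fun d => by simp

/-- The tail of a dart: the position of a letter `b`, or the position `M + 3` for `A_b`. -/
noncomputable def Dart.src (w : ℤ → Color) {M : ℤ} (d : Dart M) : ℤ :=
  if d.1.2 then (if w d.1.1 = .b then d.1.1 else vtx w d.1.1)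
  else (if w d.1.1 = .b then up w d.1.1 else dn w d.1.1)

section DartLemmas

variable {w : ℤ → Color} {M i : ℤ}

lemma rev_dart (s : Bool) : Dart.rev M (dart M i s) = dart M i (!s) := by
  unfold dart Dart.rev
  split_ifs <;> rfl

lemma src_true_b (hi : IsPos M i) (hw : w i = .b) : Dart.src w (dart M i true) = i := by
  simp [Dart.src, dart_val hi, hw]

lemma src_true_rg (hi : IsPos M i) (hw : w i ≠ .b) : Dart.src w (dart M i true) = vtx w i := by
  simp [Dart.src, dart_val hi, hw]

lemma src_false_b (hi : IsPos M i) (hw : w i = .b) : Dart.src w (dart M i false) = up w i := by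
  simp [Dart.src, dart_val hi, hw]

lemma src_false_rg (hi : IsPos M i) (hw : w i ≠ .b) : Dart.src w (dart M i false) = dn w i := by
  simp [Dart.src, dart_val hi, hw]

lemma Dart.rev_rev (d : Dart M) : Dart.rev M (Dart.rev M d) = d := by
  exact (Function.Involutive.toPerm_involutive _) d

lemma Dart.rev_ne (d : Dart M) : Dart.rev M d ≠ d := fun h => by
  have : (!d.1.2) = d.1.2 := congrArg (fun d => d.1.2) h
  simp at this

lemma vtx_of_g (hw : w i = .g) : vtx w i = up w i := by
  by_cases h : ∃ k, Up w i k
  · obtain ⟨k, hk⟩ := h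
    rw [hk.eq]
    exact Vtx.eq ⟨i, NextG.self hw, hk⟩
  · rw [vtx, up, dif_neg h, dif_neg]
    rintro ⟨k, j, hj, hk⟩
    rw [hj.unique (NextG.self hw)] at hk
    exact h ⟨k, hk⟩

end DartLemmas

namespace Valid

variable {w : ℤ → Color} {M : ℤ} (V : Valid w M)
include V

omit V in
/-- The permutation that turns around the faces. -/
noncomputable def face (V : Valid w M) : Equiv.Perm (Dart M) :=
  (Equiv.ofBijective _ V.faceDart_bijective).symm.trans
    ((Equiv.prodCongr (Equiv.refl _) (Equiv.addRight (1 : Fin 3))).trans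
      (Equiv.ofBijective _ V.faceDart_bijective))

lemma face_faceDart (o) (a : Fin 3) : V.face (faceDart w M (o, a)) = faceDart w M (o, a + 1) := by
  have h : (Equiv.ofBijective _ V.faceDart_bijective).symm (faceDart w M (o, a)) = (o, a) :=
    (Equiv.ofBijective _ V.faceDart_bijective).symm_apply_apply (o, a)
  simp only [face, Equiv.trans_apply, h]
  rfl

lemma exists_faceDart (d : Dart M) : ∃ o a, d = faceDart w M (o, a) := by
  obtain ⟨⟨o, a⟩, rfl⟩ := V.faceDart_bijective.2 d
  exact ⟨o, a, rfl⟩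

lemma face_root : V.face (dart M (-1) false) = dart M M false := V.face_faceDart none 0

lemma face_finish : V.face (dart M M false) = dart M (M + 2) true := V.face_faceDart none 1

lemma face_last : V.face (dart M (M + 2) true) = dart M (-1) false := V.face_faceDart none 2

lemma face_first {j : ℤ} (h1 : 0 ≤ j) (h2 : j ≤ M) (hw : w j ≠ .b) :
    V.face (dart M j true) = second w M j := V.face_faceDart (some ⟨j, h1, h2, hw⟩) 0

lemma face_second {j : ℤ} (h1 : 0 ≤ j) (h2 : j ≤ M) (hw : w j ≠ .b) :
    V.face (second w M j) = third w M j := V.face_faceDart (some ⟨j, h1, h2, hw⟩) 1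

lemma face_third {j : ℤ} (h1 : 0 ≤ j) (h2 : j ≤ M) (hw : w j ≠ .b) :
    V.face (third w M j) = dart M j true := V.face_faceDart (some ⟨j, h1, h2, hw⟩) 2

lemma dart_cases (d : Dart M) : (d = dart M (-1) false ∨ d = dart M M false ∨
      d = dart M (M + 2) true) ∨
    ∃ j, 0 ≤ j ∧ j ≤ M ∧ w j ≠ .b ∧ (d = dart M j true ∨ d = second w M j ∨ d = third w M j) := by
  obtain ⟨o, a, rfl⟩ := V.exists_faceDart d
  rcases o with _ | j
  · left; fin_cases a <;> simp [faceDart]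
  · right; refine ⟨j, j.2.1, j.2.2.1, j.2.2.2, ?_⟩; fin_cases a <;> simp [faceDart]


/-- The recursion rules of `Dn`, expressed along the triangle of `j`: the far end of the edge at `j`
is a corner shared with the side at `leftPos w j`. -/
lemma dn_eq {j : ℤ} (h1 : 0 ≤ j) (h2 : j ≤ M) :
    (w (leftPos w j) = .b → SchnyderWood.dn w j = leftPos w j) ∧
    (w (leftPos w j) = .g → SchnyderWood.dn w j = SchnyderWood.dn w (leftPos w j)) := by
  obtain ⟨h3, h4, h5, h6⟩ := V.leftPos_spec h1 h2
  set z := leftPos w j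
  rcases h6 with ⟨h6, h7⟩ | ⟨h6, h7, h8, h9⟩
  · rw [h7]
    refine ⟨fun h => (Dn.of_b h).eq, fun h => ?_⟩
    have : z ≠ -1 := by rintro h'; rw [← h7, h', V.start] at h; cases h
    obtain ⟨y, hy, -⟩ := V.exists_dn (j := j - 1) (by omega) (by omega)
    rw [hy.eq]
    exact (Dn.of_g h hy).eq
  · have e : z + 1 - 1 = z := by ring
    refine ⟨fun h => ?_, fun h => ?_⟩
    · have := Dn.of_b (w := w) (i := z + 1) (by rwa [e])
      rw [e] at this
      exact (Dn.of_r h6 h8 this).eq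
    · have hz : z ≠ -1 := by rintro h'; rw [h', V.start] at h; cases h
      obtain ⟨y, hy, -⟩ := V.exists_dn (j := z) (by omega) (by omega)
      rw [hy.eq]
      exact (Dn.of_r h6 h8 (Dn.of_g (i := z + 1) (by rwa [e]) (by rwa [e]))).eq

/-- The corner opposite to the first side. After an r the b directly after `leftPos w j` is the
passage; otherwise the child visited from `j` on is skipped by `Up.of_run`. -/
lemma up_leftPos {j : ℤ} (h1 : 0 ≤ j) (h2 : j ≤ M) (hw : w j ≠ .b) :
    (w (j - 1) = .r → SchnyderWood.up w (leftPos w j) = SchnyderWood.dn w (j - 1)) ∧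
    (w (j - 1) ≠ .r → SchnyderWood.up w (leftPos w j) = SchnyderWood.up w (vtx w j)) := by
  obtain ⟨h3, h4, h5, h6⟩ := V.leftPos_spec h1 h2
  rcases h6 with ⟨h6, h7⟩ | ⟨h6, h7, h8, h9⟩
  · refine ⟨fun h => absurd h h6, fun _ => ?_⟩
    obtain ⟨⟨g, hg, hg'⟩, h9, h10, -⟩ := V.vtx_spec h1 h2
    have := hg.1
    have hlt := hg'.lt
    obtain ⟨k, hk, -⟩ := V.exists_up (i := vtx w j) (by omega) (by omega)
    rw [hk.eq, h7]
    have hrun := V.run_of_vtx (by omega) h2 hw hg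
    exact (Up.of_run (by omega) (fun a h h' => hrun a (by omega) h') hg.2.1 hg' hk).eq
  · exact ⟨fun _ => by rw [h8.eq]; exact (Up.of_b h9).eq, fun h => absurd h6 h⟩

lemma vtx_pred {j : ℤ} (h1 : 0 ≤ j) (h2 : j ≤ M) (hr : w (j - 1) = .r) :
    vtx w (j - 1) = vtx w j := by
  obtain ⟨⟨g, hg, hg'⟩, -⟩ := V.vtx_spec h1 h2
  refine Vtx.eq ⟨g, NextG.of_succ (by rw [hr]; decide) ?_, hg'⟩
  rwa [sub_add_cancel]

lemma up_start : SchnyderWood.up w (-1) = M + 3 := V.up.eq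

lemma dn_finish : SchnyderWood.dn w M = -1 := V.dn.eq

lemma vtx_finish : vtx w M = M + 2 := by
  have := V.vtx_spec V.nonneg le_rfl
  omega

lemma up_last : SchnyderWood.up w (M + 2) = M + 3 := by
  have := Up.of_b (w := w) (i := M + 2) (by rw [add_assoc]; exact V.b')
  rw [add_assoc] at this
  exact this.eq

omit V in
lemma isPos_last : IsPos M (M + 2) := Or.inr rfl

lemma finish_ne_b : w M ≠ .b := by rw [V.finish]; decide

/-- The triangles close up: each side ends where the next one begins. The three corners of an inner
triangle are `dn_eq`, `up_leftPos` and the definition of the third side together with `vtx_pred`. -/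
lemma src_face (d : Dart M) : Dart.src w (V.face d) = Dart.src w (Dart.rev M d) := by
  rcases V.dart_cases d with (rfl | rfl | rfl) | ⟨j, h1, h2, hw, rfl | rfl | rfl⟩
  · rw [V.face_root, rev_dart, Bool.not_false, src_true_b V.isPos_start V.start,
      src_false_rg V.isPos_finish V.finish_ne_b, V.dn_finish]
  · rw [V.face_finish, rev_dart, Bool.not_false, src_true_b isPos_last V.b,
      src_true_rg V.isPos_finish V.finish_ne_b, V.vtx_finish]
  · rw [V.face_last, rev_dart, Bool.not_true, src_false_b isPos_last V.b,
      src_false_b V.isPos_start V.start, V.up_start, V.up_last]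
  · rw [V.face_first h1 h2 hw, rev_dart, Bool.not_true, src_false_rg (isPos_of h1 h2) hw]
    have hp := V.isPos_leftPos h1 h2
    rcases V.second_cases h1 h2 with ⟨h3, h4⟩ | ⟨h3, h4⟩
    · rw [h4, src_false_rg hp (by rw [h3]; decide), (V.dn_eq h1 h2).2 h3]
    · rw [h4, src_true_b hp h3, (V.dn_eq h1 h2).1 h3]
  · rw [V.face_second h1 h2 hw]
    have hp := V.isPos_leftPos h1 h2
    have h5 : Dart.src w (Dart.rev M (second w M j)) = SchnyderWood.up w (leftPos w j) := by
      rcases V.second_cases h1 h2 with ⟨h3, h4⟩ | ⟨h3, h4⟩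
      · rw [h4, rev_dart, Bool.not_false, src_true_rg hp (by rw [h3]; decide), vtx_of_g h3]
      · rw [h4, rev_dart, Bool.not_true, src_false_b hp h3]
    rw [h5]
    rcases V.third_cases h1 h2 with ⟨h3, h3', h4⟩ | ⟨h3, h4⟩
    · rw [h4, src_false_rg (isPos_of h3' (by omega)) (by rw [h3]; decide),
        (V.up_leftPos h1 h2 hw).1 h3]
    · rw [h4, src_false_b (V.isPos_vtx h1 h2) (V.vtx_spec h1 h2).2.1,
        (V.up_leftPos h1 h2 hw).2 h3]
  · rw [V.face_third h1 h2 hw, src_true_rg (isPos_of h1 h2) hw]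
    rcases V.third_cases h1 h2 with ⟨h3, h3', h4⟩ | ⟨h3, h4⟩
    · rw [h4, rev_dart, Bool.not_false, src_true_rg (isPos_of h3' (by omega)) (by rw [h3]; decide),
        V.vtx_pred h1 h2 h3]
    · rw [h4, rev_dart, Bool.not_false, src_true_b (V.isPos_vtx h1 h2) (V.vtx_spec h1 h2).2.1]

omit V in
/-- The permutation that turns around the vertices. -/
noncomputable def rot (V : Valid w M) : Equiv.Perm (Dart M) := V.face * Dart.rev M

lemma rot_apply (d : Dart M) : V.rot d = V.face (Dart.rev M d) := rfl

lemma rot_mul_rev : V.rot * Dart.rev M = V.face := by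
  ext1 d
  simp only [rot, Equiv.Perm.mul_apply, Dart.rev_rev]

lemma src_rot (d : Dart M) : Dart.src w (V.rot d) = Dart.src w d := by
  rw [rot_apply, src_face, Dart.rev_rev]

lemma sameCycle_face (d : Dart M) : V.rot.SameCycle (Dart.rev M d) (V.face d) := by
  have : V.face d = V.rot (Dart.rev M d) := by rw [rot_apply, Dart.rev_rev]
  rw [this]
  exact Equiv.Perm.sameCycle_apply_right.2 (.refl _ _)

omit V in
/-- A dart at the vertex `k`. -/
noncomputable def vertexDart (M k : ℤ) : Dart M :=
  if k = M + 3 then dart M (-1) false else dart M k true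

/-- The induction retraces `dn_eq`, each corner now being one rotation step at the vertex. -/
lemma sameCycle_dn {j : ℤ} (h1 : 0 ≤ j) (h2 : j ≤ M) (hw : w j ≠ .b) :
    V.rot.SameCycle (dart M j false) (dart M (SchnyderWood.dn w j) true) := by
  suffices H : ∀ (n : ℕ) (j : ℤ), j < n → 0 ≤ j → j ≤ M → w j ≠ .b →
      V.rot.SameCycle (dart M j false) (dart M (SchnyderWood.dn w j) true) from
    H (j.toNat + 1) j (by omega) h1 h2 hw
  intro n
  induction n with
  | zero => intro j h3 h4; exfalso; push_cast at h3; omega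
  | succ n ih =>
    intro j hj h1 h2 hw
    push_cast at hj
    have h := V.sameCycle_face (dart M j true)
    rw [rev_dart, Bool.not_true, V.face_first h1 h2 hw] at h
    have hl := V.leftPos_spec h1 h2
    rcases V.second_cases h1 h2 with ⟨h3, h4⟩ | ⟨h3, h4⟩
    · rw [h4] at h
      rw [(V.dn_eq h1 h2).2 h3]
      have : leftPos w j ≠ -1 := fun e => by rw [e, V.start] at h3; cases h3
      exact h.trans (ih _ (by omega) (by omega) (by omega) (by rw [h3]; decide))
    · rw [h4] at h
      rw [(V.dn_eq h1 h2).1 h3]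
      exact h

lemma sameCycle_vtx {j : ℤ} (h1 : 0 ≤ j) (h2 : j ≤ M) (hw : w j ≠ .b) :
    V.rot.SameCycle (dart M j true) (dart M (vtx w j) true) := by
  suffices H : ∀ (n : ℕ) (j : ℤ), j < n → 0 ≤ j → j ≤ M → w j ≠ .b →
      V.rot.SameCycle (dart M j true) (dart M (vtx w j) true) from
    H (j.toNat + 1) j (by omega) h1 h2 hw
  intro n
  induction n with
  | zero => intro j h3 h4; exfalso; push_cast at h3; omega
  | succ n ih =>
    intro j hj h1 h2 hw
    push_cast at hj
    have h := V.sameCycle_face (third w M j)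
    rw [V.face_third h1 h2 hw] at h
    rcases V.third_cases h1 h2 with ⟨h3, h3', h4⟩ | ⟨h3, h4⟩
    · rw [h4, rev_dart, Bool.not_false] at h
      rw [← V.vtx_pred h1 h2 h3]
      exact h.symm.trans (ih (j - 1) (by omega) h3' (by omega) (by rw [h3]; decide))
    · rw [h4, rev_dart, Bool.not_false] at h
      exact h.symm

/-- The dart of a letter `b` against its direction lies on the third side of a triangle. -/
lemma exists_vtx_eq {v : ℤ} (hv : IsPos M v) (hw : w v = .b) (h0 : v ≠ -1) :
    ∃ j, 0 ≤ j ∧ j ≤ M ∧ w j ≠ .b ∧ w (j - 1) ≠ .r ∧ vtx w j = v := by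
  rcases V.dart_cases (dart M v false) with (h | h | h) | ⟨j, h1, h2, hwj, h | h | h⟩
  · exact absurd (dart_inj hv V.isPos_start h).1 h0
  · rw [(dart_inj hv V.isPos_finish h).1, V.finish] at hw; cases hw
  · cases (dart_inj hv isPos_last h).2
  · cases (dart_inj hv (isPos_of h1 h2) h).2
  · rcases V.second_cases h1 h2 with ⟨h3, h4⟩ | ⟨h3, h4⟩ <;> rw [h4] at h
    · rw [(dart_inj hv (V.isPos_leftPos h1 h2) h).1, h3] at hw; cases hw
    · cases (dart_inj hv (V.isPos_leftPos h1 h2) h).2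
  · rcases V.third_cases h1 h2 with ⟨h3, h3', h4⟩ | ⟨h3, h4⟩ <;> rw [h4] at h
    · rw [(dart_inj hv (isPos_of h3' (by omega)) h).1, h3] at hw; cases hw
    · exact ⟨j, h1, h2, hwj, h3, (dart_inj hv (V.isPos_vtx h1 h2) h).1.symm⟩

/-- The reversed blue dart of a child sits at the parent. Rotation about the parent moves to
preceding children, until it meets the g of the parent or, at `A_b`, the edge at `-1`. -/
lemma sameCycle_up {v : ℤ} (hv : IsPos M v) (hw : w v = .b) :
    V.rot.SameCycle (dart M v false) (vertexDart M (SchnyderWood.up w v)) := by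
  suffices H : ∀ (n : ℕ) (v : ℤ), v + 1 < n → IsPos M v → w v = .b →
      V.rot.SameCycle (dart M v false) (vertexDart M (SchnyderWood.up w v)) from
    H ((v + 1).toNat + 1) v (by omega) hv hw
  have hM := V.nonneg
  intro n
  induction n with
  | zero => intro j h3 h4; exfalso; push_cast at h3; rcases h4 with h4 | h4 <;> omega
  | succ n ih =>
    intro v hvn hv hw
    push_cast at hvn
    rcases eq_or_ne v (-1) with rfl | h0
    · rw [V.up_start, vertexDart, if_pos rfl]
    obtain ⟨j, h1, h2, hwj, hr, rfl⟩ := V.exists_vtx_eq hv hw h0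
    have h := V.sameCycle_face (second w M j)
    rw [V.face_second h1 h2 hwj] at h
    have hl := V.leftPos_spec h1 h2
    have hp := V.isPos_leftPos h1 h2
    have hlt := (V.vtx_spec h1 h2).2.2.2
    rcases V.third_cases h1 h2 with ⟨h3, -⟩ | ⟨-, h4⟩
    · exact absurd h3 hr
    rw [h4] at h
    rw [← (V.up_leftPos h1 h2 hwj).2 hr]
    refine h.symm.trans ?_
    rcases V.second_cases h1 h2 with ⟨h3, h4⟩ | ⟨h3, h4⟩
    · rw [h4, rev_dart, Bool.not_false]
      have : leftPos w j ≠ -1 := fun e => by rw [e, V.start] at h3; cases h3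
      obtain ⟨k, hk, hk'⟩ := V.exists_up_g (i := leftPos w j) (by omega) (by omega) h3
      have h5 := V.sameCycle_vtx (j := leftPos w j) (by omega) (by omega) (by rw [h3]; decide)
      rw [vtx_of_g h3] at h5
      rwa [vertexDart, if_neg (by rw [hk.eq]; omega)]
    · rw [h4, rev_dart, Bool.not_true]
      exact ih _ (by omega) hp h3

lemma isPos_rg {i : ℤ} (hi : IsPos M i) (hw : w i ≠ .b) : 0 ≤ i ∧ i ≤ M := by
  rcases hi with hi | rfl
  · have : i ≠ -1 := by rintro rfl; exact hw V.start
    omega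
  · exact absurd V.b hw

lemma sameCycle_vertexDart (d : Dart M) :
    V.rot.SameCycle d (vertexDart M (Dart.src w d)) := by
  obtain ⟨⟨i, s⟩, hi⟩ := d
  have hd : (⟨(i, s), hi⟩ : Dart M) = dart M i s := Subtype.ext (dart_val hi).symm
  rw [hd]
  change IsPos M i at hi
  cases s
  · by_cases hw : w i = .b
    · rw [src_false_b hi hw]
      exact V.sameCycle_up hi hw
    · obtain ⟨h1, h2⟩ := V.isPos_rg hi hw
      rw [src_false_rg hi hw]
      obtain ⟨y, hy, -⟩ := V.exists_dn h1 h2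
      have := hy.lt
      rw [vertexDart, if_neg (by rw [hy.eq]; omega)]
      exact V.sameCycle_dn h1 h2 hw
  · by_cases hw : w i = .b
    · rw [src_true_b hi hw, vertexDart, if_neg (by rcases hi with hi | hi <;> omega)]
    · obtain ⟨h1, h2⟩ := V.isPos_rg hi hw
      rw [src_true_rg hi hw, vertexDart, if_neg (by have := V.vtx_spec h1 h2; omega)]
      exact V.sameCycle_vtx h1 h2 hw

/-- Rotation preserves the tail by `src_face`; conversely every dart can be rotated into one chosen
dart at its tail, so tails label the cycles faithfully. -/
lemma sameCycle_rot_iff (d d' : Dart M) :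
    V.rot.SameCycle d d' ↔ Dart.src w d = Dart.src w d' := by
  constructor
  · rintro ⟨k, rfl⟩
    have h1 : ∀ (n : ℕ) (d : Dart M), Dart.src w ((V.rot ^ n) d) = Dart.src w d := by
      intro n
      induction n with
      | zero => intro d; rfl
      | succ n ih => intro d; rw [pow_succ, Equiv.Perm.mul_apply, ih, src_rot]
    rcases k with n | n
    · exact (h1 n d).symm
    · have := h1 (n + 1) ((V.rot ^ (n + 1))⁻¹ d)
      rw [← Equiv.Perm.mul_apply, mul_inv_cancel] at this
      rw [zpow_negSucc, ← this]
      rfl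
  · intro h
    have := (V.sameCycle_vertexDart d).trans (h ▸ (V.sameCycle_vertexDart d').symm)
    exact this

/-- Surjectivity of `faceDart` places the dart on a face, and its letter and orientation leave only
the second side. -/
lemma exists_second {i : ℤ} (h0 : -1 ≤ i) (h1 : i < M) (hr : w i ≠ .r) :
    ∃ j, 0 ≤ j ∧ j ≤ M ∧ w j ≠ .b ∧ second w M j = dart M i (decide (w i ≠ .g)) ∧
      leftPos w j = i := by
  have hi : IsPos M i := Or.inl ⟨h0, h1.le⟩
  rcases V.dart_cases (dart M i (decide (w i ≠ .g))) with (h | h | h) | ⟨j, h2, h3, hw, h | h | h⟩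
  · obtain ⟨rfl, h⟩ := dart_inj hi V.isPos_start h
    rw [V.start] at h; simp at h
  · have := (dart_inj hi V.isPos_finish h).1; omega
  · have := (dart_inj hi isPos_last h).1; omega
  · have h := dart_inj hi (isPos_of h2 h3) h
    obtain rfl := h.1
    rcases h' : w i with _ | _ | _
    · exact absurd h' hw
    · exact absurd h' hr
    · rw [h'] at h; cases h.2
  · refine ⟨j, h2, h3, hw, h.symm, ?_⟩
    obtain ⟨z, s, h4, h5, h6, -⟩ := V.second_spec h2 h3
    rw [h4] at h
    rw [← h5]
    exact (dart_inj hi h6 h).1.symm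
  · obtain ⟨v, h4, h5, h6, -, h7⟩ := V.third_spec h2 h3
    rw [h4] at h
    have h := dart_inj hi h5 h
    obtain rfl := h.1
    rcases h7 with ⟨h7, h8⟩ | ⟨-, h7, -⟩
    · rw [h8] at hr; exact absurd h7 hr
    · rw [h7] at h; cases h.2

/-- The letter `r` that is matched to a letter `b`. -/
lemma exists_dn_eq {k : ℤ} (h0 : 0 ≤ k) (h1 : k < M) (hw : w k = .b) :
    ∃ m, 0 ≤ m ∧ m < M ∧ w m = .r ∧ Dn w m k ∧ second w M (m + 1) =
      dart M (k - 1) (decide (w (k - 1) ≠ .g)) ∧ w (m + 1) ≠ .b := by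
  have e : k - 1 + 1 = k := by omega
  obtain ⟨j, h2, h3, h4, h5, h6⟩ := V.exists_second (i := k - 1) (by omega) (by omega)
    fun h => V.not_rb _ (by omega) (by omega) h (by rwa [e])
  obtain ⟨-, -, -, h7⟩ := V.leftPos_spec h2 h3
  rw [h6, e] at h7
  rcases h7 with ⟨-, h7⟩ | ⟨h7, h8, h9, -⟩
  · rw [← show k = j by omega] at h4
    exact absurd hw h4
  · refine ⟨j - 1, h8, by omega, h7, h9, ?_, ?_⟩ <;> rwa [sub_add_cancel]

end Valid

end SchnyderWood
-- Simplicity, Euler's formula and connectedness of the model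
namespace SchnyderWood

section WordFacts

variable {w : ℤ → Color} {i j k : ℤ}

/-- A first passage does not start at a letter `b` to the left of the matched letter `g`. -/
lemma Up.not_lt_match (h : Up w j k) (hj : w j = .g) (h' : Up w i k) (hij : i < j) : False := by
  have h1 := h.lt
  have h2 := excess_add (x := .g) (y := .b) (w := w) (show i ≤ j by omega) (show j ≤ k - 1 by omega)
  rw [h.1.2.2, h'.1.2.2, excess_last hij, hj] at h2
  have h3 := h'.1.2.1 (j - 1) (by omega) (by omega)
  have h4 : step .g .b .g = 1 := rfl
  omega

/-- The r at `i` closes the excursion that starts after `k` and makes its excess negative, so the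
word from `k` to a later position cannot be balanced. -/
lemma Dn.not_lt_match (h : Dn w i k) (hi : w i = .r) (h' : Dn w j k) (hij : i < j) : False := by
  have h1 := h.lt
  have h2 := h'.1.2.1 i h1.le hij
  rw [excess_last h1, h.1.2.2, hi] at h2
  simp [step] at h2

end WordFacts

namespace Valid

variable {w : ℤ → Color} {M : ℤ} (V : Valid w M)
include V

/-- By surjectivity of `faceDart`, the reversed dart of `k` is the third side of a triangle; the
first g from the letter of that triangle on is the partner. -/
lemma exists_up_eq {k : ℤ} (h0 : 0 ≤ k) (h1 : k < M) (hw : w k = .b) :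
    ∃ g, 0 ≤ g ∧ g < M ∧ w g = .g ∧ Up w g k := by
  obtain ⟨j, h2, h3, -, -, h4⟩ := V.exists_vtx_eq (v := k) (isPos_of h0 h1.le) hw (by omega)
  obtain ⟨⟨g, hg, hg'⟩, -⟩ := V.vtx_spec h2 h3
  rw [h4] at hg'
  have := hg.1
  have := hg'.lt
  exact ⟨g, by omega, by omega, hg.2.1, hg'⟩

lemma up_lt_of_isPos {i : ℤ} (hi : IsPos M i) :
    Up w i (SchnyderWood.up w i) ∧ i < SchnyderWood.up w i := by
  obtain ⟨k, hk, -⟩ := V.exists_up (i := i) (by rcases hi with h | h <;> have := V.nonneg <;> omega)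
    (by rcases hi with h | h <;> have := V.nonneg <;> omega)
  rw [hk.eq]
  exact ⟨hk, hk.lt⟩

lemma dn_spec {j : ℤ} (h1 : 0 ≤ j) (h2 : j ≤ M) :
    Dn w j (SchnyderWood.dn w j) ∧ SchnyderWood.dn w j < j ∧ -1 ≤ SchnyderWood.dn w j ∧
      w (SchnyderWood.dn w j) = .b := by
  obtain ⟨y, hy, h⟩ := V.exists_dn h1 h2
  rw [hy.eq]
  exact ⟨hy, hy.lt, h, hy.2⟩

lemma up_fake : Up w (M + 1) (M + 2) := by
  have := Up.of_b (w := w) (i := M + 1) (by rw [add_assoc]; exact V.b)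
  rwa [add_assoc] at this

/-- Only the letters `r` lead to the vertex `A_r`. -/
lemma up_ne {i : ℤ} (hi : IsPos M i) : SchnyderWood.up w i ≠ M + 2 := by
  intro h
  have hM := V.nonneg
  obtain ⟨k, hk, -⟩ := V.exists_up (i := i) (by rcases hi with h | h <;> omega)
    (by rcases hi with h | h <;> omega)
  rw [← hk.eq.trans rfl, h] at hk
  have hlt := hk.lt
  exact V.up_fake.not_lt_match V.g hk (by rcases hi with h | h <;> omega)

/-- The end points of an edge, ordered by their positions. -/
lemma src_lt {i : ℤ} (hi : IsPos M i) :
    (w i = .b → Dart.src w (dart M i true) < Dart.src w (dart M i false)) ∧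
    (w i ≠ .b → Dart.src w (dart M i false) < Dart.src w (dart M i true)) := by
  refine ⟨fun hw => ?_, fun hw => ?_⟩
  · rw [src_true_b hi hw, src_false_b hi hw]
    exact (V.up_lt_of_isPos hi).2
  · obtain ⟨h1, h2⟩ := V.isPos_rg hi hw
    rw [src_true_rg hi hw, src_false_rg hi hw]
    have := (V.dn_spec h1 h2).2.1
    have := (V.vtx_spec h1 h2).2.2.2
    omega

lemma src_rev_ne (d : Dart M) : Dart.src w d ≠ Dart.src w (Dart.rev M d) := by
  rw [← dart_eta d, rev_dart]
  have h := V.src_lt d.2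
  by_cases hw : w d.1.1 = .b
  · have := h.1 hw
    cases d.1.2 <;> simp <;> omega
  · have := h.2 hw
    cases d.1.2 <;> simp <;> omega

/-- Attached to the same g, the earlier letter would be an r. That r closes its partner, which is
then no longer open for the later letter. -/
lemma eq_of_dn_vtx {i j : ℤ} (hi : 0 ≤ i) (hi' : i ≤ M) (hj' : j ≤ M) (hwi : w i ≠ .b)
    (h1 : SchnyderWood.dn w i = SchnyderWood.dn w j)
    (h2 : SchnyderWood.vtx w i = SchnyderWood.vtx w j) : ¬ i < j := by
  intro hij
  obtain ⟨⟨g, hg1, hg2⟩, -⟩ := V.vtx_spec hi hi'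
  obtain ⟨⟨g', hg1', hg2'⟩, -⟩ := V.vtx_spec (hi.trans hij.le) hj'
  rw [h2] at hg2
  obtain rfl := hg2.inj hg2' hg1.2.1 hg1'.2.1
  have hr := V.run_of_vtx (by omega) hi' hwi hg1 i le_rfl (by have := hg1'.1; omega)
  have h3 := (V.dn_spec hi hi').1
  have h4 := (V.dn_spec (hi.trans hij.le) hj').1
  rw [h1] at h3
  exact h3.not_lt_match hr h4 hij

/-- A blue edge parallel to the edge at `j` would start to the left of the g to which `j` attaches,
yet pass first at the partner of that g. -/
lemma not_up_eq_vtx {i j : ℤ} (hi : IsPos M i) (hj : IsPos M j) (hwj : w j ≠ .b)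
    (h1 : i = SchnyderWood.dn w j) (h2 : SchnyderWood.up w i = SchnyderWood.vtx w j) : False := by
  obtain ⟨hj, hj'⟩ := V.isPos_rg hj hwj
  obtain ⟨⟨g, hg1, hg2⟩, -⟩ := V.vtx_spec hj hj'
  have h3 := (V.up_lt_of_isPos hi).1
  rw [h2] at h3
  have h4 := (V.dn_spec hj hj').2.1
  have := hg1.1
  exact hg2.not_lt_match hg1.2.1 h3 (by omega)

/-- The positions of the end points order the ends of every edge (`src_lt`), which fixes the
relative orientation of two parallel edges. A blue edge is then determined by its tail, and the
other cases are excluded by the two preceding lemmas. -/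
lemma eq_of_src {d d' : Dart M} (h : Dart.src w d = Dart.src w d')
    (h' : Dart.src w (Dart.rev M d) = Dart.src w (Dart.rev M d')) : d = d' := by
  obtain ⟨i, s, hi, rfl⟩ : ∃ i s, IsPos M i ∧ d = dart M i s := ⟨_, _, d.2, (dart_eta d).symm⟩
  obtain ⟨j, t, hj, rfl⟩ : ∃ i s, IsPos M i ∧ d' = dart M i s := ⟨_, _, d'.2, (dart_eta d').symm⟩
  rw [rev_dart, rev_dart] at h'
  have e1 := V.src_lt hi
  have e2 := V.src_lt hj
  by_cases hwi : w i = .b <;> by_cases hwj : w j = .b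
  · have e1 := e1.1 hwi
    have e2 := e2.1 hwj
    rw [src_true_b hi hwi] at e1
    rw [src_true_b hj hwj] at e2
    cases s <;> cases t <;> simp only [Bool.not_true, Bool.not_false, src_true_b hi hwi,
      src_true_b hj hwj] at h h' <;> first | (exfalso; omega) | (rw [h']) | (rw [h])
  · have e1 := e1.1 hwi
    have e2 := e2.2 hwj
    obtain ⟨h1, h2⟩ := V.isPos_rg hj hwj
    exfalso
    cases s <;> cases t <;> simp only [Bool.not_true, Bool.not_false] at h h' <;> first
      | omega
      | (rw [src_true_b hi hwi, src_false_rg hj hwj] at *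
         rw [src_false_b hi hwi, src_true_rg hj hwj] at *
         exact V.not_up_eq_vtx hi hj hwj (by assumption) (by assumption))
  · have e1 := e1.2 hwi
    have e2 := e2.1 hwj
    obtain ⟨h1, h2⟩ := V.isPos_rg hi hwi
    exfalso
    cases s <;> cases t <;> simp only [Bool.not_true, Bool.not_false] at h h' <;> first
      | omega
      | (rw [src_true_b hj hwj, src_false_rg hi hwi] at *
         rw [src_false_b hj hwj, src_true_rg hi hwi] at *
         exact V.not_up_eq_vtx hj hi hwi (Eq.symm (by assumption)) (Eq.symm (by assumption)))
  · have e1 := e1.2 hwi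
    have e2 := e2.2 hwj
    obtain ⟨h1, h2⟩ := V.isPos_rg hi hwi
    obtain ⟨h3, h4⟩ := V.isPos_rg hj hwj
    have key : SchnyderWood.dn w i = SchnyderWood.dn w j →
        SchnyderWood.vtx w i = SchnyderWood.vtx w j → i = j := fun k1 k2 => by
      have l1 := V.eq_of_dn_vtx h1 h2 h4 hwi k1 k2
      have l2 := V.eq_of_dn_vtx h3 h4 h2 hwj k1.symm k2.symm
      omega
    cases s <;> cases t <;> simp only [Bool.not_true, Bool.not_false, src_true_rg hi hwi,
      src_true_rg hj hwj, src_false_rg hi hwi, src_false_rg hj hwj] at h h' e1 e2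
    · rw [key h h']
    · omega
    · omega
    · rw [key h' h]

omit V in
/-- The vertices: the inner letters `b`, and the outer vertices at `-1`, `M + 2` and `M + 3`. -/
def IsVert (w : ℤ → Color) (M k : ℤ) : Prop :=
  (0 ≤ k ∧ k < M ∧ w k = .b) ∨ k = -1 ∨ k = M + 2 ∨ k = M + 3

lemma isVert_src (d : Dart M) : IsVert w M (Dart.src w d) := by
  obtain ⟨i, s, hi, rfl⟩ : ∃ i s, IsPos M i ∧ d = dart M i s := ⟨_, _, d.2, (dart_eta d).symm⟩
  have hM := V.nonneg
  by_cases hw : w i = .b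
  · cases s
    · rw [src_false_b hi hw]
      obtain ⟨k, h1, h2⟩ := V.exists_up (i := i) (by rcases hi with h | h <;> omega)
        (by rcases hi with h | h <;> omega)
      rw [h1.eq]
      have h3 := h1.lt
      have h4 := h1.2
      unfold IsVert
      rcases eq_or_ne k (M + 1) with rfl | h5
      · rw [V.g] at h4; cases h4
      rcases eq_or_ne k M with rfl | h6
      · rw [V.finish] at h4; cases h4
      rcases hi with h | h <;> by_cases k < M <;> [left; right; skip; skip] <;>
        first | exact ⟨by omega, by omega, h4⟩ | omega
    · rw [src_true_b hi hw]
      unfold IsVert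
      rcases eq_or_ne i M with rfl | h6
      · rw [V.finish] at hw; cases hw
      rcases hi with h | h
      · by_cases h0 : i = -1
        · tauto
        · left; exact ⟨by omega, by omega, hw⟩
      · tauto
  · obtain ⟨h1, h2⟩ := V.isPos_rg hi hw
    cases s
    · rw [src_false_rg hi hw]
      obtain ⟨h3, h4, h5, h6⟩ := V.dn_spec h1 h2
      unfold IsVert
      by_cases h0 : SchnyderWood.dn w i = -1
      · tauto
      · left; exact ⟨by omega, by omega, h6⟩
    · rw [src_true_rg hi hw]
      obtain ⟨-, h3, h4, h5⟩ := V.vtx_spec h1 h2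
      unfold IsVert
      rcases h4 with h4 | h4
      · left; exact ⟨by omega, by omega, h3⟩
      · tauto

lemma card_isVert : 3 * (Nat.card {k // IsVert w M k} : ℤ) = M + 9 := by
  have hM := V.nonneg
  have h1 : {k | IsVert w M k} = ↑((((Finset.Ioc (-1) (M - 1)).filter (w · = .b)) ∪
      {-1, M + 2, M + 3} : Finset ℤ)) := by
    ext k
    simp only [IsVert, Set.mem_ofPred_eq, Finset.coe_union, Set.mem_union, Finset.mem_coe,
      Finset.mem_filter, Finset.mem_Ioc, Finset.mem_insert, Finset.mem_singleton]
    constructor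
    · rintro (⟨h1, h2, h3⟩ | h)
      · exact Or.inl ⟨by omega, h3⟩
      · exact Or.inr h
    · rintro (⟨h1, h3⟩ | h)
      · exact Or.inl ⟨by omega, by omega, h3⟩
      · exact Or.inr h
  have h2 : Nat.card {k // IsVert w M k} = Set.ncard {k | IsVert w M k} := rfl
  have h3 := V.card_b
  rw [h2, h1, Set.ncard_coe_finset, Finset.card_union_of_disjoint]
  · have : ({-1, M + 2, M + 3} : Finset ℤ).card = 3 := by
      rw [Finset.card_insert_of_notMem, Finset.card_insert_of_notMem, Finset.card_singleton]
      · simp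
      · simp only [Finset.mem_insert, Finset.mem_singleton]; omega
    rw [this]; push_cast; omega
  · rw [Finset.disjoint_left]
    intro a ha
    simp only [Finset.mem_filter, Finset.mem_Ioc] at ha
    simp only [Finset.mem_insert, Finset.mem_singleton]
    omega

lemma src_vertexDart {k : ℤ} (hk : IsVert w M k) : Dart.src w (vertexDart M k) = k := by
  have hM := V.nonneg
  rcases hk with ⟨h1, h2, h3⟩ | rfl | rfl | rfl
  · rw [vertexDart, if_neg (by omega), src_true_b (isPos_of h1 h2.le) h3]
  · rw [vertexDart, if_neg (by omega), src_true_b V.isPos_start V.start]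
  · rw [vertexDart, if_neg (by omega), src_true_b isPos_last V.b]
  · rw [vertexDart, if_pos rfl, src_false_b V.isPos_start V.start, V.up_start]

lemma card_cycles_rot : Nat.card (Cycles V.rot) = Nat.card {k // IsVert w M k} :=
  card_cycles _ (fun d => ⟨Dart.src w d, V.isVert_src d⟩)
    (fun k => ⟨vertexDart M k, Subtype.ext (V.src_vertexDart k.2)⟩) fun d d' => by
      rw [sameCycle_rot_iff, Subtype.mk.injEq]

lemma card_cycles_rev : (Nat.card (Cycles (Dart.rev M)) : ℤ) = M + 3 := by
  have hM := V.nonneg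
  rw [card_cycles (α := {i // IsPos M i}) _ (fun d => ⟨d.1.1, d.2⟩)
    (fun i => ⟨⟨(i.1, true), i.2⟩, rfl⟩)]
  · have h2 : Nat.card {i // IsPos M i} = Set.ncard {i | IsPos M i} := rfl
    rw [h2, coe_setOf_isPos, Set.ncard_coe_finset, Finset.card_insert_of_notMem (by simp),
      Int.card_Icc]
    push_cast
    omega
  · intro d d'
    rw [Subtype.mk.injEq]
    constructor
    · intro h
      obtain ⟨k, rfl⟩ := h
      have h1 : ∀ (n : ℕ) (d : Dart M), ((Dart.rev M ^ n) d).1.1 = d.1.1 := by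
        intro n
        induction n with
        | zero => intro d; rfl
        | succ n ih => intro d; rw [pow_succ, Equiv.Perm.mul_apply, ih]; rfl
      rcases k with n | n
      · exact (h1 n d).symm
      · have := h1 (n + 1) ((Dart.rev M ^ (n + 1))⁻¹ d)
        rw [← Equiv.Perm.mul_apply, mul_inv_cancel] at this
        rw [zpow_negSucc, ← this]
        rfl
    · intro h
      by_cases h' : d.1.2 = d'.1.2
      · rw [show d = d' from Subtype.ext (Prod.ext h h')]
      · have : d' = Dart.rev M d := Subtype.ext (Prod.ext h.symm
          (by change _ = !d.1.2; revert h'; cases d.1.2 <;> cases d'.1.2 <;> simp))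
        rw [this]
        exact Equiv.Perm.sameCycle_apply_right.2 (.refl _ _)

lemma face_pow (o) (a : Fin 3) (n : ℕ) :
    (V.face ^ n) (faceDart w M (o, a)) = faceDart w M (o, a + Fin.ofNat 3 n) := by
  induction n with
  | zero => exact congrArg (faceDart w M) (Prod.ext rfl (add_zero a).symm)
  | succ n ih =>
    rw [pow_succ', Equiv.Perm.mul_apply, ih, face_faceDart, add_assoc]
    congr 3
    exact Fin.ext (by simp [Fin.val_add])

lemma face_cube (d : Dart M) : (V.face ^ 3) d = d := by
  obtain ⟨o, a, rfl⟩ := V.exists_faceDart d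
  rw [face_pow]
  congr 2
  fin_cases a <;> rfl

lemma sameCycle_face_iff (x y) :
    V.face.SameCycle (faceDart w M x) (faceDart w M y) ↔ x.1 = y.1 := by
  obtain ⟨o, a⟩ := x
  obtain ⟨o', a'⟩ := y
  have hinj := V.faceDart_injective
  constructor
  · rintro ⟨k, hk⟩
    obtain ⟨n, hn⟩ : ∃ n : ℕ, (V.face ^ n) (faceDart w M (o, a)) = faceDart w M (o', a') := by
      have h3 : V.face ^ 3 = 1 := Equiv.ext V.face_cube
      refine ⟨(k % 3).toNat, ?_⟩
      rw [← hk]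
      have h4 : V.face ^ k = V.face ^ (k % 3) := by
        conv_lhs => rw [← Int.mul_ediv_add_emod k 3, zpow_add, zpow_mul]
        rw [show V.face ^ (3 : ℤ) = 1 from h3, one_zpow, one_mul]
      rw [h4, ← zpow_natCast, Int.toNat_of_nonneg (by omega)]
    rw [face_pow] at hn
    exact (Prod.ext_iff.1 (hinj hn)).1
  · rintro (h : o = o')
    subst h
    refine ⟨((a' - a).val : ℕ), ?_⟩
    rw [zpow_natCast, face_pow]
    congr 2
    fin_cases a <;> fin_cases a' <;> rfl

lemma card_cycles_face : 3 * (Nat.card (Cycles V.face) : ℤ) = 2 * (M + 3) := by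
  rw [← V.card_face, Nat.card_prod]
  have e := Equiv.ofBijective _ V.faceDart_bijective
  rw [card_cycles (α := Option {j : ℤ // 0 ≤ j ∧ j ≤ M ∧ w j ≠ .b}) V.face
    (fun d => ((Equiv.ofBijective _ V.faceDart_bijective).symm d).1)
    (fun o => ⟨faceDart w M (o, 0), congrArg Prod.fst
      ((Equiv.ofBijective _ V.faceDart_bijective).symm_apply_apply (o, 0))⟩)]
  · simp; ring
  · intro d d'
    obtain ⟨x, rfl⟩ := (Equiv.ofBijective _ V.faceDart_bijective).surjective d
    obtain ⟨y, rfl⟩ := (Equiv.ofBijective _ V.faceDart_bijective).surjective d'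
    rw [Equiv.symm_apply_apply, Equiv.symm_apply_apply]
    exact V.sameCycle_face_iff x y

/-- With V vertices, E edges and F faces: 3V = M + 9, E = M + 3 and 3F = 2(M + 3). -/
lemma planar : Nat.card (Cycles V.rot) + Nat.card (Cycles (V.rot * Dart.rev M)) =
    Nat.card (Cycles (Dart.rev M)) + 2 := by
  rw [rot_mul_rev, V.card_cycles_rot]
  have h1 := V.card_isVert
  have h2 := V.card_cycles_rev
  have h3 := V.card_cycles_face
  omega

/-- Each position is linked to a smaller one, hence in the end to `-1`. -/
lemma connected (d d' : Dart M) :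
    ∃ p ∈ Subgroup.closure {V.rot, Dart.rev M}, p d = d' := by
  set G := Subgroup.closure {V.rot, Dart.rev M} with hG
  have hrot : V.rot ∈ G := Subgroup.subset_closure (by simp)
  have hrev : Dart.rev M ∈ G := Subgroup.subset_closure (by simp)
  have hface : V.face ∈ G := by rw [← rot_mul_rev]; exact G.mul_mem hrot hrev
  have hM := V.nonneg
  let R : Dart M → Dart M → Prop := fun d d' => ∃ p ∈ G, p d = d'
  have symm : ∀ {d d'}, R d d' → R d' d := by
    rintro d d' ⟨p, hp, rfl⟩
    exact ⟨p⁻¹, G.inv_mem hp, by simp⟩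
  have trans : ∀ {d d' d''}, R d d' → R d' d'' → R d d'' := by
    rintro d d' d'' ⟨p, hp, rfl⟩ ⟨q, hq, rfl⟩
    exact ⟨q * p, G.mul_mem hq hp, rfl⟩
  have flip : ∀ i s, R (dart M i s) (dart M i true) := by
    rintro i (_ | _)
    · exact ⟨_, hrev, rev_dart _⟩
    · exact ⟨1, G.one_mem, rfl⟩
  have rf : ∀ d, R d (V.face d) := fun d => ⟨_, hface, rfl⟩
  have cyc : ∀ {d d'}, V.rot.SameCycle d d' → R d d' := by
    rintro d d' ⟨k, rfl⟩
    exact ⟨_, G.zpow_mem hrot k, rfl⟩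
  have down : ∀ {j}, 0 ≤ j → j ≤ M → w j ≠ .b → R (dart M j true) (dart M (leftPos w j) true) := by
    intro j h1 h2 hw
    have := rf (dart M j true)
    rw [V.face_first h1 h2 hw] at this
    exact trans this (flip _ _)
  have H : ∀ (n : ℕ) (i : ℤ), -1 ≤ i → i ≤ M → i < n → R (dart M i true) (dart M (-1) true) := by
    intro n
    induction n with
    | zero =>
      intro i h1 h2 h3
      push_cast at h3
      rw [show i = -1 by omega]
      exact ⟨1, G.one_mem, rfl⟩
    | succ n ih =>
      intro i h1 h2 h3
      push_cast at h3
      rcases eq_or_lt_of_le h1 with rfl | h1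
      · exact ⟨1, G.one_mem, rfl⟩
      -- For r or g, the side at `leftPos w i` of the same triangle is earlier. For b, the reversed
      -- dart of the matched r sits at the same vertex and shares a triangle with the edge at `i -
      -- 1`.
      by_cases hw : w i = .b
      · have hiM : i ≠ M := by rintro rfl; exact V.finish_ne_b hw
        obtain ⟨m, h4, h5, h6, h7, h8, h9⟩ := V.exists_dn_eq (k := i) (by omega) (by omega) hw
        have h10 := cyc (V.sameCycle_dn h4 h5.le (by rw [h6]; decide))
        rw [h7.eq] at h10
        have h11 := rf (second w M (m + 1))
        rw [V.face_second (by omega) (by omega) h9, h8, third, if_pos (by rwa [add_sub_cancel_right]),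
          add_sub_cancel_right] at h11
        have h12 := symm (trans h11 h10)
        exact trans h12 (trans (flip _ _) (ih (i - 1) (by omega) (by omega) (by omega)))
      · have hl := V.leftPos_spec (j := i) (by omega) h2
        exact trans (down (by omega) h2 hw) (ih _ hl.1 (by omega) (by omega))
  have H' : ∀ d, R d (dart M (-1) true) := by
    intro d
    rw [← dart_eta d]
    refine trans (flip _ _) ?_
    rcases d.2 with h | h
    · exact H (d.1.1.toNat + 1) _ h.1 h.2 (by omega)
    · rw [h]
      have h1 := rf (dart M M false)
      rw [V.face_finish] at h1
      exact trans (symm h1) (trans (flip _ _) (H (M.toNat + 1) _ (by omega) le_rfl (by omega)))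
  exact trans (H' d) (symm (H' d'))

omit V in
/-- The triangulation that is coded by a word. -/
noncomputable def plane (V : Valid w M) : PlaneTriangulation (Dart M) where
  rot := V.rot
  rev := Dart.rev M
  root := dart M (-1) false
  rev_rev := Dart.rev_rev
  rev_ne := Dart.rev_ne
  connected := V.connected
  planar := V.planar
  face_three d := by
    rw [rot_mul_rev]
    refine ⟨fun h => ?_, V.face_cube d⟩
    have := V.src_face d
    rw [h] at this
    exact V.src_rev_ne d this
  no_loop d h := V.src_rev_ne d ((V.sameCycle_rot_iff _ _).1 h)
  no_multi d d' h h' := V.eq_of_src ((V.sameCycle_rot_iff _ _).1 h) ((V.sameCycle_rot_iff _ _).1 h')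

end Valid

end SchnyderWood
-- The coloring of the model
namespace SchnyderWood

/-- The color of the edge of a letter, on the dart in forward direction. -/
def fwd (c : Color) : Bool := decide (c ≠ .r)

namespace Valid

variable {w : ℤ → Color} {M : ℤ} (V : Valid w M)
include V

lemma plane_src_eq_iff (d d' : Dart M) :
    V.plane.src d = V.plane.src d' ↔ Dart.src w d = Dart.src w d' := by
  rw [← V.sameCycle_rot_iff]
  exact Quotient.eq (r := Equiv.Perm.SameCycle.setoid V.rot)

lemma plane_face : V.plane.face = V.face := V.rot_mul_rev

lemma plane_face_apply (d : Dart M) : V.plane.face d = V.face d := by rw [plane_face]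

/-- The position that stands for an outer vertex. -/
def _root_.SchnyderWood.outerPos (M : ℤ) : Color → ℤ
  | .b => M + 3
  | .r => M + 2
  | .g => -1

lemma src_eq_outerVertex_iff (d : Dart M) (c : Color) :
    V.plane.src d = V.plane.outerVertex c ↔ Dart.src w d = outerPos M c := by
  rcases c with _ | _ | _
  · refine (V.plane_src_eq_iff _ _).trans ?_
    change _ = Dart.src w (dart M (-1) false) ↔ _
    rw [src_false_b V.isPos_start V.start, V.up_start]
    rfl
  · refine (V.plane_src_eq_iff _ _).trans ?_
    change _ = Dart.src w (V.plane.face (V.plane.face (dart M (-1) false))) ↔ _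
    rw [plane_face_apply, plane_face_apply, face_root, face_finish, src_true_b isPos_last V.b]
    rfl
  · refine (V.plane_src_eq_iff _ _).trans ?_
    change _ = Dart.src w (V.plane.face (dart M (-1) false)) ↔ _
    rw [plane_face_apply, face_root, src_false_rg V.isPos_finish V.finish_ne_b, V.dn_finish]
    rfl

lemma isInner_iff (d : Dart M) : V.plane.IsInner (V.plane.src d) ↔
    0 ≤ Dart.src w d ∧ Dart.src w d < M ∧ w (Dart.src w d) = .b := by
  have hM := V.nonneg
  unfold PlaneTriangulation.IsInner
  simp only [ne_eq, src_eq_outerVertex_iff]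
  constructor
  · intro h
    rcases V.isVert_src d with h' | h' | h' | h'
    · exact h'
    · exact absurd h' (h .g)
    · exact absurd h' (h .r)
    · exact absurd h' (h .b)
  · rintro ⟨h1, h2, h3⟩ (_ | _ | _) <;> simp only [outerPos] <;> omega

lemma isOuter_iff (d : Dart M) :
    V.plane.IsOuter d ↔ d.1.1 = -1 ∨ d.1.1 = M ∨ d.1.1 = M + 2 := by
  have h : ∀ d, V.plane.face.SameCycle V.plane.root d ↔
      d = dart M (-1) false ∨ d = dart M M false ∨ d = dart M (M + 2) true := by
    intro d
    obtain ⟨o, a, rfl⟩ := V.exists_faceDart d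
    rw [plane_face]
    refine (V.sameCycle_face_iff (none, 0) (o, a)).trans ?_
    change none = o ↔ _
    constructor
    · rintro rfl
      fin_cases a <;> simp [faceDart]
    · intro h
      by_contra hc
      have : o = none := by
        rcases h with h | h | h
        · exact congrArg Prod.fst (V.faceDart_injective (h.trans (show _ = faceDart w M (none, 0) from rfl)))
        · exact congrArg Prod.fst (V.faceDart_injective (h.trans (show _ = faceDart w M (none, 1) from rfl)))
        · exact congrArg Prod.fst (V.faceDart_injective (h.trans (show _ = faceDart w M (none, 2) from rfl)))
      exact hc this.symm
  unfold PlaneTriangulation.IsOuter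
  rw [h, h]
  change _ ∨ Dart.rev M d = _ ∨ Dart.rev M d = _ ∨ Dart.rev M d = _ ↔ _
  have e : ∀ {i s}, IsPos M i → (d = dart M i s ↔ d.1.1 = i ∧ d.1.2 = s) := fun {i s} hi => by
    rw [Subtype.ext_iff, dart_val hi, Prod.ext_iff]
  have e' : ∀ {i s}, IsPos M i → (Dart.rev M d = dart M i s ↔ d.1.1 = i ∧ (!d.1.2) = s) :=
    fun {i s} hi => by
      rw [Subtype.ext_iff, dart_val hi, Prod.ext_iff]; rfl
  rw [e V.isPos_start, e V.isPos_finish, e isPos_last, e' V.isPos_start, e' V.isPos_finish,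
    e' isPos_last]
  cases d.1.2 <;> simp <;> tauto

omit V in
/-- The color of a dart. -/
noncomputable def _root_.SchnyderWood.Dart.col (w : ℤ → Color) {M : ℤ} (d : Dart M) : Option Color :=
  if 0 ≤ d.1.1 ∧ d.1.1 < M ∧ d.1.2 = fwd (w d.1.1) then some (w d.1.1) else none

omit V in
lemma col_dart {i : ℤ} (h1 : 0 ≤ i) (h2 : i < M) :
    Dart.col w (dart M i (fwd (w i))) = some (w i) := by
  rw [Dart.col, dart_val (isPos_of h1 h2.le), if_pos ⟨h1, h2, rfl⟩]

omit V in
lemma col_true {i : ℤ} (h1 : 0 ≤ i) (h2 : i < M) (hw : w i ≠ .r) :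
    Dart.col w (dart M i true) = some (w i) := by
  have := col_dart (w := w) h1 h2
  rwa [fwd, decide_eq_true hw] at this

omit V in
lemma col_false {i : ℤ} (h1 : 0 ≤ i) (h2 : i < M) (hw : w i = .r) :
    Dart.col w (dart M i false) = some .r := by
  have := col_dart (w := w) h1 h2
  rwa [fwd, decide_eq_false (by simpa using hw), hw] at this

omit V in
lemma col_eq_some {i : ℤ} {s : Bool} {c : Color} (hi : IsPos M i) :
    Dart.col w (dart M i s) = some c ↔ 0 ≤ i ∧ i < M ∧ w i = c ∧ s = fwd c := by
  rw [Dart.col, dart_val hi]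
  split_ifs with h
  · obtain ⟨h1, h2, h3⟩ := h
    simp only [Option.some.injEq] at *
    constructor
    · rintro rfl; exact ⟨h1, h2, rfl, h3⟩
    · tauto
  · simp only [false_iff]
    rintro ⟨h1, h2, rfl, h3⟩
    exact h ⟨h1, h2, h3⟩

lemma col_outer (d : Dart M) (h : V.plane.IsOuter d) : Dart.col w d = none := by
  rw [isOuter_iff] at h
  rw [Dart.col, if_neg]
  omega

omit V in
lemma col_isSome_iff (d : Dart M) : (Dart.col w d).isSome = true ↔
    0 ≤ d.1.1 ∧ d.1.1 < M ∧ d.1.2 = fwd (w d.1.1) := by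
  rw [Dart.col]
  split_ifs with h <;> simp [h]

lemma col_inner (d : Dart M) (h : ¬ V.plane.IsOuter d) :
    (Dart.col w d).isSome = true ↔ Dart.col w (Dart.rev M d) = none := by
  rw [isOuter_iff] at h
  have h' : 0 ≤ d.1.1 ∧ d.1.1 < M := by rcases d.2 with h1 | h1 <;> omega
  rw [← Option.not_isSome_iff_eq_none, col_isSome_iff, col_isSome_iff]
  change _ ↔ ¬ (0 ≤ d.1.1 ∧ d.1.1 < M ∧ (!d.1.2) = fwd (w d.1.1))
  simp only [h', true_and]
  cases d.1.2 <;> cases fwd (w d.1.1) <;> simp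

/-- The darts of color `c` that leave the vertex `k` forward. -/
lemma exists_unique_out {k : ℤ} (h0 : 0 ≤ k) (h1 : k < M) (hk : w k = .b) (c : Color) :
    ∃! d : Dart M, Dart.src w d = k ∧ Dart.col w d = some c := by
  have key : ∀ i, 0 ≤ i → i < M → w i = c → Dart.src w (dart M i (fwd c)) = k →
      (∀ j, 0 ≤ j → j < M → w j = c → Dart.src w (dart M j (fwd c)) = k → j = i) →
      ∃! d : Dart M, Dart.src w d = k ∧ Dart.col w d = some c := by
    intro i h2 h3 h4 h5 h6
    refine ⟨dart M i (fwd c), ⟨h5, (col_eq_some (isPos_of h2 h3.le)).2 ⟨h2, h3, h4, rfl⟩⟩, ?_⟩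
    rintro d ⟨h7, h8⟩
    rw [← dart_eta d] at h7 h8 ⊢
    obtain ⟨h9, h10, h11, h12⟩ := (col_eq_some d.2).1 h8
    rw [h12] at h7 ⊢
    rw [h6 _ h9 h10 h11 h7]
  rcases c with _ | _ | _
  · refine key k h0 h1 hk (src_true_b (isPos_of h0 h1.le) hk) fun j h2 h3 h4 h5 => ?_
    exact (src_true_b (isPos_of h2 h3.le) h4).symm.trans h5
  · obtain ⟨m, h2, h3, h4, h5, -⟩ := V.exists_dn_eq h0 h1 hk
    refine key m h2 h3 h4 ((src_false_rg (isPos_of h2 h3.le) (by rw [h4]; decide)).trans h5.eq)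
      fun j h6 h7 h8 h9 => ?_
    have h10 := (src_false_rg (isPos_of h6 h7.le) (by rw [h8]; decide)).symm.trans h9
    have h11 := (V.dn_spec h6 h7.le).1
    rw [h10] at h11
    exact h11.inj h5 h8 h4
  · obtain ⟨g, h2, h3, h4, h5⟩ := V.exists_up_eq h0 h1 hk
    refine key g h2 h3 h4 ((src_true_rg (isPos_of h2 h3.le) (by rw [h4]; decide)).trans
      ((vtx_of_g h4).trans h5.eq)) fun j h6 h7 h8 h9 => ?_
    have h10 := (src_true_rg (isPos_of h6 h7.le) (by rw [h8]; decide)).symm.trans h9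
    rw [vtx_of_g h8] at h10
    obtain ⟨l, h11, -⟩ := V.exists_up_g h6 h7 h8
    rw [← h11.eq, h10] at h11
    exact h11.inj h5 h8 h4

/-- With the dart that enters the corner as variable, rotation becomes a step of `V.face`, and the
rule is checked at the three corners of a triangle. The assumption that the corner is an inner
vertex removes all outer edges from the comparison. -/
lemma schnyder_aux (e : Dart M) (h : 0 ≤ Dart.src w (Dart.rev M e) ∧ Dart.src w (Dart.rev M e) < M)
    (c : Color) :
    (Dart.col w (Dart.rev M e) = some c → Dart.col w (V.face e) = some c.next ∨
      Dart.col w (Dart.rev M (V.face e)) = some c.prev) ∧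
    (Dart.col w e = some c → Dart.col w (Dart.rev M (V.face e)) = some c ∨
      Dart.col w (V.face e) = some c.prev) := by
  have hM := V.nonneg
  rcases V.dart_cases e with (rfl | rfl | rfl) | ⟨j, h1, h2, hw, rfl | rfl | rfl⟩
  · rw [rev_dart, col_eq_some V.isPos_start, col_eq_some V.isPos_start]; omega
  · rw [rev_dart, col_eq_some V.isPos_finish, col_eq_some V.isPos_finish]; omega
  · rw [rev_dart, col_eq_some isPos_last, col_eq_some isPos_last]; omega
  · have hj := isPos_of h1 h2
    rw [rev_dart] at h
    rw [V.face_first h1 h2 hw, rev_dart, col_eq_some hj, col_eq_some hj]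
    rw [Bool.not_true, src_false_rg hj hw] at h
    have hz := V.isPos_leftPos h1 h2
    have hl := V.leftPos_spec h1 h2
    -- If the side were the outer edge at `-1`, the corner would be `A_g`.
    have h0 : 0 ≤ leftPos w j := by
      by_contra hc
      have : leftPos w j = -1 := by omega
      have h3 := (V.dn_eq h1 h2).1 (by rw [this, V.start])
      omega
    rcases V.second_cases h1 h2 with ⟨h3, h4⟩ | ⟨h3, h4⟩
    · rw [h4, rev_dart, Bool.not_false, Bool.not_true, col_true h0 (by omega) (by rw [h3]; decide), h3]
      constructor
      · rintro ⟨-, -, h5, h6⟩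
        have hb : c ≠ .b := h5 ▸ hw
        generalize Dart.col w (dart M (leftPos w j) false) = x
        clear * - hb h6
        revert c x
        decide
      · rintro ⟨-, -, h5, h6⟩
        have hb : c ≠ .b := h5 ▸ hw
        generalize Dart.col w (dart M (leftPos w j) false) = x
        clear * - hb h6
        revert c x
        decide
    · rw [h4, rev_dart, Bool.not_true, col_true h0 (by omega) (by rw [h3]; decide), h3]
      constructor
      · rintro ⟨-, -, h5, h6⟩
        have hb : c ≠ .b := h5 ▸ hw
        generalize Dart.col w (dart M (leftPos w j) false) = x
        clear * - hb h6
        revert c x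
        decide
      · rintro ⟨-, -, h5, h6⟩
        have hb : c ≠ .b := h5 ▸ hw
        generalize Dart.col w (dart M (leftPos w j) false) = x
        clear * - hb h6
        revert c x
        decide
  · have hp := V.isPos_leftPos h1 h2
    have hl := V.leftPos_spec h1 h2
    have h5 : Dart.src w (Dart.rev M (second w M j)) = SchnyderWood.up w (leftPos w j) := by
      rcases V.second_cases h1 h2 with ⟨h3, h4⟩ | ⟨h3, h4⟩
      · rw [h4, rev_dart, Bool.not_false, src_true_rg hp (by rw [h3]; decide), vtx_of_g h3]
      · rw [h4, rev_dart, Bool.not_true, src_false_b hp h3]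
    rw [h5] at h
    rw [V.face_second h1 h2 hw]
    have h6 : (Dart.col w (Dart.rev M (second w M j)) = some c → c = .g) ∧
        (Dart.col w (second w M j) = some c → c = .b) := by
      rcases V.second_cases h1 h2 with ⟨h3, h4⟩ | ⟨h3, h4⟩
      · rw [h4, rev_dart, col_eq_some hp, col_eq_some hp]
        constructor <;> rintro ⟨-, -, h11, h12⟩ <;> have hc := h3.symm.trans h11 <;>
          clear * - hc h12 <;> revert c <;> decide
      · rw [h4, rev_dart, col_eq_some hp, col_eq_some hp]
        constructor <;> rintro ⟨-, -, h11, h12⟩ <;> have hc := h3.symm.trans h11 <;>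
          clear * - hc h12 <;> revert c <;> decide
    have h7 : Dart.col w (third w M j) = some .r ∨ Dart.col w (Dart.rev M (third w M j)) = some .b := by
      rcases V.third_cases h1 h2 with ⟨h8, h9, h10⟩ | ⟨h8, h9⟩
      · left
        rw [h10, col_false h9 (by omega) h8]
      · right
        obtain ⟨h10, h11, h12, h13⟩ := V.vtx_spec h1 h2
        rw [h9, rev_dart, Bool.not_false]
        rcases h12 with h12 | h12
        · rw [col_true (by omega) h12 (by rw [h11]; decide), h11]
        · rw [(V.up_leftPos h1 h2 hw).2 h8, h12, V.up_last] at h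
          omega
    constructor
    · intro h8
      rw [h6.1 h8]
      exact h7
    · intro h8
      rw [h6.2 h8]
      exact h7.symm
  · have hj := isPos_of h1 h2
    rw [V.face_third h1 h2 hw]
    -- For `j = M` the corner would be `A_r`.
    have hjM : j < M := by
      rcases eq_or_lt_of_le h2 with rfl | h3
      · rcases V.third_cases h1 h2 with ⟨h8, h9, h10⟩ | ⟨h8, h9⟩
        · rw [h10, rev_dart, Bool.not_false, src_true_rg (isPos_of h9 (by omega))
            (by rw [h8]; decide), V.vtx_pred h1 h2 h8, V.vtx_finish] at h
          omega
        · rw [h9, rev_dart, Bool.not_false, src_true_b (V.isPos_vtx h1 h2)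
            (V.vtx_spec h1 h2).2.1, V.vtx_finish] at h
          omega
      · exact h3
    have h6 : (Dart.col w (Dart.rev M (third w M j)) = some c → c = .b) ∧
        (Dart.col w (third w M j) = some c → c = .r) := by
      rcases V.third_cases h1 h2 with ⟨h8, h9, h10⟩ | ⟨h8, h9⟩
      · rw [h10, rev_dart, col_eq_some (isPos_of h9 (by omega)),
          col_eq_some (isPos_of h9 (by omega))]
        constructor <;> rintro ⟨-, -, h11, h12⟩ <;> have hc := h8.symm.trans h11 <;>
          clear * - hc h12 <;> revert c <;> decide
      · have := (V.vtx_spec h1 h2).2.1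
        rw [h9, rev_dart, col_eq_some (V.isPos_vtx h1 h2), col_eq_some (V.isPos_vtx h1 h2)]
        constructor <;> rintro ⟨-, -, h11, h12⟩ <;> have hc := this.symm.trans h11 <;>
          clear * - hc h12 <;> revert c <;> decide
    have h7 : Dart.col w (dart M j true) = some .g ∨
        Dart.col w (Dart.rev M (dart M j true)) = some .r := by
      rcases hc : w j with _ | _ | _
      · exact absurd hc hw
      · right; rw [rev_dart, Bool.not_true, col_false h1 hjM hc]
      · left; rw [col_true h1 hjM (by rw [hc]; decide), hc]
    constructor
    · intro h8
      rw [h6.1 h8]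
      exact h7
    · intro h8
      rw [h6.2 h8]
      exact h7.symm

/-- The positions of the outer vertices are extreme: `-1` can only be a backward match, and `M + 3`
only the head of a blue edge. An inner r does not match `-1` since the r at `M` does, and `M + 2` is
out of reach for blue and green edges by `up_ne`. -/
lemma col_outerVertex (c : Color) (d : Dart M) (h : Dart.src w d = outerPos M c)
    (ho : ¬ V.plane.IsOuter d) : Dart.col w (Dart.rev M d) = some c := by
  have hM := V.nonneg
  rw [isOuter_iff] at ho
  obtain ⟨i, s, hi, rfl⟩ : ∃ i s, IsPos M i ∧ d = dart M i s := ⟨_, _, d.2, (dart_eta d).symm⟩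
  rw [dart_val hi] at ho
  have h0 : 0 ≤ i ∧ i < M := by rcases hi with h1 | h1 <;> dsimp only at ho <;> omega
  rw [rev_dart, col_eq_some hi]
  refine ⟨h0.1, h0.2, ?_⟩
  by_cases hw : w i = .b
  · cases s
    · rw [src_false_b hi hw] at h
      have h1 := (V.up_lt_of_isPos hi).2
      have h2 := V.up_ne hi
      cases c <;> simp only [outerPos] at h
      · exact ⟨hw, rfl⟩
      · omega
      · omega
    · rw [src_true_b hi hw] at h
      cases c <;> simp only [outerPos] at h <;> omega
  · cases s
    · rw [src_false_rg hi hw] at h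
      have h1 := V.dn_spec h0.1 h0.2.le
      cases c <;> simp only [outerPos] at h
      · omega
      · omega
      · rcases hc : w i with _ | _ | _
        · exact absurd hc hw
        · have h2 := h1.1
          rw [h] at h2
          have := h2.inj V.dn hc V.finish
          omega
        · exact ⟨rfl, rfl⟩
    · rw [src_true_rg hi hw] at h
      have h1 := V.vtx_spec h0.1 h0.2.le
      cases c <;> simp only [outerPos] at h
      · omega
      · rcases hc : w i with _ | _ | _
        · exact absurd hc hw
        · exact ⟨rfl, rfl⟩
        · rw [vtx_of_g hc] at h
          exact absurd h (V.up_ne hi)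
      · omega

omit V in
/-- The wooded triangulation that is coded by a word. -/
noncomputable def wood (V : Valid w M) : WoodedTriangulation (Dart M) where
  toPlaneTriangulation := V.plane
  col := Dart.col w
  col_outer := V.col_outer
  col_inner := V.col_inner
  col_out v hv c := by
    obtain ⟨d, rfl⟩ := Quotient.exists_rep v
    have h := (V.isInner_iff d).1 hv
    obtain ⟨e, he, he'⟩ := V.exists_unique_out h.1 h.2.1 h.2.2 c
    exact ⟨e, ⟨(V.plane_src_eq_iff _ _).2 he.1, he.2⟩,
      fun f hf => he' f ⟨(V.plane_src_eq_iff _ _).1 hf.1, hf.2⟩⟩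
  schnyder d hd c := by
    have h := (V.isInner_iff d).1 hd
    have h1 := V.schnyder_aux (Dart.rev M d) (by rw [Dart.rev_rev]; exact ⟨h.1, h.2.1⟩) c
    rw [Dart.rev_rev] at h1
    exact h1
  col_outerVertex c d h := V.col_outerVertex c d ((V.src_eq_outerVertex_iff d c).1 h)

end Valid

/-- Inner and outer vertices. -/
lemma WoodedTriangulation.size_add_three {D : Type} [Finite D] (S : WoodedTriangulation D) :
    S.size + 3 = Nat.card S.Vertex := by
  classical
  have : Finite S.Vertex := Quotient.finite _
  have h1 : {v | S.IsInner v} = (Set.range S.outerVertex)ᶜ := by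
    ext v
    simp only [PlaneTriangulation.IsInner, Set.mem_ofPred_eq, Set.mem_compl_iff, Set.mem_range,
      not_exists]
    exact forall_congr' fun c => ⟨fun h h' => h h'.symm, fun h h' => h h'.symm⟩
  have h2 : S.size = Set.ncard {v | S.IsInner v} := rfl
  have h3 : (Set.range S.outerVertex).ncard = 3 := by
    rw [← Set.image_univ, Set.ncard_image_of_injective _ S.outerVertex_injective, Set.ncard_univ,
      Nat.card_eq_fintype_card]
    rfl
  rw [h2, h1, ← h3, add_comm, Set.ncard_add_ncard_compl]

lemma Valid.size_wood {w : ℤ → Color} {M : ℤ} (V : Valid w M) : 3 * (V.wood.size : ℤ) = M := by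
  have h1 := V.wood.size_add_three
  have h2 : Nat.card V.wood.Vertex = _ := V.card_cycles_rot
  have h3 := V.card_isVert
  omega

end SchnyderWood
namespace SchnyderWood

namespace WoodedTriangulation

/-! ### Isomorphisms -/

/-- The bijection `e` is an isomorphism of wooded triangulations. -/
structure IsIso {D D' : Type} (S : WoodedTriangulation D) (S' : WoodedTriangulation D')
    (e : D ≃ D') : Prop where
  rot : ∀ d, e (S.rot d) = S'.rot (e d)
  rev : ∀ d, e (S.rev d) = S'.rev (e d)
  root : e S.root = S'.root
  col : ∀ d, S.col d = S'.col (e d)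

section IsIso

variable {D D' : Type} {S : WoodedTriangulation D} {S' : WoodedTriangulation D'} {e : D ≃ D'}
  (h : S.IsIso S' e)
include h

lemma IsIso.symm : S'.IsIso S e.symm where
  rot d := by rw [Equiv.symm_apply_eq, h.rot, Equiv.apply_symm_apply]
  rev d := by rw [Equiv.symm_apply_eq, h.rev, Equiv.apply_symm_apply]
  root := by rw [Equiv.symm_apply_eq, h.root]
  col d := by rw [h.col, Equiv.apply_symm_apply]

lemma IsIso.trans {D'' : Type} {S'' : WoodedTriangulation D''} {e' : D' ≃ D''}
    (h' : S'.IsIso S'' e') : S.IsIso S'' (e.trans e') where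
  rot d := by simp [h.rot, h'.rot]
  rev d := by simp [h.rev, h'.rev]
  root := by simp [h.root, h'.root]
  col d := by rw [h.col, h'.col]; rfl

lemma IsIso.src {d d' : D} (hs : S.src d = S.src d') : S'.src (e d) = S'.src (e d') := by
  obtain ⟨k, hk⟩ : S.rot.SameCycle d d' := Quotient.exact hs
  refine Quotient.sound (s := Equiv.Perm.SameCycle.setoid S'.rot) ⟨k, ?_⟩
  have h1 : ∀ (n : ℕ) d, e ((S.rot ^ n) d) = (S'.rot ^ n) (e d) := by
    intro n
    induction n with
    | zero => intro d; rfl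
    | succ n ih => intro d; rw [pow_succ', pow_succ', Equiv.Perm.mul_apply, h.rot, ih]; rfl
  rw [← hk]
  rcases k with n | n
  · exact (h1 n d).symm
  · rw [zpow_negSucc, zpow_negSucc, Equiv.Perm.inv_eq_iff_eq, ← h1, ← Equiv.Perm.mul_apply,
      mul_inv_cancel]
    rfl

lemma IsIso.face (d : D) : e (S.face d) = S'.face (e d) := by
  rw [face_apply, h.rot, h.rev, face_apply]

lemma IsIso.dartX : e S.dartX = S'.dartX := by
  unfold WoodedTriangulation.dartX; rw [h.face, h.root]

lemma IsIso.dartY : e S.dartY = S'.dartY := by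
  unfold WoodedTriangulation.dartY; rw [h.face, h.dartX]

lemma IsIso.xcol (d : D) : S'.xcol (e d) = S.xcol d := by
  have h1 : e d = S'.rev S'.root ↔ d = S.rev S.root := by
    rw [← h.root, ← h.rev, e.apply_eq_iff_eq]
  have h2 : e d = S'.dartY ↔ d = S.dartY := by rw [← h.dartY, e.apply_eq_iff_eq]
  have h3 : e d = S'.dartX ↔ d = S.dartX := by rw [← h.dartX, e.apply_eq_iff_eq]
  unfold WoodedTriangulation.xcol
  rw [← h.col]
  split_ifs <;> first
    | rfl
    | (exfalso; tauto)

lemma IsIso.out {c : Color} {d : D} (hd : S.Out c d) : S'.Out c (e d) := by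
  rw [Out, h.xcol]; exact hd

lemma IsIso.in {c : Color} {d : D} (hd : S.In c d) : S'.In c (e d) := by
  rw [In, ← h.rev, h.xcol]; exact hd

lemma IsIso.step {p p' : D} (hs : S.Step p p') : S'.Step (e p) (e p') := by
  rcases hs with ⟨h1, rfl⟩ | ⟨d, h1, h2⟩
  · exact Or.inl ⟨h.in h1, h.rot _⟩
  · refine Or.inr ⟨e d, ?_, ?_⟩
    · rcases h1 with ⟨h1, rfl⟩ | ⟨h1, rfl⟩
      · exact Or.inl ⟨h.out h1, h.rot _⟩
      · exact Or.inr ⟨h.out h1, by rw [h.rot, h.rev]⟩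
    · rcases h2 with ⟨h1, rfl⟩ | ⟨h1, h2, h3⟩
      · exact Or.inl ⟨h.in h1, by rw [h.rot, h.rev]⟩
      · exact Or.inr ⟨h.out h1, h.out h2, h.src h3⟩

lemma IsIso.letter {p : D} {c : Color} (hp : S.Letter p c) : S'.Letter (e p) c := by
  cases c
  · exact h.out hp
  · exact h.in hp
  · exact h.out hp

lemma IsIso.coding {w : ℤ → Color} {M : ℤ} {P : ℤ → D} (C : S.Coding w M P) :
    S'.Coding w M (fun i => e (P i)) where
  nonneg := C.nonneg
  start := by rw [C.start, h.rev, h.root]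
  finish := by rw [C.finish, h.rev, h.dartX]
  last := by rw [C.last, h.dartY]
  step i h1 h2 := h.step (C.step i h1 h2)
  letter i h1 h2 := h.letter (C.letter i h1 h2)

end IsIso

/-! ### Uniqueness of the word -/

section Unique

variable {D : Type} {S : WoodedTriangulation D}

lemma Step.unique {p p' p'' : D} {c : Color} (h : S.Step p p') (h' : S.Step p p'')
    (hp : S.Letter p c) : p' = p'' := by
  by_cases hc : c = .r
  · subst hc
    rw [h.of_r hp, h'.of_r hp]
  · rcases h.of_bg hp hc with ⟨h1, h2⟩ | ⟨h1, h2, h3⟩ <;>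
      rcases h'.of_bg hp hc with ⟨k1, k2⟩ | ⟨k1, k2, k3⟩
    · rw [h2, k2]
    · exact (h1.not_out k1).elim
    · exact (k1.not_out h1).elim
    · exact h2.unique k2 (h3.trans k3.symm)

lemma Coding.congr {w w' : ℤ → Color} {M : ℤ} {P : ℤ → D} (C : S.Coding w M P)
    (h : ∀ i, -1 ≤ i → i ≤ M → w i = w' i) : S.Coding w' M P where
  nonneg := C.nonneg
  start := C.start
  finish := C.finish
  last := C.last
  step := C.step
  letter i h1 h2 := by rw [← h i h1 h2]; exact C.letter i h1 h2

/-- A wooded triangulation has only one word. -/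
lemma Coding.unique {w w' : ℤ → Color} {M M' : ℤ} {P P' : ℤ → D} (C : S.Coding w M P)
    (C' : S.Coding w' M' P') : M = M' ∧ ∀ i, -1 ≤ i → i ≤ M → w i = w' i := by
  have H : ∀ (n : ℕ), (n : ℤ) - 1 ≤ M → (n : ℤ) - 1 ≤ M' → P (n - 1) = P' (n - 1) := by
    intro n
    induction n with
    | zero => intro _ _; simpa using C.start.trans C'.start.symm
    | succ n ih =>
      intro h1 h2
      push_cast at h1 h2 ⊢
      have h3 := ih (by omega) (by omega)
      have h4 := C.step (n - 1) (by omega) (by omega)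
      have h5 := C'.step (n - 1) (by omega) (by omega)
      rw [← h3] at h5
      have h6 := h4.unique h5 (C.letter _ (by omega) (by omega))
      rwa [sub_add_eq_add_sub] at h6
  have H' : ∀ i, -1 ≤ i → i ≤ M → i ≤ M' → P i = P' i := fun i h1 h2 h3 => by
    have := H (i + 1).toNat (by omega) (by omega)
    rwa [show (((i + 1).toNat : ℕ) : ℤ) - 1 = i by omega] at this
  have h0 := C.nonneg
  have h0' := C'.nonneg
  have hM : M = M' := by
    rcases le_total M M' with h | h
    · have := H' M (by omega) le_rfl h
      rw [C.finish, ← C'.finish] at this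
      exact (C'.inj (by omega) le_rfl (by omega) h this).symm
    · have := H' M' (by omega) h le_rfl
      rw [C'.finish, ← C.finish] at this
      exact (C.inj (by omega) h (by omega) le_rfl this).symm
  subst hM
  refine ⟨rfl, fun i h1 h2 => ?_⟩
  have h3 := C.letter i h1 h2
  rw [H' i h1 h2 h2] at h3
  exact h3.color (C'.letter i h1 h2)

/-- Of the two darts of an edge only one carries a letter, so distinct positions and orientations
give distinct darts. -/
lemma Letter.not_rev {d : D} {c c' : Color} (h : S.Letter d c) (h' : S.Letter (S.rev d) c') :
    False := by
  rcases c with _ | _ | _ <;> rcases c' with _ | _ | _ <;>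
    simp only [Letter, out_rev, in_rev] at h h' <;> first
    | exact h'.not_out h
    | exact h.not_out h'
    | cases h.color h'

end Unique

/-! ### A wooded triangulation is determined by its word -/

section Model

variable {D : Type} {S : WoodedTriangulation D} {w : ℤ → Color} {M : ℤ} {P : ℤ → D}

/-- The dart at a position of the word. -/
def dartOf (S : WoodedTriangulation D) (P : ℤ → D) (d : Dart M) : D :=
  if d.1.2 then P d.1.1 else S.rev (P d.1.1)

lemma dartOf_true {i : ℤ} (hi : IsPos M i) : S.dartOf P (dart M i true) = P i := by
  simp [dartOf, dart_val hi]

lemma dartOf_false {i : ℤ} (hi : IsPos M i) : S.dartOf P (dart M i false) = S.rev (P i) := by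
  simp [dartOf, dart_val hi]

lemma dartOf_rev (d : Dart M) : S.dartOf P (Dart.rev M d) = S.rev (S.dartOf P d) := by
  change (if (!d.1.2) then _ else _) = _
  unfold dartOf
  change (if (!d.1.2) then P d.1.1 else S.rev (P d.1.1)) = _
  cases d.1.2 <;> simp [S.rev_rev]

namespace Coding

variable (C : S.Coding w M P) (F : Framed w M)
include C F

lemma dartOf_second {j : ℤ} (h1 : 0 ≤ j) (h2 : j ≤ M) (hw : w j ≠ .b) :
    S.dartOf P (second w M j) = S.face (P j) := by
  have V := C.valid F
  obtain ⟨-, -, -, -, z, h3, h4, h5, h6, h7, h8⟩ := C.exists_dn h1 h2 hw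
  have hz : leftPos w j = z := by
    unfold leftPos
    split_ifs with hr
    · rw [(h8 hr).eq, add_sub_cancel_right]
    · exact (h7 hr).symm
  rw [h6, second, hz, leftDart]
  have hp : IsPos M z := Or.inl ⟨h3, by omega⟩
  rcases hc : w z with _ | _ | _
  · exact dartOf_true hp
  · exact absurd hc h5
  · exact dartOf_false hp

lemma dartOf_third {j : ℤ} (h1 : 0 ≤ j) (h2 : j ≤ M) (hw : w j ≠ .b) :
    S.face (S.dartOf P (third w M j)) = P j := by
  have V := C.valid F
  rcases V.third_cases h1 h2 with ⟨h3, h4, h5⟩ | ⟨h3, h4⟩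
  · rw [h5, dartOf_false (Valid.isPos_of h4 (by omega)), face_rev]
    have := C.next_of_r (i := j - 1) (by omega) (by omega) h3
    rw [sub_add_cancel] at this
    exact this.symm
  · obtain ⟨h5, h6⟩ := C.next_rg (i := j - 1) (by omega) (by omega) h3 (by rwa [sub_add_cancel])
    rw [sub_add_cancel] at h6
    obtain ⟨k, h7, h8, h9, d, h10, h11, h12⟩ := (C.exists_up_vtx F (by omega) h2).2 hw h1
    have h13 : S.rev (S.turn (w (j - 1)) (P (j - 1))) = d :=
      Out.unique (c := .b) h5 h10 (by rw [h11, h6, src_face])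
    rw [h4, h7.eq, dartOf_false (by have := V.isPos_vtx h1 h2; rwa [h7.eq] at this), ← h12, ← h13,
      S.rev_rev, ← h6]

/-- The triangles of the model were chosen to be those found in `exists_dn` and `exists_up_vtx`. The
second side needs no separate proof of the form of the third one: `face` is injective and its cube
is the identity. -/
lemma dartOf_face (V : Valid w M) (d : Dart M) :
    S.dartOf P (V.face d) = S.face (S.dartOf P d) := by
  rcases V.dart_cases d with (rfl | rfl | rfl) | ⟨j, h1, h2, hw, rfl | rfl | rfl⟩
  · rw [V.face_root, dartOf_false V.isPos_finish, dartOf_false V.isPos_start, C.finish, C.start,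
      S.rev_rev, S.rev_rev]; rfl
  · rw [V.face_finish, dartOf_false V.isPos_finish, dartOf_true Valid.isPos_last, C.finish, C.last,
      S.rev_rev]; rfl
  · rw [V.face_last, dartOf_false V.isPos_start, dartOf_true Valid.isPos_last, C.start, C.last,
      S.rev_rev, face_dartY]
  · rw [V.face_first h1 h2 hw, C.dartOf_second F h1 h2 hw, dartOf_true (Valid.isPos_of h1 h2)]
  · apply S.face.injective
    rw [V.face_second h1 h2 hw, C.dartOf_third F h1 h2 hw, C.dartOf_second F h1 h2 hw,
      face_face_face]
  · rw [V.face_third h1 h2 hw, C.dartOf_third F h1 h2 hw, dartOf_true (Valid.isPos_of h1 h2)]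

lemma dartOf_rot (V : Valid w M) (d : Dart M) :
    S.dartOf P (V.rot d) = S.rot (S.dartOf P d) := by
  rw [V.rot_apply, C.dartOf_face F V, dartOf_rev, face_rev]

lemma col_dartOf (d : Dart M) : Dart.col w d = S.col (S.dartOf P d) := by
  have hM := C.nonneg
  obtain ⟨i, s, hi, rfl⟩ : ∃ i s, IsPos M i ∧ d = dart M i s := ⟨_, _, d.2, (dart_eta d).symm⟩
  by_cases h : 0 ≤ i ∧ i < M
  · have ho := C.not_isOuter h.1 h.2
    have hl := C.letter i (by omega) h.2.le
    have h1 : ∀ {c}, S.Out c (P i) → S.col (P i) = some c ∧ S.col (S.rev (P i)) = none := by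
      intro c hc
      rw [← S.xcol_of_not_isOuter ho, ← S.xcol_of_not_isOuter (by rwa [isOuter_rev])]
      exact ⟨hc, S.xcol_rev_eq_none hc⟩
    have h2 : ∀ {c}, S.In c (P i) → S.col (P i) = none ∧ S.col (S.rev (P i)) = some c := by
      intro c hc
      rw [← S.xcol_of_not_isOuter ho, ← S.xcol_of_not_isOuter (d := S.rev _) (by rwa [isOuter_rev])]
      refine ⟨?_, hc⟩
      have := S.xcol_rev_eq_none hc
      rwa [S.rev_rev] at this
    have h3 : Dart.col w (dart M i s) = if s = fwd (w i) then some (w i) else none := by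
      rw [Dart.col, dart_val hi]
      simp [h]
    rw [h3]
    rcases hc : w i with _ | _ | _ <;> rw [hc] at hl <;> cases s <;>
      simp only [dartOf_true hi, dartOf_false hi]
    · exact (h1 hl).2.symm
    · exact (h1 hl).1.symm
    · exact (h2 hl).2.symm
    · exact (h2 hl).1.symm
    · exact (h1 hl).2.symm
    · exact (h1 hl).1.symm
  · have h3 : Dart.col w (dart M i s) = none := by
      rw [Dart.col, dart_val hi, if_neg]
      dsimp only
      omega
    rw [h3]
    symm
    apply S.col_outer
    rw [isOuter_iff]
    rcases (show i = -1 ∨ i = M ∨ i = M + 2 by rcases hi with h' | h' <;> omega) with rfl | rfl | rfl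
    · cases s
      · rw [dartOf_false hi, C.start, S.rev_rev]; tauto
      · rw [dartOf_true hi, C.start]; tauto
    · cases s
      · rw [dartOf_false hi, C.finish, S.rev_rev]; tauto
      · rw [dartOf_true hi, C.finish]; tauto
    · cases s
      · rw [dartOf_false hi, C.last]; tauto
      · rw [dartOf_true hi, C.last]; tauto

lemma dartOf_root : S.dartOf P (dart M (-1) false) = S.root := by
  rw [dartOf_false (C.valid F).isPos_start, C.start, S.rev_rev]

/-- The range contains the root and is stable under the two generators, so connectedness makes it
everything. -/
lemma dartOf_surjective : Function.Surjective (S.dartOf (M := M) P) := by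
  intro d
  have V := C.valid F
  obtain ⟨p, hp, rfl⟩ := S.connected S.root d
  suffices ∀ x : Dart M, ∃ y : Dart M, S.dartOf P y = p (S.dartOf P x) by
    obtain ⟨y, hy⟩ := this (dart M (-1) false)
    exact ⟨y, by rw [hy, C.dartOf_root F]⟩
  induction hp using Subgroup.closure_induction with
  | mem p hp =>
    intro x
    rcases hp with rfl | rfl
    · exact ⟨_, C.dartOf_rot F V x⟩
    · exact ⟨_, dartOf_rev x⟩
  | one => exact fun x => ⟨x, rfl⟩
  | mul p q _ _ hp hq =>
    intro x
    obtain ⟨y, hy⟩ := hq x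
    obtain ⟨z, hz⟩ := hp y
    exact ⟨z, by rw [hz, hy]; rfl⟩
  | inv p _ hp =>
    intro x
    -- A bijection that maps a finite set into itself maps it onto itself, which gives stability
    -- under inverses.
    have hfin : Finite (Set.range (S.dartOf (M := M) P)) := Set.finite_range _
    have hmap : Set.MapsTo p (Set.range (S.dartOf (M := M) P)) (Set.range (S.dartOf (M := M) P)) := by
      rintro _ ⟨y, rfl⟩
      obtain ⟨z, hz⟩ := hp y
      exact ⟨z, hz⟩
    obtain ⟨⟨_, y, rfl⟩, h⟩ := (Finite.injective_iff_surjective.1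
      (hmap.restrict_inj.2 p.injective.injOn)) ⟨_, x, rfl⟩
    rw [Subtype.ext_iff, Set.MapsTo.val_restrict_apply] at h
    dsimp only at h
    exact ⟨y, by rw [← h]; simp⟩

lemma dartOf_injective : Function.Injective (S.dartOf (M := M) P) := by
  have V := C.valid F
  intro d d' h
  have hM := C.nonneg
  have hinj : ∀ {i j}, IsPos M i → IsPos M j → P i = P j → i = j := by
    intro i j hi hj h
    rcases hi with hi | rfl <;> rcases hj with hj | rfl
    · exact C.inj hi.1 hi.2 hj.1 hj.2 h
    · rw [C.last] at h; exact absurd h (C.ne_dartY hi.1 hi.2)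
    · rw [C.last] at h; exact absurd h.symm (C.ne_dartY hj.1 hj.2)
    · rfl
  have hletter : ∀ {i}, IsPos M i → ∃ c, S.Letter (P i) c := by
    rintro i (hi | rfl)
    · exact ⟨_, C.letter i hi.1 hi.2⟩
    · exact ⟨.b, by rw [C.last]; exact S.xcol_dartY⟩
  obtain ⟨i, s, hi, rfl⟩ : ∃ i s, IsPos M i ∧ d = dart M i s := ⟨_, _, d.2, (dart_eta d).symm⟩
  obtain ⟨j, t, hj, rfl⟩ : ∃ i s, IsPos M i ∧ d' = dart M i s := ⟨_, _, d'.2, (dart_eta d').symm⟩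
  obtain ⟨c, hc⟩ := hletter hi
  obtain ⟨c', hc'⟩ := hletter hj
  cases s <;> cases t <;> simp only [dartOf_true, dartOf_false, hi, hj] at h
  · rw [hinj hi hj (S.rev_inj h)]
  · rw [← h] at hc'
    exact (hc.not_rev hc').elim
  · rw [h] at hc
    exact (hc'.not_rev hc).elim
  · rw [hinj hi hj h]

/-- A wooded triangulation is isomorphic to the model of its word. -/
lemma exists_isIso (V : Valid w M) : ∃ e : Dart M ≃ D, V.wood.IsIso S e ∧
    ∀ d, e d = S.dartOf P d :=
  ⟨Equiv.ofBijective _ ⟨C.dartOf_injective F, C.dartOf_surjective F⟩,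
    ⟨C.dartOf_rot F V, dartOf_rev, C.dartOf_root F, C.col_dartOf F⟩, fun _ => rfl⟩

end Coding

end Model

end WoodedTriangulation

end SchnyderWood
-- The model of a word is coded by that word
namespace SchnyderWood

namespace Valid

variable {w : ℤ → Color} {M : ℤ} (V : Valid w M)
include V

lemma wood_face (d : Dart M) : V.wood.face d = V.face d := V.plane_face_apply d

lemma wood_dartX : V.wood.dartX = dart M M false := (V.wood_face _).trans V.face_root

lemma wood_dartY : V.wood.dartY = dart M (M + 2) true := by
  rw [WoodedTriangulation.dartY, wood_dartX, wood_face, V.face_finish]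

lemma xcol_dart {i : ℤ} (h1 : 0 ≤ i) (h2 : i < M) (s : Bool) :
    V.wood.xcol (dart M i s) = Dart.col w (dart M i s) := by
  refine V.wood.xcol_of_not_isOuter ?_
  refine (V.isOuter_iff _).not.2 ?_
  rw [dart_val (isPos_of h1 h2.le)]
  dsimp only
  omega

lemma wood_rev (i : ℤ) (s : Bool) : V.wood.rev (dart M i s) = dart M i (!s) := rev_dart s

lemma wood_rot (d : Dart M) : V.wood.rot d = V.face (Dart.rev M d) := rfl

lemma wood_out_b {i : ℤ} (hi : IsPos M i) (hw : w i = .b) : V.wood.Out .b (dart M i true) := by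
  have hM : i ≠ M := by rintro rfl; exact V.finish_ne_b hw
  rcases eq_or_ne i (-1) with rfl | h1
  · have := V.wood.xcol_rev_root
    rwa [show V.wood.rev V.wood.root = dart M (-1) true from V.wood_rev _ _] at this
  rcases eq_or_ne i (M + 2) with rfl | h2
  · have := V.wood.xcol_dartY
    rwa [wood_dartY] at this
  · have h3 : 0 ≤ i ∧ i < M := by rcases hi with h | h <;> omega
    rw [WoodedTriangulation.Out, V.xcol_dart h3.1 h3.2, col_true h3.1 h3.2 (by rw [hw]; decide), hw]

lemma wood_letter {i : ℤ} (h1 : -1 ≤ i) (h2 : i ≤ M) : V.wood.Letter (dart M i true) (w i) := by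
  have hi : IsPos M i := Or.inl ⟨h1, h2⟩
  rcases hw : w i with _ | _ | _
  · exact V.wood_out_b hi hw
  · have h0 := (V.isPos_rg hi (by rw [hw]; decide)).1
    change V.wood.xcol (V.wood.rev _) = _
    rw [wood_rev]
    rcases eq_or_lt_of_le h2 with rfl | h2
    · have := V.wood.xcol_dartX
      rwa [wood_dartX] at this
    · rw [V.xcol_dart h0 h2, Bool.not_true, col_false h0 h2 hw]
  · have h0 := (V.isPos_rg hi (by rw [hw]; decide)).1
    have h3 : i ≠ M := by rintro rfl; rw [V.finish] at hw; cases hw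
    change V.wood.xcol _ = _
    rw [V.xcol_dart h0 (by omega), col_true h0 (by omega) (by rw [hw]; decide), hw]

/-- Each step of the walk stays on one triangle: that of `i + 1` if this letter is r or g, and that
of the letter after the matched r if it is b. In the last case the reversed dart of that r is the
outgoing red edge which announces the b. -/
lemma wood_step {i : ℤ} (h1 : -1 ≤ i) (h2 : i < M) :
    V.wood.Step (dart M i true) (dart M (i + 1) true) := by
  have hl := V.wood_letter h1 h2.le
  have e : i + 1 - 1 = i := by ring
  by_cases hr : w i = .r
  · left
    rw [hr] at hl
    refine ⟨hl, ?_⟩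
    have h0 : w (i + 1) ≠ .b := V.not_rb i h1 h2 hr
    have h3 := V.face_third (j := i + 1) (by omega) (by omega) h0
    rw [third, e, if_pos hr] at h3
    rw [wood_rot, rev_dart, Bool.not_true, h3]
  · right
    have hd : ∃ d, ((V.wood.Out .g (dart M i true) ∧ d = V.wood.rot (dart M i true)) ∨
        (V.wood.Out .b (dart M i true) ∧ d = V.wood.rot (V.wood.rev (dart M i true)))) ∧
        d = V.face (dart M i (decide (w i ≠ .g))) := by
      rcases hw : w i with _ | _ | _ <;> rw [hw] at hl
      · exact ⟨_, Or.inr ⟨hl, rfl⟩, by rw [wood_rot, wood_rev, rev_dart]; rfl⟩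
      · exact absurd hw hr
      · exact ⟨_, Or.inl ⟨hl, rfl⟩, by rw [wood_rot, rev_dart]; rfl⟩
    obtain ⟨d, hd, hd'⟩ := hd
    refine ⟨d, hd, ?_⟩
    by_cases hb : w (i + 1) = .b
    · right
      have hM : i + 1 ≠ M := by intro h; rw [h, V.finish] at hb; cases hb
      obtain ⟨m, h3, h4, h5, h6, h7, h8⟩ := V.exists_dn_eq (k := i + 1) (by omega) (by omega) hb
      rw [e] at h7
      have h9 : d = dart M m false := by
        rw [hd', ← h7, V.face_second (by omega) (by omega) h8, third, if_pos, add_sub_cancel_right]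
        rwa [add_sub_cancel_right]
      have hp : IsPos M (i + 1) := isPos_of (by omega) (by omega)
      refine ⟨?_, V.wood_out_b hp hb, ?_⟩
      · rw [h9, WoodedTriangulation.Out, V.xcol_dart h3 h4, col_false h3 h4 h5]
      · refine (V.plane_src_eq_iff _ _).2 ?_
        rw [h9, src_true_b hp hb, src_false_rg (isPos_of h3 h4.le) (by rw [h5]; decide), h6.eq]
    · left
      have h3 : second w M (i + 1) = dart M i (decide (w i ≠ .g)) := by
        unfold second leftPos
        rw [e, if_neg hr]
      rw [← h3, V.face_second (by omega) (by omega) hb] at hd'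
      constructor
      · have h4 : d = dart M (vtx w (i + 1)) false := by rw [hd', third, e, if_neg hr]
        have h5 := V.vtx_spec (j := i + 1) (by omega) (by omega)
        rw [WoodedTriangulation.In, h4, wood_rev]
        exact V.wood_out_b (V.isPos_vtx (by omega) (by omega)) h5.2.1
      · rw [wood_rot, show V.wood.rev d = Dart.rev M d from rfl, Dart.rev_rev, hd',
          V.face_third (by omega) (by omega) hb]

/-- The word of the model. -/
lemma wood_coding : V.wood.Coding w M (fun i => dart M i true) where
  nonneg := V.nonneg
  start := (V.wood_rev (-1) false).symm
  finish := by rw [wood_dartX, wood_rev]; rfl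
  last := V.wood_dartY.symm
  step _ h1 h2 := V.wood_step h1 h2
  letter _ h1 h2 := V.wood_letter h1 h2

end Valid

/-! ### Transport to another set of darts -/

namespace WoodedTriangulation

section Map

variable {D D' : Type} (e : D ≃ D')

lemma sameCycle_permCongr {p : Equiv.Perm D} {a b : D} :
    (e.permCongr p).SameCycle (e a) (e b) ↔ p.SameCycle a b := by
  have h : ∀ k : ℤ, ((e.permCongr p) ^ k) (e a) = e ((p ^ k) a) := by
    intro k
    have : (e.permCongr p) ^ k = e.permCongr (p ^ k) := (map_zpow e.permCongrHom p k).symm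
    rw [this]; simp
  simp only [Equiv.Perm.SameCycle, h, e.apply_eq_iff_eq]

lemma card_cycles_permCongr (p : Equiv.Perm D) :
    Nat.card (Cycles (e.permCongr p)) = Nat.card (Cycles p) := by
  refine card_cycles _ (fun d => (Quotient.mk _ (e.symm d) : Cycles p)) ?_ ?_
  · rintro ⟨d⟩
    exact ⟨e d, by simp; rfl⟩
  · intro d d'
    obtain ⟨d, rfl⟩ := e.surjective d
    obtain ⟨d', rfl⟩ := e.surjective d'
    rw [sameCycle_permCongr, e.symm_apply_apply, e.symm_apply_apply]
    exact (Quotient.eq (r := Equiv.Perm.SameCycle.setoid p)).symm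

/-- Transport of a triangulation. -/
def mapPlane (S : PlaneTriangulation D) : PlaneTriangulation D' where
  rot := e.permCongr S.rot
  rev := e.permCongr S.rev
  root := e S.root
  rev_rev d := by simp [S.rev_rev]
  rev_ne d h := S.rev_ne (e.symm d) (by simpa [Equiv.eq_symm_apply] using h)
  connected d d' := by
    obtain ⟨p, hp, h⟩ := S.connected (e.symm d) (e.symm d')
    refine ⟨e.permCongrHom p, ?_, by simp [h]⟩
    have := Subgroup.mem_map_of_mem e.permCongrHom.toMonoidHom hp
    rw [MonoidHom.map_closure, Set.image_pair] at this
    exact this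
  planar := by
    have : e.permCongr S.rot * e.permCongr S.rev = e.permCongr (S.rot * S.rev) :=
      (map_mul e.permCongrHom _ _).symm
    rw [this, card_cycles_permCongr, card_cycles_permCongr, card_cycles_permCongr]
    exact S.planar
  face_three d := by
    have : e.permCongr S.rot * e.permCongr S.rev = e.permCongr (S.rot * S.rev) :=
      (map_mul e.permCongrHom _ _).symm
    have h3 : (e.permCongr (S.rot * S.rev)) ^ 3 = e.permCongr ((S.rot * S.rev) ^ 3) :=
      (map_pow e.permCongrHom _ _).symm
    obtain ⟨h1, h2⟩ := S.face_three (e.symm d)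
    rw [this, h3]
    refine ⟨fun h => h1 ?_, ?_⟩
    · rw [Equiv.permCongr_apply, ← Equiv.eq_symm_apply] at h
      exact h
    · rw [Equiv.permCongr_apply, h2, e.apply_symm_apply]
  no_loop d h := by
    obtain ⟨d, rfl⟩ := e.surjective d
    rw [Equiv.permCongr_apply, e.symm_apply_apply, sameCycle_permCongr] at h
    exact S.no_loop d h
  no_multi d d' h h' := by
    obtain ⟨d, rfl⟩ := e.surjective d
    obtain ⟨d', rfl⟩ := e.surjective d'
    simp only [Equiv.permCongr_apply, e.symm_apply_apply, sameCycle_permCongr] at h h'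
    rw [S.no_multi d d' h h']

lemma mapPlane_src_iff (S : PlaneTriangulation D) (d d' : D) :
    (mapPlane e S).src (e d) = (mapPlane e S).src (e d') ↔ S.src d = S.src d' :=
  (Quotient.eq (r := Equiv.Perm.SameCycle.setoid (mapPlane e S).rot)).trans
    ((sameCycle_permCongr e).trans (Quotient.eq (r := Equiv.Perm.SameCycle.setoid S.rot)).symm)

lemma mapPlane_face (S : PlaneTriangulation D) : (mapPlane e S).face = e.permCongr S.face :=
  (map_mul e.permCongrHom _ _).symm

lemma mapPlane_isOuter_iff (S : PlaneTriangulation D) (d : D) :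
    (mapPlane e S).IsOuter (e d) ↔ S.IsOuter d := by
  unfold PlaneTriangulation.IsOuter
  have : (mapPlane e S).rev (e d) = e (S.rev d) := by
    change e.permCongr S.rev (e d) = _; simp
  rw [this, mapPlane_face]
  exact or_congr (sameCycle_permCongr e) (sameCycle_permCongr e)

lemma mapPlane_outerVertex_iff (S : PlaneTriangulation D) (d : D) (c : Color) :
    (mapPlane e S).src (e d) = (mapPlane e S).outerVertex c ↔ S.src d = S.outerVertex c := by
  have h : ∀ d, (mapPlane e S).face (e d) = e (S.face d) := fun d => by rw [mapPlane_face]; simp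
  have h0 : (mapPlane e S).root = e S.root := rfl
  cases c <;> simp only [PlaneTriangulation.outerVertex, h0, h, mapPlane_src_iff]

lemma mapPlane_isInner_iff (S : PlaneTriangulation D) (d : D) :
    (mapPlane e S).IsInner ((mapPlane e S).src (e d)) ↔ S.IsInner (S.src d) := by
  simp only [PlaneTriangulation.IsInner, ne_eq, mapPlane_outerVertex_iff]

/-- Transport of a wooded triangulation. -/
def map (S : WoodedTriangulation D) : WoodedTriangulation D' where
  toPlaneTriangulation := mapPlane e S.toPlaneTriangulation
  col d := S.col (e.symm d)
  col_outer d h := by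
    obtain ⟨d, rfl⟩ := e.surjective d
    rw [e.symm_apply_apply]
    exact S.col_outer d ((mapPlane_isOuter_iff e _ d).1 h)
  col_inner d h := by
    obtain ⟨d, rfl⟩ := e.surjective d
    have : e.symm ((mapPlane e S.toPlaneTriangulation).rev (e d)) = S.rev d := by
      change e.symm (e.permCongr S.rev (e d)) = _; simp
    rw [e.symm_apply_apply, this]
    exact S.col_inner d fun h' => h ((mapPlane_isOuter_iff e _ d).2 h')
  col_out v hv c := by
    obtain ⟨d, rfl⟩ := Quotient.exists_rep v
    obtain ⟨d, rfl⟩ := e.surjective d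
    obtain ⟨f, hf, hf'⟩ := S.col_out _ ((mapPlane_isInner_iff e _ d).1 hv) c
    refine ⟨e f, ⟨(mapPlane_src_iff e _ _ _).2 hf.1, by rw [e.symm_apply_apply]; exact hf.2⟩, ?_⟩
    rintro g ⟨hg, hg'⟩
    obtain ⟨g, rfl⟩ := e.surjective g
    rw [e.symm_apply_apply] at hg'
    rw [hf' g ⟨(mapPlane_src_iff e _ _ _).1 hg, hg'⟩]
  schnyder d hd c := by
    obtain ⟨d, rfl⟩ := e.surjective d
    have h1 : ∀ d, (mapPlane e S.toPlaneTriangulation).rev (e d) = e (S.rev d) := fun d => by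
      change e.permCongr S.rev (e d) = _; simp
    have h2 : ∀ d, (mapPlane e S.toPlaneTriangulation).rot (e d) = e (S.rot d) := fun d => by
      change e.permCongr S.rot (e d) = _; simp
    simp only [h2, h1, e.symm_apply_apply]
    exact S.schnyder d ((mapPlane_isInner_iff e _ d).1 hd) c
  col_outerVertex c d h ho := by
    obtain ⟨d, rfl⟩ := e.surjective d
    have : e.symm ((mapPlane e S.toPlaneTriangulation).rev (e d)) = S.rev d := by
      change e.symm (e.permCongr S.rev (e d)) = _; simp
    rw [this]
    exact S.col_outerVertex c d ((mapPlane_outerVertex_iff e _ d c).1 h)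
      fun h' => ho ((mapPlane_isOuter_iff e _ d).2 h')

lemma isIso_map (S : WoodedTriangulation D) : S.IsIso (S.map e) e where
  rot d := by change _ = e.permCongr S.rot (e d); simp
  rev d := by change _ = e.permCongr S.rev (e d); simp
  root := rfl
  col d := by change _ = S.col (e.symm (e d)); simp

lemma size_map [Finite D] [Finite D'] (S : WoodedTriangulation D) : (S.map e).size = S.size := by
  have h1 := (S.map e).size_add_three
  have h2 := S.size_add_three
  have h3 : Nat.card (S.map e).Vertex = Nat.card S.Vertex := card_cycles_permCongr e S.rot
  omega

end Map

end WoodedTriangulation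

/-! ### Finite words -/

/-- The word `l`, framed by the letters of the outer edges and of the outer vertices. -/
def toWord (l : List Color) (i : ℤ) : Color :=
  if i < 0 then .b else if h : i.toNat < l.length then l[i.toNat]
  else if i = l.length then .r else if i = l.length + 1 then .g else .b

lemma toWord_start (l : List Color) : toWord l (-1) = .b := by simp [toWord]

lemma toWord_finish (l : List Color) : toWord l l.length = .r := by simp [toWord]

lemma toWord_apply (l : List Color) {i : ℕ} (h : i < l.length) : toWord l i = l[i] := by
  simp [toWord, h]

lemma framed_toWord (l : List Color) : WoodedTriangulation.Framed (toWord l) l.length := by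
  constructor
  · simp [toWord]; omega
  · simp [toWord]; omega
  · simp [toWord]; omega

/-- The words of the wooded triangulations of size `n`. -/
def words (n : ℕ) : Set (List Color) := {l | l.length = 3 * n ∧ Valid (toWord l) l.length}

lemma words_finite (n : ℕ) : (words n).Finite :=
  (List.finite_length_eq Color (3 * n)).subset fun _ h => h.1

namespace LabelledWood

open WoodedTriangulation

variable {n : ℕ}

/-- The triangulation `S` has the word `l`. -/
def Coded (S : WoodedTriangulation (Fin (6 * n + 6))) (l : List Color) : Prop :=
  ∃ P, S.Coding (toWord l) l.length P

/-- The size of the triangulation is not used: the model has `2 * (M + 3)` darts, so having `6 * n +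
6` darts forces `3 * n` letters. -/
lemma exists_coded (S : WoodedTriangulation (Fin (6 * n + 6))) : ∃ l ∈ words n, Coded S l := by
  obtain ⟨w, M, P, C⟩ := S.exists_coding
  have hM := C.nonneg
  set l : List Color := List.ofFn fun i : Fin M.toNat => w i with hl
  have hlen : (l.length : ℤ) = M := by rw [hl, List.length_ofFn]; omega
  have C' : S.Coding (toWord l) l.length P := by
    rw [hlen]
    refine C.congr fun i h1 h2 => ?_
    rcases eq_or_lt_of_le h1 with rfl | h1
    · rw [toWord_start, C.letter_start]
    rcases eq_or_lt_of_le h2 with rfl | h2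
    · rw [← hlen, toWord_finish, hlen, C.letter_finish]
    · lift i to ℕ using by omega
      have : i < l.length := by omega
      rw [toWord_apply l this]
      simp [hl]
  refine ⟨l, ⟨?_, C'.valid (framed_toWord l)⟩, P, C'⟩
  have h1 := card_dart (M := l.length) (by omega)
  obtain ⟨e, -⟩ := C'.exists_isIso (framed_toWord l) (C'.valid (framed_toWord l))
  rw [Nat.card_congr e, Nat.card_eq_fintype_card, Fintype.card_fin] at h1
  push_cast at h1
  omega

lemma Coded.unique {S : WoodedTriangulation (Fin (6 * n + 6))} {l l' : List Color}
    (h : Coded S l) (h' : Coded S l') : l = l' := by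
  obtain ⟨P, C⟩ := h
  obtain ⟨P', C'⟩ := h'
  obtain ⟨h1, h2⟩ := C.unique C'
  have h1 : l.length = l'.length := by exact_mod_cast h1
  refine List.ext_getElem h1 fun i h3 h4 => ?_
  rw [← toWord_apply l h3, ← toWord_apply l' h4]
  exact h2 i (by omega) (by omega)

lemma Coded.isomorphic {S S' : WoodedTriangulation (Fin (6 * n + 6))} {l : List Color}
    (h : Coded S l) (h' : Coded S' l) : S.Isomorphic S' := by
  obtain ⟨P, C⟩ := h
  obtain ⟨P', C'⟩ := h'
  have F := framed_toWord l
  obtain ⟨e, he, -⟩ := C.exists_isIso F (C.valid F)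
  obtain ⟨e', he', -⟩ := C'.exists_isIso F (C.valid F)
  obtain ⟨h1, h2, h3, h4⟩ := he.symm.trans he'
  exact ⟨_, h1, h2, h3, h4⟩

lemma Coded.of_isomorphic {S S' : WoodedTriangulation (Fin (6 * n + 6))} {l : List Color}
    (h : Coded S l) (hS : S.Isomorphic S') : Coded S' l := by
  obtain ⟨P, C⟩ := h
  obtain ⟨e, h1, h2, h3, h4⟩ := hS
  exact ⟨_, IsIso.coding ⟨h1, h2, h3, h4⟩ C⟩

lemma exists_of_word {l : List Color} (hl : l ∈ words n) :
    ∃ S : LabelledWood n, Coded S.1 l := by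
  obtain ⟨h1, V⟩ := hl
  have h2 := card_dart V.nonneg
  have h3 : Nat.card (Dart l.length) = Nat.card (Fin (6 * n + 6)) := by
    rw [Nat.card_eq_fintype_card (α := Fin (6 * n + 6)), Fintype.card_fin]
    omega
  obtain ⟨e⟩ := (Finite.card_eq).1 h3
  refine ⟨⟨V.wood.map e, ?_⟩, _, (isIso_map e V.wood).coding V.wood_coding⟩
  have h4 := V.size_wood
  rw [size_map]
  omega

end LabelledWood

open LabelledWood in
/-- Wooded triangulations correspond to words. -/
lemma exists_code (n : ℕ) : ∃ code : Wood n → words n, Function.Bijective code ∧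
    ∀ s : Wood n, Coded s.out.1 (code s).1 := by
  choose f hf hf' using fun s : Wood n => exists_coded s.out.1
  refine ⟨fun s => ⟨f s, hf s⟩, ⟨fun s s' h => ?_, fun l => ?_⟩, hf'⟩
  · rw [Subtype.mk.injEq] at h
    rw [← Quotient.out_eq s, ← Quotient.out_eq s']
    exact Quotient.sound ((hf' s).isomorphic (h ▸ hf' s'))
  · obtain ⟨S, hS⟩ := exists_of_word l.2
    refine ⟨⟦S⟧, Subtype.ext ?_⟩
    exact (hf' ⟦S⟧).unique (hS.of_isomorphic (Setoid.symm (Quotient.mk_out S)))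

end SchnyderWood
namespace SchnyderWood

/-! ### Balls of rooted graphs -/

namespace RootedGraph

/-- There is an edge between `u` and `v`. -/
def Linked (G : RootedGraph) (u v : G.V) : Prop :=
  (∃ c, G.arc c u v) ∨ (∃ c, G.arc c v u) ∨ G.plain u v

variable {G H : RootedGraph} {k : ℕ} {u v : G.V}

lemma Linked.edist_le (h : G.Linked u v) : G.toSimpleGraph.edist u v ≤ 1 := by
  rw [SimpleGraph.edist_le_one_iff_adj_or_eq]
  by_cases huv : u = v
  · exact Or.inr huv
  · left
    rw [toSimpleGraph, SimpleGraph.fromRel_adj]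
    refine ⟨huv, ?_⟩
    rcases h with h | h | h
    · exact Or.inl (Or.inl h)
    · exact Or.inr (Or.inl h)
    · exact Or.inl (Or.inr h)

lemma linked_of_adj (h : G.toSimpleGraph.Adj u v) : G.Linked u v := by
  rw [toSimpleGraph, SimpleGraph.fromRel_adj] at h
  rcases h.2 with (h | h) | (h | h)
  · exact Or.inl h
  · exact Or.inr (Or.inr h)
  · exact Or.inr (Or.inl h)
  · exact Or.inr (Or.inr (G.plain_symm _ _ h))

lemma exists_linked {a : G.V} (h : G.toSimpleGraph.edist a v ≤ (k + 1 : ℕ)) :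
    G.toSimpleGraph.edist a v ≤ k ∨ ∃ u, G.toSimpleGraph.edist a u ≤ k ∧ G.Linked u v := by
  rw [SimpleGraph.edist_comm] at h
  obtain ⟨p, hp⟩ := SimpleGraph.exists_walk_of_edist_ne_top (G := G.toSimpleGraph) (u := v) (v := a)
    (fun h' => by rw [h'] at h; exact absurd h (by simp))
  rw [← hp] at h
  cases p with
  | nil => left; simp
  | cons hadj q =>
    right
    refine ⟨_, ?_, linked_of_adj hadj.symm⟩
    rw [SimpleGraph.edist_comm]
    refine (SimpleGraph.edist_le q).trans ?_
    have h' : (q.length + 1 : ℕ) ≤ k + 1 := by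
      rw [SimpleGraph.Walk.length_cons] at h
      exact_mod_cast h
    exact_mod_cast (show q.length ≤ k by omega)

lemma mem_ballSet_zero : v ∈ G.ballSet 0 ↔ v = G.rootTail ∨ v = G.rootHead := by
  change (_ ≤ ((0 : ℕ) : ℕ∞) ∨ _ ≤ ((0 : ℕ) : ℕ∞)) ↔ _
  rw [Nat.cast_zero, nonpos_iff_eq_zero, nonpos_iff_eq_zero, SimpleGraph.edist_eq_zero_iff,
    SimpleGraph.edist_eq_zero_iff, eq_comm, eq_comm (a := G.rootHead)]

lemma mem_ballSet_succ : v ∈ G.ballSet (k + 1) ↔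
    v ∈ G.ballSet k ∨ ∃ u ∈ G.ballSet k, G.Linked u v := by
  constructor
  · rintro (h | h)
    · rcases exists_linked h with h | ⟨u, h, h'⟩
      · exact Or.inl (Or.inl h)
      · exact Or.inr ⟨u, Or.inl h, h'⟩
    · rcases exists_linked h with h | ⟨u, h, h'⟩
      · exact Or.inl (Or.inr h)
      · exact Or.inr ⟨u, Or.inr h, h'⟩
  · have hk : ((k : ℕ) : ℕ∞) ≤ ((k + 1 : ℕ) : ℕ∞) := by exact_mod_cast k.le_succ
    rintro ((h | h) | ⟨u, h | h, h'⟩)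
    · exact Or.inl (h.trans hk)
    · exact Or.inr (h.trans hk)
    · left
      refine SimpleGraph.edist_triangle.trans ((add_le_add h h'.edist_le).trans ?_)
      push_cast; rfl
    · right
      refine SimpleGraph.edist_triangle.trans ((add_le_add h h'.edist_le).trans ?_)
      push_cast; rfl

lemma ballSet_mono {j : ℕ} (h : j ≤ k) : G.ballSet j ⊆ G.ballSet k := by
  induction h with
  | refl => exact subset_rfl
  | step _ ih => exact ih.trans fun v hv => mem_ballSet_succ.2 (Or.inl hv)

/-- A map that respects the edges at the vertices of a ball is an isomorphism between balls. -/
lemma ball_isomorphic (f : G.V → H.V) (ht : f G.rootTail = H.rootTail)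
    (hh : f G.rootHead = H.rootHead) (hc : G.rootColor = H.rootColor)
    (hout : ∀ v ∈ G.ballSet k, ∀ c y, H.arc c (f v) y ↔ ∃ u, G.arc c v u ∧ f u = y)
    (hin : ∀ v ∈ G.ballSet k, ∀ c y, H.arc c y (f v) ↔ ∃ u, G.arc c u v ∧ f u = y)
    (hp : ∀ v u, ¬ G.plain v u) (hp' : ∀ v ∈ G.ballSet k, ∀ y, ¬ H.plain (f v) y)
    (N : Set G.V) (hN : Set.InjOn f N) (hk : G.ballSet k ⊆ N)
    (hN' : ∀ v ∈ G.ballSet k, ∀ c u, G.arc c v u → u ∈ N) :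
    (G.ball k).Isomorphic (H.ball k) := by
  -- Balls grow along edges at vertices already reached, and these are matched in both directions,
  -- so `f` maps balls onto balls before injectivity plays any role.
  have hball : ∀ j ≤ k, f '' G.ballSet j = H.ballSet j := by
    intro j
    induction j with
    | zero =>
      intro _
      ext y
      simp only [Set.mem_image, mem_ballSet_zero, ← ht, ← hh]
      constructor
      · rintro ⟨v, rfl | rfl, rfl⟩ <;> simp
      · rintro (rfl | rfl)
        · exact ⟨_, Or.inl rfl, rfl⟩
        · exact ⟨_, Or.inr rfl, rfl⟩
    | succ j ih =>
      intro hj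
      have ih := ih (by omega)
      ext y
      rw [mem_ballSet_succ, ← ih]
      constructor
      · rintro ⟨v, hv, rfl⟩
        rcases mem_ballSet_succ.1 hv with hv | ⟨u, hu, h | h | h⟩
        · exact Or.inl ⟨v, hv, rfl⟩
        · obtain ⟨c, h⟩ := h
          exact Or.inr ⟨f u, ⟨u, hu, rfl⟩,
            Or.inl ⟨c, (hout u (ballSet_mono (by omega) hu) c (f v)).2 ⟨v, h, rfl⟩⟩⟩
        · obtain ⟨c, h⟩ := h
          exact Or.inr ⟨f u, ⟨u, hu, rfl⟩,
            Or.inr (Or.inl ⟨c, (hin u (ballSet_mono (by omega) hu) c (f v)).2 ⟨v, h, rfl⟩⟩)⟩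
        · exact absurd h (hp _ _)
      · rintro (⟨v, hv, rfl⟩ | ⟨_, ⟨u, hu, rfl⟩, h | h | h⟩)
        · exact ⟨v, mem_ballSet_succ.2 (Or.inl hv), rfl⟩
        · obtain ⟨c, h⟩ := h
          obtain ⟨v, h', rfl⟩ := (hout u (ballSet_mono (by omega) hu) c _).1 h
          exact ⟨v, mem_ballSet_succ.2 (Or.inr ⟨u, hu, Or.inl ⟨c, h'⟩⟩), rfl⟩
        · obtain ⟨c, h⟩ := h
          obtain ⟨v, h', rfl⟩ := (hin u (ballSet_mono (by omega) hu) c _).1 h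
          exact ⟨v, mem_ballSet_succ.2 (Or.inr ⟨u, hu, Or.inr (Or.inl ⟨c, h'⟩)⟩), rfl⟩
        · exact absurd h (hp' u (ballSet_mono (by omega) hu) _)
  have hmem : ∀ v : G.ballSet k, f v ∈ H.ballSet k := fun v => by
    rw [← hball k le_rfl]; exact ⟨v, v.2, rfl⟩
  let e : G.ballSet k ≃ H.ballSet k := Equiv.ofBijective (fun v => ⟨f v, hmem v⟩) ⟨fun u v h =>
    Subtype.ext (hN (hk u.2) (hk v.2) (congrArg Subtype.val h)), fun y => by
      obtain ⟨v, hv, h⟩ := (hball k le_rfl).ge y.2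
      exact ⟨⟨v, hv⟩, Subtype.ext h⟩⟩
  refine ⟨e, fun c u v => ?_, fun u v => ?_, Subtype.ext ht, Subtype.ext hh, hc⟩
  · change G.arc c u.1 v.1 ↔ H.arc c (f u.1) (f v.1)
    rw [hout u.1 u.2]
    constructor
    · exact fun h => ⟨v.1, h, rfl⟩
    · rintro ⟨x, h, hx⟩
      rwa [← hN (hN' u.1 u.2 c x h) (hk v.2) hx]
  · change G.plain u.1 v.1 ↔ H.plain (f u.1) (f v.1)
    exact ⟨fun h => absurd h (hp _ _), fun h => absurd h (hp' u.1 u.2 _)⟩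

end RootedGraph

/-! ### Shifts of words -/

section Shift

variable {x y : Color} {w : ℤ → Color} {s i j k t h : ℤ}

lemma excess_shift (x y : Color) (w : ℤ → Color) (s j m : ℤ) :
    excess x y (fun a => w (s + a)) j m = excess x y w (s + j) (s + m) := by
  unfold excess
  rw [← Finset.image_add_left_Ioc, Finset.sum_image (fun a _ b _ h => by simpa using h)]

lemma bal_shift : Bal x y (fun a => w (s + a)) j k ↔ Bal x y w (s + j) (s + k) := by
  unfold Bal
  simp only [excess_shift]
  rw [add_sub_assoc]
  refine and_congr (by omega) (and_congr ⟨fun H m h1 h2 => ?_, fun H m h1 h2 => ?_⟩ Iff.rfl)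
  · have := H (m - s) (by omega) (by omega)
    rwa [add_sub_cancel] at this
  · exact H _ (by omega) (by omega)

lemma up_shift : Up (fun a => w (s + a)) i k ↔ Up w (s + i) (s + k) := and_congr bal_shift Iff.rfl

lemma dn_shift : Dn (fun a => w (s + a)) i k ↔ Dn w (s + i) (s + k) := and_congr bal_shift Iff.rfl

lemma nextG_shift : NextG (fun a => w (s + a)) i k ↔ NextG w (s + i) (s + k) := by
  unfold NextG
  refine and_congr (by omega) (and_congr Iff.rfl ⟨fun H m h1 h2 => ?_, fun H m h1 h2 => ?_⟩)
  · have := H (m - s) (by omega) (by omega)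
    dsimp only at this
    rwa [add_sub_cancel] at this
  · exact H _ (by omega) (by omega)

lemma vtx_shift : Vtx (fun a => w (s + a)) i k ↔ Vtx w (s + i) (s + k) := by
  unfold Vtx
  constructor
  · rintro ⟨j, h1, h2⟩
    exact ⟨s + j, nextG_shift.1 h1, up_shift.1 h2⟩
  · rintro ⟨j, h1, h2⟩
    have e : j = s + (j - s) := by ring
    rw [e] at h1 h2
    exact ⟨j - s, nextG_shift.2 h1, up_shift.2 h2⟩

lemma edgeAt_shift : EdgeAt (fun a => w (s + a)) i t h ↔ EdgeAt w (s + i) (s + t) (s + h) := by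
  rcases hw : w (s + i) with _ | _ | _
  · rw [edgeAt_b hw, edgeAt_b (by exact hw), up_shift]
    exact and_congr (by omega) Iff.rfl
  · rw [edgeAt_r hw, edgeAt_r (by exact hw), dn_shift, vtx_shift]
  · rw [edgeAt_g hw, edgeAt_g (by exact hw), dn_shift, up_shift]

end Shift

/-! ### The graph of a finite word -/

namespace WoodedTriangulation.Coding

variable {D : Type} {S : WoodedTriangulation D} {w : ℤ → Color} {M : ℤ} {P : ℤ → D}

/-- The link between the finite and the infinite objects: inner edges of the model obey the rule
`EdgeAt`, which is also the rule for edges of a `Nice` word. -/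
lemma _root_.SchnyderWood.Valid.edgeAt (V : Valid w M) {i : ℤ} (h1 : 0 ≤ i) (h2 : i < M) :
    EdgeAt w i (Dart.src w (dart M i (fwd (w i)))) (Dart.src w (dart M i (!fwd (w i)))) := by
  have hi := Valid.isPos_of h1 h2.le
  rcases hw : w i with _ | _ | _
  · rw [edgeAt_b hw]
    refine ⟨src_true_b hi hw, ?_⟩
    rw [show (!fwd Color.b) = false from rfl, src_false_b hi hw]
    exact (V.up_lt_of_isPos hi).1
  · have hw' : w i ≠ .b := by rw [hw]; decide
    rw [edgeAt_r hw, show (!fwd Color.r) = true from rfl, show fwd Color.r = false from rfl,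
      src_true_rg hi hw', src_false_rg hi hw']
    exact ⟨(V.dn_spec h1 h2.le).1, (V.vtx_spec h1 h2.le).1⟩
  · have hw' : w i ≠ .b := by rw [hw]; decide
    rw [edgeAt_g hw, show (!fwd Color.g) = false from rfl, show fwd Color.g = true from rfl,
      src_true_rg hi hw', src_false_rg hi hw', vtx_of_g hw]
    exact ⟨(V.up_lt_of_isPos hi).1, (V.dn_spec h1 h2.le).1⟩

/-- The vertex of the triangulation at a position of the word. -/
noncomputable def vertex (S : WoodedTriangulation D) (M : ℤ) (P : ℤ → D) (k : ℤ) : S.Vertex :=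
  S.src (S.dartOf P (Valid.vertexDart M k))

/-- The edge of a letter. -/
noncomputable def edge (S : WoodedTriangulation D) (w : ℤ → Color) (P : ℤ → D) (i : ℤ) : D :=
  if fwd (w i) then P i else S.rev (P i)

lemma edge_eq {i : ℤ} (hi : IsPos M i) : edge S w P i = S.dartOf P (dart M i (fwd (w i))) := by
  simp [edge, dartOf, dart_val hi]

variable (C : S.Coding w M P) (F : Framed w M)
include C F

lemma src_dartOf_iff (d d' : Dart M) :
    S.src (S.dartOf P d) = S.src (S.dartOf P d') ↔ Dart.src w d = Dart.src w d' := by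
  have V := C.valid F
  obtain ⟨e, he, he'⟩ := C.exists_isIso F V
  rw [← V.plane_src_eq_iff, ← he', ← he']
  refine ⟨fun h => ?_, fun h => he.src h⟩
  have := he.symm.src h
  rwa [e.symm_apply_apply, e.symm_apply_apply] at this

lemma src_dartOf (d : Dart M) : S.src (S.dartOf P d) = vertex S M P (Dart.src w d) := by
  rw [vertex, C.src_dartOf_iff F, (C.valid F).src_vertexDart ((C.valid F).isVert_src d)]

lemma vertex_inj {j k : ℤ} (hj : Valid.IsVert w M j) (hk : Valid.IsVert w M k)
    (h : vertex S M P j = vertex S M P k) : j = k := by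
  rwa [vertex, vertex, C.src_dartOf_iff F, (C.valid F).src_vertexDart hj,
    (C.valid F).src_vertexDart hk] at h

lemma edge_spec {i t h : ℤ} (h1 : 0 ≤ i) (h2 : i < M) (H : EdgeAt w i t h) :
    S.col (edge S w P i) = some (w i) ∧ S.src (edge S w P i) = vertex S M P t ∧
      S.tgt (edge S w P i) = vertex S M P h := by
  have hi := Valid.isPos_of h1 h2.le
  obtain ⟨rfl, rfl⟩ := H.unique ((C.valid F).edgeAt h1 h2)
  rw [edge_eq hi, ← C.col_dartOf F, Valid.col_dart h1 h2, C.src_dartOf F, tgt_eq, ← dartOf_rev,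
    rev_dart, C.src_dartOf F]
  exact ⟨rfl, rfl, rfl⟩

/-- Every inner edge is the edge of a letter. -/
lemma exists_edge {d : D} {c : Color} (h : S.col d = some c) :
    ∃ i, 0 ≤ i ∧ i < M ∧ w i = c ∧ d = edge S w P i := by
  obtain ⟨x, rfl⟩ := C.dartOf_surjective F d
  rw [← C.col_dartOf F, ← dart_eta x, Valid.col_eq_some x.2] at h
  obtain ⟨h1, h2, h3, h4⟩ := h
  refine ⟨x.1.1, h1, h2, h3, ?_⟩
  rw [edge_eq x.2, h3, ← h4, dart_eta]

lemma edge_inj {i j : ℤ} (hi : 0 ≤ i) (hi' : i < M) (hj : 0 ≤ j) (hj' : j < M)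
    (h : edge S w P i = edge S w P j) : i = j := by
  rw [edge_eq (Valid.isPos_of hi hi'.le), edge_eq (Valid.isPos_of hj hj'.le)] at h
  exact (Valid.dart_inj (Valid.isPos_of hi hi'.le) (Valid.isPos_of hj hj'.le)
    (C.dartOf_injective F h)).1

omit C F in
lemma isOuter_src {d : D} (h : S.IsOuter d) : ∃ c, S.src d = S.outerVertex c := by
  rw [isOuter_iff] at h
  rcases h with rfl | rfl | rfl | rfl | rfl | rfl
  · exact ⟨_, S.src_root⟩
  · exact ⟨_, S.src_dartX⟩
  · exact ⟨_, S.src_dartY⟩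
  · exact ⟨_, S.src_rev_root⟩
  · exact ⟨_, S.src_rev_dartX⟩
  · exact ⟨_, S.src_rev_dartY⟩

lemma outerVertex_eq (c : Color) : S.outerVertex c = vertex S M P (outerPos M c) := by
  have V := C.valid F
  cases c
  · rw [← src_root, ← C.dartOf_root F, C.src_dartOf F, src_false_b V.isPos_start V.start, V.up_start]
    rfl
  · rw [← src_dartY, ← C.last, ← dartOf_true (S := S) (P := P) (Valid.isPos_last (M := M)), C.src_dartOf F,
      src_true_b Valid.isPos_last V.b]
    rfl
  · rw [← src_rev_root, ← C.start, ← dartOf_true (S := S) (P := P) V.isPos_start, C.src_dartOf F,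
      src_true_b V.isPos_start V.start]
    rfl

/-- Uncolored edges occur only between outer vertices, so they are invisible from a letter b inside
the word. The infinite graph has no such edges at all. -/
lemma not_isOuter_src {k : ℤ} (h1 : 0 ≤ k) (h2 : k < M) (hw : w k = .b) {d : D}
    (h : S.src d = vertex S M P k) : ¬ S.IsOuter d := fun ho => by
  obtain ⟨c, hc⟩ := isOuter_src ho
  rw [h, C.outerVertex_eq F] at hc
  have := C.vertex_inj F (Or.inl ⟨h1, h2, hw⟩) (by cases c <;> simp [outerPos, Valid.IsVert]) hc
  have hM := C.nonneg
  cases c <;> simp only [outerPos] at this <;> omega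

end WoodedTriangulation.Coding

end SchnyderWood
namespace SchnyderWood

/-! ### Locality -/

/-- The edges at the vertex `v` are visible in the window from `-R` to `R`. -/
def Local (w : ℤ → Color) (R v : ℤ) : Prop :=
  ∃ p' p q, -R ≤ p' ∧ p' < p ∧ q ≤ R ∧ w p' = .g ∧ w p = .g ∧ Up w p v ∧ w q = .r ∧ Dn w q v ∧
    ∀ i, p' ≤ i → i ≤ q → ∃ t h, EdgeAt w i t h ∧ (-R ≤ t ∧ t ≤ R) ∧ (-R ≤ h ∧ h ≤ R)

lemma Local.mem {w : ℤ → Color} {R v : ℤ} (h : Local w R v) : -R ≤ v ∧ v ≤ R := by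
  obtain ⟨p', p, q, h1, h2, h3, -, -, h4, -, h5, -⟩ := h
  have := h4.lt
  have := h5.lt
  omega

lemma Local.mono {w : ℤ → Color} {R R' v : ℤ} (h : Local w R v) (hR : R ≤ R') : Local w R' v := by
  obtain ⟨p', p, q, h1, h2, h3, h4, h5, h6, h7, h8, h9⟩ := h
  refine ⟨p', p, q, by omega, h2, by omega, h4, h5, h6, h7, h8, fun i hi hi' => ?_⟩
  obtain ⟨t, h, h10, h11, h12⟩ := h9 i hi hi'
  exact ⟨t, h, h10, by omega, by omega⟩

/-- The edges at a vertex whose neighborhood is visible. -/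
lemma Local.edge {w : ℤ → Color} {R v i t h : ℤ} (hl : Local w R v) (H : EdgeAt w i t h)
    (hv : t = v ∨ h = v) : (-R ≤ i ∧ i ≤ R) ∧ (-R ≤ t ∧ t ≤ R) ∧ (-R ≤ h ∧ h ≤ R) := by
  obtain ⟨p', p, q, h1, h2, h3, h4, h5, h6, h7, h8, h9⟩ := hl
  obtain ⟨h10, h11⟩ := H.incident hv h5 h6 h7 h8 h4 h2
  obtain ⟨t', h', H', h12⟩ := h9 i h10 h11
  obtain ⟨rfl, rfl⟩ := H.unique H'
  exact ⟨by omega, h12⟩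

/-- The edges at a vertex are the same in two words with the same window. -/
lemma Local.edge_congr {w y : ℤ → Color} {R v i t h : ℤ} (hl : Local w R v)
    (hw : ∀ a, -R ≤ a → a ≤ R → w a = y a) (H : EdgeAt y i t h) (hv : t = v ∨ h = v) :
    EdgeAt w i t h := by
  have hm := hl.mem
  obtain ⟨p', p, q, h1, h2, h3, h4, h5, h6, h7, h8, h9⟩ := hl
  have := h6.lt
  have := h8.lt
  obtain ⟨h10, h11⟩ := H.incident (p := p) (q := q) (p' := p') hv (by rw [← hw _ (by omega) (by omega), h5])
    (h6.congr fun a _ _ => hw a (by omega) (by omega)) (by rw [← hw _ (by omega) (by omega), h7])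
    (h8.congr fun a _ _ => hw a (by omega) (by omega)) (by rw [← hw _ (by omega) (by omega), h4]) h2
  obtain ⟨t', h', H', h12, h13⟩ := h9 i h10 h11
  obtain ⟨rfl, rfl⟩ := H.unique (H'.congr hw (by omega) (by omega) (by omega))
  exact H'

/-- A bi-infinite word for which all edges and matches exist. -/
structure Nice (w : ℤ → Color) : Prop where
  isEdge_iff : ∀ i t h, IsEdge w i t h ↔ EdgeAt w i t h
  exists_edgeAt : ∀ i, ∃ t h, EdgeAt w i t h
  exists_up : ∀ v, w v = .b → ∃ p, w p = .g ∧ Up w p v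
  exists_dn : ∀ v, w v = .b → ∃ q, w q = .r ∧ Dn w q v
  exists_g : ∀ p, ∃ p', p' < p ∧ w p' = .g

namespace Nice

variable {w : ℤ → Color} (hw : Nice w)
include hw

lemma exists_local {v : ℤ} (hv : w v = .b) : ∃ R : ℕ, Local w R v := by
  obtain ⟨p, h1, h2⟩ := hw.exists_up v hv
  obtain ⟨q, h3, h4⟩ := hw.exists_dn v hv
  obtain ⟨p', h5, h6⟩ := hw.exists_g p
  choose t h ht using hw.exists_edgeAt
  -- A finite range of positions has bounded end points; the sum of absolute values is a crude
  -- bound.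
  have hb : ∀ f : ℤ → ℤ, ∃ R : ℕ, ∀ i, p' ≤ i → i ≤ q → -R ≤ f i ∧ f i ≤ R := fun f => by
    refine ⟨∑ i ∈ Finset.Icc p' q, (f i).natAbs, fun i h1 h2 => ?_⟩
    have := Finset.single_le_sum (f := fun i => (f i).natAbs) (fun _ _ => Nat.zero_le _)
      (Finset.mem_Icc.2 ⟨h1, h2⟩)
    omega
  obtain ⟨R1, hR1⟩ := hb t
  obtain ⟨R2, hR2⟩ := hb h
  obtain ⟨R3, hR3⟩ := hb id
  have := h2.lt
  have := h4.lt
  have e1 := hR3 p' le_rfl (by omega)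
  have e2 := hR3 q (by omega) le_rfl
  simp only [id] at e1 e2
  refine ⟨R1 + R2 + R3, p', p, q, by push_cast; omega, h5, by push_cast; omega, h6, h1, h2, h3, h4,
    fun i hi hi' => ⟨t i, h i, ht i, ?_, ?_⟩⟩
  · have := hR1 i hi hi'; push_cast; omega
  · have := hR2 i hi hi'; push_cast; omega

lemma exists_local_window (m : ℕ) :
    ∃ R : ℕ, ∀ v : ℤ, -m ≤ v → v ≤ m → w v = .b → Local w R v := by
  have : ∀ v : ℤ, ∃ R : ℕ, w v = .b → Local w R v := fun v => by
    by_cases hv : w v = .b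
    · obtain ⟨R, hR⟩ := hw.exists_local hv
      exact ⟨R, fun _ => hR⟩
    · exact ⟨0, fun h => absurd h hv⟩
  choose R hR using this
  refine ⟨∑ v ∈ Finset.Icc (-m : ℤ) m, R v, fun v h1 h2 h3 => (hR v h3).mono ?_⟩
  exact_mod_cast Finset.single_le_sum (f := R) (fun _ _ => Nat.zero_le _)
    (Finset.mem_Icc.2 ⟨h1, h2⟩)

lemma linked_iff {t h : {i // w i = .b}} {hr : IsEdge w 0 t h} {u v : {i // w i = .b}}
    (H : (infiniteGraph w t h hr).Linked u v) :
    ∃ i, EdgeAt w i u v ∨ EdgeAt w i v u := by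
  rcases H with ⟨c, i, -, h⟩ | ⟨c, i, -, h⟩ | h
  · exact ⟨i, Or.inl ((hw.isEdge_iff _ _ _).1 h)⟩
  · exact ⟨i, Or.inr ((hw.isEdge_iff _ _ _).1 h)⟩
  · exact h.elim

/-- Every ball is visible in some window. -/
lemma exists_window (t h : {i // w i = .b}) (hr : IsEdge w 0 t h) (k : ℕ) :
    ∃ R : ℕ, ∀ v ∈ (infiniteGraph w t h hr).ballSet k, Local w R v.1 := by
  induction k with
  | zero =>
    obtain ⟨R1, h1⟩ := hw.exists_local t.2
    obtain ⟨R2, h2⟩ := hw.exists_local h.2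
    refine ⟨R1 + R2, fun v hv => ?_⟩
    rcases RootedGraph.mem_ballSet_zero.1 hv with h | h
    · rw [h]; exact h1.mono (by push_cast; omega)
    · rw [h]; exact h2.mono (by push_cast; omega)
  | succ k ih =>
    obtain ⟨R, hR⟩ := ih
    obtain ⟨R', hR'⟩ := hw.exists_local_window R
    refine ⟨R', fun v hv => ?_⟩
    rcases RootedGraph.mem_ballSet_succ.1 hv with hv | ⟨u, hu, H⟩
    · have := (hR v hv).mem
      exact hR' _ this.1 this.2 v.2
    · obtain ⟨i, H | H⟩ := hw.linked_iff H
      · have := ((hR u hu).edge H (Or.inl rfl)).2.2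
        exact hR' _ this.1 this.2 v.2
      · have := ((hR u hu).edge H (Or.inr rfl)).2.1
        exact hR' _ this.1 this.2 v.2

end Nice

open WoodedTriangulation in
/-- Balls around an edge of a finite wooded triangulation agree with balls of the infinite graph of
a word that has the same window. -/
lemma ball_isomorphic_of_window {D : Type} {S : WoodedTriangulation D} {w y : ℤ → Color} {M : ℤ}
    {P : ℤ → D} (C : S.Coding y M P) (F : Framed y M) (hw : Nice w) {k R : ℕ}
    {t h : {i // w i = .b}} {hr : IsEdge w 0 t h}
    (hR : ∀ v ∈ (infiniteGraph w t h hr).ballSet k, Local w R v.1) {s : ℤ} (h1 : R ≤ s)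
    (h2 : s + R < M) (hy : ∀ a : ℤ, -R ≤ a → a ≤ R → w a = y (s + a)) (e : S.InnerEdge)
    (he : e.1 = Coding.edge S y P s) :
    ((infiniteGraph w t h hr).ball k).Isomorphic ((S.rootedGraph e).ball k) := by
  have hroot := (hw.isEdge_iff _ _ _).1 hr
  have ht : t ∈ (infiniteGraph w t h hr).ballSet k :=
    RootedGraph.ballSet_mono (Nat.zero_le k) (RootedGraph.mem_ballSet_zero.2 (Or.inl rfl))
  have hm := ((hR t ht).edge hroot (Or.inl rfl))
  have transfer : ∀ {i t h : ℤ}, EdgeAt w i t h → (-(R : ℤ) ≤ i ∧ i ≤ R) →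
      (-(R : ℤ) ≤ t ∧ t ≤ R) → (-(R : ℤ) ≤ h ∧ h ≤ R) →
      (0 ≤ s + i ∧ s + i < M) ∧ EdgeAt y (s + i) (s + t) (s + h) := by
    intro i t h H hi ht hh
    exact ⟨by omega, edgeAt_shift.1 (H.congr hy hi ht hh)⟩
  -- Edges of the finite graph at a visible vertex are edges of the infinite one. Without `Local`,
  -- an edge coming from far outside the window could be missed.
  have back : ∀ {v : {i // w i = .b}}, v ∈ (infiniteGraph w t h hr).ballSet k →
      ∀ {i t h : ℤ}, EdgeAt y i t h → (t = s + v.1 ∨ h = s + v.1) →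
      EdgeAt w (i - s) (t - s) (h - s) := by
    intro v hv i t h H hvt
    refine (hR v hv).edge_congr hy (edgeAt_shift.2 ?_) (by omega)
    simpa using H
  have hvert : ∀ {v : {i // w i = .b}}, -(R : ℤ) ≤ v.1 → v.1 ≤ R →
      Valid.IsVert y M (s + v.1) := fun {v} h3 h4 =>
    Or.inl ⟨by omega, by omega, by rw [← hy _ h3 h4]; exact v.2⟩
  refine RootedGraph.ball_isomorphic (fun v => Coding.vertex S M P (s + v.1)) ?_ ?_ ?_ ?_ ?_ ?_ ?_
    {v | -(R : ℤ) ≤ v.1 ∧ v.1 ≤ R} ?_ ?_ ?_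
  · obtain ⟨h3, h4⟩ := transfer hroot hm.1 hm.2.1 hm.2.2
    rw [add_zero] at h4
    have := (C.edge_spec F (by omega) (by omega) h4).2.1
    rw [← he] at this
    exact this.symm
  · obtain ⟨h3, h4⟩ := transfer hroot hm.1 hm.2.1 hm.2.2
    rw [add_zero] at h4
    have := (C.edge_spec F (by omega) (by omega) h4).2.2
    rw [← he] at this
    exact this.symm
  · obtain ⟨h3, h4⟩ := transfer hroot hm.1 hm.2.1 hm.2.2
    rw [add_zero] at h4
    have := (C.edge_spec F (by omega) (by omega) h4).1
    rw [← he] at this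
    change w 0 = (S.col e.1).get e.2
    simp only [this, Option.get_some]
    rw [hy 0 (by omega) (by omega), add_zero]
  · intro v hv c x
    have hvm := (hR v hv).mem
    constructor
    · rintro ⟨d, h3, h4, h5⟩
      obtain ⟨i, h6, h7, h8, rfl⟩ := C.exists_edge F h3
      have H := (C.valid F).edgeAt h6 h7
      have h9 := C.edge_spec F h6 h7 H
      have h10 := C.vertex_inj F ((C.valid F).isVert_src _) (hvert hvm.1 hvm.2) (h9.2.1.symm.trans h4)
      have h11 := back hv H (Or.inl h10)
      rw [h10, add_sub_cancel_left] at h11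
      have h12 := (hR v hv).edge h11 (Or.inl rfl)
      refine ⟨⟨_, h11.color.2⟩, ⟨i - s, ?_, (hw.isEdge_iff _ _ _).2 h11⟩, ?_⟩
      · rw [hy _ h12.1.1 h12.1.2, add_sub_cancel, h8]
      · dsimp only
        rw [add_sub_cancel, ← h5, h9.2.2]
    · rintro ⟨u, ⟨i, h3, h4⟩, rfl⟩
      have h4 := (hw.isEdge_iff _ _ _).1 h4
      have h5 := (hR v hv).edge h4 (Or.inl rfl)
      obtain ⟨h6, h7⟩ := transfer h4 h5.1 h5.2.1 h5.2.2
      have h8 := C.edge_spec F h6.1 h6.2 h7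
      exact ⟨_, by rw [h8.1, ← hy _ h5.1.1 h5.1.2, h3], h8.2⟩
  · intro v hv c x
    have hvm := (hR v hv).mem
    constructor
    · rintro ⟨d, h3, h4, h5⟩
      obtain ⟨i, h6, h7, h8, rfl⟩ := C.exists_edge F h3
      have H := (C.valid F).edgeAt h6 h7
      have h9 := C.edge_spec F h6 h7 H
      have h10 := C.vertex_inj F ((C.valid F).isVert_src _) (hvert hvm.1 hvm.2) (h9.2.2.symm.trans h5)
      have h11 := back hv H (Or.inr h10)
      rw [h10, add_sub_cancel_left] at h11
      have h12 := (hR v hv).edge h11 (Or.inr rfl)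
      refine ⟨⟨_, h11.color.1⟩, ⟨i - s, ?_, (hw.isEdge_iff _ _ _).2 h11⟩, ?_⟩
      · rw [hy _ h12.1.1 h12.1.2, add_sub_cancel, h8]
      · dsimp only
        rw [add_sub_cancel, ← h4, h9.2.1]
    · rintro ⟨u, ⟨i, h3, h4⟩, rfl⟩
      have h4 := (hw.isEdge_iff _ _ _).1 h4
      have h5 := (hR v hv).edge h4 (Or.inr rfl)
      obtain ⟨h6, h7⟩ := transfer h4 h5.1 h5.2.1 h5.2.2
      have h8 := C.edge_spec F h6.1 h6.2 h7
      exact ⟨_, by rw [h8.1, ← hy _ h5.1.1 h5.1.2, h3], h8.2⟩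
  · exact fun _ _ h => h
  · rintro v hv x ⟨d, h3, h4, -⟩
    have hvm := (hR v hv).mem
    refine C.not_isOuter_src F (k := s + v.1) (by omega) (by omega) ?_ h4 h3
    rw [← hy _ hvm.1 hvm.2]; exact v.2
  · intro u hu v hv huv
    have := C.vertex_inj F (hvert hu.1 hu.2) (hvert hv.1 hv.2) huv
    exact Subtype.ext (by omega)
  · exact fun v hv => (hR v hv).mem
  · rintro v hv c u ⟨i, -, h4⟩
    exact ((hR v hv).edge ((hw.isEdge_iff _ _ _).1 h4) (Or.inl rfl)).2.2

end SchnyderWood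
namespace SchnyderWood

/-! ### Expectations for the Markov chain -/

lemma sum_color (f : Color → ℝ) : ∑ y, f y = f .b + f .r + f .g := by
  have h4 : (Finset.univ : Finset Color) = {.b, .r, .g} := rfl
  rw [h4, Finset.sum_insert (by decide), Finset.sum_insert (by decide), Finset.sum_singleton]
  ring

lemma transition_nonneg (x y : Color) : 0 ≤ transition x y := by
  cases x <;> cases y <;> simp only [transition] <;> norm_num

lemma sum_transition (x : Color) : ∑ y, transition x y = 1 := by
  rw [sum_color]
  cases x <;> simp only [transition] <;> norm_num

/-- Expectation of a function of the next `m` letters after the letter `x`. -/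
noncomputable def Ex : ℕ → Color → (List Color → ℝ) → ℝ
  | 0, _, F => F []
  | m + 1, x, F => ∑ y, transition x y * Ex m y fun l => F (y :: l)

section Ex

variable {m k : ℕ} {x : Color} {F G : List Color → ℝ}

lemma Ex_mono (h : ∀ l, l.length = m → F l ≤ G l) : Ex m x F ≤ Ex m x G := by
  induction m generalizing x F G with
  | zero => exact h [] rfl
  | succ m ih =>
    exact Finset.sum_le_sum fun y _ => mul_le_mul_of_nonneg_left
      (ih fun l hl => h _ (by simp [hl])) (transition_nonneg _ _)

lemma Ex_congr (h : ∀ l, l.length = m → F l = G l) : Ex m x F = Ex m x G :=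
  le_antisymm (Ex_mono fun l hl => (h l hl).le) (Ex_mono fun l hl => (h l hl).ge)

lemma Ex_const (m : ℕ) (x : Color) (c : ℝ) : Ex m x (fun _ => c) = c := by
  induction m generalizing x with
  | zero => rfl
  | succ m ih => simp only [Ex, ih, ← Finset.sum_mul, sum_transition, one_mul]

lemma Ex_add (F G : List Color → ℝ) : Ex m x (fun l => F l + G l) = Ex m x F + Ex m x G := by
  induction m generalizing x F G with
  | zero => rfl
  | succ m ih => simp only [Ex, ih, mul_add, Finset.sum_add_distrib]

lemma Ex_mul (c : ℝ) (F : List Color → ℝ) : Ex m x (fun l => c * F l) = c * Ex m x F := by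
  induction m generalizing x F with
  | zero => rfl
  | succ m ih => simp only [Ex, ih, Finset.mul_sum, mul_left_comm]

lemma Ex_nonneg (h : ∀ l, l.length = m → 0 ≤ F l) : 0 ≤ Ex m x F := by
  have := Ex_mono (x := x) (F := fun _ => 0) h
  rwa [Ex_const] at this

/-- The Markov property: the second block depends on the first only through its last letter, or
through `x` if the first block is empty. -/
lemma Ex_append (m k : ℕ) (x : Color) (F : List Color → ℝ) :
    Ex (m + k) x F = Ex m x fun l => Ex k (l.getLastD x) fun l' => F (l ++ l') := by
  induction m generalizing x F with
  | zero => simp [Ex]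
  | succ m ih =>
    rw [Nat.succ_add]
    simp only [Ex, ih, List.getLastD_cons, List.cons_append]

lemma Ex_take (h : k ≤ m) : Ex m x (fun l => F (l.take k)) = Ex k x F := by
  obtain ⟨j, rfl⟩ := Nat.exists_eq_add_of_le h
  rw [Ex_append]
  refine Ex_congr fun l hl => ?_
  rw [← Ex_const j (l.getLastD x) (F l)]
  refine Ex_congr fun l' _ => ?_
  rw [List.take_left' hl]

end Ex

/-! ### Concentration of the number of occurrences of a pattern -/

open Classical in
/-- Indicator of a proposition. -/
noncomputable def ind (p : Prop) : ℝ := if p then 1 else 0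

lemma ind_nonneg (p : Prop) : 0 ≤ ind p := by unfold ind; split_ifs <;> norm_num

lemma ind_le_one (p : Prop) : ind p ≤ 1 := by unfold ind; split_ifs <;> norm_num

lemma ind_true {p : Prop} (h : p) : ind p = 1 := if_pos h

lemma ind_false {p : Prop} (h : ¬ p) : ind p = 0 := if_neg h

lemma ind_mono {p q : Prop} (h : p → q) : ind p ≤ ind q := by
  by_cases hp : p
  · rw [ind_true hp, ind_true (h hp)]
  · rw [ind_false hp]; exact ind_nonneg q

/-- Number of occurrences of patterns of length `K + 1` with the property `A`. -/
noncomputable def cnt (K : ℕ) (A : List Color → Prop) : List Color → ℝ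
  | [] => 0
  | y :: l => ind (K ≤ l.length ∧ A ((y :: l).take (K + 1))) + cnt K A l

/-- Probability of a property of `K + 1` successive letters, after the letter `x`. -/
noncomputable def condProb (K : ℕ) (A : List Color → Prop) (x : Color) : ℝ :=
  Ex (K + 1) x fun l => ind (A l)

/-- Stationary probability of a property of `K + 1` successive letters. -/
noncomputable def prob (K : ℕ) (A : List Color → Prop) : ℝ :=
  (∑ x, condProb K A x) / 3

section Count

variable (K : ℕ) (A : List Color → Prop)

lemma cnt_nonneg (l : List Color) : 0 ≤ cnt K A l := by
  induction l with
  | nil => exact le_rfl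
  | cons y l ih => exact add_nonneg (ind_nonneg _) ih

lemma cnt_le (l : List Color) : cnt K A l ≤ l.length := by
  induction l with
  | nil => simp [cnt]
  | cons y l ih =>
    have := ind_le_one (K ≤ l.length ∧ A ((y :: l).take (K + 1)))
    simp only [cnt, List.length_cons]
    push_cast
    linarith

/-- Only the occurrences that straddle the cut are lost, so the count is superadditive; this is
enough for a lower tail. -/
lemma cnt_append (l l' : List Color) : cnt K A l + cnt K A l' ≤ cnt K A (l ++ l') := by
  induction l with
  | nil => simp [cnt]
  | cons y l ih =>
    have h : ind (K ≤ l.length ∧ A ((y :: l).take (K + 1))) ≤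
        ind (K ≤ (l ++ l').length ∧ A ((y :: (l ++ l')).take (K + 1))) := by
      refine ind_mono fun ⟨h1, h2⟩ => ⟨by rw [List.length_append]; omega, ?_⟩
      rwa [← List.cons_append, List.take_append_of_le_length (by simp; omega)]
    simp only [cnt, List.cons_append]
    linarith

lemma condProb_nonneg (x : Color) : 0 ≤ condProb K A x := Ex_nonneg fun _ _ => ind_nonneg _

lemma condProb_le_one (x : Color) : condProb K A x ≤ 1 := by
  rw [← Ex_const (K + 1) x 1]
  exact Ex_mono fun _ _ => ind_le_one _

lemma prob_nonneg : 0 ≤ prob K A :=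
  div_nonneg (Finset.sum_nonneg fun x _ => condProb_nonneg K A x) (by norm_num)

lemma prob_le_one : prob K A ≤ 1 := by
  have h1 := condProb_le_one K A .b
  have h2 := condProb_le_one K A .r
  have h3 := condProb_le_one K A .g
  rw [prob, sum_color]
  linarith

/-- Solution of the Poisson equation. -/
noncomputable def potential (x : Color) : ℝ :=
  condProb K A x + 4 / 3 * ∑ y, transition x y * condProb K A y

/-- The transition matrix has eigenvalues 1, 1/4 and 0, so on functions of mean zero its powers sum
to the identity plus 4/3 times the matrix. This is where the coefficient in `potential` comes from.
-/
lemma poisson (x : Color) :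
    condProb K A x + ∑ y, transition x y * potential K A y = potential K A x + prob K A := by
  unfold potential prob
  simp only [sum_color]
  cases x <;> simp only [transition] <;> ring

lemma potential_le (x : Color) : potential K A x ≤ 7 / 3 := by
  have h1 := condProb_le_one K A x
  have h2 : ∑ y, transition x y * condProb K A y ≤ ∑ y, transition x y := by
    refine Finset.sum_le_sum fun y _ => ?_
    exact mul_le_of_le_one_right (transition_nonneg _ _) (condProb_le_one K A y)
  rw [sum_transition] at h2
  unfold potential
  linarith

lemma potential_nonneg (x : Color) : 0 ≤ potential K A x := by
  have h2 : 0 ≤ ∑ y, transition x y * condProb K A y :=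
    Finset.sum_nonneg fun y _ => mul_nonneg (transition_nonneg _ _) (condProb_nonneg K A y)
  have := condProb_nonneg K A x
  unfold potential
  linarith

/-- The Poisson equation telescopes: the expected number of occurrences at `j` positions is `j *
prob K A` plus the initial potential minus the expected final one, and 7/3 = 1 + 4/3 bounds the
latter. -/
lemma le_Ex_cnt (j : ℕ) (x : Color) :
    j * prob K A + potential K A x - 7 / 3 ≤ Ex (K + j) x (cnt K A) := by
  induction j generalizing x with
  | zero =>
    have h1 := potential_le K A x
    have h2 : 0 ≤ Ex (K + 0) x (cnt K A) := Ex_nonneg fun l _ => cnt_nonneg K A l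
    push_cast
    linarith
  | succ j ih =>
    have h1 : Ex (K + (j + 1)) x (cnt K A) =
        condProb K A x + ∑ y, transition x y * Ex (K + j) y (cnt K A) := by
      have h2 : ∀ y, Ex (K + j) y (fun l => cnt K A (y :: l)) =
          Ex (K + j) y (fun l => ind (A ((y :: l).take (K + 1)))) + Ex (K + j) y (cnt K A) := by
        intro y
        rw [← Ex_add]
        refine Ex_congr fun l hl => ?_
        simp only [cnt]
        rw [show (K ≤ l.length ∧ A ((y :: l).take (K + 1))) = A ((y :: l).take (K + 1)) from
          propext (and_iff_right (by omega))]
      have h3 : condProb K A x = Ex (K + j + 1) x fun l => ind (A (l.take (K + 1))) :=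
        (Ex_take (F := fun l => ind (A l)) (by omega)).symm
      rw [h3, ← add_assoc]
      simp only [Ex, h2, mul_add, Finset.sum_add_distrib]
    have h4 : ∑ y, transition x y * (j * prob K A + potential K A y - 7 / 3) ≤
        ∑ y, transition x y * Ex (K + j) y (cnt K A) :=
      Finset.sum_le_sum fun y _ => mul_le_mul_of_nonneg_left (ih y) (transition_nonneg _ _)
    have h5 : ∑ y, transition x y * (j * prob K A + potential K A y - 7 / 3) =
        (j * prob K A - 7 / 3) + ∑ y, transition x y * potential K A y := by
      have : ∀ y, transition x y * (j * prob K A + potential K A y - 7 / 3) =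
          transition x y * (j * prob K A - 7 / 3) + transition x y * potential K A y :=
        fun y => by ring
      simp only [this, Finset.sum_add_distrib, ← Finset.sum_mul, sum_transition, one_mul]
    have h6 := poisson K A x
    rw [h1]
    push_cast
    linarith

/-- Second-order expansion of the exponential on one block, valid because the exponent is at most 1
in absolute value; the mean comes from `le_Ex_cnt`. -/
lemma Ex_exp_le {θ : ℝ} (hθ : 0 ≤ θ) {j : ℕ} (hB : θ * (K + j : ℕ) ≤ 1) (x : Color) :
    Ex (K + j) x (fun l => Real.exp (-θ * cnt K A l)) ≤
      Real.exp (-θ * (j * prob K A - 7 / 3) + (θ * (K + j : ℕ)) ^ 2) := by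
  have h1 : ∀ l : List Color, l.length = K + j →
      Real.exp (-θ * cnt K A l) ≤ (1 + (θ * (K + j : ℕ)) ^ 2) + (-θ) * cnt K A l := by
    intro l hl
    have h2 := cnt_nonneg K A l
    have h3 := cnt_le K A l
    rw [hl] at h3
    have h4 : θ * cnt K A l ≤ θ * (K + j : ℕ) := mul_le_mul_of_nonneg_left h3 hθ
    have h5 : 0 ≤ θ * cnt K A l := mul_nonneg hθ h2
    have h6 := Real.abs_exp_sub_one_sub_id_le (x := -θ * cnt K A l)
      (by rw [neg_mul, abs_neg, abs_of_nonneg h5]; linarith)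
    have h7 := (abs_le.1 h6).2
    have h8 : (-θ * cnt K A l) ^ 2 ≤ (θ * (K + j : ℕ)) ^ 2 := by
      rw [neg_mul, neg_sq]
      exact pow_le_pow_left₀ h5 h4 2
    linarith
  have h2 := Ex_mono (x := x) h1
  rw [Ex_add, Ex_const, Ex_mul] at h2
  have h3 := le_Ex_cnt K A j x
  have h4 := potential_nonneg K A x
  have h5 : θ * (j * prob K A - 7 / 3) ≤ θ * Ex (K + j) x (cnt K A) :=
    mul_le_mul_of_nonneg_left (by linarith) hθ
  have h6 := Real.add_one_le_exp (-θ * (j * prob K A - 7 / 3) + (θ * (K + j : ℕ)) ^ 2)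
  linarith

/-- The bound `h` is uniform in the preceding letter, so superadditivity of the count and the Markov
property multiply it over blocks of length `B`. The remainder of length `r` is dropped. -/
lemma Ex_exp_le_pow {θ ρ : ℝ} (hθ : 0 ≤ θ) {B : ℕ}
    (h : ∀ x, Ex B x (fun l => Real.exp (-θ * cnt K A l)) ≤ ρ) (n r : ℕ) (x : Color) :
    Ex (n * B + r) x (fun l => Real.exp (-θ * cnt K A l)) ≤ ρ ^ n := by
  have hρ : 0 ≤ ρ := (Ex_nonneg fun _ _ => (Real.exp_pos _).le).trans (h .b)
  induction n generalizing x with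
  | zero =>
    rw [pow_zero, ← Ex_const (0 * B + r) x 1]
    refine Ex_mono fun l _ => ?_
    rw [Real.exp_le_one_iff]
    have := mul_nonneg hθ (cnt_nonneg K A l)
    linarith
  | succ n ih =>
    rw [show (n + 1) * B + r = B + (n * B + r) by ring, Ex_append]
    have h1 : ∀ l : List Color, l.length = B →
        Ex (n * B + r) (l.getLastD x) (fun l' => Real.exp (-θ * cnt K A (l ++ l'))) ≤
          ρ ^ n * Real.exp (-θ * cnt K A l) := by
      intro l _
      have h2 := mul_le_mul_of_nonneg_left (ih (l.getLastD x)) (Real.exp_pos (-θ * cnt K A l)).le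
      rw [← Ex_mul] at h2
      rw [mul_comm (ρ ^ n)]
      refine (Ex_mono fun l' _ => ?_).trans h2
      rw [← Real.exp_add, Real.exp_le_exp]
      have := mul_le_mul_of_nonneg_left (cnt_append K A l l') hθ
      linarith
    refine (Ex_mono h1).trans ?_
    rw [Ex_mul, pow_succ]
    exact mul_le_mul_of_nonneg_left (h x) (pow_nonneg hρ n)

/-- Exponential bound for the lower tail of the number of occurrences of a pattern. -/
lemma exists_concentration {δ : ℝ} (hδ : 0 < δ) : ∃ c > 0, ∀ (N : ℕ) (x : Color),
    Ex N x (fun l => ind (cnt K A l ≤ (prob K A - δ) * N)) ≤ 3 * Real.exp (-c * N) := by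
  wlog hδ1 : δ ≤ 1 generalizing δ
  · obtain ⟨c, hc, h⟩ := this one_pos le_rfl
    refine ⟨c, hc, fun N x => (Ex_mono fun l _ => ind_mono fun h' => h'.trans ?_).trans (h N x)⟩
    exact mul_le_mul_of_nonneg_right (by linarith) (Nat.cast_nonneg N)
  set p := prob K A with hp
  have hp0 : 0 ≤ p := prob_nonneg K A
  have hp1 : p ≤ 1 := prob_le_one K A
  -- Blocks so long that both the incomplete windows at the end and the error 7/3 cost at most a
  -- fraction δ/4.
  obtain ⟨j, hj⟩ := exists_nat_ge ((K + 7 / 3) * (4 / δ))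
  have hj' : K + 7 / 3 ≤ δ / 4 * j := by
    have h1 := mul_le_mul_of_nonneg_left hj (show 0 ≤ δ / 4 by linarith)
    have h2 : δ / 4 * ((K + 7 / 3) * (4 / δ)) = K + 7 / 3 := by field_simp
    linarith
  have hj0 : 0 < j := by
    rcases Nat.eq_zero_or_pos j with h | h
    · rw [h] at hj'
      have : (0 : ℝ) ≤ K := Nat.cast_nonneg K
      norm_num at hj'; linarith
    · exact h
  set B := K + j with hB
  have hB0 : (0 : ℝ) < B := by exact_mod_cast (by omega : 0 < B)
  -- The gain in the exponent is linear in θ and the error is quadratic; `θ * B = δ / 4` balances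
  -- them.
  set θ := δ / (4 * B) with hθ
  have hθ0 : 0 < θ := by positivity
  have hθB : θ * B = δ / 4 := by rw [hθ]; field_simp
  have h1 : ∀ x, Ex B x (fun l => Real.exp (-θ * cnt K A l)) ≤
      Real.exp (-(δ / 4) * (p - δ / 2)) := by
    intro x
    refine (Ex_exp_le K A hθ0.le (j := j) (by rw [← hB, hθB]; linarith) x).trans ?_
    rw [Real.exp_le_exp, ← hB, hθB]
    have h2 : (p - δ / 4) * B ≤ j * p - 7 / 3 := by
      rw [hB]
      push_cast
      have : p * K ≤ K := mul_le_of_le_one_left (Nat.cast_nonneg K) hp1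
      have : 0 ≤ δ / 4 * K := by positivity
      nlinarith
    have h3 := mul_le_mul_of_nonneg_left h2 hθ0.le
    have h4 : θ * ((p - δ / 4) * B) = (δ / 4) * (p - δ / 4) := by
      rw [← hθB]; ring
    nlinarith
  refine ⟨θ * (δ / 2), by positivity, fun N x => ?_⟩
  have h2 := Ex_exp_le_pow K A hθ0.le h1 (N / B) (N % B) x
  rw [Nat.div_add_mod', ← Real.exp_nat_mul] at h2
  have h3 : ∀ l : List Color, l.length = N → ind (cnt K A l ≤ (p - δ) * N) ≤
      Real.exp (θ * ((p - δ) * N)) * Real.exp (-θ * cnt K A l) := by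
    intro l _
    rw [← Real.exp_add]
    by_cases h : cnt K A l ≤ (p - δ) * N
    · rw [ind_true h, Real.one_le_exp_iff]
      have := mul_le_mul_of_nonneg_left h hθ0.le
      linarith
    · rw [ind_false h]; exact (Real.exp_pos _).le
  refine (Ex_mono h3).trans ?_
  rw [Ex_mul]
  refine (mul_le_mul_of_nonneg_left h2 (Real.exp_pos _).le).trans ?_
  rw [← Real.exp_add]
  have h4 : Real.exp 1 ≤ 3 := Real.exp_one_lt_three.le
  refine le_trans ?_ (mul_le_mul_of_nonneg_right h4 (Real.exp_pos _).le)
  rw [← Real.exp_add, Real.exp_le_exp]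
  have h5 : ((N / B : ℕ) : ℝ) * B ≤ N := by exact_mod_cast Nat.div_mul_le_self N B
  have h6 : (N : ℝ) ≤ (N / B : ℕ) * B + B := by
    exact_mod_cast (Nat.lt_div_mul_add (by omega : 0 < B)).le
  set q : ℝ := ((N / B : ℕ) : ℝ) with hq
  have h7 : q * (-(δ / 4) * (p - δ / 2)) = -θ * ((p - δ / 2) * (q * B)) := by
    rw [← hθB]; ring
  rw [h7]
  -- The incomplete last block costs at most `B`, so at most `θ * B ≤ 1` in the exponent: the factor
  -- 3 is a bound for e.
  have h8 : (p - δ / 2) * N - (p - δ / 2) * (q * B) ≤ B := by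
    rw [← mul_sub]
    have h9 : 0 ≤ N - q * B := by linarith
    have h10 : (p - δ / 2) * (N - q * B) ≤ 1 * (N - q * B) :=
      mul_le_mul_of_nonneg_right (by linarith) h9
    linarith
  have h9 := mul_le_mul_of_nonneg_left h8 hθ0.le
  rw [hθB] at h9
  nlinarith

end Count

end SchnyderWood
namespace SchnyderWood

lemma cnt_eq_sum (K : ℕ) (A : List Color → Prop) (l : List Color) :
    cnt K A l = ∑ i ∈ Finset.range l.length,
      ind (i + K < l.length ∧ A ((l.drop i).take (K + 1))) := by
  induction l with
  | nil => simp [cnt]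
  | cons y l ih =>
    rw [cnt, ih, List.length_cons, Finset.sum_range_succ', add_comm]
    congr 1
    · refine Finset.sum_congr rfl fun i _ => ?_
      rw [List.drop_succ_cons]
      congr 2
      rw [eq_iff_iff]; omega
    · rw [List.drop_zero]
      congr 2
      rw [eq_iff_iff]; omega

lemma Ex_sum {ι : Type*} (s : Finset ι) (m : ℕ) (x : Color) (F : ι → List Color → ℝ) :
    Ex m x (fun l => ∑ i ∈ s, F i l) = ∑ i ∈ s, Ex m x (F i) := by
  classical
  induction s using Finset.induction_on with
  | empty => simp [Ex_const]
  | insert a s ha ih => simp only [Finset.sum_insert ha, Ex_add, ih]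

lemma ind_exists_le {ι : Type*} (s : Finset ι) (Q : ι → Prop) :
    ind (∃ i ∈ s, Q i) ≤ ∑ i ∈ s, ind (Q i) := by
  by_cases h : ∃ i ∈ s, Q i
  · obtain ⟨i, hi, hq⟩ := h
    rw [ind_true ⟨i, hi, hq⟩, ← ind_true hq]
    exact Finset.single_le_sum (f := fun i => ind (Q i)) (fun _ _ => ind_nonneg _) hi
  · rw [ind_false h]
    exact Finset.sum_nonneg fun _ _ => ind_nonneg _

/-! ### Typical words -/

lemma cnt_singleton (x : Color) (l : List Color) : cnt 0 (fun u => u = [x]) l = l.count x := by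
  induction l with
  | nil => simp [cnt]
  | cons y l ih =>
    rw [cnt, ih, List.count_cons]
    by_cases h : y = x
    · rw [ind_true ⟨Nat.zero_le _, by simp [h]⟩]; simp [h, add_comm]
    · rw [ind_false (by simp [h])]; simp [h]

lemma prob_singleton (x : Color) : prob 0 (fun u => u = [x]) = 1 / 3 := by
  have h : ∀ z, condProb 0 (fun u => u = [x]) z = transition z x := by
    intro z
    simp only [condProb, Ex]
    rw [Finset.sum_eq_single x]
    · rw [ind_true rfl, mul_one]
    · intro y _ hy
      rw [ind_false (by simpa using hy), mul_zero]
    · simp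
  rw [prob]
  simp only [h, sum_color]
  cases x <;> simp only [transition] <;> norm_num

/-- In all prefixes of `l`, the numbers of the three letters are almost the same. -/
def Typical (ε : ℝ) (l : List Color) : Prop :=
  ∀ n ≤ l.length, ∀ x y, ((l.take n).count x : ℝ) - (l.take n).count y ≤ ε * l.length

lemma length_eq_count (l : List Color) : l.length = l.count .b + l.count .r + l.count .g := by
  induction l with
  | nil => rfl
  | cons y l ih => cases y <;> simp [ih] <;> omega

/-- Long words are typical. -/
lemma exists_typical {ε η : ℝ} (hε : 0 < ε) (hη : 0 < η) : ∃ N₀ : ℕ, ∀ N ≥ N₀, ∀ z,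
    Ex N z (fun l => ind (¬ Typical ε l)) ≤ η := by
  choose c hc hc' using fun x : Color => exists_concentration 0 (fun u => u = [x])
    (δ := ε / 3) (by positivity)
  obtain ⟨c0, h0, h0b, h0r, h0g⟩ : ∃ c0 > 0, c0 ≤ c .b ∧ c0 ≤ c .r ∧ c0 ≤ c .g :=
    ⟨min (c .b) (min (c .r) (c .g)), lt_min (hc _) (lt_min (hc _) (hc _)), min_le_left _ _,
      (min_le_right _ _).trans (min_le_left _ _), (min_le_right _ _).trans (min_le_right _ _)⟩
  have h0c : ∀ x, c0 ≤ c x := by rintro (_ | _ | _) <;> assumption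
  have htend : Tendsto (fun N : ℕ => ((N : ℝ) + 1) * (9 * Real.exp (-(c0 * ε) * N))) atTop (𝓝 0) := by
    have ha : 0 < c0 * ε := by positivity
    have h1 : Tendsto (fun x : ℝ => x ^ 1 * Real.exp (-(c0 * ε) * x)) atTop (𝓝 0) := by
      simpa using tendsto_rpow_mul_exp_neg_mul_atTop_nhds_zero 1 (c0 * ε) ha
    have h2 : Tendsto (fun x : ℝ => x ^ 0 * Real.exp (-(c0 * ε) * x)) atTop (𝓝 0) := by
      simpa using tendsto_rpow_mul_exp_neg_mul_atTop_nhds_zero 0 (c0 * ε) ha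
    have h3 := ((h1.add h2).const_mul 9).comp tendsto_natCast_atTop_atTop
    rw [add_zero, mul_zero] at h3
    refine h3.congr fun N => ?_
    simp only [Function.comp]
    ring
  obtain ⟨N₀, hN₀⟩ := (htend.eventually (gt_mem_nhds hη)).exists_forall_of_atTop
  refine ⟨N₀, fun N hN z => le_trans ?_ (hN₀ N hN).le⟩
  -- Prefixes shorter than `ε * N` cannot violate the condition. For the others the exponential
  -- bound beats their number, at most `N + 1`.
  have hx : ∀ x, ∀ n ∈ (Finset.range (N + 1)).filter (fun n : ℕ => ε * N ≤ n),
      Ex N z (fun l => ind ((((l.take n).count x : ℕ) : ℝ) ≤ (1 / 3 - ε / 3) * n)) ≤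
        3 * Real.exp (-(c0 * ε) * N) := by
    intro x n hn
    rw [Finset.mem_filter, Finset.mem_range] at hn
    rw [Ex_take (F := fun l => ind (((l.count x : ℕ) : ℝ) ≤ (1 / 3 - ε / 3) * n)) (by omega)]
    have h1 := hc' x n z
    rw [prob_singleton] at h1
    simp only [cnt_singleton] at h1
    refine h1.trans (mul_le_mul_of_nonneg_left ?_ (by norm_num))
    rw [Real.exp_le_exp]
    have h2 : c0 * (ε * N) ≤ c x * n :=
      mul_le_mul (h0c x) hn.2 (by positivity) (hc x).le
    linarith
  have key : ∀ l : List Color, l.length = N → ind (¬ Typical ε l) ≤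
      ∑ n ∈ (Finset.range (N + 1)).filter (fun n : ℕ => ε * N ≤ n), ∑ x : Color,
        ind ((((l.take n).count x : ℕ) : ℝ) ≤ (1 / 3 - ε / 3) * n) := by
    intro l hl
    have h1 := ind_exists_le ((Finset.range (N + 1)).filter (fun n : ℕ => ε * N ≤ n))
      (fun n => ∃ x ∈ (Finset.univ : Finset Color),
        (((l.take n).count x : ℕ) : ℝ) ≤ (1 / 3 - ε / 3) * n)
    refine le_trans (ind_mono ?_) (h1.trans (Finset.sum_le_sum fun n _ => ind_exists_le _ _))
    intro h
    by_contra hcon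
    push Not at hcon
    refine h fun n hn x y => ?_
    rw [hl] at hn ⊢
    have hlen := length_eq_count (l.take n)
    rw [List.length_take, hl, min_eq_left hn] at hlen
    have hlen' : (n : ℝ) = (l.take n).count .b + (l.take n).count .r + (l.take n).count .g := by
      exact_mod_cast hlen
    have p1 : (0 : ℝ) ≤ (l.take n).count .b := Nat.cast_nonneg _
    have p2 : (0 : ℝ) ≤ (l.take n).count .r := Nat.cast_nonneg _
    have p3 : (0 : ℝ) ≤ (l.take n).count .g := Nat.cast_nonneg _
    -- Lower bounds for all three letters are also upper bounds, since the counts sum to `n`: each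
    -- lies between (1 - ε)n/3 and (1 + 2ε)n/3.
    by_cases hn' : ε * N ≤ n
    · have h2 := fun x => hcon n (Finset.mem_filter.2 ⟨Finset.mem_range.2 (by omega), hn'⟩) x
        (Finset.mem_univ x)
      have hb := h2 .b
      have hr := h2 .r
      have hg := h2 .g
      have hnN : ε * n ≤ ε * N := mul_le_mul_of_nonneg_left (by exact_mod_cast hn) hε.le
      cases x <;> cases y <;> linarith
    · cases x <;> cases y <;> linarith
  refine (Ex_mono key).trans ?_
  rw [Ex_sum]
  simp only [Ex_sum]
  refine (Finset.sum_le_sum fun n hn => (Finset.sum_le_sum fun x _ => hx x n hn)).trans ?_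
  rw [Finset.sum_const, Finset.sum_const, nsmul_eq_mul, nsmul_eq_mul]
  have h1 : (((Finset.range (N + 1)).filter (fun n : ℕ => ε * N ≤ n)).card : ℝ) ≤ N + 1 := by
    have := Finset.card_filter_le (Finset.range (N + 1)) (fun n : ℕ => ε * N ≤ n)
    rw [Finset.card_range] at this
    exact_mod_cast this
  have h2 : ((Finset.univ : Finset Color).card : ℝ) = 3 := by
    norm_num [show (Finset.univ : Finset Color).card = 3 from rfl]
  rw [h2]
  refine mul_le_mul h1 (le_of_eq (by ring)) (by positivity) (by positivity)

/-! ### Windows of the random word -/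

/-- The `N` letters from the position `m` on. -/
def window (w : ℤ → Color) : ℤ → ℕ → List Color
  | _, 0 => []
  | m, N + 1 => w m :: window w (m + 1) N

lemma length_window (w : ℤ → Color) (m : ℤ) (N : ℕ) : (window w m N).length = N := by
  induction N generalizing m with
  | zero => rfl
  | succ N ih => simp [window, ih]

lemma getElem_window (w : ℤ → Color) (m : ℤ) {N i : ℕ} (h : i < (window w m N).length) :
    (window w m N)[i] = w (m + i) := by
  induction N generalizing m i with
  | zero => simp [window] at h
  | succ N ih =>
    cases i with
    | zero => simp [window]
    | succ i =>
      simp only [window, List.getElem_cons_succ, ih]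
      congr 1
      push_cast
      ring

lemma window_succ' (w : ℤ → Color) (m : ℤ) (N : ℕ) :
    window w m (N + 1) = window w m N ++ [w (m + N)] := by
  refine List.ext_getElem (by simp [length_window]) fun i h1 h2 => ?_
  rw [getElem_window, List.getElem_append]
  rw [length_window] at h1
  split_ifs with h
  · rw [getElem_window]
  · rw [length_window] at h
    obtain rfl : i = N := by omega
    simp

lemma window_eq_iff {w w' : ℤ → Color} {m m' : ℤ} {N : ℕ} :
    window w m N = window w' m' N ↔ ∀ i : ℕ, i < N → w (m + i) = w' (m' + i) := by
  constructor
  · intro h i hi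
    have h1 : i < (window w m N).length := by rwa [length_window]
    have h2 : i < (window w' m' N).length := by rwa [length_window]
    rw [← getElem_window w m h1, ← getElem_window w' m' h2]
    simp only [h]
  · intro h
    refine List.ext_getElem (by simp [length_window]) fun i h1 h2 => ?_
    rw [getElem_window, getElem_window]
    rw [length_window] at h1
    exact h i h1

lemma window_toWord {l : List Color} {i N : ℕ} (h : i + N ≤ l.length) :
    window (toWord l) i N = (l.drop i).take N := by
  refine List.ext_getElem (by simp [length_window]; omega) fun j h1 h2 => ?_
  rw [length_window] at h1
  rw [getElem_window, ← Nat.cast_add, toWord_apply _ (by omega), List.getElem_take,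
    List.getElem_drop]

section Law

variable {Ω : Type*} [MeasurableSpace Ω] {μ : Measure Ω} [IsProbabilityMeasure μ]
  {w : Ω → ℤ → Color}

lemma measureReal_eq_sum {f : Ω → Color} (hf : Measurable f) (S : Set Ω) :
    μ.real S = ∑ y, μ.real (S ∩ {ω | f ω = y}) := by
  have hm : ∀ y, MeasurableSet {ω | f ω = y} := fun y => hf (measurableSet_singleton y)
  rw [sum_color, ← measureReal_inter_add_sdiff (s := S) (hm .b),
    ← measureReal_inter_add_sdiff (s := S \ {ω | f ω = .b}) (hm .r), ← add_assoc]
  congr 2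
  · congr 1
    ext ω
    simp only [Set.mem_inter_iff, Set.mem_sdiff, Set.mem_ofPred_eq]
    refine ⟨fun h => ⟨h.1.1, h.2⟩, fun h => ⟨⟨h.1, fun h' => ?_⟩, h.2⟩⟩
    rw [h'] at h; cases h.2
  · ext ω
    simp only [Set.mem_inter_iff, Set.mem_sdiff, Set.mem_ofPred_eq]
    rcases f ω <;> simp

variable (hw : IsStationaryMarkovWord μ w)
include hw

/-- The first letter of the window is moved into the cylinder by splitting over its value, and each
such extension contributes one transition probability. Hence the induction has to leave the cylinder
arbitrary. -/
lemma law_cylinder (m : ℤ) (N : ℕ) (A : List Color → Prop) (k : ℕ) (x : ℕ → Color) :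
    μ.real ({ω | ∀ j ≤ k, w ω (m + j) = x j} ∩ {ω | A (window (w ω) (m + k + 1) N)}) =
      μ.real {ω | ∀ j ≤ k, w ω (m + j) = x j} * Ex N (x k) fun l => ind (A l) := by
  induction N generalizing A k x with
  | zero =>
    simp only [window, Ex]
    by_cases h : A []
    · simp [h, ind_true]
    · simp [h, ind_false]
  | succ N ih =>
    rw [measureReal_eq_sum (hw.measurable (m + k + 1))]
    simp only [Ex, Finset.mul_sum]
    refine Finset.sum_congr rfl fun y _ => ?_
    set x' := Function.update x (k + 1) y with hx'
    have h1 : ∀ j ≤ k, x' j = x j := fun j hj => Function.update_of_ne (by omega) _ _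
    have h2 : x' (k + 1) = y := Function.update_self _ _ _
    have h3 := ih (fun l => A (y :: l)) (k + 1) x'
    have h4 : μ.real {ω | ∀ j ≤ k + 1, w ω (m + j) = x' j} =
        μ.real {ω | ∀ j ≤ k, w ω (m + j) = x j} * transition (x k) y := by
      rw [hw.law, hw.law, Finset.prod_range_succ, h2, h1 k le_rfl, mul_assoc]
      congr 2
      refine Finset.prod_congr rfl fun j hj => ?_
      rw [Finset.mem_range] at hj
      rw [h1 j (by omega), h1 (j + 1) (by omega)]
    rw [h4, h2, mul_assoc] at h3
    rw [← h3]
    congr 1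
    ext ω
    simp only [Set.mem_inter_iff, Set.mem_ofPred_eq, window]
    push_cast
    rw [← add_assoc m]
    constructor
    · rintro ⟨⟨h5, h6⟩, rfl⟩
      refine ⟨fun j hj => ?_, h6⟩
      rcases Nat.lt_or_ge j (k + 1) with h | h
      · rw [h1 j (by omega), h5 j (by omega)]
      · obtain rfl : j = k + 1 := by omega
        rw [h2]; push_cast; rw [← add_assoc]
    · rintro ⟨h5, h6⟩
      have h7 := h5 (k + 1) le_rfl
      push_cast at h7
      rw [← add_assoc, h2] at h7
      exact ⟨⟨fun j hj => by rw [h5 j (by omega), h1 j hj], by rwa [h7]⟩, h7⟩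

/-- The law of a window. -/
lemma law_window (m : ℤ) (N : ℕ) (A : List Color → Prop) :
    μ.real {ω | A (window (w ω) m (N + 1))} = (∑ x, Ex N x fun l => ind (A (x :: l))) / 3 := by
  rw [measureReal_eq_sum (hw.measurable m), Finset.sum_div]
  refine Finset.sum_congr rfl fun x _ => ?_
  have h := law_cylinder hw m N (fun l => A (x :: l)) 0 fun _ => x
  rw [hw.law, Finset.range_zero, Finset.prod_empty, mul_one] at h
  rw [div_eq_inv_mul, ← one_div, ← h]
  congr 1
  ext ω
  simp only [Set.mem_inter_iff, Set.mem_ofPred_eq, window, Nat.le_zero, forall_eq, Nat.cast_zero,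
    add_zero]
  refine ⟨fun ⟨h, h'⟩ => ⟨h', by rwa [← h']⟩, fun ⟨h', h⟩ => ⟨by rwa [h'], h'⟩⟩

/-- `prob` averages over a letter that precedes the pattern, the left side of `law_window` over the
first letter of the pattern itself. They agree because the columns of the transition matrix sum to
1. -/
lemma prob_eq (m : ℤ) (K : ℕ) (A : List Color → Prop) :
    prob K A = μ.real {ω | A (window (w ω) m (K + 1))} := by
  rw [law_window hw, prob]
  simp only [condProb, Ex, sum_color]
  simp only [transition]
  ring

/-- The future of a letter `b` has the same law as the future of a letter `g`. -/
lemma law_future_b_eq_g (m : ℤ) (N : ℕ) (A : List Color → Prop) :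
    μ.real {ω | w ω m = .b ∧ A (window (w ω) (m + 1) N)} =
      μ.real {ω | w ω m = .g ∧ A (window (w ω) (m + 1) N)} := by
  have h : ∀ x, μ.real {ω | w ω m = x ∧ A (window (w ω) (m + 1) N)} =
      1 / 3 * Ex N x fun l => ind (A l) := fun x => by
    have h := law_cylinder hw m N A 0 fun _ => x
    rw [hw.law, Finset.range_zero, Finset.prod_empty, mul_one] at h
    rw [← h]
    congr 1
    ext ω
    simp
  -- The rows of b and g in the transition matrix are equal.
  have h3 : (Ex N .b fun l => ind (A l)) = Ex N .g fun l => ind (A l) := by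
    cases N with
    | zero => rfl
    | succ N => simp only [Ex, sum_color, transition]
  rw [h, h, h3]

/-- The past of a letter `g` has the same law as the past of a letter `r`. -/
lemma law_past_g_eq_r (m : ℤ) (N : ℕ) (A : List Color → Prop) :
    μ.real {ω | w ω (m + N) = .g ∧ A (window (w ω) m N)} =
      μ.real {ω | w ω (m + N) = .r ∧ A (window (w ω) m N)} := by
  have h1 : ∀ c, {ω | w ω (m + N) = c ∧ A (window (w ω) m N)} =
      {ω | ∃ l, window (w ω) m (N + 1) = l ++ [c] ∧ A l} := by
    intro c
    ext ω
    simp only [Set.mem_ofPred_eq, window_succ']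
    constructor
    · rintro ⟨rfl, h⟩
      exact ⟨_, rfl, h⟩
    · rintro ⟨l, h, h'⟩
      obtain ⟨rfl, h⟩ := List.append_inj' h rfl
      exact ⟨by simpa using h, h'⟩
  have h2 : ∀ c x, Ex N x (fun l => ind (∃ l', x :: l = l' ++ [c] ∧ A l')) =
      match N with
      | 0 => ind (x = c ∧ A [])
      | n + 1 => Ex n x fun l => transition (l.getLastD x) c * ind (A (x :: l)) := by
    intro c x
    cases N with
    | zero =>
      simp only [Ex]
      congr 1
      rw [eq_iff_iff]
      constructor
      · rintro ⟨l', h, h'⟩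
        obtain ⟨rfl, h⟩ := List.append_inj' (s₁ := []) h rfl
        exact ⟨by simpa using h, h'⟩
      · rintro ⟨rfl, h⟩
        exact ⟨[], rfl, h⟩
    | succ n =>
      rw [Ex_append n 1]
      refine Ex_congr fun l _ => ?_
      simp only [Ex]
      rw [Finset.sum_eq_single c]
      · congr 2
        rw [eq_iff_iff]
        constructor
        · rintro ⟨l', h, h'⟩
          obtain ⟨rfl, -⟩ := List.append_inj' (s₁ := x :: l) h rfl
          exact h'
        · exact fun h => ⟨x :: l, rfl, h⟩
      · intro y _ hy
        rw [ind_false, mul_zero]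
        rintro ⟨l', h, -⟩
        exact hy (by simpa using (List.append_inj' (s₁ := x :: l) h rfl).2)
      · simp
  rw [h1, h1, law_window hw m N (fun u => ∃ l, u = l ++ [Color.g] ∧ A l),
    law_window hw m N (fun u => ∃ l, u = l ++ [Color.r] ∧ A l)]
  simp only [h2]
  cases N with
  | zero =>
    simp only [sum_color]
    by_cases h : A [] <;> simp [h, ind]
  | succ n =>
    -- The columns of g and r in the transition matrix are equal.
    have h3 : ∀ x, transition x .g = transition x .r := by rintro (_ | _ | _) <;> rfl
    simp only [h3]

end Law

end SchnyderWood
namespace SchnyderWood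

/-! ### Almost sure existence of matches -/

section Unmatched

variable (x y : Color)

/-- No letter `y` is matched to the position `i` within distance `K` to the right. -/
def OpenRight (K : ℕ) (w : ℤ → Color) (i : ℤ) : Prop :=
  ∀ m, i ≤ m → m ≤ i + K → 0 ≤ excess x y w i m

/-- No letter `x` is matched to the position `i` within distance `K` to the left. -/
def OpenLeft (K : ℕ) (w : ℤ → Color) (i : ℤ) : Prop :=
  ∀ m, i - K ≤ m → m < i → excess x y w m (i - 1) ≤ 0

variable {x y} (hxy : x ≠ y)
include hxy

lemma step_left : step x y x = 1 := by simp [step, hxy]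

lemma step_right : step x y y = -1 := by simp [step, hxy.symm]

/-- From one open letter to just before the next the excess is nonnegative, since the first is still
open, and every open letter adds 1. Many unmatched letters therefore force a large excess, which
typical words do not have. -/
lemma card_openRight_le {K : ℕ} {w : ℤ → Color} {s : ℤ} (S : Finset ℤ)
    (hS : ∀ i ∈ S, s ≤ i ∧ i < s + K ∧ w i = x ∧ OpenRight x y K w i) (hne : S.Nonempty) :
    ∃ a b, s - 1 ≤ a ∧ a < b ∧ b ∈ S ∧ (∀ i ∈ S, i ≤ b) ∧ (S.card : ℤ) ≤ excess x y w a b := by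
  induction S using Finset.induction_on_max with
  | empty => exact absurd hne (by simp)
  | insert a S ha ih =>
    obtain ⟨h1, h2, h3, h4⟩ := hS a (Finset.mem_insert_self a S)
    have hcard : (insert a S).card = S.card + 1 :=
      Finset.card_insert_of_notMem fun h => lt_irrefl _ (ha a h)
    rcases S.eq_empty_or_nonempty with rfl | hne'
    · refine ⟨a - 1, a, by omega, by omega, by simp, by simp, ?_⟩
      rw [excess_one, h3, step_left hxy]; simp
    · obtain ⟨c, b, h5, h6, h7, h8, h9⟩ :=
        ih (fun i hi => hS i (Finset.mem_insert_of_mem hi)) hne'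
      have hba := ha b h7
      obtain ⟨h10, h11, h12, h13⟩ := hS b (Finset.mem_insert_of_mem h7)
      refine ⟨c, a, h5, by omega, Finset.mem_insert_self a S, fun i hi => ?_, ?_⟩
      · rcases Finset.mem_insert.1 hi with rfl | hi
        · exact le_rfl
        · exact (ha i hi).le
      · rw [excess_add (i := b) (by omega) hba.le, excess_last hba, h3, step_left hxy, hcard]
        have := h13 (a - 1) (by omega) (by omega)
        push_cast
        omega

/-- The mirror image: here nonnegativity comes from the later letter, which looks back as far as the
previous one. -/
lemma card_openLeft_le {K : ℕ} {w : ℤ → Color} {s : ℤ} (S : Finset ℤ)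
    (hS : ∀ i ∈ S, s ≤ i ∧ i < s + K ∧ w i = y ∧ OpenLeft x y K w i) (hne : S.Nonempty) :
    ∃ a b, s - 1 ≤ a ∧ a < b ∧ b ∈ S ∧ (∀ i ∈ S, i ≤ b) ∧ (S.card : ℤ) ≤ -excess x y w a b := by
  induction S using Finset.induction_on_max with
  | empty => exact absurd hne (by simp)
  | insert a S ha ih =>
    obtain ⟨h1, h2, h3, h4⟩ := hS a (Finset.mem_insert_self a S)
    have hcard : (insert a S).card = S.card + 1 :=
      Finset.card_insert_of_notMem fun h => lt_irrefl _ (ha a h)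
    rcases S.eq_empty_or_nonempty with rfl | hne'
    · refine ⟨a - 1, a, by omega, by omega, by simp, by simp, ?_⟩
      rw [excess_one, h3, step_right hxy]; simp
    · obtain ⟨c, b, h5, h6, h7, h8, h9⟩ :=
        ih (fun i hi => hS i (Finset.mem_insert_of_mem hi)) hne'
      have hba := ha b h7
      obtain ⟨h10, h11, h12, h13⟩ := hS b (Finset.mem_insert_of_mem h7)
      refine ⟨c, a, h5, by omega, Finset.mem_insert_self a S, fun i hi => ?_, ?_⟩
      · rcases Finset.mem_insert.1 hi with rfl | hi
        · exact le_rfl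
        · exact (ha i hi).le
      · rw [excess_add (i := b) (by omega) hba.le, excess_last hba, h3, step_right hxy, hcard]
        have := h4 b (by omega) hba
        push_cast
        omega

end Unmatched

lemma window_toWord_window (w : ℤ → Color) (i : ℤ) (N : ℕ) :
    window (toWord (window w i N)) 0 N = window w i N := by
  have h := window_toWord (l := window w i N) (i := 0) (N := N) (by rw [length_window]; omega)
  rw [List.drop_zero, List.take_of_length_le (by rw [length_window])] at h
  exact h

/-- The excess of a prefix. -/
lemma excess_toWord (x y : Color) (l : List Color) {n : ℕ} (h : n ≤ l.length) :
    excess x y (toWord l) (-1) (n - 1) = (l.take n).count x - (l.take n).count y := by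
  induction n with
  | zero => simp [excess_self]
  | succ n ih =>
    rw [excess_last (by push_cast; omega)]
    push_cast
    rw [add_sub_cancel_right, ih (by omega), List.take_succ_eq_append_getElem (by omega),
      List.count_append, List.count_append, toWord_apply l (by omega)]
    unfold step
    push_cast
    simp only [List.count_singleton, beq_iff_eq]
    split_ifs <;> push_cast <;> ring

lemma Typical.abs_excess_le {ε : ℝ} {l : List Color} (h : Typical ε l) (x y : Color) {a b : ℤ}
    (ha : -1 ≤ a) (hab : a ≤ b) (hb : b < l.length) :
    |(excess x y (toWord l) a b : ℝ)| ≤ 2 * ε * l.length := by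
  have h1 : ∀ c : ℤ, -1 ≤ c → c < l.length →
      |(excess x y (toWord l) (-1) c : ℝ)| ≤ ε * l.length := by
    intro c hc hc'
    have h2 := excess_toWord x y l (n := (c + 1).toNat) (by omega)
    rw [show (((c + 1).toNat : ℕ) : ℤ) - 1 = c by omega] at h2
    rw [h2, abs_le]
    push_cast
    have h3 := h (c + 1).toNat (by omega) x y
    have h4 := h (c + 1).toNat (by omega) y x
    constructor <;> linarith
  have h2 := excess_add (x := x) (y := y) (w := toWord l) ha hab
  have h3 := h1 a ha (by omega)
  have h4 := h1 b (by omega) hb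
  have h5 : (excess x y (toWord l) (-1) b : ℝ) =
      excess x y (toWord l) (-1) a + excess x y (toWord l) a b := by exact_mod_cast h2
  rw [abs_le] at *
  constructor <;> linarith

lemma measureReal_setOf_mono {Ω : Type*} [MeasurableSpace Ω] {μ : Measure Ω} [IsFiniteMeasure μ]
    {p q : Ω → Prop} (h : ∀ ω, p ω → q ω) : μ.real {ω | p ω} ≤ μ.real {ω | q ω} :=
  measureReal_mono h

section Small

variable {Ω : Type*} [MeasurableSpace Ω] {μ : Measure Ω} [IsProbabilityMeasure μ]
  {w : Ω → ℤ → Color} (hw : IsStationaryMarkovWord μ w)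
include hw

/-- A local property that occurs only at few positions has small probability. -/
lemma exists_small (x y : Color) (U : ℕ → (ℤ → Color) → ℤ → Prop)
    (hU : ∀ K w w' s s', window w s (K + 1) = window w' s' (K + 1) → U K w s → U K w' s')
    (hcard : ∀ (K : ℕ) w (S : Finset ℤ), (∀ i ∈ S, 0 ≤ i ∧ i < K ∧ U K w i) → S.Nonempty →
      ∃ a b : ℤ, -1 ≤ a ∧ a ≤ b ∧ b < 2 * K ∧ (S.card : ℤ) ≤ |excess x y w a b|)
    {ε : ℝ} (hε : 0 < ε) : ∃ K : ℕ, ∀ i, μ.real {ω | U K (w ω) i} ≤ ε := by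
  obtain ⟨N₀, hN₀⟩ := exists_typical (ε := ε / 16) (η := ε / 8) (by positivity) (by positivity)
  obtain ⟨K, hK⟩ := exists_nat_ge (max (N₀ : ℝ) (14 / (3 * ε) + 1))
  have hK1 : (N₀ : ℝ) ≤ K := (le_max_left _ _).trans hK
  have hK2 : 14 / (3 * ε) + 1 ≤ K := (le_max_right _ _).trans hK
  have hK0 : (0 : ℝ) < K := by have : 0 < 14 / (3 * ε) := by positivity
                               linarith
  have hK3 : 7 / 3 ≤ ε / 2 * K := by
    have h1 : ε / 2 * (14 / (3 * ε)) = 7 / 3 := by field_simp; norm_num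
    have h2 : ε / 2 * (14 / (3 * ε)) ≤ ε / 2 * K := mul_le_mul_of_nonneg_left (by linarith) (by positivity)
    linarith
  set A : List Color → Prop := fun l => U K (toWord l) 0 with hA
  have hAw : ∀ (w : ℤ → Color) i, A (window w i (K + 1)) ↔ U K w i := fun w i =>
    ⟨hU K _ _ _ _ (window_toWord_window w i (K + 1)),
      hU K _ _ _ _ (window_toWord_window w i (K + 1)).symm⟩
  refine ⟨K, fun i => ?_⟩
  have h1 := prob_eq hw i K A
  simp only [hAw] at h1
  rw [← h1]
  have h2 := le_Ex_cnt K A K .b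
  have h3 := potential_nonneg K A .b
  -- A word of `2 * K` letters has `K` positions with a full window. A typical one has excess at
  -- most 2(ε/16)(2K) = εK/4; an atypical one counts at most `2 * K`, with probability at most ε/8.
  -- With 7/3 ≤ εK/2 from the choice of `K`, the total is εK.
  have h4 : ∀ l : List Color, l.length = K + K →
      cnt K A l ≤ ε / 4 * K + 2 * K * ind (¬ Typical (ε / 16) l) := by
    intro l hl
    have hl' : (l.length : ℝ) = K + K := by exact_mod_cast hl
    by_cases ht : Typical (ε / 16) l
    · rw [ind_false (by simpa using ht), mul_zero, add_zero]
      classical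
      have h5 : cnt K A l = (((Finset.range l.length).filter fun i => i + K < l.length ∧
          A ((l.drop i).take (K + 1))).card : ℝ) := by
        rw [cnt_eq_sum, Finset.card_filter]
        push_cast
        refine Finset.sum_congr rfl fun i _ => ?_
        unfold ind
        split_ifs <;> rfl
      set T := (Finset.range l.length).filter fun i => i + K < l.length ∧
          A ((l.drop i).take (K + 1)) with hT
      have h6 : ∀ i ∈ T.map (Nat.castEmbedding (R := ℤ)), 0 ≤ i ∧ i < K ∧ U K (toWord l) i := by
        intro i hi
        obtain ⟨j, hj, rfl⟩ := Finset.mem_map.1 hi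
        rw [hT, Finset.mem_filter] at hj
        obtain ⟨-, hj1, hj2⟩ := hj
        rw [← window_toWord (by omega), hAw] at hj2
        exact ⟨Int.natCast_nonneg j, by simp only [Nat.castEmbedding_apply]; omega, hj2⟩
      rw [h5]
      rcases T.eq_empty_or_nonempty with hTe | hTn
      · rw [hTe]; simp; positivity
      · obtain ⟨a, b, h7, h8, h9, h10⟩ := hcard K (toWord l) _ h6 (by simpa using hTn)
        rw [Finset.card_map] at h10
        have h11 := ht.abs_excess_le x y h7 h8 (by rw [hl]; push_cast; linarith)
        have h12 : (T.card : ℝ) ≤ |(excess x y (toWord l) a b : ℝ)| := by exact_mod_cast h10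
        rw [hl'] at h11
        linarith
    · rw [ind_true ht]
      have := cnt_le K A l
      rw [hl'] at this
      have : 0 ≤ ε / 4 * K := by positivity
      linarith
  have h5 := Ex_mono (x := .b) h4
  rw [Ex_add, Ex_const, Ex_mul] at h5
  have h6 := hN₀ (K + K) (by have : N₀ ≤ K := by exact_mod_cast hK1
                             omega) .b
  have h7 : 2 * (K : ℝ) * Ex (K + K) .b (fun l => ind (¬ Typical (ε / 16) l)) ≤ 2 * K * (ε / 8) :=
    mul_le_mul_of_nonneg_left h6 (by positivity)
  have h8 : K * prob K A ≤ K * ε := by linarith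
  exact le_of_mul_le_mul_left h8 hK0

omit hw in
lemma openRight_congr {x y : Color} {w w' : ℤ → Color} {s s' : ℤ} {K : ℕ}
    (h : window w (s + 1) K = window w' (s' + 1) K) (h' : OpenRight x y K w s) :
    OpenRight x y K w' s' := by
  rw [window_eq_iff] at h
  intro m h1 h2
  have h3 := h' (s + (m - s')) (by omega) (by omega)
  have h4 := excess_shift x y w' s' 0 (m - s')
  have h5 := excess_shift x y w s 0 (m - s')
  rw [add_zero, add_sub_cancel] at h4
  rw [add_zero] at h5
  rw [← h4, ← excess_congr (w := fun a => w (s + a)), h5]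
  · exact h3
  · intro i h6 h7
    have h8 := h (i - 1).toNat (by omega)
    rw [show s + 1 + ((i - 1).toNat : ℕ) = s + i by omega,
      show s' + 1 + ((i - 1).toNat : ℕ) = s' + i by omega] at h8
    exact h8

omit hw in
lemma openLeft_congr {x y : Color} {w w' : ℤ → Color} {s s' : ℤ} {K : ℕ}
    (h : window w s K = window w' s' K) (h' : OpenLeft x y K w (s + K)) :
    OpenLeft x y K w' (s' + K) := by
  rw [window_eq_iff] at h
  intro m h1 h2
  have h3 := h' (s + (m - s')) (by omega) (by omega)
  have h4 := excess_shift x y w' s' (m - s') (K - 1)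
  have h5 := excess_shift x y w s (m - s') (K - 1)
  rw [add_sub_cancel] at h4
  rw [show s' + ((K : ℤ) - 1) = s' + K - 1 by ring] at h4
  rw [show s + ((K : ℤ) - 1) = s + K - 1 by ring] at h5
  rw [← h4, ← excess_congr (w := fun a => w (s + a)), h5]
  · exact h3
  · intro i h6 h7
    have h8 := h i.toNat (by omega)
    rwa [show s + (i.toNat : ℕ) = s + i by omega,
      show s' + (i.toNat : ℕ) = s' + i by omega] at h8

lemma exists_small_openRight {x y : Color} (hxy : x ≠ y) {ε : ℝ} (hε : 0 < ε) :
    ∃ K : ℕ, ∀ i, μ.real {ω | w ω i = x ∧ OpenRight x y K (w ω) i} ≤ ε := by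
  refine exists_small hw x y (fun K w i => w i = x ∧ OpenRight x y K w i) ?_ ?_ hε
  · rintro K w w' s s' h ⟨h1, h2⟩
    simp only [window, List.cons.injEq] at h
    exact ⟨by rw [← h.1, h1], openRight_congr h.2 h2⟩
  · intro K w S hS hne
    obtain ⟨a, b, h1, h2, h3, -, h4⟩ := card_openRight_le hxy (s := 0) S
      (fun i hi => ⟨(hS i hi).1, by have := (hS i hi).2.1; omega, (hS i hi).2.2⟩) hne
    have := (hS b h3).2.1
    exact ⟨a, b, by omega, h2.le, by omega, h4.trans (le_abs_self _)⟩

/-- `exists_small` wants windows that start at the marked position, so the open letter is put at the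
right end of the window, at distance `K`. -/
lemma exists_small_openLeft {x y : Color} (hxy : x ≠ y) {ε : ℝ} (hε : 0 < ε) :
    ∃ K : ℕ, ∀ i, μ.real {ω | w ω i = y ∧ OpenLeft x y K (w ω) i} ≤ ε := by
  obtain ⟨K, hK⟩ := exists_small hw x y (fun K w i => w (i + K) = y ∧ OpenLeft x y K w (i + K))
    (by
      rintro K w w' s s' h ⟨h1, h2⟩
      rw [window_succ', window_succ'] at h
      obtain ⟨h3, h4⟩ := List.append_inj' h rfl
      refine ⟨?_, openLeft_congr h3 h2⟩
      rw [← h1]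
      simpa using h4.symm)
    (by
      intro K w S hS hne
      obtain ⟨a, b, h1, h2, h3, -, h4⟩ := card_openLeft_le hxy (w := w) (s := K) (K := K)
        (S.map (addRightEmbedding (K : ℤ)))
        (fun i hi => by
          obtain ⟨j, hj, rfl⟩ := Finset.mem_map.1 hi
          obtain ⟨h5, h6, h7⟩ := hS j hj
          simp only [addRightEmbedding_apply]
          exact ⟨by omega, by omega, h7⟩) (by simpa using hne)
      obtain ⟨j, hj, rfl⟩ := Finset.mem_map.1 h3
      have := (hS j hj).2.1
      simp only [addRightEmbedding_apply] at *
      rw [Finset.card_map] at h4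
      exact ⟨a, j + K, by omega, h2.le, by omega, h4.trans (neg_le_abs _)⟩) hε
  refine ⟨K, fun i => ?_⟩
  have := hK (i - K)
  simpa only [sub_add_cancel] using this

omit hw [IsProbabilityMeasure μ] in
lemma ae_not_of_small {p : Ω → Prop} [IsFiniteMeasure μ] (h : ∀ ε > 0, μ.real {ω | p ω} ≤ ε) :
    ∀ᵐ ω ∂μ, ¬ p ω := by
  have h1 : μ.real {ω | p ω} = 0 := le_antisymm (le_of_forall_pos_le_add fun ε hε => by
    rw [zero_add]; exact h ε hε) measureReal_nonneg
  rw [measureReal_eq_zero_iff] at h1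
  rw [ae_iff]
  simpa using h1

lemma ae_exists_right {x y : Color} (hxy : x ≠ y) (i : ℤ) :
    ∀ᵐ ω ∂μ, w ω i = x → ∃ k, Bal x y (w ω) i k ∧ w ω k = y := by
  have := ae_not_of_small (μ := μ) (p := fun ω => w ω i = x ∧ ∀ m, i ≤ m → 0 ≤ excess x y (w ω) i m)
    fun ε hε => by
      obtain ⟨K, hK⟩ := exists_small_openRight hw hxy hε
      exact (measureReal_setOf_mono fun ω h => ⟨h.1, fun m h1 _ => h.2 m h1⟩).trans (hK i)
  filter_upwards [this] with ω h1 h2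
  push Not at h1
  obtain ⟨m, h3, h4⟩ := h1 h2
  have hne : m ≠ i := by rintro rfl; rw [excess_self] at h4; omega
  obtain ⟨k, h5, h6, -⟩ := exists_bal_right (x := x) (y := y) (w := w ω) (i := i) ⟨m, by omega, h4⟩
  exact ⟨k, h5, step_eq_neg_one h6⟩

lemma ae_exists_left {x y : Color} (hxy : x ≠ y) (i : ℤ) :
    ∀ᵐ ω ∂μ, w ω i = y → ∃ k, Bal x y (w ω) k i ∧ w ω k = x := by
  have := ae_not_of_small (μ := μ)
    (p := fun ω => w ω i = y ∧ ∀ m, m < i → excess x y (w ω) m (i - 1) ≤ 0)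
    fun ε hε => by
      obtain ⟨K, hK⟩ := exists_small_openLeft hw hxy hε
      exact (measureReal_setOf_mono fun ω h => ⟨h.1, fun m _ h1 => h.2 m h1⟩).trans (hK i)
  filter_upwards [this] with ω h1 h2
  push Not at h1
  obtain ⟨m, h3, h4⟩ := h1 h2
  obtain ⟨k, h5, h6, -⟩ := exists_bal_left (x := x) (y := y) (w := w ω) (i := i) ⟨m, h3, h4⟩
  exact ⟨k, h5, step_eq_one h6⟩

/-- The counting argument concerns an unmatched g. It carries over to b because the chain continues
after b as it does after g. -/
lemma ae_exists_up_b (i : ℤ) : ∀ᵐ ω ∂μ, w ω i = .b → ∃ k, Up (w ω) i k := by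
  have := ae_not_of_small (μ := μ)
    (p := fun ω => w ω i = .b ∧ ∀ m, i ≤ m → 0 ≤ excess .g .b (w ω) i m)
    fun ε hε => by
      obtain ⟨K, hK⟩ := exists_small_openRight hw (x := .g) (y := .b) (by decide) hε
      have h1 := law_future_b_eq_g hw i K fun l => OpenRight .g .b K (toWord l) (-1)
      have h2 : ∀ w : ℤ → Color, OpenRight .g .b K (toWord (window w (i + 1) K)) (-1) ↔
          OpenRight .g .b K w i := fun w =>
        ⟨openRight_congr (window_toWord_window w (i + 1) K),
          openRight_congr (window_toWord_window w (i + 1) K).symm⟩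
      simp only [h2] at h1
      exact (measureReal_setOf_mono fun ω h => ⟨h.1, fun m h1 _ => h.2 m h1⟩).trans (h1.le.trans (hK i))
  filter_upwards [this] with ω h1 h2
  push Not at h1
  obtain ⟨m, h3, h4⟩ := h1 h2
  have hne : m ≠ i := by rintro rfl; rw [excess_self] at h4; omega
  obtain ⟨k, h5, h6, -⟩ := exists_bal_right (x := .g) (y := .b) (w := w ω) (i := i) ⟨m, by omega, h4⟩
  exact ⟨k, h5, step_eq_neg_one h6⟩

/-- The past of a g is distributed like that of an r, for which the counting argument applies. -/
lemma ae_exists_dn_g (i : ℤ) : ∀ᵐ ω ∂μ, w ω i = .g → ∃ k, Dn (w ω) i k := by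
  have := ae_not_of_small (μ := μ)
    (p := fun ω => w ω i = .g ∧ ∀ m, m < i → excess .b .r (w ω) m (i - 1) ≤ 0)
    fun ε hε => by
      obtain ⟨K, hK⟩ := exists_small_openLeft hw (x := .b) (y := .r) (by decide) hε
      have h1 := law_past_g_eq_r hw (i - K) K fun l => OpenLeft .b .r K (toWord l) (0 + K)
      have h2 : ∀ w : ℤ → Color, OpenLeft .b .r K (toWord (window w (i - K) K)) (0 + K) ↔
          OpenLeft .b .r K w (i - K + K) := fun w =>
        ⟨openLeft_congr (window_toWord_window w (i - K) K),
          openLeft_congr (window_toWord_window w (i - K) K).symm⟩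
      simp only [h2, sub_add_cancel] at h1
      exact (measureReal_setOf_mono fun ω h => ⟨h.1, fun m _ h1 => h.2 m h1⟩).trans (h1.le.trans (hK i))
  filter_upwards [this] with ω h1 h2
  push Not at h1
  obtain ⟨m, h3, h4⟩ := h1 h2
  obtain ⟨k, h5, h6, -⟩ := exists_bal_left (x := .b) (y := .r) (w := w ω) (i := i) ⟨m, h3, h4⟩
  exact ⟨k, h5, step_eq_one h6⟩

/-- In a typical word without g, the letters b and r would each make up at most a quarter of the
letters. -/
lemma exists_small_no_g {ε : ℝ} (hε : 0 < ε) :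
    ∃ K : ℕ, ∀ i : ℤ, μ.real {ω | ∀ a : ℕ, a < K + 1 → w ω (i + a) ≠ .g} ≤ ε := by
  obtain ⟨N₀, hN₀⟩ := exists_typical (ε := 1 / 4) (by norm_num) hε
  refine ⟨N₀ + 1, fun i => ?_⟩
  have h1 := law_window hw i (N₀ + 1) fun l => l.count .g = 0
  have h2 : ∀ x, Ex (N₀ + 1) x (fun l => ind ((x :: l).count .g = 0)) ≤ ε := by
    intro x
    refine (Ex_mono fun l hl => ind_mono fun h ht => ?_).trans (hN₀ (N₀ + 1) (by omega) x)
    have h3 : l.count .g = 0 := by rw [List.count_cons] at h; omega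
    have h4 := ht l.length le_rfl .b .g
    have h5 := ht l.length le_rfl .r .g
    rw [List.take_length, h3] at h4 h5
    have h6 : (l.length : ℝ) = l.count .b + l.count .r + l.count .g := by
      exact_mod_cast length_eq_count l
    have h7 : (0 : ℝ) < l.length := by rw [hl]; positivity
    rw [h3] at h6
    push_cast at h4 h5 h6
    linarith
  have h3 : ∑ x, Ex (N₀ + 1) x (fun l => ind ((x :: l).count .g = 0)) ≤ 3 * ε := by
    rw [sum_color]; linarith [h2 .b, h2 .r, h2 .g]
  refine le_trans (measureReal_setOf_mono fun ω h => ?_) (h1.le.trans (by linarith))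
  rw [List.count_eq_zero]
  intro hg
  obtain ⟨n, h4, h5⟩ := List.getElem_of_mem hg
  rw [getElem_window] at h5
  rw [length_window] at h4
  exact h n h4 h5

lemma ae_exists_g_left (i : ℤ) : ∀ᵐ ω ∂μ, ∃ j, j < i ∧ w ω j = .g := by
  have := ae_not_of_small (μ := μ) (p := fun ω => ∀ j, j < i → w ω j ≠ .g) fun ε hε => by
    obtain ⟨K, hK⟩ := exists_small_no_g hw hε
    exact (measureReal_setOf_mono fun ω h a h1 => h _ (by push_cast; omega)).trans (hK (i - (K + 1 : ℕ)))
  filter_upwards [this] with ω h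
  push Not at h
  exact h

lemma ae_exists_g_right (i : ℤ) : ∀ᵐ ω ∂μ, ∃ j, i ≤ j ∧ w ω j = .g := by
  have := ae_not_of_small (μ := μ) (p := fun ω => ∀ j, i ≤ j → w ω j ≠ .g) fun ε hε => by
    obtain ⟨K, hK⟩ := exists_small_no_g hw hε
    exact (measureReal_setOf_mono fun ω h a h1 => h _ (by omega)).trans (hK i)
  filter_upwards [this] with ω h
  push Not at h
  exact h

/-- Almost surely, all edges of the infinite graph exist. -/
lemma ae_nice : ∀ᵐ ω ∂μ, Nice (w ω) := by
  have h1 := ae_all_iff.2 fun i => ae_exists_right hw (x := .g) (y := .b) (by decide) i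
  have h2 := ae_all_iff.2 fun i => ae_exists_left hw (x := .b) (y := .r) (by decide) i
  have h3 := ae_all_iff.2 fun i => ae_exists_left hw (x := .g) (y := .b) (by decide) i
  have h4 := ae_all_iff.2 fun i => ae_exists_right hw (x := .b) (y := .r) (by decide) i
  have h5 := ae_all_iff.2 fun i => ae_exists_up_b hw i
  have h6 := ae_all_iff.2 fun i => ae_exists_dn_g hw i
  have h7 := ae_all_iff.2 fun i => ae_exists_g_left hw i
  have h8 := ae_all_iff.2 fun i => ae_exists_g_right hw i
  filter_upwards [h1, h2, h3, h4, h5, h6, h7, h8] with ω h1 h2 h3 h4 h5 h6 h7 h8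
  have g3 : ∀ v, w ω v = .b → ∃ p, w ω p = .g ∧ Up (w ω) p v := fun v hv => by
    obtain ⟨p, hp, hp'⟩ := h3 v hv
    exact ⟨p, hp', hp, hv⟩
  have g4 : ∀ v, w ω v = .b → ∃ q, w ω q = .r ∧ Dn (w ω) q v := fun v hv => by
    obtain ⟨q, hq, hq'⟩ := h4 v hv
    exact ⟨q, hq', hq, hv⟩
  have he : ∀ i, ∃ t h, EdgeAt (w ω) i t h := by
    intro i
    rcases hi : w ω i with _ | _ | _
    · obtain ⟨k, hk⟩ := h5 i hi
      exact ⟨i, k, (edgeAt_b hi).2 ⟨rfl, hk⟩⟩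
    · obtain ⟨j, hj, hj'⟩ := h2 i hi
      obtain ⟨p, ⟨hp, hp'⟩, hp''⟩ := Int.exists_least_of_bdd (P := fun k => i ≤ k ∧ w ω k = .g)
        ⟨i, fun z hz => hz.1⟩ (h8 i)
      obtain ⟨k, hk, hk'⟩ := h1 p hp'
      exact ⟨j, k, (edgeAt_r hi).2 ⟨⟨hj, hj'⟩, p, ⟨hp, hp', fun a h9 h10 h11 => by
        have := hp'' a ⟨h9, h11⟩; omega⟩, hk, hk'⟩⟩
    · obtain ⟨k, hk, hk'⟩ := h1 i hi
      obtain ⟨j, hj⟩ := h6 i hi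
      exact ⟨k, j, (edgeAt_g hi).2 ⟨⟨hk, hk'⟩, hj⟩⟩
  -- First passages are edges because every b has a gb partner and a br partner. The converse
  -- follows from uniqueness of the edge of a letter, since a first-passage edge exists.
  have hE : ∀ {i t h}, EdgeAt (w ω) i t h → IsEdge (w ω) i t h := fun H =>
    H.isEdge (fun _ => g3 _ H.color.2) (fun _ => g4 _ H.color.2)
  refine ⟨fun i t h => ⟨fun H => ?_, hE⟩, he, g3, g4, h7⟩
  obtain ⟨t', h', H'⟩ := he i
  obtain ⟨rfl, rfl⟩ := H.unique (hE H')
  exact H'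

end Small

end SchnyderWood
namespace SchnyderWood

/-! ### The number of words of wooded triangulations -/

/-- There is no letter `r` followed by a letter `b`. -/
def Legal (l : List Color) : Prop := l.IsChain fun x y => x = .r → y ≠ .b

lemma legal_cons_cons {x y : Color} {l : List Color} :
    Legal (x :: y :: l) ↔ (x = .r → y ≠ .b) ∧ Legal (y :: l) := List.isChain_cons_cons

lemma transition_eq_zero {x y : Color} (h : ¬ (x = .r → y ≠ .b)) : transition x y = 0 := by
  revert h
  cases x <;> cases y <;> simp [transition]

lemma le_transition {x y : Color} (h : x = .r → y ≠ .b) : 1 / 4 ≤ transition x y := by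
  revert h
  cases x <;> cases y <;> simp only [transition] <;> norm_num

lemma Ex_mono_legal {m : ℕ} {x : Color} {F G : List Color → ℝ}
    (h : ∀ l, l.length = m → Legal (x :: l) → F l ≤ G l) : Ex m x F ≤ Ex m x G := by
  induction m generalizing x F G with
  | zero => exact h [] rfl (List.isChain_singleton _)
  | succ m ih =>
    refine Finset.sum_le_sum fun y _ => ?_
    by_cases hxy : x = .r → y ≠ .b
    · exact mul_le_mul_of_nonneg_left
        (ih fun l hl hl' => h _ (by simp [hl]) (legal_cons_cons.2 ⟨hxy, hl'⟩)) (transition_nonneg x y)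
    · rw [transition_eq_zero hxy, zero_mul, zero_mul]

/-- Prescribing a legal letter costs a factor of at least 1/4, the least positive transition
probability. -/
lemma le_Ex_append {m : ℕ} {x : Color} {F : List Color → ℝ} (v : List Color)
    (hv : Legal (x :: v)) (hF : ∀ l, 0 ≤ F l) :
    (1 / 4) ^ v.length * Ex m (v.getLastD x) (fun l => F (v ++ l)) ≤ Ex (v.length + m) x F := by
  induction v generalizing x F with
  | nil => simp
  | cons y v ih =>
    rw [legal_cons_cons] at hv
    have h1 := ih (F := fun l => F (y :: l)) hv.2 fun l => hF _
    rw [List.length_cons, Nat.succ_add, Ex, List.getLastD_cons, pow_succ']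
    refine le_trans ?_ (Finset.single_le_sum (f := fun y => transition x y *
      Ex (v.length + m) y fun l => F (y :: l)) (fun y _ => mul_nonneg (transition_nonneg _ _)
        (Ex_nonneg fun l _ => hF _)) (Finset.mem_univ y))
    rw [mul_assoc]
    exact mul_le_mul (le_transition hv.1) h1
      (mul_nonneg (by positivity) (Ex_nonneg fun l _ => hF _)) (transition_nonneg _ _)

lemma le_Ex {x : Color} {F : List Color → ℝ} (v : List Color)
    (hv : Legal (x :: v)) (hF : ∀ l, 0 ≤ F l) : (1 / 4) ^ v.length * F v ≤ Ex v.length x F := by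
  simpa [Ex] using le_Ex_append (m := 0) v hv hF

/-- The two walks of the word `l`, started at `a` and `c` after the letter `x`, stay nonnegative and
end at `0`, and no letter `r` is followed by a letter `b`. -/
def Ok : ℤ → ℤ → Color → List Color → Prop
  | a, c, _, [] => a = 0 ∧ c = 0
  | a, c, x, y :: l => (x = .r → y ≠ .b) ∧ 0 ≤ a + step .g .b y ∧ 0 ≤ c + step .b .r y ∧
      Ok (a + step .g .b y) (c + step .b .r y) y l

lemma Ok.legal {a c : ℤ} {x : Color} {l : List Color} (h : Ok a c x l) : Legal (x :: l) := by
  induction l generalizing a c x with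
  | nil => exact List.isChain_singleton _
  | cons y l ih => exact legal_cons_cons.2 ⟨h.1, ih h.2.2.2⟩

lemma Ok.congr {a c : ℤ} {x y : Color} {l : List Color} (h : Ok a c x l) (hy : y ≠ .r) :
    Ok a c y l := by
  cases l with
  | nil => exact h
  | cons z l => exact ⟨fun h => absurd h hy, h.2⟩

lemma count_sub_cons (x y z : Color) (l : List Color) :
    ((z :: l).count x : ℤ) - (z :: l).count y = step x y z + (l.count x - l.count y) := by
  unfold step
  simp only [List.count_cons, beq_iff_eq]
  push_cast
  ring

lemma Ok.nonneg {a c : ℤ} {x : Color} {l : List Color} (h : Ok a c x l) (ha : 0 ≤ a) (hc : 0 ≤ c)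
    (n : ℕ) : 0 ≤ a + ((l.take n).count .g - (l.take n).count .b) ∧
      0 ≤ c + ((l.take n).count .b - (l.take n).count .r) := by
  induction l generalizing a c x n with
  | nil => simpa using ⟨ha, hc⟩
  | cons y l ih =>
    cases n with
    | zero => simpa using ⟨ha, hc⟩
    | succ n =>
      rw [List.take_succ_cons, count_sub_cons, count_sub_cons, ← add_assoc, ← add_assoc]
      exact ih h.2.2.2 h.2.1 h.2.2.1 n

lemma Ok.count {a c : ℤ} {x : Color} {l : List Color} (h : Ok a c x l) :
    a + (l.count .g - l.count .b) = 0 ∧ c + (l.count .b - l.count .r) = 0 := by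
  induction l generalizing a c x with
  | nil => simp [h.1, h.2]
  | cons y l ih =>
    rw [count_sub_cons, count_sub_cons, ← add_assoc, ← add_assoc]
    exact ih h.2.2.2

lemma Ok.append {a c : ℤ} {x : Color} {u l : List Color} (hu : Legal (x :: u))
    (hn : ∀ n ≤ u.length, 0 ≤ a + ((u.take n).count .g - (u.take n).count .b) ∧
      0 ≤ c + ((u.take n).count .b - (u.take n).count .r))
    (h : Ok (a + (u.count .g - u.count .b)) (c + (u.count .b - u.count .r)) (u.getLastD x) l) :
    Ok a c x (u ++ l) := by
  induction u generalizing a c x with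
  | nil => simpa using h
  | cons y u ih =>
    rw [legal_cons_cons] at hu
    have h1 := hn 1 (by simp)
    rw [List.take_succ_cons, List.take_zero, count_sub_cons, count_sub_cons] at h1
    simp only [List.count_nil, Nat.cast_zero, sub_zero, add_zero] at h1
    refine ⟨hu.1, h1.1, h1.2, ih hu.2 (fun n hn' => ?_) ?_⟩
    · have h2 := hn (n + 1) (by simpa using hn')
      rw [List.take_succ_cons, count_sub_cons, count_sub_cons, ← add_assoc, ← add_assoc] at h2
      exact h2
    · rw [count_sub_cons, count_sub_cons, ← add_assoc, ← add_assoc, List.getLastD_cons] at h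
      exact h

lemma toWord_pred (l : List Color) {i : ℕ} (h : i < (Color.b :: l).length) :
    toWord l ((i : ℤ) - 1) = (Color.b :: l)[i] := by
  cases i with
  | zero => exact toWord_start l
  | succ i =>
    rw [List.length_cons] at h
    push_cast
    rw [add_sub_cancel_right, toWord_apply l (by omega), List.getElem_cons_succ]

/-- The states of `Ok` are the two walks from `-1` on. The r at `M` is legal after any letter, and
the other framing letters move the gb walk to 1, 0 and then first to -1 at the last b. -/
lemma Ok.mem_words {l : List Color} {n : ℕ} (h : Ok 0 0 .b l) (hl : l.length = 3 * n) :
    l ∈ words n := by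
  have F := framed_toWord l
  have hn := h.nonneg le_rfl le_rfl
  have hc := h.count
  have he : ∀ x y : Color, ∀ m : ℤ, -1 ≤ m → m < l.length → excess x y (toWord l) (-1) m =
      (l.take (m + 1).toNat).count x - (l.take (m + 1).toNat).count y := by
    intro x y m h1 h2
    rw [← excess_toWord x y l (by omega)]
    congr 1
    omega
  have hfull : ∀ x y : Color, excess x y (toWord l) (-1) (l.length - 1) =
      l.count x - l.count y := by
    intro x y
    rw [excess_toWord x y l le_rfl, List.take_length]
  have hM := toWord_finish l
  have hgb : ∀ m : ℤ, -1 ≤ m → m < l.length → 0 ≤ excess .g .b (toWord l) (-1) m := fun m h1 h2 => by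
    rw [he _ _ m h1 h2]; have := (hn (m + 1).toNat).1; omega
  have h0 : excess .g .b (toWord l) (-1) l.length = 0 := by
    rw [excess_last (by omega), hM, hfull]
    have := hc.1
    simp [step]; omega
  have h1 : excess .g .b (toWord l) (-1) (l.length + 1) = 1 := by
    rw [excess_last (by omega), add_sub_cancel_right, h0, F.g]; simp [step]
  have h2 : excess .g .b (toWord l) (-1) (l.length + 2) = 0 := by
    rw [excess_last (by omega), show (l.length : ℤ) + 2 - 1 = l.length + 1 by ring, h1, F.b]
    simp [step]
  refine ⟨hl, F, Int.natCast_nonneg _, toWord_start l, hM, fun i hi1 hi2 => ?_,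
    ⟨⟨by omega, fun m h1 h2 => ?_, ?_⟩, toWord_start l⟩, ⟨⟨by omega, fun m h3 h4 => ?_, ?_⟩, F.b'⟩⟩
  · have hlg := List.isChain_iff_getElem.1 h.legal
    obtain ⟨j, rfl⟩ : ∃ j : ℕ, i = j - 1 := ⟨(i + 1).toNat, by omega⟩
    rcases eq_or_ne (j : ℤ) l.length with hj | hj
    · rw [sub_add_cancel, hj, hM]; simp
    · have := hlg j (by rw [List.length_cons]; omega)
      rw [← toWord_pred, ← toWord_pred] at this
      push_cast at this
      rw [add_sub_cancel_right] at this
      rwa [sub_add_cancel]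
  · rw [he _ _ m h1 h2]; have := (hn (m + 1).toNat).2; omega
  · rw [hfull]; have := hc.2; omega
  · rcases lt_or_ge m l.length with h | h
    · exact hgb m h3 h
    · obtain rfl | rfl | rfl : m = l.length ∨ m = l.length + 1 ∨ m = l.length + 2 := by omega
      all_goals omega
  · rw [show (l.length : ℤ) + 3 - 1 = l.length + 2 by ring, h2]

lemma legal_of_mem_words {l : List Color} {n : ℕ} (h : l ∈ words n) : Legal (.b :: l) := by
  refine List.isChain_iff_getElem.2 fun i hi => ?_
  rw [List.length_cons] at hi
  have h1 := h.2.not_rb (i - 1) (by omega) (by omega)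
  rw [sub_add_cancel, show (i : ℤ) = ((i + 1 : ℕ) : ℤ) - 1 by push_cast; ring] at h1
  push_cast at h1
  rw [add_sub_cancel_right, toWord_pred l (by rw [List.length_cons]; omega)] at h1
  rw [← toWord_pred l (i := i + 1) (by rw [List.length_cons]; omega)]
  push_cast
  rwa [add_sub_cancel_right]

lemma count_of_mem_words {l : List Color} {n : ℕ} (h : l ∈ words n) (x : Color) : l.count x = n := by
  have h1 := h.2.excess_br_eq_zero
  have h2 := h.2.excess_gb_eq_zero
  rw [excess_toWord _ _ l le_rfl, List.take_length] at h1 h2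
  have h3 := length_eq_count l
  rw [h.1] at h3
  cases x <;> omega

/-! #### Equal weights -/

/-- The harmonic function in the weights of the words. -/
noncomputable def harm : Color → ℝ
  | .r => 2
  | _ => 1

lemma harm_pos (x : Color) : 0 < harm x := by cases x <;> simp [harm]

lemma harm_le (x : Color) : harm x ≤ 2 := by cases x <;> simp [harm]

lemma one_le_harm (x : Color) : 1 ≤ harm x := by cases x <;> simp [harm]

/-- For a legal pair, the transition from x to y is `harm x / harm y` times 1/2, 1/2 or 1/4, for y =
b, r, g. The ratios telescope, so the probability depends only on the letter counts and the two end
letters. -/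
lemma Ex_eq_word {v : List Color} {x : Color} (hv : Legal (x :: v)) :
    Ex v.length x (fun l => ind (l = v)) = harm x / harm (v.getLastD x) *
      ((1 / 2) ^ v.count .b * (1 / 2) ^ v.count .r * (1 / 4) ^ v.count .g) := by
  induction v generalizing x with
  | nil =>
    have := (harm_pos x).ne'
    simp [Ex, ind_true, this]
  | cons y v ih =>
    rw [legal_cons_cons] at hv
    rw [List.length_cons, Ex, Finset.sum_eq_single y]
    · have h1 : ∀ l, ind (y :: l = y :: v) = ind (l = v) := fun l => by
        congr 1; rw [List.cons.injEq]; simp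
      simp only [h1]
      rw [ih hv.2, List.getLastD_cons]
      have h2 := (harm_pos (v.getLastD y)).ne'
      rw [div_mul_eq_mul_div, div_mul_eq_mul_div, ← mul_div_assoc]
      congr 1
      have h3 := hv.1
      cases x <;> cases y <;> simp [harm, transition, pow_succ] at h3 ⊢ <;> ring
    · intro z _ hz
      have h1 : ∀ l, ind (z :: l = y :: v) = 0 := fun l =>
        ind_false fun h => hz (List.cons.inj h).1
      simp only [h1, Ex_const, mul_zero]
    · simp

lemma Ex_mem (m : ℕ) (x : Color) (V : Finset (List Color)) :
    Ex m x (fun l => ind (l ∈ V)) = ∑ v ∈ V, Ex m x fun l => ind (l = v) := by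
  classical
  rw [← Ex_sum]
  refine Ex_congr fun l _ => ?_
  by_cases h : l ∈ V
  · rw [ind_true h, Finset.sum_eq_single l, ind_true rfl]
    · exact fun v _ hv => ind_false hv.symm
    · exact fun h' => absurd h h'
  · rw [ind_false h, Finset.sum_eq_zero]
    exact fun v hv => ind_false fun h' => h (h' ▸ hv)

/-- Each letter occurs `n` times and the walk starts after b, so only the last letter matters; its
harmonic value is 1 or 2. -/
lemma weight_bounds {n : ℕ} {v : List Color} (hv : v ∈ words n) :
    1 / 2 * ((1 / 2) ^ n * (1 / 2) ^ n * (1 / 4) ^ n) ≤ Ex (3 * n) .b (fun l => ind (l = v)) ∧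
    Ex (3 * n) .b (fun l => ind (l = v)) ≤ (1 / 2) ^ n * (1 / 2) ^ n * (1 / 4) ^ n := by
  have h := Ex_eq_word (legal_of_mem_words hv)
  rw [hv.1] at h
  simp only [count_of_mem_words hv] at h
  rw [h]
  have h1 := harm_pos (v.getLastD .b)
  have h2 : 1 / 2 ≤ harm .b / harm (v.getLastD .b) := by
    have := harm_le (v.getLastD .b)
    rw [div_le_div_iff₀ (by norm_num) h1]; simp only [harm] at *; linarith
  have h3 : harm .b / harm (v.getLastD .b) ≤ 1 := by
    rw [div_le_one h1]; exact one_le_harm _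
  have h4 : (0 : ℝ) ≤ (1 / 2) ^ n * (1 / 2) ^ n * (1 / 4) ^ n := by positivity
  exact ⟨mul_le_mul_of_nonneg_right h2 h4, mul_le_of_le_one_left h4 h3⟩

/-- All words of wooded triangulations have almost the same probability. -/
lemma card_mul_Ex_le {n : ℕ} {V W : Finset (List Color)} (hW : ↑W = words n) (hV : V ⊆ W) :
    V.card * Ex (3 * n) .b (fun l => ind (l ∈ W)) ≤
      2 * W.card * Ex (3 * n) .b (fun l => ind (l ∈ V)) := by
  set q : ℝ := (1 / 2) ^ n * (1 / 2) ^ n * (1 / 4) ^ n with hq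
  have hmem : ∀ v ∈ W, v ∈ words n := fun v hv => by rw [← hW]; exact hv
  have h1 : Ex (3 * n) .b (fun l => ind (l ∈ W)) ≤ W.card * q := by
    rw [Ex_mem, ← nsmul_eq_mul]
    exact Finset.sum_le_card_nsmul _ _ _ fun v hv => (weight_bounds (hmem v hv)).2
  have h2 : V.card * (1 / 2 * q) ≤ Ex (3 * n) .b (fun l => ind (l ∈ V)) := by
    rw [Ex_mem, ← nsmul_eq_mul]
    exact Finset.card_nsmul_le_sum _ _ _ fun v hv => (weight_bounds (hmem v (hV hv))).1
  calc (V.card : ℝ) * Ex (3 * n) .b (fun l => ind (l ∈ W))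
      ≤ V.card * (W.card * q) := mul_le_mul_of_nonneg_left h1 (Nat.cast_nonneg _)
    _ = 2 * W.card * (V.card * (1 / 2 * q)) := by ring
    _ ≤ _ := mul_le_mul_of_nonneg_left h2 (by positivity)

/-! #### A lower bound for the probability of the words -/

/-- The block gbr returns to the state (0, 0) and is legal after any letter, so it fills up any
length divisible by 3. The next two lemmas prepend r to lower the second height, and then b to trade
the first height for the second. -/
lemma exists_ok_zero_zero (t : ℕ) (x : Color) : ∃ v : List Color, v.length = 3 * t ∧ Ok 0 0 x v := by
  induction t generalizing x with
  | zero => exact ⟨[], rfl, rfl, rfl⟩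
  | succ t ih =>
    obtain ⟨v, hv, hv'⟩ := ih .r
    exact ⟨.g :: .b :: .r :: v, by simp [hv]; omega, by simpa [Ok, step] using hv'⟩

lemma exists_ok_zero (c t : ℕ) (x : Color) :
    ∃ v : List Color, v.length = c + 3 * t ∧ Ok 0 c x v := by
  induction c generalizing x with
  | zero => simpa using exists_ok_zero_zero t x
  | succ c ih =>
    obtain ⟨v, hv, hv'⟩ := ih .r
    exact ⟨.r :: v, by simp [hv]; omega, by simpa [Ok, step] using hv'⟩

lemma exists_ok (a c t : ℕ) {x : Color} (hx : x ≠ .r) :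
    ∃ v : List Color, v.length = 2 * a + c + 3 * t ∧ Ok a c x v := by
  induction a generalizing c x with
  | zero => simpa using exists_ok_zero c t x
  | succ a ih =>
    obtain ⟨v, hv, hv'⟩ := ih (c + 1) (x := .b) (by decide)
    refine ⟨.b :: v, by simp [hv]; omega, ?_⟩
    push_cast at hv'
    have : (0 : ℤ) ≤ c + 1 := by positivity
    simpa [Ok, step, hx, this] using hv'

/-- Every state is completed by a word of prescribed length. -/
lemma exists_ok_of_length {a c : ℤ} {m : ℕ} (ha : 0 ≤ a) (hc : 0 ≤ c) (hm : 2 * a + c + 3 ≤ m)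
    (hd : (3 : ℤ) ∣ m - 2 * a - c) (x : Color) : ∃ v : List Color, v.length = m ∧ Ok a c x v := by
  lift a to ℕ using ha
  lift c to ℕ using hc
  obtain ⟨t, ht⟩ := hd
  -- A leading g makes the word legal even if the preceding letter is r; it raises the first height
  -- by one and replaces one block of three letters.
  obtain ⟨v, hv, hv'⟩ := exists_ok (a + 1) c (t - 1).toNat (x := .g) (by decide)
  refine ⟨.g :: v, by rw [List.length_cons, hv]; omega, ?_⟩
  push_cast at hv'
  have : (0 : ℤ) ≤ a + 1 := by positivity
  simpa [Ok, step, this] using hv'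

lemma Ok.replicate_g {a c : ℤ} {l : List Color} (n : ℕ) (ha : 0 ≤ a) (hc : 0 ≤ c)
    (h : Ok (a + n) c .b l) {x : Color} (hx : x ≠ .r) : Ok a c x (List.replicate n .g ++ l) := by
  induction n generalizing a x with
  | zero => simp only [Nat.cast_zero, add_zero] at h; exact h.congr hx
  | succ n ih =>
    have h1 := ih (a := a + 1) (by omega) (by push_cast at h; rw [add_assoc, add_comm 1]; exact h)
      (x := .g) (by decide)
    rw [List.replicate_succ, List.cons_append]
    refine ⟨by simp, ?_, ?_, ?_⟩ <;> simp [step]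
    · omega
    · exact hc
    · exact h1

lemma Ok.replicate_b {a c : ℤ} {l : List Color} (n : ℕ) (ha : 0 ≤ a) (hc : 0 ≤ c)
    (h : Ok a (c + n) .b l) {x : Color} (hx : x ≠ .r) :
    Ok (a + n) c x (List.replicate n .b ++ l) := by
  induction n generalizing c x with
  | zero => simp only [Nat.cast_zero, add_zero] at h ⊢; exact h.congr hx
  | succ n ih =>
    have h1 := ih (c := c + 1) (by omega) (by push_cast at h; rw [add_assoc, add_comm 1]; exact h)
      (x := .b) (by decide)
    rw [List.replicate_succ, List.cons_append]
    refine ⟨fun h => absurd h hx, ?_, ?_, ?_⟩ <;> simp [step]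
    · omega
    · omega
    · convert h1 using 1
      ring

/-- Both walks are lifted to height `K`, a typical word keeps them nonnegative, and a forced word
brings them back to 0. Only the `9 * K + 3` forced letters are paid for. -/
lemma le_Ex_words {n N K : ℕ} (hK : 0 < K) (hN : 3 * n = N + 9 * K + 3) {ε : ℝ}
    (hε : ε * N ≤ K) :
    (1 / 4) ^ (9 * K + 3) * Ex N .b (fun l => ind (Typical ε l)) ≤
      Ex (3 * n) .b fun l => ind (l ∈ words n) := by
  -- After `2 * K` letters g and `K` letters b both heights are `K`. The g come first because b
  -- lowers the gb walk.
  set v := List.replicate (2 * K) Color.g ++ List.replicate K Color.b with hv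
  have hvl : v.length = 3 * K := by simp [hv]; omega
  have hlast : v.getLastD .b = .b := by
    obtain ⟨k, rfl⟩ := Nat.exists_eq_succ_of_ne_zero hK.ne'
    rw [hv, List.replicate_succ' (n := k), ← List.append_assoc, List.getLastD_concat]
  have hok : ∀ l, Ok K K .b l → Ok 0 0 .b (v ++ l) := by
    intro l h
    rw [hv, List.append_assoc]
    refine Ok.replicate_g _ le_rfl le_rfl ?_ (by decide)
    have := Ok.replicate_b (a := K) (c := 0) (l := l) K (by omega) le_rfl (by simpa using h)
      (x := .b) (by decide)
    convert this using 1
    push_cast; ring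
  have hleg : Legal (.b :: v) := by
    obtain ⟨t, ht, ht'⟩ := exists_ok_of_length (a := K) (c := K) (m := 3 * K + 3) (by omega)
      (by omega) (by omega) ⟨1, by push_cast; ring⟩ .b
    have h1 := (hok t ht').legal
    rw [← List.cons_append] at h1
    exact (List.isChain_append.1 h1).1
  have h1 := le_Ex_append (m := N + (6 * K + 3)) (F := fun l => ind (l ∈ words n)) v hleg
    fun _ => ind_nonneg _
  rw [hlast, hvl, show 3 * K + (N + (6 * K + 3)) = 3 * n by omega] at h1
  refine le_trans ?_ h1
  rw [Ex_append, show 9 * K + 3 = 3 * K + (6 * K + 3) by ring, pow_add, mul_assoc, ← Ex_mul]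
  refine mul_le_mul_of_nonneg_left (Ex_mono_legal fun u hu hleg' => ?_) (by positivity)
  by_cases ht : Typical ε u
  · have hcount : ∀ m ≤ u.length, ∀ x y, ((u.take m).count x : ℤ) - (u.take m).count y ≤ K := by
      intro m hm x y
      have := ht m hm x y
      rw [hu] at this
      rw [← @Int.cast_le ℝ]
      push_cast
      exact this.trans hε
    have hfull := hcount u.length le_rfl
    rw [List.take_length] at hfull
    have hlen := length_eq_count u
    have e1 := hfull .b .g
    have e2 := hfull .r .b
    have e3 := hfull .b .r
    have e4 := hfull .g .b
    -- The length `6 * K + 3` suffices for every end state of a typical word, and the divisibility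
    -- by 3 follows from the total length `3 * n`.
    obtain ⟨t, ht1, ht2⟩ := exists_ok_of_length (a := K + (u.count .g - u.count .b))
      (c := K + (u.count .b - u.count .r)) (m := 6 * K + 3) (by omega) (by omega)
      (by have := hfull .g .r; push_cast; omega) (by push_cast; omega) (u.getLastD .b)
    have h2 : Ok K K .b (u ++ t) := by
      refine Ok.append hleg' (fun m hm => ?_) ht2
      have := hcount m hm .b .g
      have := hcount m hm .r .b
      omega
    have h3 : v ++ (u ++ t) ∈ words n := (hok _ h2).mem_words (by simp [hvl, hu, ht1]; omega)
    have h4 := le_Ex (F := fun l' => ind (v ++ (u ++ l') ∈ words n)) t ht2.legal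
      fun _ => ind_nonneg _
    rw [ht1, ind_true h3] at h4
    rwa [ind_true ht]
  · rw [ind_false ht, mul_zero]
    exact Ex_nonneg fun _ _ => ind_nonneg _

/-- The probability of the words of wooded triangulations does not decay exponentially. -/
lemma exists_le_Ex_words {ε : ℝ} (hε : 0 < ε) : ∃ C > 0, ∃ n₀ : ℕ, ∀ n ≥ n₀,
    C * Real.exp (-ε * n) ≤ Ex (3 * n) .b fun l => ind (l ∈ words n) := by
  -- The height is about δn. The forced letters cost at most exp(-18K - 6), since 1/4 ≥ exp(-2), so
  -- δ ≤ ε/18 suffices; δ ≤ 1/10 leaves room for the typical part.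
  obtain ⟨δ, hδ, hδ1, hδ2⟩ : ∃ δ > 0, δ ≤ ε / 18 ∧ δ ≤ 1 / 10 :=
    ⟨min (ε / 18) (1 / 10), lt_min (by positivity) (by norm_num), min_le_left _ _, min_le_right _ _⟩
  obtain ⟨N₀, hN₀⟩ := exists_typical (ε := δ / 3) (η := 1 / 2) (by positivity) (by norm_num)
  refine ⟨Real.exp (-24) * (1 / 2), by positivity, N₀ + 12, fun n hn => ?_⟩
  set K := ⌊δ * n⌋₊ + 1 with hK
  have hn0 : (0 : ℝ) ≤ δ * n := by positivity
  have hK1 : δ * n ≤ K := by rw [hK]; push_cast; exact (Nat.lt_floor_add_one _).le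
  have hK2 : (K : ℝ) ≤ δ * n + 1 := by
    rw [hK]; push_cast; linarith [Nat.floor_le hn0]
  have hK3 : 10 * K ≤ n + 10 := by
    have h1 : δ * n ≤ 1 / 10 * n := mul_le_mul_of_nonneg_right hδ2 (Nat.cast_nonneg _)
    have h2 : (10 : ℝ) * K ≤ n + 10 := by linarith
    exact_mod_cast h2
  obtain ⟨N, hN⟩ : ∃ N, 3 * n = N + 9 * K + 3 := ⟨3 * n - (9 * K + 3), by omega⟩
  have hNn : (N : ℝ) ≤ 3 * n := by
    have : N ≤ 3 * n := by omega
    exact_mod_cast this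
  refine le_trans ?_ (le_Ex_words (Nat.succ_pos _) hN (ε := δ / 3) ?_)
  · have h1 := hN₀ N (by omega) .b
    have h2 : (1 : ℝ) / 2 ≤ Ex N .b fun l => ind (Typical (δ / 3) l) := by
      have h3 : Ex N .b (fun l => ind (Typical (δ / 3) l) + ind (¬ Typical (δ / 3) l)) = 1 := by
        rw [← Ex_const N .b 1]
        refine Ex_congr fun l _ => ?_
        by_cases h : Typical (δ / 3) l
        · rw [ind_true h, ind_false (by simpa using h), add_zero]
        · rw [ind_false h, ind_true h, zero_add]
      rw [Ex_add] at h3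
      linarith
    have h3 : Real.exp (-24) * Real.exp (-ε * n) ≤ (1 / 4) ^ (9 * K + 3) := by
      have h4 : Real.exp (-2) ≤ 1 / 4 := by
        rw [Real.exp_neg, ← one_div]
        refine one_div_le_one_div_of_le (by norm_num) ?_
        have h5 : Real.exp 2 = Real.exp 1 * Real.exp 1 := by rw [← Real.exp_add]; norm_num
        have h6 : (2 : ℝ) ≤ Real.exp 1 := by linarith [Real.add_one_le_exp 1]
        rw [h5]
        nlinarith
      refine le_trans ?_ (pow_le_pow_left₀ (Real.exp_pos _).le h4 _)
      rw [← Real.exp_add, ← Real.exp_nat_mul, Real.exp_le_exp]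
      push_cast
      have h5 : 18 * (δ * n) ≤ ε * n := by
        rw [← mul_assoc]
        exact mul_le_mul_of_nonneg_right (by linarith) (Nat.cast_nonneg _)
      linarith
    calc Real.exp (-24) * (1 / 2) * Real.exp (-ε * n)
        = Real.exp (-24) * Real.exp (-ε * n) * (1 / 2) := by ring
      _ ≤ _ := mul_le_mul h3 h2 (by norm_num) (by positivity)
  · have : δ / 3 * N ≤ δ / 3 * (3 * n) := mul_le_mul_of_nonneg_left hNn (by positivity)
    linarith

/-- The words of wooded triangulations. -/
noncomputable def wordFinset (n : ℕ) : Finset (List Color) := (words_finite n).toFinset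

lemma mem_wordFinset {n : ℕ} {l : List Color} : l ∈ wordFinset n ↔ l ∈ words n :=
  (words_finite n).mem_toFinset

open Classical in
/-- In most words of wooded triangulations, a pattern occurs at least as often as in the infinite
random word. -/
lemma tendsto_card_atypical (K : ℕ) (A : List Color → Prop) {δ : ℝ} (hδ : 0 < δ) :
    Tendsto (fun n => (((wordFinset n).filter fun l =>
      cnt K A l ≤ (prob K A - δ) * (3 * n : ℕ)).card : ℝ) / (wordFinset n).card) atTop (𝓝 0) := by
  obtain ⟨c, hc, hc'⟩ := exists_concentration K A hδ
  obtain ⟨C, hC, n₀, hn₀⟩ := exists_le_Ex_words (ε := c) hc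
  have hlim : Tendsto (fun n : ℕ => 6 / C * Real.exp (-(2 * c) * n)) atTop (𝓝 0) := by
    have h1 : Tendsto (fun x : ℝ => x ^ 0 * Real.exp (-(2 * c) * x)) atTop (𝓝 0) := by
      simpa using tendsto_rpow_mul_exp_neg_mul_atTop_nhds_zero 0 (2 * c) (by positivity)
    have h2 := (h1.const_mul (6 / C)).comp tendsto_natCast_atTop_atTop
    rw [mul_zero] at h2
    refine h2.congr fun n => ?_
    simp
  refine squeeze_zero' (Eventually.of_forall fun n => by positivity) ?_ hlim
  filter_upwards [eventually_ge_atTop n₀] with n hn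
  set W := wordFinset n
  set V := W.filter fun l => cnt K A l ≤ (prob K A - δ) * (3 * n : ℕ)
  have h1 := card_mul_Ex_le (n := n) (V := V) (W := W)
    (by ext l; exact mem_wordFinset) (Finset.filter_subset _ _)
  have h2 := hn₀ n hn
  simp only [← mem_wordFinset] at h2
  have h3 : Ex (3 * n) .b (fun l => ind (l ∈ V)) ≤ 3 * Real.exp (-c * (3 * n : ℕ)) :=
    (Ex_mono fun l _ => ind_mono fun h => (Finset.mem_filter.1 h).2).trans (hc' (3 * n) .b)
  have hV : (V.card : ℝ) ≤ W.card := by exact_mod_cast Finset.card_filter_le _ _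
  rcases Nat.eq_zero_or_pos W.card with hW | hW
  · rw [hW]; simp; positivity
  have hW' : (0 : ℝ) < W.card := by exact_mod_cast hW
  rw [div_le_iff₀ hW']
  -- The rate is `c` per letter for the tail, thus `3 * c` per vertex, against the loss `c` chosen
  -- for the probability of `words n`; the difference `2 * c` remains.
  have h4 : V.card * (C * Real.exp (-c * n)) ≤ 2 * W.card * (3 * Real.exp (-c * (3 * n : ℕ))) :=
    (mul_le_mul_of_nonneg_left h2 (Nat.cast_nonneg _)).trans
      (h1.trans (mul_le_mul_of_nonneg_left h3 (by positivity)))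
  have h5 : Real.exp (-c * (3 * n : ℕ)) = Real.exp (-(2 * c) * n) * Real.exp (-c * n) := by
    rw [← Real.exp_add]; congr 1; push_cast; ring
  rw [h5] at h4
  have h6 := Real.exp_pos (-c * n)
  have h7 : (V.card * C) * Real.exp (-c * n) ≤
      (6 * W.card * Real.exp (-(2 * c) * n)) * Real.exp (-c * n) := by linarith
  have h8 := le_of_mul_le_mul_right h7 h6
  rw [show 6 / C * Real.exp (-(2 * c) * n) * W.card =
    (6 * W.card * Real.exp (-(2 * c) * n)) / C by ring, le_div_iff₀ hC]
  exact h8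

end SchnyderWood
namespace SchnyderWood

/-! ### Local convergence -/

lemma RootedGraph.Isomorphic.symm {G H : RootedGraph} (h : G.Isomorphic H) : H.Isomorphic G := by
  obtain ⟨e, h1, h2, h3, h4, h5⟩ := h
  refine ⟨e.symm, fun c u v => ?_, fun u v => ?_, ?_, ?_, h5.symm⟩
  · rw [h1, e.apply_symm_apply, e.apply_symm_apply]
  · rw [h2, e.apply_symm_apply, e.apply_symm_apply]
  · rw [e.symm_apply_eq, h3]
  · rw [e.symm_apply_eq, h4]

lemma RootedGraph.Isomorphic.trans {G H K : RootedGraph} (h : G.Isomorphic H)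
    (h' : H.Isomorphic K) : G.Isomorphic K := by
  obtain ⟨e, h1, h2, h3, h4, h5⟩ := h
  obtain ⟨f, k1, k2, k3, k4, k5⟩ := h'
  refine ⟨e.trans f, fun c u v => ?_, fun u v => ?_, ?_, ?_, h5.trans k5⟩
  · rw [h1, k1]; rfl
  · rw [h2, k2]; rfl
  · rw [Equiv.trans_apply, h3, k3]
  · rw [Equiv.trans_apply, h4, k4]

/-- Properties that do not depend on the choice of a graph up to isomorphism. -/
def IsInvariant (Q : RootedGraph → Prop) : Prop := ∀ G H, G.Isomorphic H → Q G → Q H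

lemma isInvariant_isomorphic (T : RootedGraph) : IsInvariant fun G => G.Isomorphic T :=
  fun _ _ h h' => h.symm.trans h'

lemma IsInvariant.not {Q : RootedGraph → Prop} (hQ : IsInvariant Q) : IsInvariant fun G => ¬ Q G :=
  fun G H h h' h'' => h' (hQ H G h.symm h'')

/-- The root edge exists in the word `w`, its neighborhood of radius `k` is visible in the window
of radius `R`, and it has the property `Q`. -/
def Visible (Q : RootedGraph → Prop) (k R : ℕ) (w : ℤ → Color) : Prop :=
  ∃ (t h : {i // w i = .b}) (hr : IsEdge w 0 t h), Q ((infiniteGraph w t h hr).ball k) ∧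
    ∀ v ∈ (infiniteGraph w t h hr).ballSet k, Local w R v.1

/-- The windows of radius `R` in which one sees that the neighborhood of radius `k` of the root
edge has the property `Q`. -/
def Pattern (Q : RootedGraph → Prop) (k R : ℕ) (l : List Color) : Prop :=
  ∃ w, Nice w ∧ Visible Q k R w ∧ l = window w (-R) (2 * R + 1)

lemma Visible.mono {Q : RootedGraph → Prop} {k R R' : ℕ} {w : ℤ → Color} (h : Visible Q k R w)
    (hR : R ≤ R') : Visible Q k R' w := by
  obtain ⟨t, h, hr, h1, h2⟩ := h
  exact ⟨t, h, hr, h1, fun v hv => (h2 v hv).mono (by exact_mod_cast hR)⟩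

section Finite

open WoodedTriangulation LabelledWood

variable {n : ℕ} {S : WoodedTriangulation (Fin (6 * n + 6))} {l : List Color}

/-- The inner edges are enumerated by the letters of the word. -/
lemma exists_innerEdge_bijective {P : ℤ → Fin (6 * n + 6)}
    (C : S.Coding (toWord l) l.length P) :
    ∃ f : Fin l.length → S.InnerEdge, Function.Bijective f ∧
      ∀ i, (f i).1 = Coding.edge S (toWord l) P (i : ℕ) := by
  have F := framed_toWord l
  have h1 : ∀ i : Fin l.length, (S.col (Coding.edge S (toWord l) P (i : ℕ))).isSome = true := by
    intro i
    have h2 : ((i : ℕ) : ℤ) < l.length := by exact_mod_cast i.2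
    rw [(C.edge_spec F (by omega) h2 ((C.valid F).edgeAt (by omega) h2)).1]
    rfl
  refine ⟨fun i => ⟨_, h1 i⟩, ⟨fun i j hij => ?_, fun e => ?_⟩, fun i => rfl⟩
  · rw [Subtype.mk.injEq] at hij
    have h2 : ((i : ℕ) : ℤ) < l.length := by exact_mod_cast i.2
    have h3 : ((j : ℕ) : ℤ) < l.length := by exact_mod_cast j.2
    have := C.edge_inj F (by omega) h2 (by omega) h3 hij
    exact Fin.ext (by exact_mod_cast this)
  · obtain ⟨c, hc⟩ := Option.isSome_iff_exists.1 e.2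
    obtain ⟨i, hi, hi', -, he⟩ := C.exists_edge F hc
    lift i to ℕ using hi
    exact ⟨⟨i, by exact_mod_cast hi'⟩, Subtype.ext he.symm⟩

lemma LabelledWood.Coded.card_innerEdge (h : Coded S l) : Nat.card S.InnerEdge = l.length := by
  obtain ⟨P, C⟩ := h
  obtain ⟨f, hf, -⟩ := exists_innerEdge_bijective C
  rw [← Nat.card_congr (Equiv.ofBijective f hf), Nat.card_eq_fintype_card, Fintype.card_fin]

/-- Every pattern in the word is an inner edge with the corresponding neighborhood. -/
lemma LabelledWood.Coded.cnt_pattern_le (h : Coded S l) {Q : RootedGraph → Prop}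
    (hQ : IsInvariant Q) (k R : ℕ) :
    cnt (2 * R) (Pattern Q k R) l ≤
      Nat.card {e : S.InnerEdge // S.rootedGraph e ∈ {G | Q (G.ball k)}} := by
  classical
  obtain ⟨P, C⟩ := h
  obtain ⟨f, hf, hfe⟩ := exists_innerEdge_bijective C
  set V := (Finset.range l.length).filter fun i => i + 2 * R < l.length ∧
    Pattern Q k R ((l.drop i).take (2 * R + 1)) with hV
  have h1 : cnt (2 * R) (Pattern Q k R) l = V.card := by
    rw [cnt_eq_sum, hV, Finset.card_filter]
    push_cast
    refine Finset.sum_congr rfl fun i _ => ?_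
    unfold ind
    split_ifs <;> rfl
  have hlt : ∀ i : V, i.1 + R < l.length := fun i => by
    have := (Finset.mem_filter.1 i.2).2.1; omega
  have h2 : ∀ i : V, S.rootedGraph (f ⟨i.1 + R, hlt i⟩) ∈ {G | Q (G.ball k)} := by
    intro i
    obtain ⟨-, h3, w, hw, ⟨t, h, hr, h4, h5⟩, h6⟩ := Finset.mem_filter.1 i.2
    rw [← window_toWord (by omega), window_eq_iff] at h6
    -- The window has `2 * R + 1` letters and starts at `i`, so the root edge is that of its central
    -- letter, at `i + R`.
    refine hQ _ _ (ball_isomorphic_of_window C (framed_toWord l) hw h5 (s := (i.1 + R : ℕ))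
      (by push_cast; omega) (by push_cast; omega) (fun a ha ha' => ?_) _ (hfe _)) h4
    have h7 := h6 (a + R).toNat (by omega)
    rw [show (-(R : ℤ) + (a + R).toNat) = a by omega] at h7
    rw [← h7]
    congr 1
    push_cast
    omega
  rw [h1, ← Nat.card_eq_finsetCard V]
  refine Nat.cast_le.2 (Nat.card_le_card_of_injective (fun i : V => ⟨_, h2 i⟩) fun i j hij => ?_)
  have h3 := congrArg (fun e => e.1) hij
  have h4 := congrArg Fin.val (hf.1 h3)
  exact Subtype.ext (by simpa using h4)

lemma wordFinset_card_pos (n : ℕ) : 0 < (wordFinset n).card := by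
  obtain ⟨v, hv, hv'⟩ := exists_ok_zero_zero n .b
  exact Finset.card_pos.2 ⟨v, mem_wordFinset.2 (hv'.mem_words hv)⟩

lemma natCard_wood (n : ℕ) : Nat.card (Wood n) = (wordFinset n).card := by
  obtain ⟨code, hcode, -⟩ := exists_code n
  rw [Nat.card_congr (Equiv.ofBijective code hcode), Nat.card_coe_set_eq,
    Set.ncard_eq_toFinset_card _ (words_finite n)]
  rfl

lemma finiteLaw_add_finiteLaw_not {n : ℕ} (hn : 1 ≤ n) (Q : RootedGraph → Prop) (k : ℕ) :
    finiteLaw n {G | Q (G.ball k)} + finiteLaw n {G | ¬ Q (G.ball k)} = 1 := by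
  classical
  obtain ⟨code, -, hcode⟩ := exists_code n
  have hpos : (0 : ℝ) < Nat.card (Wood n) := by
    rw [natCard_wood]; exact_mod_cast wordFinset_card_pos n
  rw [finiteLaw, finiteLaw, ← add_div, ← Finset.sum_add_distrib, div_eq_one_iff_eq hpos.ne',
    Nat.card_eq_fintype_card, ← Finset.card_univ, Finset.cast_card]
  refine Finset.sum_congr rfl fun s _ => ?_
  have h1 : Nat.card s.out.1.InnerEdge = 3 * n := by
    rw [(hcode s).card_innerEdge, (code s).2.1]
  have h2 : Nat.card s.out.1.InnerEdge ≠ 0 := by omega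
  rw [← add_div, div_eq_one_iff_eq (by exact_mod_cast h2), ← Nat.cast_add]
  norm_cast
  have h3 := Fintype.card_subtype_compl
    fun e : s.out.1.InnerEdge => s.out.1.rootedGraph e ∈ {G | Q (G.ball k)}
  have h4 := Fintype.card_subtype_le
    fun e : s.out.1.InnerEdge => s.out.1.rootedGraph e ∈ {G | Q (G.ball k)}
  simp only [← Nat.card_eq_fintype_card, Set.mem_ofPred_eq] at h3 h4 ⊢
  omega

/-- The law of the finite triangulations is bounded below by the frequencies of patterns. -/
lemma eventually_le_finiteLaw {Q : RootedGraph → Prop} (hQ : IsInvariant Q) (k R : ℕ) {δ : ℝ}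
    (hδ : 0 < δ) : ∀ᶠ n in atTop,
      prob (2 * R) (Pattern Q k R) - 2 * δ ≤ finiteLaw n {G | Q (G.ball k)} := by
  classical
  set p := prob (2 * R) (Pattern Q k R) with hp
  filter_upwards [(tendsto_card_atypical (2 * R) (Pattern Q k R) hδ).eventually (gt_mem_nhds hδ),
    eventually_ge_atTop 1] with n h1 hn
  obtain ⟨code, hcode, hcoded⟩ := exists_code n
  set W := wordFinset n with hW
  have hWpos : (0 : ℝ) < W.card := by exact_mod_cast wordFinset_card_pos n
  have hn' : (0 : ℝ) < (3 * n : ℕ) := by exact_mod_cast (by omega : 0 < 3 * n)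
  set V := W.filter fun l => cnt (2 * R) (Pattern Q k R) l ≤ (p - δ) * (3 * n : ℕ) with hV
  have hsum : ∑ s : Wood n, cnt (2 * R) (Pattern Q k R) (code s).1 / (3 * n : ℕ) =
      ∑ l ∈ W, cnt (2 * R) (Pattern Q k R) l / (3 * n : ℕ) := by
    refine Finset.sum_bij (fun s _ => (code s).1) (fun s _ => mem_wordFinset.2 (code s).2)
      (fun s _ s' _ h => hcode.1 (Subtype.ext h)) (fun l hl => ?_) fun _ _ => rfl
    obtain ⟨s, hs⟩ := hcode.2 ⟨l, mem_wordFinset.1 hl⟩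
    exact ⟨s, Finset.mem_univ s, by rw [hs]⟩
  -- For an exceptional word the bound is made trivial by subtracting 1, as `p ≤ 1`. There are fewer
  -- than δ times `W.card` of these.
  have hle : ∀ l ∈ W, (p - δ) - (if l ∈ V then 1 else 0) ≤
      cnt (2 * R) (Pattern Q k R) l / (3 * n : ℕ) := by
    intro l hl
    split_ifs with h
    · have h2 : p ≤ 1 := prob_le_one _ _
      have h3 : 0 ≤ cnt (2 * R) (Pattern Q k R) l / (3 * n : ℕ) :=
        div_nonneg (cnt_nonneg _ _ _) hn'.le
      linarith
    · rw [sub_zero, le_div_iff₀ hn']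
      by_contra h2
      exact h (Finset.mem_filter.2 ⟨hl, (not_le.1 h2).le⟩)
  have h2 := Finset.sum_le_sum hle
  rw [Finset.sum_sub_distrib, Finset.sum_const, nsmul_eq_mul, Finset.sum_boole,
    Finset.filter_mem_eq_inter, Finset.inter_eq_right.2 (Finset.filter_subset _ _), ← hsum] at h2
  rw [finiteLaw, natCard_wood, le_div_iff₀ hWpos]
  rw [div_lt_iff₀ hWpos] at h1
  calc (p - 2 * δ) * W.card ≤ W.card * (p - δ) - V.card := by linarith
    _ ≤ _ := h2
    _ ≤ _ := Finset.sum_le_sum fun s _ => by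
      rw [(hcoded s).card_innerEdge, (code s).2.1]
      exact div_le_div_of_nonneg_right ((hcoded s).cnt_pattern_le hQ k R) hn'.le

end Finite

section Infinite

variable {Ω : Type*} [MeasurableSpace Ω] {μ : Measure Ω} [IsProbabilityMeasure μ]
  {w : Ω → ℤ → Color} (hw : IsStationaryMarkovWord μ w)
include hw

/-- The law of the infinite graph is bounded above by the frequencies of patterns. -/
lemma exists_infiniteLaw_le (Q : RootedGraph → Prop) (k : ℕ) {δ : ℝ} (hδ : 0 < δ) :
    ∃ R, infiniteLaw μ w {G | Q (G.ball k)} ≤ prob (2 * R) (Pattern Q k R) + δ := by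
  set B : ℕ → Set Ω := fun R => {ω | Nice (w ω) ∧ Visible Q k R (w ω)} with hB
  have hmono : Monotone B := fun R R' hR ω h => ⟨h.1, h.2.mono hR⟩
  have h1 : infiniteLaw μ w {G | Q (G.ball k)} ≤ μ.real (⋃ R, B R) := by
    refine ENNReal.toReal_mono (measure_ne_top _ _) (measure_mono_ae ?_)
    filter_upwards [ae_nice hw] with ω hω
    rintro ⟨t, h, hr, hq⟩
    obtain ⟨R, hR⟩ := hω.exists_window t h hr k
    exact Set.mem_iUnion.2 ⟨R, hω, t, h, hr, hq, hR⟩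
  -- Continuity from below holds for arbitrary increasing sets, so measurability of the events is
  -- not needed.
  have h2 : Tendsto (fun R => μ.real (B R)) atTop (𝓝 (μ.real (⋃ R, B R))) :=
    (ENNReal.tendsto_toReal (measure_ne_top _ _)).comp (tendsto_measure_iUnion_atTop hmono)
  obtain ⟨R, hR⟩ := (h2.eventually (lt_mem_nhds (sub_lt_self _ hδ))).exists
  refine ⟨R, ?_⟩
  have h3 : μ.real (B R) ≤ prob (2 * R) (Pattern Q k R) := by
    rw [prob_eq hw (-R)]
    exact measureReal_setOf_mono fun ω h => ⟨w ω, h.1, h.2, rfl⟩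
  linarith

/-- The events are not known to be measurable, so additivity is not available; subadditivity gives
this inequality, which is the direction that the conclusion needs. -/
lemma one_le_infiniteLaw_add (Q : RootedGraph → Prop) (k : ℕ) :
    1 ≤ infiniteLaw μ w {G | Q (G.ball k)} + infiniteLaw μ w {G | ¬ Q (G.ball k)} := by
  have h1 : μ.real Set.univ = 1 := by simp
  rw [← h1]
  refine le_trans ?_ (measureReal_union_le _ _)
  refine ENNReal.toReal_mono (measure_ne_top _ _) (measure_mono_ae ?_)
  filter_upwards [ae_nice hw] with ω hω _
  obtain ⟨t, h, ht⟩ := hω.exists_edgeAt 0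
  have hr := (hω.isEdge_iff _ _ _).2 ht
  by_cases hq : Q ((infiniteGraph (w ω) ⟨t, ht.color.1⟩ ⟨h, ht.color.2⟩ hr).ball k)
  · exact Or.inl ⟨_, _, hr, hq⟩
  · exact Or.inr ⟨_, _, hr, hq⟩

lemma eventually_infiniteLaw_le {Q : RootedGraph → Prop} (hQ : IsInvariant Q) (k : ℕ) {δ : ℝ}
    (hδ : 0 < δ) : ∀ᶠ n in atTop,
      infiniteLaw μ w {G | Q (G.ball k)} - δ ≤ finiteLaw n {G | Q (G.ball k)} := by
  obtain ⟨R, hR⟩ := exists_infiniteLaw_le hw Q k (δ := δ / 3) (by positivity)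
  filter_upwards [eventually_le_finiteLaw hQ k R (δ := δ / 3) (by positivity)] with n hn
  linarith

end Infinite

end SchnyderWood
theorem proposition2p8 {Ω : Type*} [MeasurableSpace Ω] (μ : Measure Ω) [IsProbabilityMeasure μ]
    (w : Ω → ℤ → SchnyderWood.Color) (hw : SchnyderWood.IsStationaryMarkovWord μ w) :
    SchnyderWood.BenjaminiSchrammConverges SchnyderWood.finiteLaw
      (SchnyderWood.infiniteLaw μ w) := by
  intro T k
  have hT := SchnyderWood.isInvariant_isomorphic T
  refine Metric.tendsto_nhds.2 fun ε hε => ?_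
  -- The lower bound for the complement becomes an upper bound for the event, since the finite
  -- probabilities sum to 1 and the infinite ones to at least 1.
  filter_upwards [SchnyderWood.eventually_infiniteLaw_le hw hT k (half_pos hε),
    SchnyderWood.eventually_infiniteLaw_le hw hT.not k (half_pos hε),
    eventually_ge_atTop 1] with n h1 h2 hn
  have h3 := SchnyderWood.finiteLaw_add_finiteLaw_not hn (fun G => G.Isomorphic T) k
  have h4 := SchnyderWood.one_le_infiniteLaw_add hw (fun G => G.Isomorphic T) k
  rw [Real.dist_eq, abs_lt]
  constructor <;> linarith
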